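/- **Setting.** Let $d\ge 1$, $p,q\in(1,\infty)$ with $\frac1p+\frac1q=1$. Let $(\Omega,\mathcal F,P)$ be a probability space with separable measure, $\langle\cdot\rangle$ its expectation, and $(T_x)_{x\in\mathbb Z^d}$ a measurable, measure-preserving action of $\mathbb Z^d$ on $\Omega$ ($T_0=\mathrm{Id}$, $T_{x+y}=T_xT_y$); ergodicity is not assumed. On $\varepsilon\mathbb Z^d$ put $m_\varepsilon=\varepsilon^d\sum_{x\in\varepsilon\mathbb Z^d}\delta_x$ and $\nabla^\varepsilon u(x)=\big(\frac{u(x+\varepsilon e_j)-u(x)}{\varepsilon}\big)_{j}$ (for vector-valued $u$, the matrix with rows $\nabla^\varepsilon u_i$). *Lattice graph.* Let $b_1,\dots,b_k\in\mathbb Z^d\setminus\{0\}$ include $e_1,\dots,e_d$. For $u:\varepsilon\mathbb Z^d\to\mathbb R^d$ let $\nabla^\varepsilon_su(x)\in\mathbb R^k$ have entries $\frac{b_i}{|b_i|}\cdot\frac{u(x+\varepsilon b_i)-u(x)}{\varepsilon|b_i|}$. Assume (Korn): there is $C>0$ such that $\sum_{x\in\mathbb Z^d}|\nabla^1u(x)|^p\le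 C\sum_{x\in\mathbb Z^d}|\nabla^1_su(x)|^p$ for all finitely supported $u:\mathbb Z^d\to\mathbb R^d$. Fix any finitely supported $B_i:\mathbb Z^d\to\mathbb R^d$ with $\frac{u(x+b_i)-u(x)}{|b_i|}=\sum_{y\in\mathbb Z^d}\nabla^1u(x-y)B_i(y)$ for all $u$ and $x$ (such $B_i$ exist). For a random matrix field $F$ set $(F_s)_i(\omega,x)=\frac{b_i}{|b_i|}\cdot\sum_{y\in\mathbb Z^d}F(T_{-y}\omega,x)B_i(y)$, and write $\nabla_sU=(\nabla U)_s$. *Energies.* Let $O\subset\mathbb R^d$ be a bounded domain with Lipschitz boundary and $O^{+\varepsilon}=O\cup\{x:(x,x+\varepsilon b_i)\cap O\ne\emptyset\text{ for some }i\}$. Let $V:\Omega\times\mathbb R^k\to\mathbb R$ be jointly measurable, with $V(\omega,\cdot)$ convex for a.e. $\omega$, and let there be $C>0$ with $\frac1C|F|^p-C\le V(\omega,F)\le C(|F|^p+1)$ for a.e. $\omega$ and all $F\in\mathbb R^k$. Set $$\mathcal E_\varepsilon(u)=\Big\langle\int_{O^{+\varepsilon}\cap\varepsilon\mathbb Z^d}V(T_{x/\varepsilon}\omega,\nabla^\varepsilon_su(\omega,x))\,dm_\varepsilon(x)\Big\rangle,\qquad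 \mathcal E_0(U,\chi)=\Big\langle\int_OV(\omega,\nabla_sU(\omega,x)+\chi_s(\omega,x))\,dx\Big\rangle .$$ *Spaces.* Functions on $O$ are extended by $0$ to $\mathbb R^d$. $L^p(\Omega)\otimes L^p_0(O\cap\varepsilon\mathbb Z^d)$ is the space of $u\in L^p(\Omega\times\varepsilon\mathbb Z^d)$ vanishing outside $O$. $L^p_{\mathsf{inv}}(\Omega)$ is the set of $\varphi\in L^p(\Omega)$ with $\varphi\circ T_x=\varphi$ a.s. for all $x$. $\mathbf L^p_{\mathsf{pot}}(\Omega)$ is the closure in $L^p(\Omega)^d$ of $\{(\varphi\circ T_{e_j}-\varphi)_{j}:\varphi\in L^p(\Omega)\}$. $W^{1,p}_0(O)$ is the closure of $C_c^\infty(O)$ in $W^{1,p}$. $L^p_{\mathsf{inv}}(\Omega)\otimes W^{1,p}_0(O)$ and $\mathbf L^p_{\mathsf{pot}}(\Omega)\otimes L^p(O)$ are the closures of the spans of products in $L^p(\Omega;W^{1,p}(\mathbb R^d))$ and $L^p(\Omega\times\mathbb R^d)^d$. In $(\mathbf L^p_{\mathsf{pot}}(\Omega)\otimes L^p(O))^d$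 the $i$-th component is the $i$-th row of a matrix field. *Two-scale convergence.* For $x\in\mathbb R^d$ let $\lfloor x\rfloor_\varepsilon\in\varepsilon\mathbb Z^d$ be given by $x-\lfloor x\rfloor_\varepsilon\in\varepsilon[-\frac12,\frac12)^d$, and $(\mathcal T_\varepsilon u)(\omega,x)=u(T_{-\lfloor x\rfloor_\varepsilon/\varepsilon}\,\omega,\lfloor x\rfloor_\varepsilon)$. Then $u_\varepsilon\overset2\rightharpoonup U$ (resp. $u_\varepsilon\overset2\to U$) means $\mathcal T_\varepsilon u_\varepsilon\to U$ weakly (resp. strongly) in $L^p(\Omega\times\mathbb R^d)$, componentwise. **Theorem 4.1 (Two-scale homogenization).** (i) (Compactness) Let $\varepsilon\to0$ along a sequence of positive numbers and let $u_\varepsilon\in(L^p(\Omega)\otimes L^p_0(O\cap\varepsilon\mathbb Z^d))^d$ satisfy $\limsup_{\varepsilon\to0}\mathcal E_\varepsilon(u_\varepsilon)<\infty$. Then there are $U\in(L^p_{\mathsf{inv}}(\Omega)\otimes W^{1,p}_0(O))^d$ and $\chi\in(\mathbf L^p_{\mathsf{pot}}(\Omega)\otimes L^p(O))^d$ such that,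 along a subsequence, $$u_\varepsilon\overset2\rightharpoonup U,\qquad\nabla^\varepsilon u_\varepsilon\overset2\rightharpoonup\nabla U+\chi.\tag{$*$}$$ (ii) (Lower bound) If $u_\varepsilon\in(L^p(\Omega)\otimes L^p_0(O\cap\varepsilon\mathbb Z^d))^d$, $U\in(L^p_{\mathsf{inv}}(\Omega)\otimes W^{1,p}_0(O))^d$ and $\chi\in(\mathbf L^p_{\mathsf{pot}}(\Omega)\otimes L^p(O))^d$ are such that $(*)$ holds along the whole sequence $\varepsilon\to0$, then $\liminf_{\varepsilon\to0}\mathcal E_\varepsilon(u_\varepsilon)\ge\mathcal E_0(U,\chi)$. (iii) (Upper bound) For all $U\in(L^p_{\mathsf{inv}}(\Omega)\otimes W^{1,p}_0(O))^d$ and $\chi\in(\mathbf L^p_{\mathsf{pot}}(\Omega)\otimes L^p(O))^d$ there are $u_\varepsilon\in(L^p(\Omega)\otimes L^p_0(O\cap\varepsilon\mathbb Z^d))^d$, $\varepsilon>0$, such that, as $\varepsilon\to0$, $$u_\varepsilon\overset2\to U,\qquad\nabla^\varepsilon u_\varepsilon\overset2\to\nabla U+\chi,\qquad\mathcal E_\varepsilon(u_\varepsilon)\to\mathcal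 E_0(U,\chi).$$ -/

import Mathlib

open MeasureTheory Filter Topology Set
open scoped ENNReal

noncomputable section

/-! Lattice and space -/

/-- The lattice `ℤ^d`. The scaled lattice `ε ℤ^d` is indexed by `z ∈ ℤ^d` through `x = ε z`. -/
abbrev IntLattice (d : ℕ) : Type := Fin d → ℤ

/-- Euclidean space `ℝ^d`. -/
abbrev Space (d : ℕ) : Type := EuclideanSpace ℝ (Fin d)

/-- The point `x = ε z` of `ε ℤ^d`. -/
def latticePoint {d : ℕ} (ε : ℝ) (z : IntLattice d) : Space d :=
  WithLp.toLp 2 fun i => ε * (z i : ℝ)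

/-- The unit lattice vector `e_i`. -/
def latticeUnit {d : ℕ} (i : Fin d) : IntLattice d := Pi.single i 1

/-- The measure `m_ε = ε^d ∑_{x ∈ ε ℤ^d} δ_x`, in the index variable `z = x / ε`. -/
def latticeMeasure (d : ℕ) (ε : ℝ) : Measure (IntLattice d) :=
  ENNReal.ofReal (ε ^ d) • Measure.count

/-- The index `z` of the cell `ε (z + [-1/2, 1/2)^d)` that contains `x`. -/
def cellIndex {d : ℕ} (ε : ℝ) (x : Space d) : IntLattice d := fun i => ⌊x i / ε + 1 / 2⌋

/-- A bounded domain (open and connected) with Lipschitz boundary: near each boundary point, `O` is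
the region on one side of the graph of a Lipschitz function over the hyperplane orthogonal to some
unit vector `ν`; that function is written as a function `γ` on `ℝ^d` that is constant in the
direction `ν`. -/
structure IsLipschitzDomain {d : ℕ} (O : Set (Space d)) : Prop where
  isOpen : IsOpen O
  isConnected : IsConnected O
  isBounded : Bornology.IsBounded O
  lipschitz_boundary : ∀ x₀ ∈ frontier O, ∃ ν : Space d, ‖ν‖ = 1 ∧
    ∃ (γ : Space d → ℝ) (K : NNReal), LipschitzWith K γ ∧
      (∀ (y : Space d) (t : ℝ), γ (y + t • ν) = γ y) ∧
      ∃ r > 0, ∀ y ∈ Metric.ball x₀ r, (y ∈ O ↔ γ y < inner ℝ ν y)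

/-! Discrete differential calculus -/

/-- The discrete gradient `∇^ε u (εz)` of a scalar function on `ε ℤ^d`. -/
def discreteGrad {d : ℕ} (ε : ℝ) (u : IntLattice d → ℝ) (z : IntLattice d) : Space d :=
  WithLp.toLp 2 fun j => (u (z + latticeUnit j) - u z) / ε

/-- The discrete symmetrized gradient, whose `i`-th entry is
`b_i / |b_i| · (u (x + ε b_i) - u x) / (ε |b_i|)`. -/
def discreteSymGrad {d k : ℕ} (ε : ℝ) (b : Fin k → IntLattice d) (u : IntLattice d → Space d)
    (z : IntLattice d) : EuclideanSpace ℝ (Fin k) :=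
  WithLp.toLp 2 fun i =>
    inner ℝ (‖latticePoint 1 (b i)‖⁻¹ • latticePoint 1 (b i))
      ((ε * ‖latticePoint 1 (b i)‖)⁻¹ • (u (z + b i) - u z))

/-- `b` enumerates an edge generating set: nonzero vectors, including all `e_i`. -/
structure IsEdgeGenerating {d k : ℕ} (b : Fin k → IntLattice d) : Prop where
  ne_zero : ∀ i, b i ≠ 0
  unit_mem : ∀ j, ∃ i, b i = latticeUnit j

/-- The discrete Korn inequality of the lattice graph (with `|∇u|` the Frobenius norm). -/
def SatisfiesKorn {d k : ℕ} (p : ℝ≥0∞) (b : Fin k → IntLattice d) : Prop :=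
  ∃ C > 0, ∀ u : IntLattice d → Space d, (Function.support u).Finite →
    ∑' z, Real.sqrt (∑ i, ‖discreteGrad 1 (fun z' => u z' i) z‖ ^ 2) ^ p.toReal
      ≤ C * ∑' z, ‖discreteSymGrad 1 b u z‖ ^ p.toReal

/-- A finitely supported `B : ℤ^d → ℝ^d` expresses the normalized difference quotient along the
edge `β` through the discrete gradient: `∂_β u (x) = ∑_y ∇u (x - y) · B(y)` for all `u`. -/
def RepresentsEdge {d : ℕ} (β : IntLattice d) (B : IntLattice d →₀ Space d) : Prop :=
  ∀ (u : IntLattice d → ℝ) (x : IntLattice d),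
    (u (x + β) - u x) / ‖latticePoint 1 β‖ =
      B.sum fun y v => inner ℝ v (discreteGrad 1 u (x - y))

/-- Such a `B` exists for every edge. -/
theorem exists_representsEdge {d : ℕ} (β : IntLattice d) :
    ∃ B : IntLattice d →₀ Space d, RepresentsEdge β B := by
  suffices h : ∃ B : IntLattice d →₀ Space d, ∀ (u : IntLattice d → ℝ) (x : IntLattice d),
      u (x + β) - u x = B.sum fun y v => inner ℝ v (discreteGrad 1 u (x - y)) by
    obtain ⟨B, hB⟩ := h
    refine ⟨‖latticePoint 1 β‖⁻¹ • B, fun u x => ?_⟩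
    rw [hB, Finsupp.sum_smul_index' (by simp), div_eq_inv_mul]
    simp [Finsupp.sum, Finset.mul_sum, inner_smul_left]
  have hmem : β ∈ AddSubgroup.closure (Set.range (latticeUnit (d := d))) := by
    have : β = ∑ i, β i • latticeUnit i := by
      ext j
      simp [latticeUnit, Finset.sum_apply, Pi.single_apply]
    rw [this]
    exact sum_mem fun i _ => zsmul_mem (AddSubgroup.subset_closure (Set.mem_range_self i)) _
  have shift : ∀ (B : IntLattice d →₀ Space d) (c x : IntLattice d) (u : IntLattice d → ℝ),
      ((B.mapDomain (· + c)).sum fun y v => inner ℝ v (discreteGrad 1 u (x - y))) =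
        B.sum fun y v => inner ℝ v (discreteGrad 1 u (x - c - y)) := by
    intro B c x u
    rw [Finsupp.sum_mapDomain_index (by simp) (by simp [inner_add_left])]
    refine Finsupp.sum_congr fun y _ => ?_
    rw [show x - (y + c) = x - c - y by abel]
  induction hmem using AddSubgroup.closure_induction with
  | mem c hc =>
    obtain ⟨i, rfl⟩ := hc
    refine ⟨Finsupp.single 0 (EuclideanSpace.single i 1), fun u x => ?_⟩
    simp [discreteGrad, EuclideanSpace.inner_single_left]
  | zero => exact ⟨0, by simp⟩
  | add a c _ _ ha hc =>
    obtain ⟨A, hA⟩ := ha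
    obtain ⟨C, hC⟩ := hc
    refine ⟨A + C.mapDomain (· + (-a)), fun u x => ?_⟩
    rw [Finsupp.sum_add_index' (by simp) (by simp [inner_add_left]), shift, ← hA]
    have h := hC u (x + a)
    rw [sub_neg_eq_add, ← h, ← add_assoc]
    ring
  | neg a _ ha =>
    obtain ⟨A, hA⟩ := ha
    refine ⟨-(A.mapDomain (· + a)), fun u x => ?_⟩
    have h := hA u (x - a)
    rw [Finsupp.sum_neg_index (by simp)]
    simp only [inner_neg_left, Finsupp.sum_neg]
    rw [shift, ← h, sub_add_cancel, ← sub_eq_add_neg]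
    ring

/-- The set `O^{+ε} = O ∪ {x : (x, x + ε b_i) ∩ O ≠ ∅ for some i}`. -/
def enlarge {d k : ℕ} (ε : ℝ) (b : Fin k → IntLattice d) (O : Set (Space d)) : Set (Space d) :=
  O ∪ {x | ∃ i, (openSegment ℝ x (x + latticePoint ε (b i)) ∩ O).Nonempty}

/-! Random media -/

/-- A measure preserving action `T` of `ℤ^d` on the probability space. -/
structure IsDynamicalSystem {Ω : Type*} [MeasurableSpace Ω] {d : ℕ} (P : Measure Ω)
    (T : IntLattice d → Ω → Ω) : Prop where
  zero : ∀ ω, T 0 ω = ω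
  add : ∀ x y ω, T (x + y) ω = T x (T y ω)
  measurePreserving : ∀ x, MeasurePreserving (T x) P P

section Spaces

variable {Ω : Type*} [MeasurableSpace Ω] {d : ℕ}

/-- `u ∈ (L^p(Ω) ⊗ L^p_0(O ∩ ε ℤ^d))^d`: the `p`-integrable random fields on `ε ℤ^d` that vanish
outside `O`. -/
def IsLatticeField (p : ℝ≥0∞) (P : Measure Ω) (O : Set (Space d)) (ε : ℝ)
    (u : Ω → IntLattice d → Space d) : Prop :=
  MemLp (fun y : Ω × IntLattice d => u y.1 y.2) p (P.prod (latticeMeasure d ε)) ∧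
    ∀ᵐ ω ∂P, ∀ z, latticePoint ε z ∉ O → u ω z = 0

/-- The shift-invariant functions `L^p_inv(Ω)`. -/
def LpInv (p : ℝ≥0∞) (P : Measure Ω) (T : IntLattice d → Ω → Ω) : Set (Lp ℝ p P) :=
  {φ | ∀ z, ∀ᵐ ω ∂P, φ (T z ω) = φ ω}

/-- `L^p_pot(Ω)`: the closure in `L^p(Ω)^d` of the range of the horizontal derivative
`(Dφ)_j (ω) = φ (T_{e_j} ω) - φ ω` on `L^p(Ω)`. -/
def LpPot (p : ℝ≥0∞) [Fact (1 ≤ p)] (P : Measure Ω) (T : IntLattice d → Ω → Ω) :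
    Set (Lp (Space d) p P) :=
  closure {ψ | ∃ φ : Lp ℝ p P,
    ∀ᵐ ω ∂P, ψ ω = WithLp.toLp 2 fun j => φ (T (latticeUnit j) ω) - φ ω}

/-- `L^p(O)`, extended by `0` to `ℝ^d`. -/
def LpDomain (p : ℝ≥0∞) (O : Set (Space d)) : Set (Lp ℝ p (volume : Measure (Space d))) :=
  {η | ∀ᵐ x, x ∉ O → η x = 0}

/-- `W^{1,p}_0(O)`, extended by `0` to `ℝ^d`: the closure of `C_c^∞(O)` in `W^{1,p}`. Here
`W^{1,p}(ℝ^d)` is embedded in `L^p(ℝ^d; ℝ × ℝ^d)` by `η ↦ (η, ∇η)`, with closed range, so that an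
element of the closure is a Sobolev function together with its weak gradient. -/
def SobolevZero (p : ℝ≥0∞) [Fact (1 ≤ p)] (O : Set (Space d)) :
    Set (Lp (ℝ × Space d) p (volume : Measure (Space d))) :=
  closure {f | ∃ η : Space d → ℝ, ContDiff ℝ (⊤ : ℕ∞) η ∧ HasCompactSupport η ∧ tsupport η ⊆ O ∧
    ∀ᵐ x, f x = (η x, gradient η x)}

/-- `L^p_inv(Ω) ⊗ W^{1,p}_0(O)`: the closure in `L^p(Ω; W^{1,p}(ℝ^d))` of the span of the products
`φ(ω) η(x)`. An element `U` is a pair: `(U y).1` is the function and `(U y).2` its gradient in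
`x`. -/
def InvSobolev (p : ℝ≥0∞) [Fact (1 ≤ p)] (P : Measure Ω) (T : IntLattice d → Ω → Ω)
    (O : Set (Space d)) : Set (Lp (ℝ × Space d) p (P.prod (volume : Measure (Space d)))) :=
  closure (Submodule.span ℝ {f | ∃ φ ∈ LpInv p P T, ∃ η ∈ SobolevZero p O,
    ∀ᵐ y ∂P.prod (volume : Measure (Space d)), f y = φ y.1 • η y.2} :
      Submodule ℝ (Lp (ℝ × Space d) p (P.prod (volume : Measure (Space d)))))

/-- `L^p_pot(Ω) ⊗ L^p(O)`: the closure in `L^p(Ω × ℝ^d)^d` of the span of the products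
`ψ(ω) η(x)`. -/
def PotTensor (p : ℝ≥0∞) [Fact (1 ≤ p)] (P : Measure Ω) (T : IntLattice d → Ω → Ω)
    (O : Set (Space d)) : Set (Lp (Space d) p (P.prod (volume : Measure (Space d)))) :=
  closure (Submodule.span ℝ {f | ∃ ψ ∈ LpPot p P T, ∃ η ∈ LpDomain p O,
    ∀ᵐ y ∂P.prod (volume : Measure (Space d)), f y = η y.2 • ψ y.1} :
      Submodule ℝ (Lp (Space d) p (P.prod (volume : Measure (Space d)))))

/-- The matrix field `∇U + χ`, with entries `∂_j U_i + χ_{ij}`. -/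
def gradField {p : ℝ≥0∞} {P : Measure Ω}
    (U : Fin d → Lp (ℝ × Space d) p (P.prod (volume : Measure (Space d))))
    (χ : Fin d → Lp (Space d) p (P.prod (volume : Measure (Space d)))) :
    Ω × Space d → Matrix (Fin d) (Fin d) ℝ :=
  fun y => Matrix.of fun i j => (U i y).2 j + χ i y j

/-! Two-scale convergence -/

/-- Stochastic unfolding: `(𝒯_ε u)(ω, x) = u (T_{-⌊x⌋_ε / ε} ω, ⌊x⌋_ε)`. -/
def unfolding (T : IntLattice d → Ω → Ω) (ε : ℝ) (u : Ω → IntLattice d → ℝ) : Ω × Space d → ℝ :=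
  fun y => u (T (-cellIndex ε y.2) y.1) (cellIndex ε y.2)

/-- Weak stochastic two-scale convergence in the mean: `𝒯_ε u_ε ⇀ U` weakly in `L^p(Ω × ℝ^d)`,
tested with `L^q(Ω × ℝ^d)`, where `q` is the dual exponent. -/
def WeakTwoScale {ι : Type*} (q : ℝ≥0∞) (P : Measure Ω) (T : IntLattice d → Ω → Ω) (l : Filter ι)
    (ε : ι → ℝ) (u : ι → Ω → IntLattice d → ℝ) (U : Ω × Space d → ℝ) : Prop :=
  ∀ g : Ω × Space d → ℝ, MemLp g q (P.prod (volume : Measure (Space d))) →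
    Tendsto (fun n => ∫ y, unfolding T (ε n) (u n) y * g y ∂P.prod (volume : Measure (Space d))) l
      (𝓝 (∫ y, U y * g y ∂P.prod (volume : Measure (Space d))))

/-- Strong stochastic two-scale convergence in the mean: `𝒯_ε u_ε → U` in `L^p(Ω × ℝ^d)`. -/
def StrongTwoScale {ι : Type*} (p : ℝ≥0∞) (P : Measure Ω) (T : IntLattice d → Ω → Ω) (l : Filter ι)
    (ε : ι → ℝ) (u : ι → Ω → IntLattice d → ℝ) (U : Ω × Space d → ℝ) : Prop :=
  Tendsto (fun n => eLpNorm (fun y => unfolding T (ε n) (u n) y - U y) p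
    (P.prod (volume : Measure (Space d)))) l (𝓝 0)

/-! Energies -/

/-- Random convex integrands with `p`-growth. -/
structure IsConvexIntegrand {k : ℕ} (p : ℝ≥0∞) (P : Measure Ω)
    (V : Ω → EuclideanSpace ℝ (Fin k) → ℝ) : Prop where
  measurable : Measurable fun y : Ω × EuclideanSpace ℝ (Fin k) => V y.1 y.2
  convex : ∀ᵐ ω ∂P, ConvexOn ℝ univ (V ω)
  growth : ∃ C > 0, ∀ᵐ ω ∂P, ∀ F, C⁻¹ * ‖F‖ ^ p.toReal - C ≤ V ω F ∧
    V ω F ≤ C * (‖F‖ ^ p.toReal + 1)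

/-- The averaged energy
`ℰ_ε(u) = ⟨∫_{O^{+ε} ∩ ε ℤ^d} V(T_{x/ε} ω, ∇_s^ε u(ω, x)) dm_ε(x)⟩`.
For a bounded `O`, the lattice set is finite and the growth of `V` makes the integrand integrable. -/
def discreteEnergy {k : ℕ} (P : Measure Ω) (T : IntLattice d → Ω → Ω)
    (V : Ω → EuclideanSpace ℝ (Fin k) → ℝ) (b : Fin k → IntLattice d) (O : Set (Space d)) (ε : ℝ)
    (u : Ω → IntLattice d → Space d) : ℝ :=
  ∫ ω, ∫ z in {z | latticePoint ε z ∈ enlarge ε b O},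
    V (T z ω) (discreteSymGrad ε b (u ω) z) ∂(latticeMeasure d ε) ∂P

/-- Symmetrization of a matrix-valued random field:
`(F_s)_i (ω, x) = b_i / |b_i| · ∑_y F(T_{-y} ω, x) B_i(y)`. -/
def symField {k : ℕ} (T : IntLattice d → Ω → Ω) (b : Fin k → IntLattice d)
    (B : Fin k → IntLattice d →₀ Space d) (F : Ω × Space d → Matrix (Fin d) (Fin d) ℝ)
    (y : Ω × Space d) : EuclideanSpace ℝ (Fin k) :=
  WithLp.toLp 2 fun i =>
    inner ℝ (‖latticePoint 1 (b i)‖⁻¹ • latticePoint 1 (b i))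
      ((B i).sum fun z v => WithLp.toLp 2 ((F (T (-z) y.1, y.2)).mulVec v.ofLp))

/-- The two-scale energy `⟨∫_O V(ω, F_s(ω, x)) dx⟩`, to be used with `F = ∇U + χ`.
For a bounded `O` and `F` in `L^p`, the growth of `V` makes the integrand integrable. -/
def twoScaleEnergy {k : ℕ} (P : Measure Ω) (T : IntLattice d → Ω → Ω)
    (V : Ω → EuclideanSpace ℝ (Fin k) → ℝ) (b : Fin k → IntLattice d)
    (B : Fin k → IntLattice d →₀ Space d) (O : Set (Space d))
    (F : Ω × Space d → Matrix (Fin d) (Fin d) ℝ) : ℝ :=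
  ∫ ω, ∫ x in O, V ω (symField T b B F (ω, x)) ∂volume ∂P

end Spaces

end

/-! Unfolding is composition with the measure-preserving map `unfoldMap`, hence an isometry into the
fixed space L^p(Ω × ℝ^d). Two-scale convergence is therefore ordinary weak or strong convergence
there. A lattice shift by b becomes the joint shift (ω, x) ↦ (T_b ω, x + εb), which on fixed
functions converges strongly to the shift of ω alone, because translations in x are continuous in
L^p.

Compactness. The growth of V bounds the symmetrized gradients, Korn's inequality at fixed ω bounds
the gradients, and a discrete Poincaré inequality bounds the fields. Weak compactness yields limits
U and G. Since the difference quotients stay bounded, U is invariant; summation by parts against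
ψ(ω)η(x) with ψ solenoidal gives ∫ G·ψη = -∫ U ψ·∇η (`HasTwoScaleGradient`).

It remains to write (U, G) as (W, ∇W + χ); this is `exists_decomposition`, the core of the proof.
The set of all such pairs is closed, because ∇W is invariant and so is its dual element
sign(t)|t|^(p-1), which annihilates χ; hence the norm of W is controlled by that of the sum. By
Hahn-Banach and Riesz it then suffices that every annihilator (g₀, g) of these pairs annihilates (U,
G). Annihilating potential fields means that g is solenoidal on O; annihilating the invariant pairs
means, formally, that g₀ equals div g when tested with invariant functions. Formally one inserts g
into the identity for G and U into the identity for g₀. Neither is smooth in x, so the space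
variable is doubled: G and U are evaluated at y, g at x, and a kernel κ(x, y) = θ(y)ρ(x - y) is
inserted. For fixed x the kernel is a test function in y and g(·, x) is an admissible ψ; for fixed y
it is a test function in x and U(·, y) is an admissible invariant φ. The derivatives falling on ρ
cancel. The bumps ρ are centred at a small vector pointing into O, which keeps κ(·, y) inside O; the
cone condition of a Lipschitz domain provides such vectors locally. As ρ concentrates, only the
terms with ∇θ remain, and they cancel when summed over a partition of unity (`product_rule`).

Lower bound. Up to an error proportional to the measure of the symmetric difference of O and the
union of the cells, the discrete energy dominates S ↦ ⟨∫_O V(ω, S)⟩ at the unfolded symmetrized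
gradient. This functional is convex and continuous on L^p, so its sublevel sets are weakly closed.

Upper bound. The pairs that are strong limits of fields and their gradients form a closed subspace
(`recoverable`). It contains (φη, φ∇η) for invariant φ, through the fields φ(ω)η(x), and (0, Dφ η)
for every φ in L^p, through the correctors εφ(T_{x/ε}ω)η(x); by density it contains every (U, ∇U +
χ). The energies converge by continuity of the functional. -/

set_option linter.unusedSectionVars false

/-! ### Duality of `L^p` spaces -/

section Duality

variable {α : Type*} [MeasurableSpace α] {μ : Measure α} {p q : ℝ≥0∞}

/-- Two continuous linear functionals on `L^p` that agree on indicators coincide. -/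
theorem Lp_functional_ext [Fact (1 ≤ p)] (hp' : p ≠ ∞) {ℓ m : Lp ℝ p μ →L[ℝ] ℝ}
    (h : ∀ (s : Set α) (hs : MeasurableSet s) (hμs : μ s ≠ ∞),
      ℓ (indicatorConstLp p hs hμs (1 : ℝ)) = m (indicatorConstLp p hs hμs 1)) : ℓ = m := by
  ext f
  refine Lp.induction hp' (fun f => ℓ f = m f) ?_ ?_ ?_ f
  · intro c s hs hμs
    have : (Lp.simpleFunc.indicatorConst p hs hμs.ne c : Lp ℝ p μ) =
        c • indicatorConstLp p hs hμs.ne (1 : ℝ) := by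
      rw [Lp.simpleFunc.coe_indicatorConst]
      ext1
      filter_upwards [indicatorConstLp_coeFn (p := p) (hs := hs) (hμs := hμs.ne) (c := c),
        Lp.coeFn_smul c (indicatorConstLp p hs hμs.ne (1 : ℝ)),
        indicatorConstLp_coeFn (p := p) (hs := hs) (hμs := hμs.ne) (c := (1 : ℝ))] with x h1 h2 h3
      rw [h1, h2, Pi.smul_apply, h3]
      by_cases hx : x ∈ s <;> simp [hx]
    rw [this, map_smul, map_smul, h]
  · intro f g hf hg _ h1 h2
    rw [map_add, map_add, h1, h2]
  · exact isClosed_eq ℓ.continuous m.continuous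

open Classical in
/-- The signed measure `s ↦ ℓ (1_s)` of a functional on `L^p` of a finite measure space. -/
noncomputable def signedMeasureOfFunctional [IsFiniteMeasure μ] [Fact (1 ≤ p)] (hp' : p ≠ ∞)
    (ℓ : Lp ℝ p μ →L[ℝ] ℝ) : SignedMeasure α where
  measureOf' s :=
    if h : MeasurableSet s then ℓ (indicatorConstLp p h (measure_ne_top μ s) 1) else 0
  empty' := by simp
  not_measurable' s hs := by simp [hs]
  m_iUnion' f hf hd := by
    simp only [hf, MeasurableSet.iUnion hf, dif_pos]
    refine ContinuousLinearMap.hasSum ℓ ?_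
    have hfin : ∀ s : Finset ℕ, MeasurableSet (⋃ i ∈ s, f i) := fun s =>
      Finset.measurableSet_biUnion _ fun i _ => hf i
    have key : ∀ s : Finset ℕ, ∑ i ∈ s, indicatorConstLp p (hf i) (measure_ne_top μ _) (1 : ℝ) =
        indicatorConstLp p (hfin s) (measure_ne_top μ _) 1 := by
      intro s
      induction s using Finset.induction_on with
      | empty => simp
      | insert a s ha ih =>
        have hdis : Disjoint (f a) (⋃ i ∈ s, f i) := by
          rw [Set.disjoint_iUnion₂_right]
          intro i hi
          exact hd (fun h => ha (h ▸ hi))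
        rw [Finset.sum_insert ha, ih, ← indicatorConstLp_disjoint_union (hf a) (hfin s)
          (measure_ne_top μ _) (measure_ne_top μ _) hdis]
        congr 1
        simp
    rw [HasSum]
    simp_rw [key]
    -- Countable additivity is the L^p convergence of the indicators of finite partial unions; for
    -- finite p it follows from the vanishing measure of the remainder.
    refine tendsto_indicatorConstLp_set hp' ?_
    have h1 : ∀ s : Finset ℕ, symmDiff (⋃ i ∈ s, f i) (⋃ i, f i) = (⋃ i, f i) \ ⋃ i ∈ s, f i := by
      intro s
      rw [symmDiff_def, Set.sdiff_eq_empty.2 (Set.iUnion₂_subset_iUnion _ _)]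
      exact Set.empty_union _
    simp_rw [h1]
    have h2 : ∀ s : Finset ℕ, μ ((⋃ i, f i) \ ⋃ i ∈ s, f i) = μ (⋃ i, f i) - ∑ i ∈ s, μ (f i) := by
      intro s
      rw [measure_sdiff (Set.iUnion₂_subset_iUnion _ _) (hfin s).nullMeasurableSet
        (measure_ne_top μ _), measure_biUnion_finset (fun i _ j _ hij => hd hij) fun i _ => hf i]
    simp_rw [h2]
    have h3 : Tendsto (fun s : Finset ℕ => ∑ i ∈ s, μ (f i)) atTop (𝓝 (μ (⋃ i, f i))) := by
      rw [measure_iUnion hd hf]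
      exact ENNReal.summable.hasSum
    have := ENNReal.Tendsto.sub (tendsto_const_nhds (x := μ (⋃ i, f i))) h3
      (Or.inl (measure_ne_top μ _))
    simpa using this

theorem signedMeasureOfFunctional_apply [IsFiniteMeasure μ] [Fact (1 ≤ p)] (hp' : p ≠ ∞)
    (ℓ : Lp ℝ p μ →L[ℝ] ℝ) {s : Set α} (hs : MeasurableSet s) :
    signedMeasureOfFunctional hp' ℓ s = ℓ (indicatorConstLp p hs (measure_ne_top μ s) 1) := by
  exact dif_pos hs

/-- The pairing with a function in the conjugate space, as a functional on `L^p`. -/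
noncomputable def pairingFunctional [Fact (1 ≤ p)] [ENNReal.HolderConjugate p q] {g : α → ℝ}
    (hg : MemLp g q μ) : Lp ℝ p μ →L[ℝ] ℝ :=
  haveI : Fact (1 ≤ q) := ⟨ENNReal.HolderConjugate.one_le q p⟩
  ((ContinuousLinearMap.mul ℝ ℝ).lpPairing μ p q).flip (hg.toLp g)

theorem pairingFunctional_apply [Fact (1 ≤ p)] [ENNReal.HolderConjugate p q] {g : α → ℝ}
    (hg : MemLp g q μ) (f : Lp ℝ p μ) : pairingFunctional hg f = ∫ x, f x * g x ∂μ := by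
  have : Fact (1 ≤ q) := ⟨ENNReal.HolderConjugate.one_le q p⟩
  rw [pairingFunctional, ContinuousLinearMap.flip_apply,
    ContinuousLinearMap.lpPairing_eq_integral]
  refine integral_congr_ae ?_
  filter_upwards [hg.coeFn_toLp] with x hx
  simp [hx]

theorem integral_indicatorConstLp_mul {s : Set α} (hs : MeasurableSet s) (hμs : μ s ≠ ∞)
    (g : α → ℝ) : ∫ x, indicatorConstLp p hs hμs (1 : ℝ) x * g x ∂μ = ∫ x in s, g x ∂μ := by
  rw [← integral_indicator hs]
  refine integral_congr_ae ?_
  filter_upwards [indicatorConstLp_coeFn (p := p) (hs := hs) (hμs := hμs) (c := (1 : ℝ))] with x hx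
  rw [hx]
  by_cases h : x ∈ s <;> simp [h]

/-- The duality map `t ↦ sign(t) |t|^{r-1}`. -/
noncomputable def dualMap (r t : ℝ) : ℝ := SignType.sign t * |t| ^ (r - 1)

theorem dualMap_zero (r : ℝ) : dualMap r 0 = 0 := by simp [dualMap]

theorem measurable_dualMap (r : ℝ) : Measurable (dualMap r) := by
  refine Measurable.mul ?_ (measurable_abs.pow_const _)
  have : (fun t : ℝ => ((SignType.sign t : SignType) : ℝ)) =
      fun t => if 0 < t then 1 else if t < 0 then -1 else 0 := by
    ext t
    rw [sign_apply]
    split_ifs <;> simp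
  rw [this]
  exact Measurable.ite measurableSet_Ioi measurable_const
    (Measurable.ite measurableSet_Iio measurable_const measurable_const)

theorem abs_dualMap {r : ℝ} (hr : 1 < r) (t : ℝ) : |dualMap r t| = |t| ^ (r - 1) := by
  simp only [dualMap, abs_mul]
  rw [abs_of_nonneg (Real.rpow_nonneg (abs_nonneg _) _)]
  rcases eq_or_ne t 0 with rfl | h0
  · simp [Real.zero_rpow (by linarith : r - 1 ≠ 0)]
  · rcases lt_or_gt_of_ne h0 with h1 | h1 <;> simp [sign_neg, sign_pos, h1]

theorem dualMap_mul_self {r : ℝ} (hr : 1 < r) (t : ℝ) : dualMap r t * t = |t| ^ r := by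
  rw [dualMap, mul_right_comm, sign_mul_self, ← Real.rpow_one_add' (abs_nonneg _) (by linarith)]
  congr 1
  ring

/-- The duality map sends `L^q` to the conjugate space `L^p` and computes the norm of `L^q`. -/
theorem memLp_dualMap_and_eLpNorm_le [ENNReal.HolderConjugate p q] (hp : 1 < p) (hp' : p ≠ ∞)
    {g : α → ℝ} (hg : MemLp g q μ) :
    MemLp (fun x => dualMap q.toReal (g x)) p μ ∧ ∀ M : ℝ, 0 ≤ M →
      ∫ x, dualMap q.toReal (g x) * g x ∂μ ≤
        M * (eLpNorm (fun x => dualMap q.toReal (g x)) p μ).toReal →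
      eLpNorm g q μ ≤ ENNReal.ofReal M := by
  have hq : 1 < q := (ENNReal.HolderConjugate.lt_top_iff_one_lt p q).1 hp'.lt_top
  have hq' : q ≠ ∞ := ((ENNReal.HolderConjugate.lt_top_iff_one_lt q p).2 hp).ne
  have hpr : 1 < p.toReal := by
    rw [← ENNReal.toReal_one]; exact (ENNReal.toReal_lt_toReal (by simp) hp').2 hp
  have hpq : p.toReal.HolderConjugate q.toReal := ENNReal.HolderConjugate.toReal hpr
  set r := q.toReal with hr
  set s := p.toReal with hs
  have hr1 : 1 < r := hpq.symm.lt
  have hr0 : 0 < r := by linarith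
  have hs0 : 0 < s := by linarith
  have hp0 : p ≠ 0 := (zero_lt_one.trans hp).ne'
  have hq0 : q ≠ 0 := (zero_lt_one.trans hq).ne'
  have hfp : ∀ x, |dualMap r (g x)| ^ s = |g x| ^ r := by
    intro x
    rw [abs_dualMap hr1, ← Real.rpow_mul (abs_nonneg _)]
    congr 1
    exact hpq.symm.sub_one_mul_conj
  have hf : MemLp (fun x => dualMap r (g x)) p μ := by
    have hm : AEStronglyMeasurable (fun x => dualMap r (g x)) μ :=
      ((measurable_dualMap r).comp_aemeasurable hg.1.aemeasurable).aestronglyMeasurable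
    rw [← integrable_norm_rpow_iff hm hp0 hp']
    simp_rw [Real.norm_eq_abs, ← hs, hfp]
    exact hg.integrable_norm_rpow hq0 hq'
  refine ⟨hf, fun M hM hle => ?_⟩
  set X := ∫ x, |g x| ^ r ∂μ with hX
  have hX0 : 0 ≤ X := integral_nonneg fun x => Real.rpow_nonneg (abs_nonneg _) _
  simp_rw [dualMap_mul_self hr1] at hle
  rw [hf.eLpNorm_eq_integral_rpow_norm hp0 hp', ENNReal.toReal_ofReal (by positivity)] at hle
  simp_rw [Real.norm_eq_abs, ← hs, hfp, ← hX] at hle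
  rw [hg.eLpNorm_eq_integral_rpow_norm hq0 hq']
  refine ENNReal.ofReal_le_ofReal ?_
  simp_rw [Real.norm_eq_abs, ← hr, ← hX]
  rcases hX0.eq_or_lt with h0 | h0
  · rw [← h0, Real.zero_rpow (by positivity)]
    exact hM
  -- The hypothesis now reads X ≤ M X^(1/s); cancelling X^(1/s) leaves X^(1/r) ≤ M, since the
  -- exponents are conjugate.
  · have : X = X ^ r⁻¹ * X ^ s⁻¹ := by
      rw [← Real.rpow_add h0, add_comm, hpq.inv_add_inv_eq_one, Real.rpow_one]
    have h2 : 0 < X ^ s⁻¹ := by positivity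
    nlinarith [this, hle]

/-- Take for g the Radon-Nikodym density of s ↦ ℓ(1_s). A priori g is only integrable. Testing ℓ
with the dual elements of its truncations bounds their L^q norms by ‖ℓ‖, and Fatou's lemma passes
the bound to g. -/
theorem exists_pairing_of_isFiniteMeasure [IsFiniteMeasure μ] [Fact (1 ≤ p)]
    [ENNReal.HolderConjugate p q] (hp : 1 < p) (hp' : p ≠ ∞) (ℓ : Lp ℝ p μ →L[ℝ] ℝ) :
    ∃ g : α → ℝ, MemLp g q μ ∧ ∀ f : Lp ℝ p μ, ℓ f = ∫ x, f x * g x ∂μ := by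
  set ν := signedMeasureOfFunctional hp' ℓ with hν
  have hac : VectorMeasure.AbsolutelyContinuous ν μ.toENNRealVectorMeasure := by
    refine VectorMeasure.AbsolutelyContinuous.mk fun s hs h0 => ?_
    rw [Measure.toENNRealVectorMeasure_apply_measurable hs] at h0
    rw [hν, signedMeasureOfFunctional_apply hp' ℓ hs]
    have : indicatorConstLp p hs (measure_ne_top μ s) (1 : ℝ) = 0 := by
      rw [← norm_eq_zero, norm_indicatorConstLp (zero_lt_one.trans hp).ne' hp', measureReal_def, h0]
      have : p.toReal ≠ 0 := (ENNReal.toReal_pos (zero_lt_one.trans hp).ne' hp').ne'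
      simp [Real.zero_rpow, this]
    rw [this, map_zero]
  set g := ν.rnDeriv μ with hg
  have hgm : Measurable g := SignedMeasure.measurable_rnDeriv _ _
  have hgi : Integrable g μ := SignedMeasure.integrable_rnDeriv _ _
  have hνg : ∀ s (hs : MeasurableSet s),
      ℓ (indicatorConstLp p hs (measure_ne_top μ s) 1) = ∫ x in s, g x ∂μ := by
    intro s hs
    rw [← signedMeasureOfFunctional_apply hp' ℓ hs, ← hν,
      ← SignedMeasure.withDensityᵥ_rnDeriv_eq ν μ hac, withDensityᵥ_apply hgi hs]
  have hA : ∀ n : ℕ, MeasurableSet {x | |g x| ≤ n} := fun n =>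
    measurableSet_le hgm.abs measurable_const
  let gn : ℕ → α → ℝ := fun n => {x | |g x| ≤ n}.indicator g
  have hgnm : ∀ n, Measurable (gn n) := fun n => hgm.indicator (hA n)
  have hgnb : ∀ n x, |gn n x| ≤ n := by
    intro n x
    by_cases hx : |g x| ≤ n
    · simp [gn, hx]
    · simp [gn, hx]
  have hgnq : ∀ n, MemLp (gn n) q μ := fun n =>
    MemLp.of_bound (hgnm n).aestronglyMeasurable n (ae_of_all _ (hgnb n))
  -- Multiplication by the indicator of {|g| ≤ n}: pairing with the truncation `gn n` is the
  -- composition of ℓ with this operator, as is seen on indicators.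
  let R : ℕ → Lp ℝ p μ →L[ℝ] Lp ℝ p μ := fun n =>
    (ContinuousLinearMap.mul ℝ ℝ).holderL μ ∞ p p
      (indicatorConstLp ∞ (hA n) (measure_ne_top μ _) 1)
  have hR : ∀ n (f : Lp ℝ p μ), R n f =ᵐ[μ] {x | |g x| ≤ n}.indicator f := by
    intro n f
    have h1 := (ContinuousLinearMap.mul ℝ ℝ).coeFn_holder (r := p)
      (indicatorConstLp ∞ (hA n) (measure_ne_top μ _) 1) f
    filter_upwards [h1, indicatorConstLp_coeFn (p := ∞) (hs := hA n)
      (hμs := measure_ne_top μ _) (c := (1 : ℝ))] with x h1 h2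
    simp only [R, ContinuousLinearMap.holderL_apply_apply, h1, h2]
    by_cases hx : |g x| ≤ n <;> simp [hx]
  have hpair : ∀ n, pairingFunctional (p := p) (hgnq n) = ℓ.comp (R n) := by
    intro n
    refine Lp_functional_ext hp' fun s hs hμs => ?_
    rw [pairingFunctional_apply, integral_indicatorConstLp_mul hs, ContinuousLinearMap.comp_apply]
    have : R n (indicatorConstLp p hs hμs 1) =
        indicatorConstLp p ((hA n).inter hs) (measure_ne_top μ _) 1 := by
      ext1
      filter_upwards [hR n (indicatorConstLp p hs hμs 1),
        indicatorConstLp_coeFn (p := p) (hs := hs) (hμs := hμs) (c := (1 : ℝ)),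
        indicatorConstLp_coeFn (p := p) (hs := (hA n).inter hs) (hμs := measure_ne_top μ _)
          (c := (1 : ℝ))] with x h1 h2 h3
      rw [h1, h3, Set.indicator_apply, h2, ← Set.indicator_apply, Set.indicator_indicator]
    rw [this, hνg, setIntegral_indicator (hA n), Set.inter_comm]
  have hbound : ∀ n, eLpNorm (gn n) q μ ≤ ENNReal.ofReal ‖ℓ‖ := by
    intro n
    obtain ⟨hf, hM⟩ := memLp_dualMap_and_eLpNorm_le (p := p) hp hp' (hgnq n)
    refine hM _ (norm_nonneg _) ?_
    set f : α → ℝ := fun x => dualMap q.toReal (gn n x) with hfdef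
    have hf0 : ∀ x, gn n x = 0 → f x = 0 := fun x hx => by
      simp only [hfdef, hx, dualMap_zero]
    have h1 : ∫ x, f x * gn n x ∂μ = pairingFunctional (p := p) (hgnq n) (hf.toLp f) := by
      rw [pairingFunctional_apply]
      refine integral_congr_ae ?_
      filter_upwards [hf.coeFn_toLp] with x hx
      rw [hx]
    -- The dual element of the truncation vanishes wherever the truncation does, so the cut-off
    -- leaves it unchanged.
    have h2 : R n (hf.toLp f) = hf.toLp f := by
      ext1
      filter_upwards [hR n (hf.toLp f), hf.coeFn_toLp] with x hx hx'
      rw [hx, Set.indicator_apply]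
      split_ifs with h
      · rfl
      · rw [hx', hf0 x]
        simp only [gn]
        rw [Set.indicator_of_notMem h]
    rw [← Lp.norm_toLp f hf]
    refine le_trans (le_of_eq ?_) ((le_abs_self _).trans (ℓ.le_opNorm (hf.toLp f)))
    rw [← h2, ← ContinuousLinearMap.comp_apply, ← hpair, ← h1]
  have hgq : MemLp g q μ := by
    refine ⟨hgm.aestronglyMeasurable, lt_of_le_of_lt ?_ (ENNReal.ofReal_lt_top (r := ‖ℓ‖))⟩
    refine (Lp.eLpNorm_lim_le_liminf_eLpNorm (f := gn)
      (fun n => (hgnm n).aestronglyMeasurable) g (ae_of_all _ fun x => ?_)).trans ?_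
    · obtain ⟨N, hN⟩ := exists_nat_ge |g x|
      refine tendsto_const_nhds.congr' ?_
      filter_upwards [eventually_ge_atTop N] with n hn
      have : x ∈ {x | |g x| ≤ n} := hN.trans (by exact_mod_cast hn)
      simp only [gn]
      rw [Set.indicator_of_mem this]
    · exact (liminf_le_liminf (Eventually.of_forall hbound)).trans (by simp)
  refine ⟨g, hgq, fun f => ?_⟩
  rw [← pairingFunctional_apply hgq]
  congr 1
  refine Lp_functional_ext hp' fun s hs hμs => ?_
  rw [hνg, pairingFunctional_apply, integral_indicatorConstLp_mul]

/-- Riesz representation: every continuous linear functional on `L^p` is the pairing with a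
function in `L^q`. -/
theorem exists_pairing_of_functional [SigmaFinite μ] [Fact (1 ≤ p)]
    [ENNReal.HolderConjugate p q] (hp : 1 < p) (hp' : p ≠ ∞) (ℓ : Lp ℝ p μ →L[ℝ] ℝ) :
    ∃ g : α → ℝ, MemLp g q μ ∧ ∀ f : Lp ℝ p μ, ℓ f = ∫ x, f x * g x ∂μ := by
  have hq : 1 < q := (ENNReal.HolderConjugate.lt_top_iff_one_lt p q).1 hp'.lt_top
  have hq' : q ≠ ∞ := ((ENNReal.HolderConjugate.lt_top_iff_one_lt q p).2 hp).ne
  have hpr : 1 < p.toReal := by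
    rw [← ENNReal.toReal_one]; exact (ENNReal.toReal_lt_toReal (by simp) hp').2 hp
  have hpq : p.toReal.HolderConjugate q.toReal := ENNReal.HolderConjugate.toReal hpr
  -- Reduction to a finite measure: for a positive integrable weight w, f ↦ f w^(1/p) is an isometry
  -- of L^p(wμ) onto L^p(μ), and f ↦ f w^(1/q) does the same for q. The two weights multiply to w,
  -- so the pairing is preserved.
  obtain ⟨w, hw0, hwm, hwi⟩ := exists_pos_lintegral_lt_of_sigmaFinite μ one_ne_zero
  set ν := μ.withDensity (fun x => (w x : ℝ≥0∞)) with hν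
  have hwm' : Measurable fun x => (w x : ℝ) := hwm.coe_nnreal_real
  have hwr0 : ∀ x, 0 < (w x : ℝ) := fun x => by exact_mod_cast hw0 x
  have : IsFiniteMeasure ν := isFiniteMeasure_withDensity (hwi.trans (by simp)).ne
  have hνμ : ν ≪ μ := withDensity_absolutelyContinuous _ _
  have hμν : μ ≪ ν := withDensity_absolutelyContinuous' hwm.coe_nnreal_ennreal.aemeasurable
    (ae_of_all _ fun x => by simpa using (hw0 x).ne')
  have hnorm : ∀ (t : ℝ≥0∞), 1 < t → t ≠ ∞ → ∀ f : α → ℝ,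
      eLpNorm (fun x => f x * (w x : ℝ) ^ t.toReal⁻¹) t μ = eLpNorm f t ν := by
    intro t ht ht' f
    have ht0 : 0 < t.toReal := ENNReal.toReal_pos (zero_lt_one.trans ht).ne' ht'
    rw [eLpNorm_eq_lintegral_rpow_enorm_toReal (zero_lt_one.trans ht).ne' ht',
      eLpNorm_eq_lintegral_rpow_enorm_toReal (zero_lt_one.trans ht).ne' ht', hν,
      lintegral_withDensity_eq_lintegral_mul_non_measurable _ hwm.coe_nnreal_ennreal
        (ae_of_all _ fun x => by simp)]
    congr 1
    refine lintegral_congr fun x => ?_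
    rw [Pi.mul_apply, enorm_mul, ENNReal.mul_rpow_of_nonneg _ _ ht0.le, mul_comm]
    congr 1
    rw [Real.enorm_eq_ofReal (by have := hwr0 x; positivity),
      ENNReal.ofReal_rpow_of_nonneg (by have := hwr0 x; positivity) ht0.le,
      ← Real.rpow_mul (hwr0 x).le, inv_mul_cancel₀ ht0.ne', Real.rpow_one]
    simp
  have hmem : ∀ (t : ℝ≥0∞), 1 < t → t ≠ ∞ → ∀ f : α → ℝ, MemLp f t ν →
      MemLp (fun x => f x * (w x : ℝ) ^ t.toReal⁻¹) t μ := by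
    intro t ht ht' f hf
    refine ⟨(hf.1.mono_ac hμν).mul (hwm'.pow_const _).aestronglyMeasurable, ?_⟩
    rw [hnorm t ht ht']
    exact hf.2
  let J₀ : Lp ℝ p ν →ₗ[ℝ] Lp ℝ p μ :=
    { toFun := fun f => (hmem p hp hp' f (Lp.memLp f)).toLp _
      map_add' := fun f g => by
        rw [← MemLp.toLp_add]
        refine MemLp.toLp_congr _ _ ?_
        filter_upwards [hμν.ae_le (Lp.coeFn_add f g)] with x hx
        simp only [hx, Pi.add_apply]
        ring
      map_smul' := fun c f => by
        rw [RingHom.id_apply, ← MemLp.toLp_const_smul]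
        refine MemLp.toLp_congr _ _ ?_
        filter_upwards [hμν.ae_le (Lp.coeFn_smul c f)] with x hx
        simp only [hx, Pi.smul_apply, smul_eq_mul]
        ring }
  let J : Lp ℝ p ν →L[ℝ] Lp ℝ p μ := J₀.mkContinuous 1 fun f => by
    simp only [J₀, LinearMap.coe_mk, AddHom.coe_mk]
    rw [Lp.norm_toLp, hnorm p hp hp', one_mul, Lp.norm_def]
  obtain ⟨g, hgq, hg⟩ := exists_pairing_of_isFiniteMeasure (q := q) hp hp' (ℓ.comp J)
  refine ⟨_, hmem q hq hq' g hgq, fun f => ?_⟩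
  let f' : α → ℝ := fun x => f x * (w x : ℝ) ^ (-p.toReal⁻¹)
  have hff : ∀ x, f' x * (w x : ℝ) ^ p.toReal⁻¹ = f x := fun x => by
    simp only [f']
    rw [mul_assoc, ← Real.rpow_add (hwr0 x), neg_add_cancel, Real.rpow_zero, mul_one]
  have hf' : MemLp f' p ν := by
    refine ⟨((Lp.aestronglyMeasurable f).mono_ac hνμ).mul
      (hwm'.pow_const _).aestronglyMeasurable, ?_⟩
    rw [← hnorm p hp hp']
    simp_rw [hff]
    exact (Lp.memLp f).2
  have hJ : J (hf'.toLp f') = f := by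
    change (hmem p hp hp' _ (Lp.memLp (hf'.toLp f'))).toLp _ = f
    ext1
    refine (MemLp.coeFn_toLp _).trans ?_
    filter_upwards [hμν.ae_le hf'.coeFn_toLp] with x hx
    rw [hx, hff]
  calc ℓ f = (ℓ.comp J) (hf'.toLp f') := by rw [ContinuousLinearMap.comp_apply, hJ]
    _ = ∫ x, hf'.toLp f' x * g x ∂ν := hg _
    _ = ∫ x, f' x * g x ∂ν := integral_congr_ae (by
        filter_upwards [hf'.coeFn_toLp] with x hx
        rw [hx])
    _ = _ := by
      rw [hν, integral_withDensity_eq_integral_smul hwm]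
      refine integral_congr_ae (ae_of_all _ fun x => ?_)
      simp only [NNReal.smul_def, smul_eq_mul, f']
      have : (w x : ℝ) = (w x : ℝ) ^ p.toReal⁻¹ * (w x : ℝ) ^ q.toReal⁻¹ := by
        rw [← Real.rpow_add (hwr0 x), hpq.inv_add_inv_eq_one, Real.rpow_one]
      rw [Real.rpow_neg (hwr0 x).le]
      have h1 : (w x : ℝ) ^ p.toReal⁻¹ ≠ 0 := (Real.rpow_pos_of_pos (hwr0 x) _).ne'
      generalize (w x : ℝ) ^ p.toReal⁻¹ = a at *
      generalize (w x : ℝ) ^ q.toReal⁻¹ = b at *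
      rw [this]
      field_simp

end Duality

/-! ### Weak convergence in `L^p` -/

section WeakConvergence

variable {α : Type*} [MeasurableSpace α] {μ : Measure α} {p q : ℝ≥0∞}

theorem enorm_integral_mul_le [ENNReal.HolderConjugate p q] {f g : α → ℝ}
    (hf : AEStronglyMeasurable f μ) (hg : AEStronglyMeasurable g μ) :
    ‖∫ x, f x * g x ∂μ‖ₑ ≤ eLpNorm f p μ * eLpNorm g q μ := by
  refine (enorm_integral_le_lintegral_enorm _).trans ?_
  rw [← eLpNorm_one_eq_lintegral_enorm]
  have h := eLpNorm_smul_le_mul_eLpNorm (p := p) (q := q) (r := 1) hg hf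
  rwa [show (f • g : α → ℝ) = fun x => f x * g x from rfl] at h

theorem integrable_mul_of_conjugate [ENNReal.HolderConjugate p q] {f g : α → ℝ}
    (hf : MemLp f p μ) (hg : MemLp g q μ) : Integrable (fun x => f x * g x) μ :=
  MemLp.integrable_mul hf hg

/-- Weak convergence in `L^p`, tested with the functions of the conjugate space `L^q`. -/
def TendstoWeakLp {ι : Type*} (q : ℝ≥0∞) (μ : Measure α) (l : Filter ι) (f : ι → α → ℝ)
    (F : α → ℝ) : Prop :=
  ∀ g : α → ℝ, MemLp g q μ → Tendsto (fun n => ∫ x, f n x * g x ∂μ) l (𝓝 (∫ x, F x * g x ∂μ))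

/-- The pairing of a bounded weakly convergent family with a strongly convergent one converges. -/
theorem TendstoWeakLp.tendsto_integral_mul [ENNReal.HolderConjugate p q] {ι : Type*}
    {l : Filter ι} {f g : ι → α → ℝ} {F G : α → ℝ} (h : TendstoWeakLp q μ l f F)
    (hf : ∀ n, MemLp (f n) p μ) {C : ℝ≥0∞} (hC : C ≠ ∞) (hfC : ∀ n, eLpNorm (f n) p μ ≤ C)
    (hg : ∀ n, MemLp (g n) q μ) (hG : MemLp G q μ)
    (hgG : Tendsto (fun n => eLpNorm (g n - G) q μ) l (𝓝 0)) :
    Tendsto (fun n => ∫ x, f n x * g n x ∂μ) l (𝓝 (∫ x, F x * G x ∂μ)) := by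
  have h1 : ∀ n, ∫ x, f n x * g n x ∂μ = ∫ x, f n x * G x ∂μ + ∫ x, f n x * (g n - G) x ∂μ := by
    intro n
    rw [← integral_add (integrable_mul_of_conjugate (hf n) hG)
      (integrable_mul_of_conjugate (hf n) ((hg n).sub hG))]
    refine integral_congr_ae (ae_of_all _ fun x => ?_)
    simp only [Pi.sub_apply]
    ring
  simp_rw [h1]
  have h2 : Tendsto (fun n => ∫ x, f n x * (g n - G) x ∂μ) l (𝓝 0) := by
    rw [tendsto_zero_iff_enorm_tendsto_zero]
    have h3 : Tendsto (fun n => C * eLpNorm (g n - G) q μ) l (𝓝 0) := by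
      simpa using ENNReal.Tendsto.const_mul hgG (Or.inr hC)
    refine tendsto_of_tendsto_of_tendsto_of_le_of_le tendsto_const_nhds h3 (fun _ => zero_le)
      fun n => ?_
    exact (enorm_integral_mul_le (p := p) (q := q) (hf n).1 ((hg n).sub hG).1).trans
      (mul_le_mul_left (hfC n) _)
  simpa using (h G hG).add h2

/-- The norm of `L^p` is dominated by the pairing with `L^q`: sequential weak compactness of
bounded sets. -/
theorem exists_subseq_tendstoWeakLp [SigmaFinite μ] [Fact (1 ≤ q)] [ENNReal.HolderConjugate p q]
    (hq : 1 < q) (hq' : q ≠ ∞) [TopologicalSpace.SeparableSpace (Lp ℝ q μ)]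
    {f : ℕ → α → ℝ} (hf : ∀ n, MemLp (f n) p μ) {C : ℝ≥0∞} (hC : C ≠ ∞)
    (hfC : ∀ n, eLpNorm (f n) p μ ≤ C) :
    ∃ s : ℕ → ℕ, StrictMono s ∧ ∃ F : α → ℝ, MemLp F p μ ∧
      TendstoWeakLp q μ atTop (fun n => f (s n)) F := by
  -- The functions are regarded as functionals on the separable space L^q, where bounded sequences
  -- have weak-* convergent subsequences.
  let φ : ℕ → WeakDual ℝ (Lp ℝ q μ) := fun n =>
    StrongDual.toWeakDual (pairingFunctional (p := q) (q := p) (hf n))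
  have hφ : ∀ n, φ n ∈ WeakDual.toStrongDual ⁻¹'
      Metric.closedBall (0 : StrongDual ℝ (Lp ℝ q μ)) C.toReal := by
    intro n
    simp only [φ, mem_preimage, mem_closedBall_zero_iff]
    refine ContinuousLinearMap.opNorm_le_bound _ ENNReal.toReal_nonneg fun g => ?_
    change ‖pairingFunctional (p := q) (q := p) (hf n) g‖ ≤ _
    rw [pairingFunctional_apply, Lp.norm_def, ← ENNReal.toReal_mul, ← toReal_enorm]
    refine ENNReal.toReal_mono (ENNReal.mul_ne_top hC (Lp.eLpNorm_ne_top g)) ?_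
    refine (enorm_integral_mul_le (p := q) (q := p) (Lp.aestronglyMeasurable g) (hf n).1).trans ?_
    rw [mul_comm]
    exact mul_le_mul_left (hfC n) _
  obtain ⟨ℓ, -, s, hs, hlim⟩ := WeakDual.isSeqCompact_closedBall ℝ (Lp ℝ q μ) 0 C.toReal hφ
  -- Riesz representation with the two exponents exchanged turns the limit functional back into a
  -- function in L^p.
  obtain ⟨F, hF, hℓ⟩ := exists_pairing_of_functional (q := p) hq hq' (WeakDual.toStrongDual ℓ)
  refine ⟨s, hs, F, hF, fun g hg => ?_⟩
  have h1 := tendsto_iff_forall_eval_tendsto_topDualPairing.1 hlim (hg.toLp g)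
  have h2 : ∀ (h : α → ℝ), ∫ x, hg.toLp g x * h x ∂μ = ∫ x, h x * g x ∂μ := fun h =>
    integral_congr_ae (by
      filter_upwards [hg.coeFn_toLp] with x hx
      rw [hx, mul_comm])
  have h3 : topDualPairing ℝ (Lp ℝ q μ) ℓ (hg.toLp g) = ∫ x, F x * g x ∂μ := by
    rw [← h2]
    exact hℓ _
  have h4 : ∀ n, topDualPairing ℝ (Lp ℝ q μ) ((φ ∘ s) n) (hg.toLp g) =
      ∫ x, f (s n) x * g x ∂μ := by
    intro n
    rw [← h2]
    exact pairingFunctional_apply (p := q) (q := p) (hf (s n)) (hg.toLp g)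
  rw [← h3]
  exact h1.congr h4

theorem TendstoWeakLp.comp {ι κ : Type*} {l : Filter ι} {l' : Filter κ} {f : ι → α → ℝ}
    {F : α → ℝ} (h : TendstoWeakLp q μ l f F) {s : κ → ι} (hs : Tendsto s l' l) :
    TendstoWeakLp q μ l' (fun n => f (s n)) F :=
  fun g hg => (h g hg).comp hs

/-- Simultaneous extraction for finitely many bounded sequences. -/
theorem exists_subseq_tendstoWeakLp_fintype {κ : Type*} [Finite κ] [SigmaFinite μ] [Fact (1 ≤ q)]
    [ENNReal.HolderConjugate p q] (hq : 1 < q) (hq' : q ≠ ∞)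
    [TopologicalSpace.SeparableSpace (Lp ℝ q μ)]
    {f : κ → ℕ → α → ℝ} (hf : ∀ k n, MemLp (f k n) p μ) {C : ℝ≥0∞} (hC : C ≠ ∞)
    (hfC : ∀ k n, eLpNorm (f k n) p μ ≤ C) :
    ∃ s : ℕ → ℕ, StrictMono s ∧ ∃ F : κ → α → ℝ, ∀ k, MemLp (F k) p μ ∧
      TendstoWeakLp q μ atTop (fun n => f k (s n)) (F k) := by
  classical
  have := Fintype.ofFinite κ
  suffices h : ∀ A : Finset κ, ∃ s : ℕ → ℕ, StrictMono s ∧ ∃ F : κ → α → ℝ, ∀ k ∈ A,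
      MemLp (F k) p μ ∧ TendstoWeakLp q μ atTop (fun n => f k (s n)) (F k) by
    simpa using h Finset.univ
  intro A
  induction A using Finset.induction_on with
  | empty => exact ⟨id, strictMono_id, fun _ _ => 0, by simp⟩
  | insert a A ha ih =>
    obtain ⟨s, hs, F, hF⟩ := ih
    obtain ⟨t, ht, G, hG, hfG⟩ := exists_subseq_tendstoWeakLp (q := q) hq hq'
      (fun n => hf a (s n)) hC (fun n => hfC a (s n))
    refine ⟨s ∘ t, hs.comp ht, Function.update F a G, fun k hk => ?_⟩
    rcases eq_or_ne k a with rfl | hka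
    · simpa using ⟨hG, hfG⟩
    · have hkA : k ∈ A := (Finset.mem_insert.1 hk).resolve_left hka
      rw [Function.update_of_ne hka]
      exact ⟨(hF k hkA).1, (hF k hkA).2.comp ht.tendsto_atTop⟩

/-! ### Duality for vector-valued L^p spaces -/

section Vector

variable {E : Type*} [NormedAddCommGroup E] [NormedSpace ℝ E] {κ : Type*} [Fintype κ]

/-- Riesz representation for vector-valued `L^p`, in coordinates `x = ∑ c_i(x) e_i`. -/
theorem exists_pairing_of_functional_vector [SigmaFinite μ] [Fact (1 ≤ p)]
    [ENNReal.HolderConjugate p q] (hp : 1 < p) (hp' : p ≠ ∞) (c : κ → E →L[ℝ] ℝ) (e : κ → E)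
    (hce : ∀ x, x = ∑ i, c i x • e i) (ℓ : Lp E p μ →L[ℝ] ℝ) :
    ∃ g : κ → α → ℝ, (∀ i, MemLp (g i) q μ) ∧
      ∀ f : Lp E p μ, ℓ f = ∑ i, ∫ x, c i (f x) * g i x ∂μ := by
  have h := fun i => exists_pairing_of_functional (q := q) hp hp'
    (ℓ.comp ((ContinuousLinearMap.toSpanSingleton ℝ (e i)).compLpL p μ))
  choose g hg hgℓ using h
  refine ⟨g, hg, fun f => ?_⟩
  have hf : f = ∑ i, (ContinuousLinearMap.toSpanSingleton ℝ (e i)).compLpL p μ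
      ((c i).compLpL p μ f) := by
    ext1
    have h1 : ∀ i, ((ContinuousLinearMap.toSpanSingleton ℝ (e i)).compLpL p μ
        ((c i).compLpL p μ f) : Lp E p μ) =ᵐ[μ] fun x => c i (f x) • e i := by
      intro i
      filter_upwards [(ContinuousLinearMap.toSpanSingleton ℝ (e i)).coeFn_compLpL
        ((c i).compLpL p μ f), (c i).coeFn_compLpL f] with x h1 h2
      rw [h1, h2, ContinuousLinearMap.toSpanSingleton_apply]
    have h2 := Lp.coeFn_finsetSum Finset.univ fun i =>
      (ContinuousLinearMap.toSpanSingleton ℝ (e i)).compLpL p μ ((c i).compLpL p μ f)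
    filter_upwards [h2, ae_all_iff.2 h1] with x h2 h1
    rw [h2, Finset.sum_apply]
    simp_rw [h1]
    exact hce _
  conv_lhs => rw [hf]
  rw [map_sum]
  refine Finset.sum_congr rfl fun i _ => ?_
  rw [← ContinuousLinearMap.comp_apply, hgℓ]
  refine integral_congr_ae ?_
  filter_upwards [(c i).coeFn_compLpL f] with x hx
  rw [hx]

/-- The bipolar theorem in `L^p`: membership in a closed subspace is tested with annihilators. -/
theorem mem_of_forall_annihilator [SigmaFinite μ] [Fact (1 ≤ p)]
    [ENNReal.HolderConjugate p q] (hp : 1 < p) (hp' : p ≠ ∞) (c : κ → E →L[ℝ] ℝ) (e : κ → E)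
    (hce : ∀ x, x = ∑ i, c i x • e i) (S : Submodule ℝ (Lp E p μ)) (hS : IsClosed (S : Set (Lp E p μ)))
    (f : Lp E p μ)
    (h : ∀ g : κ → α → ℝ, (∀ i, MemLp (g i) q μ) →
      (∀ u ∈ S, ∑ i, ∫ x, c i (u x) * g i x ∂μ = 0) → ∑ i, ∫ x, c i (f x) * g i x ∂μ = 0) :
    f ∈ S := by
  by_contra hf
  obtain ⟨ℓ, r, h1, h2⟩ := geometric_hahn_banach_closed_point (s := (S : Set (Lp E p μ)))
    S.convex hS hf
  have h3 : ∀ u ∈ S, ℓ u = 0 := by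
    intro u hu
    by_contra hne
    have h0 := h1 0 S.zero_mem
    -- A functional with ℓ < r on a subspace vanishes there: otherwise this multiple of u takes the
    -- value r.
    have h4 := h1 ((r / ℓ u) • u) (S.smul_mem _ hu)
    rw [map_smul, smul_eq_mul, div_mul_cancel₀ _ hne] at h4
    exact lt_irrefl _ h4
  obtain ⟨g, hg, hℓ⟩ := exists_pairing_of_functional_vector (q := q) hp hp' c e hce ℓ
  have h4 := h g hg fun u hu => by rw [← hℓ, h3 u hu]
  rw [← hℓ] at h4
  have h5 := h1 0 S.zero_mem
  rw [map_zero] at h5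
  linarith

/-- Closed convex sets of `L^p` are weakly sequentially closed. -/
theorem mem_of_tendstoWeakLp [SigmaFinite μ] [Fact (1 ≤ p)]
    [ENNReal.HolderConjugate p q] (hp : 1 < p) (hp' : p ≠ ∞) (c : κ → E →L[ℝ] ℝ) (e : κ → E)
    (hce : ∀ x, x = ∑ i, c i x • e i) {S : Set (Lp E p μ)} (hS : IsClosed S)
    (hSc : Convex ℝ S) {ι : Type*} {l : Filter ι} {u : ι → Lp E p μ} (hu : ∃ᶠ n in l, u n ∈ S)
    {f : Lp E p μ}
    (huf : ∀ i, TendstoWeakLp q μ l (fun n x => c i (u n x)) (fun x => c i (f x))) :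
    f ∈ S := by
  by_contra hf
  obtain ⟨ℓ, r, h1, h2⟩ := geometric_hahn_banach_closed_point hSc hS hf
  obtain ⟨g, hg, hℓ⟩ := exists_pairing_of_functional_vector (q := q) hp hp' c e hce ℓ
  have h3 : Tendsto (fun n => ℓ (u n)) l (𝓝 (ℓ f)) := by
    simp_rw [hℓ]
    exact tendsto_finsetSum _ fun i _ => huf i (g i) (hg i)
  obtain ⟨n, hn, hn'⟩ := (hu.and_eventually (h3.eventually (lt_mem_nhds h2))).exists
  exact lt_asymm (h1 _ hn) hn'

end Vector

end WeakConvergence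

/-! ### `L^p` spaces over the product of the probability space and `ℝ^d` -/

section Product

variable {α β : Type*} [MeasurableSpace α] [MeasurableSpace β] {μ : Measure α} {ν : Measure β}
  {p : ℝ≥0∞}

/-- By Tonelli's theorem the integral of the p-th power of a product of functions of separate
variables factorizes. -/
theorem eLpNorm_prod_le [SFinite μ] [SFinite ν] {E F G : Type*} [NormedAddCommGroup E]
    [NormedAddCommGroup F] [NormedAddCommGroup G] (hp : p ≠ 0) (hp' : p ≠ ∞)
    {f : α → E} {g : β → F} (hf : AEStronglyMeasurable f μ) (hg : AEStronglyMeasurable g ν)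
    {h : α × β → G} {C : NNReal} (hh : ∀ᵐ y ∂μ.prod ν, ‖h y‖ ≤ C * (‖f y.1‖ * ‖g y.2‖)) :
    eLpNorm h p (μ.prod ν) ≤ C * (eLpNorm f p μ * eLpNorm g p ν) := by
  have hp0 : 0 < p.toReal := ENNReal.toReal_pos hp hp'
  have key : eLpNorm (fun y : α × β => ‖f y.1‖ * ‖g y.2‖) p (μ.prod ν) =
      eLpNorm f p μ * eLpNorm g p ν := by
    rw [eLpNorm_eq_lintegral_rpow_enorm_toReal hp hp', eLpNorm_eq_lintegral_rpow_enorm_toReal hp hp',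
      eLpNorm_eq_lintegral_rpow_enorm_toReal hp hp', ← ENNReal.mul_rpow_of_nonneg _ _ (by positivity)]
    congr 1
    simp_rw [enorm_mul, enorm_norm, ENNReal.mul_rpow_of_nonneg _ _ hp0.le]
    exact lintegral_prod_mul (hf.enorm.pow_const _) (hg.enorm.pow_const _)
  rw [← key]
  exact eLpNorm_le_nnreal_smul_eLpNorm_of_ae_le_mul (by
    filter_upwards [hh] with y hy
    rw [← NNReal.coe_le_coe]
    simpa using hy) p

theorem memLp_bilin_prod [SFinite μ] [SFinite ν] {E F G : Type*} [NormedAddCommGroup E]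
    [NormedAddCommGroup F] [NormedAddCommGroup G] [NormedSpace ℝ E] [NormedSpace ℝ F]
    [NormedSpace ℝ G] (B : E →L[ℝ] F →L[ℝ] G) (hp : p ≠ 0) (hp' : p ≠ ∞)
    {f : α → E} {g : β → F} (hf : MemLp f p μ) (hg : MemLp g p ν) :
    MemLp (fun y : α × β => B (f y.1) (g y.2)) p (μ.prod ν) ∧
      eLpNorm (fun y : α × β => B (f y.1) (g y.2)) p (μ.prod ν) ≤
        ‖B‖₊ * (eLpNorm f p μ * eLpNorm g p ν) := by
  have h1 := eLpNorm_prod_le hp hp' hf.1 hg.1 (h := fun y : α × β => B (f y.1) (g y.2))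
    (C := ‖B‖₊) (ae_of_all _ fun y => by
      rw [← mul_assoc]
      exact B.le_opNorm₂ _ _)
  exact ⟨⟨B.aestronglyMeasurable_comp₂ hf.1.comp_fst hg.1.comp_snd, h1.trans_lt
    (ENNReal.mul_lt_top (by simp) (ENNReal.mul_lt_top hf.2 hg.2))⟩, h1⟩

theorem MeasureTheory.MemLp.mul_prod [SFinite μ] [SFinite ν] (hp : p ≠ 0) (hp' : p ≠ ∞) {f : α → ℝ} {g : β → ℝ}
    (hf : MemLp f p μ) (hg : MemLp g p ν) :
    MemLp (fun y : α × β => f y.1 * g y.2) p (μ.prod ν) :=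
  (memLp_bilin_prod (ContinuousLinearMap.mul ℝ ℝ) hp hp' hf hg).1

/-- The tensor product `(f ⊗ g)(x, y) = B (f x) (g y)` on `L^p` spaces. -/
noncomputable def tensorLp [SFinite μ] [SFinite ν] {E F G : Type*} [NormedAddCommGroup E]
    [NormedAddCommGroup F] [NormedAddCommGroup G] [NormedSpace ℝ E] [NormedSpace ℝ F]
    [NormedSpace ℝ G] [Fact (1 ≤ p)] (hp : p ≠ 0) (hp' : p ≠ ∞) (B : E →L[ℝ] F →L[ℝ] G) :
    Lp E p μ →L[ℝ] Lp F p ν →L[ℝ] Lp G p (μ.prod ν) :=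
  LinearMap.mkContinuous₂
    (LinearMap.mk₂ ℝ
      (fun f g => (memLp_bilin_prod B hp hp' (Lp.memLp f) (Lp.memLp g)).1.toLp _)
      (fun f f' g => by
        rw [← MemLp.toLp_add]
        refine MemLp.toLp_congr _ _ ?_
        filter_upwards [Measure.quasiMeasurePreserving_fst.ae (Lp.coeFn_add f f')] with y hy
        simp only [hy, Pi.add_apply, map_add, add_apply])
      (fun c f g => by
        rw [← MemLp.toLp_const_smul]
        refine MemLp.toLp_congr _ _ ?_
        filter_upwards [Measure.quasiMeasurePreserving_fst.ae (Lp.coeFn_smul c f)] with y hy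
        simp [hy])
      (fun f g g' => by
        rw [← MemLp.toLp_add]
        refine MemLp.toLp_congr _ _ ?_
        filter_upwards [Measure.quasiMeasurePreserving_snd.ae (Lp.coeFn_add g g')] with y hy
        simp only [hy, Pi.add_apply, map_add])
      (fun c f g => by
        rw [← MemLp.toLp_const_smul]
        refine MemLp.toLp_congr _ _ ?_
        filter_upwards [Measure.quasiMeasurePreserving_snd.ae (Lp.coeFn_smul c g)] with y hy
        simp [hy]))
    ‖B‖ (fun f g => by
      rw [LinearMap.mk₂_apply, Lp.norm_toLp, Lp.norm_def, Lp.norm_def, mul_assoc,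
        ← ENNReal.toReal_mul, ← coe_nnnorm B, ← ENNReal.coe_toReal, ← ENNReal.toReal_mul]
      exact ENNReal.toReal_mono (ENNReal.mul_ne_top (by simp)
        (ENNReal.mul_ne_top (Lp.eLpNorm_ne_top f) (Lp.eLpNorm_ne_top g)))
        (memLp_bilin_prod B hp hp' (Lp.memLp f) (Lp.memLp g)).2)

theorem coeFn_tensorLp [SFinite μ] [SFinite ν] {E F G : Type*} [NormedAddCommGroup E]
    [NormedAddCommGroup F] [NormedAddCommGroup G] [NormedSpace ℝ E] [NormedSpace ℝ F]
    [NormedSpace ℝ G] [Fact (1 ≤ p)] (hp : p ≠ 0) (hp' : p ≠ ∞) (B : E →L[ℝ] F →L[ℝ] G)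
    (f : Lp E p μ) (g : Lp F p ν) :
    tensorLp hp hp' B f g =ᵐ[μ.prod ν] fun y => B (f y.1) (g y.2) :=
  (memLp_bilin_prod B hp hp' (Lp.memLp f) (Lp.memLp g)).1.coeFn_toLp

theorem eLpNorm_le_of_abs_le_of_support {E : Type*} [NormedAddCommGroup E] {f : β → E} {c : ℝ}
    (hc : ∀ x, ‖f x‖ ≤ c) {K : Set β} (hK : ∀ x, x ∉ K → f x = 0) :
    eLpNorm f p ν ≤ ν K ^ p.toReal⁻¹ * ENNReal.ofReal c := by
  rw [← eLpNorm_restrict_eq_of_support_subset (s := K) (fun x hx => by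
    by_contra h
    exact hx (hK x h))]
  refine (eLpNorm_le_of_ae_bound (ae_of_all _ hc)).trans ?_
  simp

end Product

/-! ### Products of indicators and test functions separate L^p(Ω × ℝ^d) -/

section SmoothProducts

variable {Ω : Type*} [MeasurableSpace Ω] {P : Measure Ω} [IsFiniteMeasure P] {d : ℕ}
  {p q : ℝ≥0∞}

theorem isFiniteMeasure_restrict_univ_prod {K : Set (Space d)} (hK : Bornology.IsBounded K) :
    IsFiniteMeasure ((P.prod (volume : Measure (Space d))).restrict (univ ×ˢ K)) := by
  refine ⟨?_⟩
  rw [Measure.restrict_apply_univ, Measure.prod_prod]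
  exact ENNReal.mul_lt_top (measure_lt_top P _) hK.measure_lt_top

theorem MeasureTheory.MemLp.integrableOn_univ_prod {E : Type*} [NormedAddCommGroup E] (hp : 1 ≤ p)
    {g : Ω × Space d → E} (hg : MemLp g p (P.prod (volume : Measure (Space d))))
    {K : Set (Space d)} (hK : Bornology.IsBounded K) :
    IntegrableOn g (univ ×ˢ K) (P.prod (volume : Measure (Space d))) := by
  have := isFiniteMeasure_restrict_univ_prod (P := P) hK
  exact (hg.restrict _).integrable hp

theorem HasCompactSupport.exists_nonneg_bound {η : Space d → ℝ} (hη : Continuous η)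
    (hηc : HasCompactSupport η) : ∃ C, 0 ≤ C ∧ ∀ x, ‖η x‖ ≤ C := by
  obtain ⟨C, hC⟩ := hηc.exists_bound_of_continuous hη
  exact ⟨C, (norm_nonneg _).trans (hC 0), hC⟩

theorem integrable_mul_indicator_mul {g : Ω × Space d → ℝ} (hp : 1 ≤ p)
    (hg : MemLp g p (P.prod (volume : Measure (Space d)))) {A : Set Ω} (hA : MeasurableSet A)
    {η : Space d → ℝ} (hη : Continuous η) (hηc : HasCompactSupport η) :
    Integrable (fun y : Ω × Space d => g y * (A.indicator 1 y.1 * η y.2))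
      (P.prod (volume : Measure (Space d))) := by
  obtain ⟨C, -, hC⟩ := hηc.exists_nonneg_bound hη
  have h1 := hg.integrableOn_univ_prod hp hηc.isCompact.isBounded
  rw [← integrableOn_iff_integrable_of_support_subset (s := univ ×ˢ tsupport η)]
  · refine h1.mul_bdd (c := C) ?_ ?_
    · exact ((measurable_one.indicator hA).comp measurable_fst).aestronglyMeasurable.mul
        (hη.measurable.comp measurable_snd).aestronglyMeasurable
    · refine ae_of_all _ fun y => ?_
      by_cases hy : y.1 ∈ A
      · simpa [hy] using hC y.2
      · simpa [hy] using (norm_nonneg _).trans (hC 0)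
  · intro y hy
    refine ⟨mem_univ _, ?_⟩
    by_contra h
    exact hy (by simp [image_eq_zero_of_notMem_tsupport h])

/-- A function in `L^p(Ω × ℝ^d)` that is orthogonal to all products of indicators and smooth
functions vanishes. -/
theorem ae_eq_zero_of_forall_integral_prod {g : Ω × Space d → ℝ} (hp : 1 ≤ p)
    (hg : MemLp g p (P.prod (volume : Measure (Space d))))
    (h : ∀ (A : Set Ω) (_ : MeasurableSet A) (η : Space d → ℝ), ContDiff ℝ (⊤ : ℕ∞) η →
      HasCompactSupport η → ∫ y, g y * (A.indicator 1 y.1 * η y.2) ∂P.prod volume = 0) :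
    g =ᵐ[P.prod volume] 0 := by
  -- For fixed A, the function x ↦ ∫_A g(·, x) is locally integrable and orthogonal to all test
  -- functions, so it vanishes almost everywhere. Hence g has integral zero over bounded rectangles,
  -- and a π-λ argument extends this to all measurable subsets of Ω × ball.
  have hA : ∀ A : Set Ω, MeasurableSet A → ∀ᵐ x : Space d, ∫ ω in A, g (ω, x) ∂P = 0 := by
    intro A hA
    refine ae_eq_zero_of_integral_contDiff_smul_eq_zero ?_ ?_
    · rw [locallyIntegrable_iff]
      intro K hK
      have h1 := hg.integrableOn_univ_prod hp hK.isBounded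
      have h2 : Integrable g ((P.restrict A).prod (volume.restrict K)) := by
        rw [Measure.prod_restrict]
        exact h1.mono_set (prod_mono (subset_univ _) subset_rfl)
      exact h2.integral_prod_right
    · intro η hη hηc
      have h1 := integrable_mul_indicator_mul hp hg hA hη.continuous hηc
      rw [← h A hA η hη hηc, integral_prod_symm _ h1]
      refine integral_congr_ae (ae_of_all _ fun x => ?_)
      simp only [smul_eq_mul]
      rw [← integral_const_mul, ← integral_indicator hA]
      refine integral_congr_ae (ae_of_all _ fun ω => ?_)
      by_cases hω : ω ∈ A <;> simp [hω, mul_comm]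
  have hB : ∀ (A : Set Ω) (B : Set (Space d)), MeasurableSet A → MeasurableSet B →
      Bornology.IsBounded B → ∫ y in A ×ˢ B, g y ∂P.prod volume = 0 := by
    intro A B hAm hBm hBb
    have h1 : Integrable g ((P.restrict A).prod (volume.restrict B)) := by
      rw [Measure.prod_restrict]
      exact (hg.integrableOn_univ_prod hp hBb).mono_set (prod_mono (subset_univ _) subset_rfl)
    rw [← Measure.prod_restrict, integral_prod_symm _ h1]
    refine integral_eq_zero_of_ae ?_
    filter_upwards [ae_restrict_of_ae (hA A hAm)] with x hx
    exact hx
  have hn : ∀ n : ℕ, ∀ᵐ y ∂P.prod (volume : Measure (Space d)),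
      y ∈ (univ : Set Ω) ×ˢ Metric.ball (0 : Space d) n → g y = 0 := by
    intro n
    have hS : MeasurableSet ((univ : Set Ω) ×ˢ Metric.ball (0 : Space d) n) :=
      MeasurableSet.univ.prod measurableSet_ball
    rw [← ae_restrict_iff' hS]
    have hgi := hg.integrableOn_univ_prod hp (Metric.isBounded_ball (x := (0 : Space d)) (r := n))
    have hgi' : Integrable g ((P.prod volume).restrict
        ((univ : Set Ω) ×ˢ Metric.ball (0 : Space d) n)) := hgi
    refine hgi'.ae_eq_zero_of_forall_setIntegral_eq_zero fun S hSm _ => ?_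
    -- The restricted measure is finite. The finiteness condition on the set is dropped so that the
    -- induction concerns measurability alone and can pass to complements and unions.
    rename_i hSfin
    clear hSfin
    induction S, hSm using MeasurableSpace.induction_on_inter generateFrom_prod.symm
      isPiSystem_prod with
    | empty => simp
    | basic S hS' =>
      obtain ⟨A, hA, B, hB', rfl⟩ := hS'
      rw [Measure.restrict_restrict (MeasurableSet.prod hA (show MeasurableSet B from hB')), prod_inter_prod, inter_univ]
      exact hB A _ hA (MeasurableSet.inter hB' measurableSet_ball)
        (Metric.isBounded_ball.subset inter_subset_right)
    | compl S hSm ih =>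
      have h1 := integral_add_compl hSm hgi'
      rw [ih, zero_add] at h1
      rw [h1]
      exact hB univ _ MeasurableSet.univ measurableSet_ball Metric.isBounded_ball
    | iUnion f hf hfm ih =>
      rw [integral_iUnion hfm hf hgi'.integrableOn]
      simp [ih]
  filter_upwards [ae_all_iff.2 hn] with y hy
  obtain ⟨n, hn⟩ := exists_nat_gt ‖y.2‖
  exact hy n ⟨mem_univ _, by simpa using hn⟩

end SmoothProducts

/-! ### Density, separability and continuity of translations -/

section Density

variable {Ω : Type*} [MeasurableSpace Ω] {P : Measure Ω} [IsFiniteMeasure P] {d : ℕ}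
  {p q : ℝ≥0∞}

/-- The products `1_A(ω) η(x)` with a smooth, compactly supported `η`. -/
def smoothProducts (p : ℝ≥0∞) (P : Measure Ω) (d : ℕ) :
    Set (Lp ℝ p (P.prod (volume : Measure (Space d)))) :=
  {f | ∃ A : Set Ω, MeasurableSet A ∧ ∃ η : Space d → ℝ, ContDiff ℝ (⊤ : ℕ∞) η ∧
    HasCompactSupport η ∧ f =ᵐ[P.prod volume] fun y => A.indicator 1 y.1 * η y.2}

theorem memLp_indicator_one {A : Set Ω} (hA : MeasurableSet A) :
    MemLp (A.indicator (1 : Ω → ℝ)) p P :=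
  memLp_indicator_const p hA 1 (Or.inr (measure_ne_top P A))

theorem Continuous.memLp_space {η : Space d → ℝ} (hη : Continuous η)
    (hηc : HasCompactSupport η) : MemLp η p volume :=
  hη.memLp_of_hasCompactSupport hηc

theorem memLp_indicator_mul (hp : p ≠ 0) (hp' : p ≠ ∞) {A : Set Ω} (hA : MeasurableSet A)
    {η : Space d → ℝ} (hη : Continuous η) (hηc : HasCompactSupport η) :
    MemLp (fun y : Ω × Space d => A.indicator 1 y.1 * η y.2) p (P.prod volume) :=
  MemLp.mul_prod hp hp' (memLp_indicator_one hA) (hη.memLp_space hηc)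

/-- By duality: an element of L^q that annihilates the span is orthogonal to all products
1_A(ω)η(x), hence zero. -/
theorem topologicalClosure_span_smoothProducts [Fact (1 ≤ p)] [ENNReal.HolderConjugate p q]
    (hp : 1 < p) (hp' : p ≠ ∞) :
    (Submodule.span ℝ (smoothProducts p P d)).topologicalClosure = ⊤ := by
  have hp0 : p ≠ 0 := (zero_lt_one.trans hp).ne'
  rw [eq_top_iff]
  intro f _
  refine mem_of_forall_annihilator (q := q) hp hp' (κ := Unit)
    (fun _ => ContinuousLinearMap.id ℝ ℝ) (fun _ => 1) (by simp) _
    (Submodule.isClosed_topologicalClosure _) f ?_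
  intro g hg hS
  have hg0 : g () =ᵐ[P.prod volume] 0 := by
    refine ae_eq_zero_of_forall_integral_prod (ENNReal.HolderConjugate.one_le q p) (hg ()) ?_
    intro A hA η hη hηc
    have hm := memLp_indicator_mul (P := P) hp0 hp' hA hη.continuous hηc
    have h1 := hS (hm.toLp _) (Submodule.le_topologicalClosure _ (Submodule.subset_span
      ⟨A, hA, η, hη, hηc, hm.coeFn_toLp⟩))
    simp only [Finset.univ_unique, Finset.sum_singleton, ContinuousLinearMap.id_apply] at h1
    rw [← h1]
    refine integral_congr_ae ?_
    filter_upwards [hm.coeFn_toLp] with y hy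
    rw [hy, mul_comm]
  simp only [Finset.univ_unique, Finset.sum_singleton]
  refine integral_eq_zero_of_ae ?_
  filter_upwards [hg0] with y hy
  simp [show g default y = 0 from hy]

/-- Separability of the predual is what makes bounded sets weakly sequentially compact. The tensor
map is continuous on a product of two separable spaces, and the span of its range contains the dense
set of smooth products. -/
theorem separableSpace_Lp_prod [IsSeparable P] [Fact (1 ≤ p)] [ENNReal.HolderConjugate p q]
    (hp : 1 < p) (hp' : p ≠ ∞) :
    TopologicalSpace.SeparableSpace (Lp ℝ p (P.prod (volume : Measure (Space d)))) := by
  have hp0 : p ≠ 0 := (zero_lt_one.trans hp).ne'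
  have : Fact (p ≠ ∞) := ⟨hp'⟩
  rw [← TopologicalSpace.isSeparable_univ_iff]
  let t : Lp ℝ p P × Lp ℝ p (volume : Measure (Space d)) → Lp ℝ p (P.prod volume) :=
    fun z => tensorLp hp0 hp' (ContinuousLinearMap.mul ℝ ℝ) z.1 z.2
  have ht : Continuous t :=
    (tensorLp hp0 hp' (ContinuousLinearMap.mul ℝ ℝ)).continuous₂
  have h1 : TopologicalSpace.IsSeparable (range t) := TopologicalSpace.isSeparable_range ht
  have h2 := h1.span (R := ℝ)
  refine h2.closure.mono ?_
  rw [← Submodule.top_coe (R := ℝ), ← topologicalClosure_span_smoothProducts (q := q) hp hp',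
    Submodule.topologicalClosure_coe]
  refine closure_mono (Submodule.span_mono ?_)
  rintro f ⟨A, hA, η, hη, hηc, hf⟩
  refine ⟨((memLp_indicator_one hA).toLp _, (hη.continuous.memLp_space hηc).toLp _), ?_⟩
  ext1
  filter_upwards [coeFn_tensorLp hp0 hp' (ContinuousLinearMap.mul ℝ ℝ)
      ((memLp_indicator_one (P := P) (p := p) hA).toLp _)
      ((hη.continuous.memLp_space (p := p) hηc).toLp _), hf,
    Measure.quasiMeasurePreserving_fst.ae (memLp_indicator_one (P := P) (p := p) hA).coeFn_toLp,
    Measure.quasiMeasurePreserving_snd.ae (hη.continuous.memLp_space (p := p) hηc).coeFn_toLp]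
    with y h1 h2 h3 h4
  rw [h1, h2, h3, h4]
  rfl

theorem measurePreserving_shift (h : Space d) :
    MeasurePreserving (fun y : Ω × Space d => (y.1, y.2 + h)) (P.prod volume) (P.prod volume) :=
  (MeasurePreserving.id P).prod (measurePreserving_add_right volume h)

/-- Translations are strongly continuous on `L^p(Ω × ℝ^d)`. -/
theorem tendsto_eLpNorm_shift_sub [ENNReal.HolderConjugate p q]
    (hp : 1 < p) (hp' : p ≠ ∞) {f : Ω × Space d → ℝ} (hf : MemLp f p (P.prod volume)) :
    Tendsto (fun h : Space d => eLpNorm (fun y => f (y.1, y.2 + h) - f y) p (P.prod volume))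
      (𝓝 0) (𝓝 0) := by
  have hp0 : p ≠ 0 := (zero_lt_one.trans hp).ne'
  have : Fact (1 ≤ p) := ⟨hp.le⟩
  have hmp := measurePreserving_shift (P := P) (d := d)
  have hcomp : ∀ (g : Ω × Space d → ℝ), MemLp g p (P.prod volume) → ∀ h : Space d,
      MemLp (fun y : Ω × Space d => g (y.1, y.2 + h)) p (P.prod volume) := fun g hg h =>
    hg.comp_measurePreserving (hmp h)
  have hspan : ∀ g ∈ Submodule.span ℝ (smoothProducts p P d),
      Tendsto (fun h : Space d => eLpNorm (fun y => g (y.1, y.2 + h) - g y) p (P.prod volume))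
        (𝓝 0) (𝓝 0) := by
    intro g hg
    induction hg using Submodule.span_induction with
    | mem g hg =>
      obtain ⟨A, hA, η, hη, hηc, hg⟩ := hg
      have huc := hηc.uniformContinuous_of_continuous hη.continuous
      set K : Set (Space d) := Metric.cthickening 1 (tsupport η) with hK
      have hKb : Bornology.IsBounded K := hηc.isCompact.isBounded.cthickening
      have hKv : volume K ≠ ∞ := hKb.measure_lt_top.ne
      -- Uniform continuity makes the increment of η at most c for small h, and for ‖h‖ < 1 the
      -- increment is supported in the 1-neighbourhood K of the support of η.
      have hbound : ∀ c > 0, ∀ᶠ h : Space d in 𝓝 0,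
          eLpNorm (fun y => g (y.1, y.2 + h) - g y) p (P.prod volume) ≤
            eLpNorm (A.indicator (1 : Ω → ℝ)) p P *
              (volume K ^ p.toReal⁻¹ * ENNReal.ofReal c) := by
        intro c hc
        obtain ⟨δ, hδ, hδc⟩ := Metric.uniformContinuous_iff.1 huc c hc
        filter_upwards [Metric.ball_mem_nhds (0 : Space d) (lt_min hδ one_pos)] with h hh
        have hh' : ‖h‖ < min δ 1 := by simpa using hh
        have h1 : (fun y : Ω × Space d => g (y.1, y.2 + h) - g y) =ᵐ[P.prod volume]
            fun y => A.indicator 1 y.1 * (η (y.2 + h) - η y.2) := by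
          filter_upwards [hg, (hmp h).quasiMeasurePreserving.ae hg] with y h1 h2
          rw [h1, h2]
          ring
        rw [eLpNorm_congr_ae h1]
        refine (eLpNorm_prod_le (C := 1) hp0 hp' (memLp_indicator_one (p := p) hA).1
          (g := fun x => η (x + h) - η x) ?_ (ae_of_all _ fun y => ?_)).trans ?_
        · exact ((hη.continuous.comp (continuous_add_const h)).sub
            hη.continuous).aestronglyMeasurable
        · rw [norm_mul]; simp
        · simp only [ENNReal.coe_one, one_mul]
          gcongr
          refine eLpNorm_le_of_abs_le_of_support (fun x => ?_) (fun x hx => ?_)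
          · rw [← dist_eq_norm]
            exact (hδc (by simpa using hh'.trans_le (min_le_left _ _))).le
          · have hx1 : x ∉ tsupport η := fun h' =>
              hx (Metric.self_subset_cthickening _ h')
            have hx2 : x + h ∉ tsupport η := fun h' => hx (by
              refine Metric.mem_cthickening_of_dist_le x (x + h) 1 _ h' ?_
              simpa using (hh'.trans_le (min_le_right _ _)).le)
            simp [image_eq_zero_of_notMem_tsupport hx1, image_eq_zero_of_notMem_tsupport hx2]
      set M := eLpNorm (A.indicator (1 : Ω → ℝ)) p P * volume K ^ p.toReal⁻¹ with hM
      have hMt : M ≠ ∞ := ENNReal.mul_ne_top (memLp_indicator_one hA).2.ne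
        (ENNReal.rpow_ne_top_of_nonneg (by positivity) hKv)
      rw [ENNReal.tendsto_nhds_zero]
      intro ε hε
      have hlim : Tendsto (fun c : ℝ => M * ENNReal.ofReal c) (𝓝[>] 0) (𝓝 0) := by
        have h1 : Tendsto (fun c : ℝ => ENNReal.ofReal c) (𝓝[>] 0) (𝓝 0) := by
          simpa using (ENNReal.tendsto_ofReal (tendsto_id (α := ℝ) (x := 𝓝 0))).mono_left
            nhdsWithin_le_nhds
        simpa using ENNReal.Tendsto.const_mul h1 (Or.inr hMt)
      obtain ⟨c, hc1, hc⟩ := ((ENNReal.tendsto_nhds_zero.1 hlim ε hε).and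
        self_mem_nhdsWithin).exists
      filter_upwards [hbound c hc] with h hh
      refine hh.trans ?_
      rwa [← mul_assoc]
    | zero =>
      refine tendsto_const_nhds.congr fun h => ?_
      rw [eLpNorm_congr_ae (g := 0), eLpNorm_zero]
      filter_upwards [Lp.coeFn_zero ℝ p (P.prod (volume : Measure (Space d))),
        (hmp h).quasiMeasurePreserving.ae (Lp.coeFn_zero ℝ p (P.prod volume))] with y h1 h2
      rw [h1, h2]
      simp
    | add f g _ _ hf hg =>
      have h1 := hf.add hg
      rw [add_zero] at h1
      refine tendsto_of_tendsto_of_tendsto_of_le_of_le tendsto_const_nhds h1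
        (fun _ => zero_le) fun h => ?_
      refine le_trans (le_of_eq ?_) (eLpNorm_add_le
        ((hcomp f (Lp.memLp f) h).sub (Lp.memLp f)).1
        ((hcomp g (Lp.memLp g) h).sub (Lp.memLp g)).1 hp.le)
      refine eLpNorm_congr_ae ?_
      filter_upwards [Lp.coeFn_add f g, (hmp h).quasiMeasurePreserving.ae (Lp.coeFn_add f g)]
        with y h1 h2
      rw [h1, h2]
      simp only [Pi.add_apply]
      ring
    | smul a f _ hf =>
      have h1 := ENNReal.Tendsto.const_mul (a := ‖a‖ₑ) hf (Or.inr (by simp))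
      rw [mul_zero] at h1
      refine h1.congr fun h => ?_
      rw [← eLpNorm_const_smul]
      refine eLpNorm_congr_ae ?_
      filter_upwards [Lp.coeFn_smul a f, (hmp h).quasiMeasurePreserving.ae (Lp.coeFn_smul a f)]
        with y h1 h2
      rw [h1, h2]
      simp only [Pi.smul_apply, smul_eq_mul]
      ring
  rw [ENNReal.tendsto_nhds_zero]
  intro ε hε
  have hfcl : hf.toLp f ∈ closure (Submodule.span ℝ (smoothProducts p P d) : Set _) := by
    rw [← Submodule.topologicalClosure_coe, topologicalClosure_span_smoothProducts (q := q) hp hp']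
    trivial
  have hε3 : 0 < ε / 3 := ENNReal.div_pos hε.ne' (by simp)
  obtain ⟨g, hgS, hg⟩ := EMetric.mem_closure_iff.1 hfcl (ε / 3) hε3
  have hfg : eLpNorm (f - ⇑g) p (P.prod volume) ≤ ε / 3 := by
    rw [Lp.edist_def] at hg
    refine le_trans (le_of_eq (eLpNorm_congr_ae ?_)) hg.le
    filter_upwards [hf.coeFn_toLp] with y hy
    simp [hy]
  filter_upwards [ENNReal.tendsto_nhds_zero.1 (hspan g hgS) (ε / 3) hε3] with h hh
  have hm := hf.sub (Lp.memLp g)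
  have h1 : eLpNorm (fun y => (f - ⇑g) (y.1, y.2 + h)) p (P.prod volume) ≤ ε / 3 := by
    rw [show (fun y : Ω × Space d => (f - ⇑g) (y.1, y.2 + h)) =
      (f - ⇑g) ∘ (fun y => (y.1, y.2 + h)) from rfl, eLpNorm_comp_measurePreserving hm.1 (hmp h)]
    exact hfg
  -- Density argument with three terms: translation is an isometry, so the shifted error f - g is as
  -- small as the unshifted one.
  have h2 : (fun y : Ω × Space d => f (y.1, y.2 + h) - f y) =
      (fun y => (f - ⇑g) (y.1, y.2 + h)) + (fun y => g (y.1, y.2 + h) - g y) - (f - ⇑g) := by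
    ext y
    simp only [Pi.add_apply, Pi.sub_apply]
    ring
  rw [h2]
  have m1 := hcomp _ hm h
  have m2 := (hcomp g (Lp.memLp g) h).sub (Lp.memLp g)
  calc _ ≤ _ := eLpNorm_sub_le (m1.add m2).1 hm.1 hp.le
    _ ≤ (ε / 3 + ε / 3) + ε / 3 :=
      add_le_add ((eLpNorm_add_le m1.1 m2.1 hp.le).trans (add_le_add h1 hh)) hfg
    _ = ε := ENNReal.add_thirds ε

end Density

/-! ### The lattice and stochastic unfolding -/

section Lattice

variable {d : ℕ}

@[simp] theorem latticePoint_apply (ε : ℝ) (z : IntLattice d) (i : Fin d) :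
    latticePoint ε z i = ε * (z i : ℝ) := rfl

theorem latticePoint_neg (ε : ℝ) (z : IntLattice d) : latticePoint ε (-z) = -latticePoint ε z := by
  ext i; simp

theorem latticePoint_add (ε : ℝ) (z w : IntLattice d) :
    latticePoint ε (z + w) = latticePoint ε z + latticePoint ε w := by
  ext i; simp [mul_add]

theorem latticePoint_eq_smul (ε : ℝ) (z : IntLattice d) :
    latticePoint ε z = ε • latticePoint 1 z := by
  ext i; simp

theorem cellIndex_add {ε : ℝ} (hε : 0 < ε) (x : Space d) (b : IntLattice d) :
    cellIndex ε (x + latticePoint ε b) = cellIndex ε x + b := by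
  ext i
  simp only [cellIndex, PiLp.add_apply, latticePoint_apply, Pi.add_apply]
  rw [← Int.floor_add_intCast]
  congr 1
  field_simp
  ring

theorem measurable_cellIndex (ε : ℝ) : Measurable (cellIndex (d := d) ε) := by
  refine measurable_pi_iff.2 fun i => ?_
  exact Int.measurable_floor.comp (by fun_prop)

theorem volume_cell {ε : ℝ} (hε : 0 < ε) (z : IntLattice d) :
    volume (cellIndex (d := d) ε ⁻¹' {z}) = ENNReal.ofReal (ε ^ d) := by
  have h1 : cellIndex (d := d) ε ⁻¹' {z} = (WithLp.ofLp : Space d → Fin d → ℝ) ⁻¹'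
      (Set.pi univ fun i => Ico (ε * (z i - 1 / 2)) (ε * (z i + 1 / 2))) := by
    ext x
    simp only [mem_preimage, mem_singleton_iff, Set.mem_pi, mem_univ, true_imp_iff, mem_Ico]
    rw [funext_iff]
    refine forall_congr' fun i => ?_
    simp only [cellIndex]
    rw [Int.floor_eq_iff, ← sub_le_iff_le_add, le_div_iff₀ hε, ← lt_sub_iff_add_lt, div_lt_iff₀ hε]
    constructor <;> rintro ⟨h1, h2⟩ <;> constructor <;> nlinarith
  rw [h1, (PiLp.volume_preserving_ofLp (Fin d)).measure_preimage
    (MeasurableSet.univ_pi fun i => measurableSet_Ico).nullMeasurableSet, volume_pi_pi]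
  simp_rw [Real.volume_Ico]
  have : ∀ i, ENNReal.ofReal (ε * (z i + 1 / 2) - ε * (z i - 1 / 2)) = ENNReal.ofReal ε := by
    intro i; congr 1; ring
  simp_rw [this]
  rw [Finset.prod_const, Finset.card_univ, Fintype.card_fin, ENNReal.ofReal_pow hε.le]

/-- Each cell has volume ε^d, which is the mass of a lattice point. -/
theorem measurePreserving_cellIndex {ε : ℝ} (hε : 0 < ε) :
    MeasurePreserving (cellIndex (d := d) ε) volume (latticeMeasure d ε) := by
  refine ⟨measurable_cellIndex ε, ?_⟩
  refine Measure.ext_of_singleton fun z => ?_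
  rw [Measure.map_apply (measurable_cellIndex ε) (measurableSet_singleton z), volume_cell hε]
  simp [latticeMeasure]

theorem measurePreserving_lattice_add (ε : ℝ) (b : IntLattice d) :
    MeasurePreserving (fun z : IntLattice d => z + b) (latticeMeasure d ε)
      (latticeMeasure d ε) := by
  refine ⟨measurable_of_countable _, Measure.ext_of_singleton fun z => ?_⟩
  rw [Measure.map_apply (measurable_of_countable _) (measurableSet_singleton z)]
  have : (fun w : IntLattice d => w + b) ⁻¹' {z} = {z - b} := by
    ext w
    simp only [mem_preimage, mem_singleton_iff, eq_sub_iff_add_eq]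
  rw [this]
  simp [latticeMeasure]

end Lattice

/-! ### Unfolding as a measure-preserving change of variables -/

section Unfolding

variable {Ω : Type*} [MeasurableSpace Ω] {P : Measure Ω} {d : ℕ}
  {T : IntLattice d → Ω → Ω}

/-- The unfolding map `(ω, x) ↦ (T_{-⌊x⌋_ε / ε} ω, ⌊x⌋_ε / ε)`. -/
noncomputable def unfoldMap (T : IntLattice d → Ω → Ω) (ε : ℝ) (y : Ω × Space d) : Ω × IntLattice d :=
  (T (-cellIndex ε y.2) y.1, cellIndex ε y.2)

/-- The joint shift `(ω, x) ↦ (T_b ω, x + ε b)`. -/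
noncomputable def jointShift (T : IntLattice d → Ω → Ω) (ε : ℝ) (b : IntLattice d) (y : Ω × Space d) :
    Ω × Space d :=
  (T b y.1, y.2 + latticePoint ε b)

theorem IsDynamicalSystem.measurable_uncurry (hT : IsDynamicalSystem P T) :
    Measurable fun y : IntLattice d × Ω => T y.1 y.2 :=
  measurable_from_prod_countable_right fun z => (hT.measurePreserving z).measurable

theorem IsDynamicalSystem.neg_apply (hT : IsDynamicalSystem P T) (z : IntLattice d) (ω : Ω) :
    T (-z) (T z ω) = ω := by
  rw [← hT.add, neg_add_cancel, hT.zero]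

theorem IsDynamicalSystem.apply_neg (hT : IsDynamicalSystem P T) (z : IntLattice d) (ω : Ω) :
    T z (T (-z) ω) = ω := by
  rw [← hT.add, add_neg_cancel, hT.zero]

variable [IsProbabilityMeasure P]

/-- A skew product: the base map x ↦ ⌊x⌋_ε/ε preserves the measures, and on each fibre the map of Ω
is one of the measure-preserving T_z. Therefore unfolding is an isometry of L^p spaces. -/
theorem measurePreserving_unfoldMap (hT : IsDynamicalSystem P T) {ε : ℝ} (hε : 0 < ε) :
    MeasurePreserving (unfoldMap T ε) (P.prod volume) (P.prod (latticeMeasure d ε)) := by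
  have h1 : MeasurePreserving (fun y : Space d × Ω => (cellIndex ε y.1, T (-cellIndex ε y.1) y.2))
      (volume.prod P) ((latticeMeasure d ε).prod P) := by
    refine (measurePreserving_cellIndex hε).skew_product (g := fun x ω => T (-cellIndex ε x) ω) ?_
      (ae_of_all _ fun x => (hT.measurePreserving _).map_eq)
    exact hT.measurable_uncurry.comp
      ((((measurable_cellIndex ε).comp measurable_fst).neg).prodMk measurable_snd)
  exact (Measure.measurePreserving_swap.comp h1).comp Measure.measurePreserving_swap

theorem measurePreserving_jointShift (hT : IsDynamicalSystem P T) (ε : ℝ) (b : IntLattice d) :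
    MeasurePreserving (jointShift T ε b) (P.prod volume) (P.prod volume) :=
  (hT.measurePreserving b).prod (measurePreserving_add_right volume (latticePoint ε b))

theorem jointShift_neg_apply (hT : IsDynamicalSystem P T) (ε : ℝ) (b : IntLattice d)
    (y : Ω × Space d) : jointShift T ε (-b) (jointShift T ε b y) = y := by
  simp [jointShift, hT.neg_apply, latticePoint_neg]

theorem jointShift_apply_neg (hT : IsDynamicalSystem P T) (ε : ℝ) (b : IntLattice d)
    (y : Ω × Space d) : jointShift T ε b (jointShift T ε (-b) y) = y := by
  simp [jointShift, hT.apply_neg, latticePoint_neg]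

/-- Change of variables for the joint shift. -/
theorem integral_comp_jointShift (hT : IsDynamicalSystem P T) (ε : ℝ) (b : IntLattice d)
    (f g : Ω × Space d → ℝ) :
    ∫ y, f (jointShift T ε b y) * g y ∂P.prod volume =
      ∫ y, f y * g (jointShift T ε (-b) y) ∂P.prod volume := by
  let e : (Ω × Space d) ≃ᵐ (Ω × Space d) :=
    { toFun := jointShift T ε b
      invFun := jointShift T ε (-b)
      left_inv := jointShift_neg_apply hT ε b
      right_inv := jointShift_apply_neg hT ε b
      measurable_toFun := (measurePreserving_jointShift hT ε b).measurable
      measurable_invFun := (measurePreserving_jointShift hT ε (-b)).measurable }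
  have h1 := (measurePreserving_jointShift hT ε b).integral_comp (e.measurableEmbedding)
    (fun y => f y * g (jointShift T ε (-b) y))
  rw [← h1]
  simp_rw [jointShift_neg_apply hT]

theorem unfolding_eq_comp (T : IntLattice d → Ω → Ω) (ε : ℝ) (u : Ω → IntLattice d → ℝ) :
    unfolding T ε u = (fun y : Ω × IntLattice d => u y.1 y.2) ∘ unfoldMap T ε := rfl

/-- Moving x by εb moves the cell by b, and the additional T_{-b} in the unfolding undoes the T_b
applied to ω. Thus a pure lattice shift at fixed ω is seen, after unfolding, as a simultaneous shift
of ω and x. -/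
theorem unfoldMap_jointShift (hT : IsDynamicalSystem P T) {ε : ℝ} (hε : 0 < ε) (b : IntLattice d)
    (y : Ω × Space d) :
    unfoldMap T ε (jointShift T ε b y) = ((unfoldMap T ε y).1, (unfoldMap T ε y).2 + b) := by
  simp only [unfoldMap, jointShift, cellIndex_add hε]
  rw [neg_add, hT.add, hT.neg_apply]

theorem unfolding_add (hT : IsDynamicalSystem P T) {ε : ℝ} (hε : 0 < ε) (b : IntLattice d)
    (u : Ω → IntLattice d → ℝ) (y : Ω × Space d) :
    unfolding T ε (fun ω z => u ω (z + b)) y = unfolding T ε u (jointShift T ε b y) := by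
  simp only [unfolding_eq_comp, Function.comp_apply, unfoldMap_jointShift hT hε]

theorem unfolding_discreteGrad (hT : IsDynamicalSystem P T) {ε : ℝ} (hε : 0 < ε)
    (u : Ω → IntLattice d → ℝ) (j : Fin d) (y : Ω × Space d) :
    unfolding T ε (fun ω z => discreteGrad ε (u ω) z j) y =
      (unfolding T ε u (jointShift T ε (latticeUnit j) y) - unfolding T ε u y) / ε := by
  rw [← unfolding_add hT hε]
  rfl

/-- The unit vector in the direction of an edge. -/
noncomputable def edgeDirection {d : ℕ} (β : IntLattice d) : Space d :=
  ‖latticePoint 1 β‖⁻¹ • latticePoint 1 β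

theorem symField_apply {k : ℕ} (b : Fin k → IntLattice d) (B : Fin k → IntLattice d →₀ Space d)
    (F : Ω × Space d → Matrix (Fin d) (Fin d) ℝ) (y : Ω × Space d) (i : Fin k) :
    symField T b B F y i = ∑ a, ∑ z ∈ (B i).support, ∑ j,
      (edgeDirection (b i) a * B i z j) * F (T (-z) y.1, y.2) a j := by
  simp only [symField, Finsupp.sum, PiLp.inner_apply, edgeDirection]
  refine Finset.sum_congr rfl fun a _ => ?_
  simp only [WithLp.ofLp_sum, Finset.sum_apply, Matrix.mulVec, dotProduct, RCLike.inner_apply,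
    conj_trivial, Finset.sum_mul]
  refine Finset.sum_congr rfl fun z _ => Finset.sum_congr rfl fun j _ => ?_
  ring

theorem discreteSymGrad_apply {k : ℕ} {b : Fin k → IntLattice d}
    {B : Fin k → IntLattice d →₀ Space d} (hB : ∀ i, RepresentsEdge (b i) (B i)) (ε : ℝ)
    (u : IntLattice d → Space d) (z : IntLattice d) (i : Fin k) :
    discreteSymGrad ε b u z i = ∑ a, ∑ w ∈ (B i).support, ∑ j,
      (edgeDirection (b i) a * B i w j) * discreteGrad ε (fun z' => u z' a) (z - w) j := by
  simp only [discreteSymGrad, PiLp.inner_apply]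
  refine Finset.sum_congr rfl fun a _ => ?_
  have h := hB i (fun z' => u z' a) z
  simp only [Finsupp.sum, PiLp.inner_apply, RCLike.inner_apply, conj_trivial, discreteGrad,
    div_one] at h
  simp only [RCLike.inner_apply, conj_trivial, PiLp.smul_apply, PiLp.sub_apply, smul_eq_mul]
  rw [mul_inv, mul_assoc ε⁻¹, mul_comm _ (u (z + b i) a - u z a), ← div_eq_mul_inv, h,
    show edgeDirection (b i) a = ‖latticePoint 1 (b i)‖⁻¹ * latticePoint 1 (b i) a from rfl]
  simp only [Finset.mul_sum, Finset.sum_mul, discreteGrad]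
  refine Finset.sum_congr rfl fun w _ => Finset.sum_congr rfl fun j _ => ?_
  ring

/-- The coefficients are those of `symField_apply`; only the joint shift with parameter ε stands in
place of the one with parameter 0. Convergence of the gradient entries therefore carries over to the
symmetrized gradient term by term. -/
theorem unfolding_discreteSymGrad (hT : IsDynamicalSystem P T) {k : ℕ} {b : Fin k → IntLattice d}
    {B : Fin k → IntLattice d →₀ Space d} (hB : ∀ i, RepresentsEdge (b i) (B i)) {ε : ℝ}
    (hε : 0 < ε) (u : Ω → IntLattice d → Space d) (y : Ω × Space d) (i : Fin k) :
    unfolding T ε (fun ω z => discreteSymGrad ε b (u ω) z i) y =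
      ∑ a, ∑ w ∈ (B i).support, ∑ j, (edgeDirection (b i) a * B i w j) *
        unfolding T ε (fun ω z => discreteGrad ε (fun z' => u ω z' a) z j)
          (jointShift T ε (-w) y) := by
  simp_rw [← unfolding_add hT hε (-_)]
  simp only [unfolding, discreteSymGrad_apply hB, sub_eq_add_neg]

end Unfolding

/-! ### The limit space -/

section LimitSpace

variable {Ω : Type*} [MeasurableSpace Ω] {P : Measure Ω} [IsProbabilityMeasure P] {d : ℕ}
  {p q : ℝ≥0∞} {T : IntLattice d → Ω → Ω}

/-- The value ε = 0 encodes the action on ω alone, so the statements about joint shifts cover both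
the discrete level and the limit. -/
theorem jointShift_zero_apply (b : IntLattice d) (y : Ω × Space d) :
    jointShift T 0 b y = (T b y.1, y.2) := by
  simp only [jointShift, Prod.mk.injEq, true_and]
  ext i
  simp

variable [Fact (1 ≤ p)]

/-- `L^p_inv(Ω) ⊗ W^{1,p}_0(O)` as a closed subspace. -/
noncomputable def invSobolevSubmodule (p : ℝ≥0∞) [Fact (1 ≤ p)] (P : Measure Ω)
    (T : IntLattice d → Ω → Ω) (O : Set (Space d)) :
    Submodule ℝ (Lp (ℝ × Space d) p (P.prod (volume : Measure (Space d)))) :=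
  (Submodule.span ℝ {f | ∃ φ ∈ LpInv p P T, ∃ η ∈ SobolevZero p O,
    ∀ᵐ y ∂P.prod (volume : Measure (Space d)), f y = φ y.1 • η y.2}).topologicalClosure

/-- `L^p_pot(Ω) ⊗ L^p(O)` as a closed subspace. -/
noncomputable def potTensorSubmodule (p : ℝ≥0∞) [Fact (1 ≤ p)] (P : Measure Ω)
    (T : IntLattice d → Ω → Ω) (O : Set (Space d)) :
    Submodule ℝ (Lp (Space d) p (P.prod (volume : Measure (Space d)))) :=
  (Submodule.span ℝ {f | ∃ ψ ∈ LpPot p P T, ∃ η ∈ LpDomain p O,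
    ∀ᵐ y ∂P.prod (volume : Measure (Space d)), f y = η y.2 • ψ y.1}).topologicalClosure

/-- The elements of `L^p_inv(Ω) ⊗ W^{1,p}_0(O)` are invariant. -/
theorem invSobolev_invariant (hT : IsDynamicalSystem P T) {O : Set (Space d)}
    {W : Lp (ℝ × Space d) p (P.prod (volume : Measure (Space d)))} (hW : W ∈ InvSobolev p P T O)
    (b : IntLattice d) :
    (fun y => W (jointShift T 0 b y)) =ᵐ[P.prod volume] W := by
  have hmp := measurePreserving_jointShift hT 0 b
  let L := Lp.compMeasurePreservingₗᵢ ℝ (E := ℝ × Space d) (p := p) (jointShift T 0 b) hmp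
  have hcl : IsClosed {f | L f = f} := isClosed_eq L.continuous continuous_id
  have hsub : InvSobolev p P T O ⊆ {f | L f = f} := by
    refine closure_minimal ?_ hcl
    have : (LinearMap.eqLocus L.toLinearMap LinearMap.id : Set _) = {f | L f = f} := rfl
    rw [← this, SetLike.coe_subset_coe, Submodule.span_le]
    rintro f ⟨φ, hφ, η, hη, hf⟩
    change L f = f
    ext1
    refine (Lp.coeFn_compMeasurePreserving f hmp).trans ?_
    filter_upwards [hmp.quasiMeasurePreserving.ae hf, hf,
      Measure.quasiMeasurePreserving_fst.ae (hφ b)] with y h1 h2 h3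
    rw [Function.comp_apply, h1, h2, jointShift_zero_apply]
    simp only [h3]
  have h1 : L W = W := hsub hW
  have h2 := Lp.coeFn_compMeasurePreserving W hmp
  filter_upwards [h2] with y hy
  have h3 : (L W) y = W (jointShift T 0 b y) := hy
  rw [← h3, h1]

/-- Integration against an invariant function annihilates `L^p_pot(Ω) ⊗ L^p(O)`. -/
theorem potTensor_orthogonal [ENNReal.HolderConjugate p q] (hp : 1 < p) (hp' : p ≠ ∞)
    (hT : IsDynamicalSystem P T) {O : Set (Space d)}
    {χ : Lp (Space d) p (P.prod (volume : Measure (Space d)))} (hχ : χ ∈ PotTensor p P T O)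
    (j : Fin d) {g : Ω × Space d → ℝ} (hg : MemLp g q (P.prod volume))
    (hinv : (fun y => g (jointShift T 0 (-latticeUnit j) y)) =ᵐ[P.prod volume] g) :
    ∫ y, χ y j * g y ∂P.prod volume = 0 := by
  have hp0 : p ≠ 0 := (zero_lt_one.trans hp).ne'
  let ℓ : Lp (Space d) p (P.prod (volume : Measure (Space d))) →L[ℝ] ℝ :=
    (pairingFunctional (p := p) hg).comp
      ((EuclideanSpace.proj j : Space d →L[ℝ] ℝ).compLpL p (P.prod volume))
  have hℓ : ∀ f, ℓ f = ∫ y, f y j * g y ∂P.prod volume := by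
    intro f
    simp only [ℓ, ContinuousLinearMap.comp_apply, pairingFunctional_apply]
    refine integral_congr_ae ?_
    filter_upwards [(EuclideanSpace.proj j : Space d →L[ℝ] ℝ).coeFn_compLpL f] with y hy
    rw [hy]
    rfl
  rw [← hℓ]
  have hsub : PotTensor p P T O ⊆ {f | ℓ f = 0} := by
    refine closure_minimal ?_ (isClosed_eq ℓ.continuous continuous_const)
    have : ((LinearMap.ker ℓ.toLinearMap : Submodule ℝ _) : Set _) = {f | ℓ f = 0} := rfl
    rw [← this, SetLike.coe_subset_coe, Submodule.span_le]
    rintro f ⟨ψ, hψ, η, hη, hf⟩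
    change ℓ f = 0
    let tens : Lp (Space d) p P →L[ℝ] Lp ℝ p (volume : Measure (Space d)) →L[ℝ]
        Lp (Space d) p (P.prod (volume : Measure (Space d))) :=
      tensorLp hp0 hp' (ContinuousLinearMap.lsmul ℝ ℝ).flip
    let t : Lp (Space d) p P → Lp (Space d) p (P.prod (volume : Measure (Space d))) := fun ψ =>
      tens ψ η
    have htc : Continuous t := (tens.flip η).continuous
    have ht : ∀ ψ, t ψ =ᵐ[P.prod volume] fun y => η y.2 • ψ y.1 := fun ψ =>
      coeFn_tensorLp hp0 hp' _ ψ η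
    have hft : f = t ψ := by
      ext1
      filter_upwards [hf, ht ψ] with y h1 h2
      rw [h1, h2]
    rw [hft]
    -- With η fixed the tensor product is continuous in ψ, so it suffices to test horizontal
    -- derivatives Dφ.
    have hcl : IsClosed {ψ | ℓ (t ψ) = 0} := isClosed_eq (ℓ.continuous.comp htc) continuous_const
    refine closure_minimal ?_ hcl hψ
    rintro ψ' ⟨φ, hφ⟩
    change ℓ (t ψ') = 0
    rw [hℓ]
    have hF : MemLp (fun y : Ω × Space d => φ y.1 * η y.2) p (P.prod volume) :=
      MemLp.mul_prod hp0 hp' (Lp.memLp φ) (Lp.memLp η)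
    have hmp := measurePreserving_jointShift hT 0 (latticeUnit j)
    have hFs : MemLp (fun y : Ω × Space d => φ (jointShift T 0 (latticeUnit j) y).1 *
        η (jointShift T 0 (latticeUnit j) y).2) p (P.prod volume) :=
      hF.comp_measurePreserving hmp
    have h1 : ∀ᵐ y ∂P.prod (volume : Measure (Space d)), t ψ' y j * g y =
        (φ (jointShift T 0 (latticeUnit j) y).1 * η (jointShift T 0 (latticeUnit j) y).2) * g y -
          (φ y.1 * η y.2) * g y := by
      filter_upwards [ht ψ', Measure.quasiMeasurePreserving_fst.ae hφ] with y h1 h2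
      rw [h1, h2, jointShift_zero_apply]
      simp only [PiLp.smul_apply, smul_eq_mul]
      ring
    -- The change of variables moves the shift from φ to g, where invariance absorbs it; the two
    -- terms of Dφ then cancel.
    rw [integral_congr_ae h1, integral_sub (integrable_mul_of_conjugate hFs hg)
      (integrable_mul_of_conjugate hF hg), integral_comp_jointShift hT 0 (latticeUnit j)
      (fun y => φ y.1 * η y.2) g, sub_eq_zero]
    refine integral_congr_ae ?_
    filter_upwards [hinv] with y hy
    rw [hy]
  exact hsub hχ

/-- Let J(a) = sign(a)|a|^(p-1). If h - a is orthogonal to J(a), then ‖a‖ ‖J(a)‖ = ∫ a J(a) = ∫ h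
J(a) ≤ ‖h‖ ‖J(a)‖. This replaces the bounded projection onto invariant functions, without
constructing conditional expectations. -/
theorem eLpNorm_le_of_annihilator [ENNReal.HolderConjugate p q] (hp : 1 < p) (hp' : p ≠ ∞)
    {a h : Ω × Space d → ℝ} (ha : MemLp a p (P.prod volume)) (hh : MemLp h p (P.prod volume))
    (horth : ∀ _ : MemLp (fun y => dualMap p.toReal (a y)) q (P.prod volume),
      ∫ y, (h y - a y) * dualMap p.toReal (a y) ∂P.prod volume = 0) :
    eLpNorm a p (P.prod volume) ≤ eLpNorm h p (P.prod volume) := by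
  have hq : 1 < q := (ENNReal.HolderConjugate.lt_top_iff_one_lt p q).1 hp'.lt_top
  have hq' : q ≠ ∞ := ((ENNReal.HolderConjugate.lt_top_iff_one_lt q p).2 hp).ne
  obtain ⟨hg, hM⟩ := memLp_dualMap_and_eLpNorm_le (p := q) (q := p) hq hq' ha
  have h0 := horth hg
  set g : Ω × Space d → ℝ := fun y => dualMap p.toReal (a y) with hgdef
  have h1 := hM (eLpNorm h p (P.prod volume)).toReal ENNReal.toReal_nonneg ?_
  · rwa [ENNReal.ofReal_toReal hh.2.ne] at h1
  have h2 : ∫ y, (h y - a y) * g y ∂P.prod volume =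
      ∫ y, h y * g y ∂P.prod volume - ∫ y, a y * g y ∂P.prod volume := by
    rw [← integral_sub (integrable_mul_of_conjugate hh hg) (integrable_mul_of_conjugate ha hg)]
    refine integral_congr_ae (ae_of_all _ fun y => ?_)
    ring
  have h3 : ∫ y, g y * a y ∂P.prod volume = ∫ y, h y * g y ∂P.prod volume := by
    simp_rw [mul_comm (g _) (a _)]
    linarith
  rw [h3, ← ENNReal.toReal_mul]
  refine (le_abs_self _).trans ?_
  rw [← Real.norm_eq_abs, ← toReal_enorm]
  exact ENNReal.toReal_mono (ENNReal.mul_ne_top hh.2.ne hg.2.ne)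
    (enorm_integral_mul_le (p := p) (q := q) hh.1 hg.1)

/-- The embedding `χ ↦ (0, χ)`. -/
noncomputable def gradInr (p : ℝ≥0∞) [Fact (1 ≤ p)] (P : Measure Ω) (d : ℕ) :
    Lp (Space d) p (P.prod (volume : Measure (Space d))) →L[ℝ]
      Lp (ℝ × Space d) p (P.prod (volume : Measure (Space d))) :=
  (ContinuousLinearMap.inr ℝ ℝ (Space d)).compLpL p (P.prod volume)

theorem coeFn_gradInr (χ : Lp (Space d) p (P.prod (volume : Measure (Space d)))) :
    gradInr p P d χ =ᵐ[P.prod volume] fun y => ((0 : ℝ), χ y) :=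
  (ContinuousLinearMap.inr ℝ ℝ (Space d)).coeFn_compLpL χ

theorem coeFn_add_gradInr (W : Lp (ℝ × Space d) p (P.prod (volume : Measure (Space d))))
    (χ : Lp (Space d) p (P.prod (volume : Measure (Space d)))) :
    ⇑(W + gradInr p P d χ) =ᵐ[P.prod volume] fun y => ((W y).1, (W y).2 + χ y) := by
  filter_upwards [Lp.coeFn_add W (gradInr p P d χ), coeFn_gradInr χ] with y h1 h2
  rw [h1, Pi.add_apply, h2]
  ext <;> simp

theorem memLp_fst {α : Type*} [MeasurableSpace α] {μ : Measure α} {f : α → ℝ × Space d}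
    (hf : MemLp f p μ) : MemLp (fun y => (f y).1) p μ :=
  (ContinuousLinearMap.fst ℝ ℝ (Space d)).comp_memLp' hf

theorem memLp_coord {α : Type*} [MeasurableSpace α] {μ : Measure α} {n : ℕ}
    {f : α → EuclideanSpace ℝ (Fin n)}
    (hf : MemLp f p μ) (j : Fin n) : MemLp (fun y => f y j) p μ :=
  (EuclideanSpace.proj j : EuclideanSpace ℝ (Fin n) →L[ℝ] ℝ).comp_memLp' hf

theorem memLp_snd_coord {α : Type*} [MeasurableSpace α] {μ : Measure α} {f : α → ℝ × Space d}
    (hf : MemLp f p μ) (j : Fin d) : MemLp (fun y => (f y).2 j) p μ :=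
  memLp_coord ((ContinuousLinearMap.snd ℝ ℝ (Space d)).comp_memLp' hf) j

theorem norm_le_sum_abs {n : ℕ} (x : EuclideanSpace ℝ (Fin n)) : ‖x‖ ≤ ∑ j, |x j| := by
  have h : x = ∑ j, x j • EuclideanSpace.single j (1 : ℝ) := by
    ext i
    simp [Finset.sum_apply, Pi.single_apply]
  conv_lhs => rw [h]
  refine (norm_sum_le _ _).trans (Finset.sum_le_sum fun j _ => ?_)
  rw [norm_smul]
  simp

/-- `‖W‖ ≤ (1 + d) ‖W + χ‖`: the invariant part is controlled by the sum. -/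
theorem norm_le_norm_add_gradInr [ENNReal.HolderConjugate p q] (hp : 1 < p) (hp' : p ≠ ∞)
    (hT : IsDynamicalSystem P T) {O : Set (Space d)}
    {W : Lp (ℝ × Space d) p (P.prod (volume : Measure (Space d)))} (hW : W ∈ InvSobolev p P T O)
    {χ : Lp (Space d) p (P.prod (volume : Measure (Space d)))} (hχ : χ ∈ PotTensor p P T O) :
    ‖W‖ ≤ (1 + d) * ‖W + gradInr p P d χ‖ := by
  set V := W + gradInr p P d χ with hV
  have hVc := coeFn_add_gradInr W χ
  set N := eLpNorm V p (P.prod volume) with hN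
  have hcoord : ∀ j, eLpNorm (fun y => (W y).2 j) p (P.prod volume) ≤ N := by
    intro j
    have h1 : eLpNorm (fun y => (V y).2 j) p (P.prod volume) ≤ N := by
      refine eLpNorm_mono_ae (ae_of_all _ fun y => ?_)
      exact (PiLp.norm_apply_le _ j).trans (norm_snd_le _)
    -- Each component of the gradient part of W is invariant, hence so is its dual element, which
    -- annihilates the corresponding component of χ.
    refine le_trans (eLpNorm_le_of_annihilator (q := q) hp hp' (memLp_snd_coord (Lp.memLp W) j)
      (memLp_snd_coord (Lp.memLp V) j) fun hg => ?_) h1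
    rw [← potTensor_orthogonal (q := q) hp hp' hT hχ j hg]
    · refine integral_congr_ae ?_
      filter_upwards [hVc] with y hy
      rw [hy]
      simp
    · filter_upwards [invSobolev_invariant hT hW (-latticeUnit j)] with y hy
      rw [hy]
  have hfst : eLpNorm (fun y => (W y).1) p (P.prod volume) ≤ N := by
    refine eLpNorm_mono_ae ?_
    filter_upwards [hVc] with y hy
    rw [hy]
    exact norm_fst_le ((W y).1, (W y).2 + χ y)
  have hle : eLpNorm W p (P.prod volume) ≤ ((1 + d : ℕ) : ℝ≥0∞) * N := by
    calc eLpNorm W p (P.prod volume)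
        ≤ eLpNorm (fun y => ‖(W y).1‖ + ∑ j, ‖(W y).2 j‖) p (P.prod volume) := by
          refine eLpNorm_mono_ae (ae_of_all _ fun y => ?_)
          rw [Real.norm_of_nonneg (by positivity)]
          refine (max_le_add_of_nonneg (norm_nonneg _) (norm_nonneg _)).trans ?_
          gcongr
          exact norm_le_sum_abs _
      _ ≤ eLpNorm (fun y => ‖(W y).1‖) p (P.prod volume) +
          eLpNorm (∑ j, fun y => ‖(W y).2 j‖) p (P.prod volume) := by
          have : (fun y => ‖(W y).1‖ + ∑ j, ‖(W y).2 j‖) =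
              (fun y => ‖(W y).1‖) + ∑ j, fun y => ‖(W y).2 j‖ := by
            ext y; simp [Finset.sum_apply]
          rw [this]
          refine eLpNorm_add_le (memLp_fst (Lp.memLp W)).1.norm ?_ hp.le
          exact Finset.aestronglyMeasurable_sum _
            fun j _ => (memLp_snd_coord (Lp.memLp W) j).1.norm
      _ ≤ N + ∑ _j : Fin d, N := by
          refine add_le_add ((eLpNorm_norm _).trans_le hfst) ?_
          refine (eLpNorm_sum_le (fun j _ => (memLp_snd_coord (Lp.memLp W) j).1.norm) hp.le).trans ?_
          exact Finset.sum_le_sum fun j _ => (eLpNorm_norm _).trans_le (hcoord j)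
      _ = _ := by
          rw [Finset.sum_const, Finset.card_univ, Fintype.card_fin, nsmul_eq_mul]
          push_cast
          ring
  rw [Lp.norm_def, Lp.norm_def]
  have := ENNReal.toReal_mono (ENNReal.mul_ne_top (by simp) (Lp.eLpNorm_ne_top V)) hle
  rw [ENNReal.toReal_mul, ENNReal.toReal_natCast] at this
  push_cast at this
  exact this

/-- The map `(W, χ) ↦ W + (0, χ)`. -/
noncomputable def limitSum (p : ℝ≥0∞) [Fact (1 ≤ p)] (P : Measure Ω) [IsProbabilityMeasure P]
    (T : IntLattice d → Ω → Ω) (O : Set (Space d)) :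
    (invSobolevSubmodule p P T O × potTensorSubmodule p P T O) →L[ℝ]
      Lp (ℝ × Space d) p (P.prod (volume : Measure (Space d))) :=
  ((invSobolevSubmodule p P T O).subtypeL).coprod
    ((gradInr p P d).comp (potTensorSubmodule p P T O).subtypeL)

theorem limitSum_apply (O : Set (Space d))
    (z : invSobolevSubmodule p P T O × potTensorSubmodule p P T O) :
    limitSum p P T O z = z.1 + gradInr p P d z.2 := rfl

/-- The sum controls W, and then χ by subtraction; this accounts for the constant 2 + d. So the sum
map is bounded below on a complete space and its range is closed, as the bipolar argument requires.
-/
theorem isClosed_range_limitSum [ENNReal.HolderConjugate p q] (hp : 1 < p) (hp' : p ≠ ∞)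
    (hT : IsDynamicalSystem P T) (O : Set (Space d)) :
    IsClosed (range (limitSum p P T O)) := by
  have : CompleteSpace (invSobolevSubmodule p P T O) :=
    (Submodule.isClosed_topologicalClosure _).completeSpace_coe
  have : CompleteSpace (potTensorSubmodule p P T O) :=
    (Submodule.isClosed_topologicalClosure _).completeSpace_coe
  have hbound : ∀ z : invSobolevSubmodule p P T O × potTensorSubmodule p P T O,
      ‖z‖ ≤ ((2 + d : ℕ) : NNReal) * ‖limitSum p P T O z‖ := by
    intro z
    have h1 := norm_le_norm_add_gradInr (q := q) hp hp' hT (O := O) z.1.2 z.2.2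
    rw [← limitSum_apply] at h1
    have h2 : ‖z.2‖ = ‖gradInr p P d z.2‖ := by
      rw [Submodule.coe_norm, Lp.norm_def, Lp.norm_def]
      congr 1
      refine eLpNorm_congr_norm_ae ?_
      filter_upwards [coeFn_gradInr (z.2 : Lp (Space d) p (P.prod volume))] with y hy
      rw [hy, Prod.norm_mk]
      simp
    have h3 : ‖gradInr p P d z.2‖ ≤ ‖limitSum p P T O z‖ + ‖z.1‖ := by
      have : gradInr p P d z.2 = limitSum p P T O z - z.1 := by
        rw [limitSum_apply]; abel
      rw [this]
      exact norm_sub_le _ _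
    have h4 : ‖z.1‖ ≤ (1 + d) * ‖limitSum p P T O z‖ := h1
    have h5 : 0 ≤ ‖limitSum p P T O z‖ := norm_nonneg _
    rw [Prod.norm_def, NNReal.coe_natCast]
    push_cast
    refine max_le ?_ ?_ <;> nlinarith
  exact (AddMonoidHomClass.antilipschitz_of_bound (limitSum p P T O) hbound).isClosed_range
    (limitSum p P T O).uniformContinuous

end LimitSpace

/-! ### Trilinear forms with a kernel in space -/

section Kernel

variable {Ω : Type*} [MeasurableSpace Ω] {P : Measure Ω} [IsProbabilityMeasure P] {d : ℕ}
  {p q : ℝ≥0∞} {T : IntLattice d → Ω → Ω}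

/-- The partial derivative `∂_j η`. -/
noncomputable def coordDeriv (j : Fin d) (η : Space d → ℝ) (x : Space d) : ℝ :=
  fderiv ℝ η x (EuclideanSpace.single j 1)

/-- The form `∫∫∫ a(ω, y) b(ω, x) κ(x, y)`. -/
noncomputable def kernelForm (P : Measure Ω) (a b : Ω × Space d → ℝ) (κ : Space d → Space d → ℝ) :
    ℝ :=
  ∫ w : Space d × (Ω × Space d), a w.2 * b (w.2.1, w.1) * κ w.1 w.2.2
    ∂((volume : Measure (Space d)).prod (P.prod (volume : Measure (Space d))))

/-- Bounded measurable kernels with bounded support. -/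
structure IsBoundedKernel (κ : Space d → Space d → ℝ) : Prop where
  measurable : Measurable (Function.uncurry κ)
  bounded : ∃ C, ∀ x y, ‖κ x y‖ ≤ C
  support : ∃ R : ℝ, ∀ x y, (x ∉ Metric.ball (0 : Space d) R ∨ y ∉ Metric.ball (0 : Space d) R) →
    κ x y = 0

/-- The exchange of the two space variables. -/
def exchange (w : Space d × (Ω × Space d)) : Space d × (Ω × Space d) := (w.2.2, (w.2.1, w.1))

theorem measurable_exchange : Measurable (exchange (Ω := Ω) (d := d)) := by
  unfold exchange
  fun_prop

theorem measurePreserving_exchange :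
    MeasurePreserving (exchange (Ω := Ω) (d := d))
      ((volume : Measure (Space d)).prod (P.prod (volume : Measure (Space d))))
      ((volume : Measure (Space d)).prod (P.prod (volume : Measure (Space d)))) := by
  have h1 := (measurePreserving_prodAssoc (volume : Measure (Space d)) P
    (volume : Measure (Space d))).symm
  have h2 : MeasurePreserving (Prod.swap : (Space d × Ω) × Space d → _)
      ((volume.prod P).prod volume) (volume.prod (volume.prod P)) :=
    Measure.measurePreserving_swap
  have h3 : MeasurePreserving (Prod.map id Prod.swap : Space d × (Space d × Ω) → _)
      (volume.prod (volume.prod P)) (volume.prod (P.prod volume)) :=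
    (MeasurePreserving.id _).prod Measure.measurePreserving_swap
  exact h3.comp (h2.comp h1)

/-- The exchange of the two space variables, as a measurable equivalence. -/
def exchangeEquiv : (Space d × (Ω × Space d)) ≃ᵐ (Space d × (Ω × Space d)) where
  toFun := exchange
  invFun := exchange
  left_inv _ := rfl
  right_inv _ := rfl
  measurable_toFun := measurable_exchange
  measurable_invFun := measurable_exchange

/-- The change of variables `(s, (ω, y)) ↦ (y + s, (ω, y))`. -/
noncomputable def shearEquiv : (Space d × (Ω × Space d)) ≃ᵐ (Space d × (Ω × Space d)) where
  toFun w := (w.2.2 + w.1, w.2)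
  invFun w := (w.1 - w.2.2, w.2)
  left_inv w := by simp
  right_inv w := by simp
  measurable_toFun := by simp only [Equiv.coe_fn_mk]; fun_prop
  measurable_invFun := by simp only [Equiv.coe_fn_symm_mk]; fun_prop

theorem measurePreserving_shear :
    MeasurePreserving (shearEquiv (Ω := Ω) (d := d))
      ((volume : Measure (Space d)).prod (P.prod (volume : Measure (Space d))))
      ((volume : Measure (Space d)).prod (P.prod (volume : Measure (Space d)))) := by
  have h1 : MeasurePreserving (fun w : (Ω × Space d) × Space d => (w.1, w.1.2 + w.2))
      ((P.prod volume).prod volume) ((P.prod volume).prod volume) := by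
    refine (MeasurePreserving.id _).skew_product (g := fun (z : Ω × Space d) s => z.2 + s) ?_
      (ae_of_all _ fun z => (measurePreserving_add_left volume z.2).map_eq)
    simp only [Function.uncurry_def]
    fun_prop
  exact Measure.measurePreserving_swap.comp (h1.comp Measure.measurePreserving_swap)

/-- Each of a and b is constant in one of the two space variables. The bounded support of κ allows
that variable to be cut off by a ball, after which a lies in L^p and b in L^q of the triple product,
and Hölder's inequality applies. -/
theorem integrable_kernelForm [ENNReal.HolderConjugate p q] (hp : 1 < p) (hp' : p ≠ ∞)
    {a b : Ω × Space d → ℝ} (ha : MemLp a p (P.prod volume)) (hb : MemLp b q (P.prod volume))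
    {κ : Space d → Space d → ℝ} (hκ : IsBoundedKernel κ) :
    Integrable (fun w : Space d × (Ω × Space d) => a w.2 * b (w.2.1, w.1) * κ w.1 w.2.2)
      ((volume : Measure (Space d)).prod (P.prod (volume : Measure (Space d)))) := by
  have hq : 1 < q := (ENNReal.HolderConjugate.lt_top_iff_one_lt p q).1 hp'.lt_top
  have hq' : q ≠ ∞ := ((ENNReal.HolderConjugate.lt_top_iff_one_lt q p).2 hp).ne
  obtain ⟨C, hC⟩ := hκ.bounded
  obtain ⟨R, hR⟩ := hκ.support
  set K := Metric.ball (0 : Space d) R with hK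
  have hind : ∀ r : ℝ≥0∞, MemLp (K.indicator (1 : Space d → ℝ)) r volume := fun r =>
    memLp_indicator_const r measurableSet_ball 1 (Or.inr Metric.isBounded_ball.measure_lt_top.ne)
  have h1 : MemLp (fun w : Space d × (Ω × Space d) => K.indicator 1 w.1 * a w.2) p
      ((volume : Measure (Space d)).prod (P.prod volume)) :=
    MemLp.mul_prod (zero_lt_one.trans hp).ne' hp' (hind p) ha
  have h2' : MemLp (fun w : Space d × (Ω × Space d) => K.indicator 1 w.1 * b w.2) q
      ((volume : Measure (Space d)).prod (P.prod volume)) :=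
    MemLp.mul_prod (zero_lt_one.trans hq).ne' hq' (hind q) hb
  have h2 : MemLp (fun w : Space d × (Ω × Space d) => K.indicator 1 w.2.2 * b (w.2.1, w.1)) q
      ((volume : Measure (Space d)).prod (P.prod volume)) :=
    h2'.comp_measurePreserving (f := exchange) measurePreserving_exchange
  have hm : Measurable (fun w : Space d × (Ω × Space d) => κ w.1 w.2.2) :=
    hκ.measurable.comp (measurable_fst.prodMk (measurable_snd.comp measurable_snd))
  have h0 := integrable_mul_of_conjugate h1 h2
  have h3 := h0.mul_bdd (c := C) hm.aestronglyMeasurable (ae_of_all _ fun w => hC _ _)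
  refine h3.congr (ae_of_all _ fun w => ?_)
  by_cases hx : w.1 ∈ K <;> by_cases hy : w.2.2 ∈ K
  · simp [hx, hy]
  · simp [hR _ _ (Or.inr hy)]
  · simp [hR _ _ (Or.inl hx)]
  · simp [hR _ _ (Or.inl hx)]

theorem kernelForm_eq_left [ENNReal.HolderConjugate p q] (hp : 1 < p) (hp' : p ≠ ∞)
    {a b : Ω × Space d → ℝ} (ha : MemLp a p (P.prod volume)) (hb : MemLp b q (P.prod volume))
    {κ : Space d → Space d → ℝ} (hκ : IsBoundedKernel κ) :
    kernelForm P a b κ = ∫ x, ∫ z, a z * b (z.1, x) * κ x z.2 ∂P.prod volume :=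
  integral_prod _ (integrable_kernelForm hp hp' ha hb hκ)

theorem integrable_kernelForm_exchange [ENNReal.HolderConjugate p q] (hp : 1 < p) (hp' : p ≠ ∞)
    {a b : Ω × Space d → ℝ} (ha : MemLp a p (P.prod volume)) (hb : MemLp b q (P.prod volume))
    {κ : Space d → Space d → ℝ} (hκ : IsBoundedKernel κ) :
    Integrable (fun w : Space d × (Ω × Space d) => a (w.2.1, w.1) * b w.2 * κ w.2.2 w.1)
      ((volume : Measure (Space d)).prod (P.prod (volume : Measure (Space d)))) :=
  measurePreserving_exchange.integrable_comp_of_integrable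
    (integrable_kernelForm hp hp' ha hb hκ)

theorem kernelForm_eq_right [ENNReal.HolderConjugate p q] (hp : 1 < p) (hp' : p ≠ ∞)
    {a b : Ω × Space d → ℝ} (ha : MemLp a p (P.prod volume)) (hb : MemLp b q (P.prod volume))
    {κ : Space d → Space d → ℝ} (hκ : IsBoundedKernel κ) :
    kernelForm P a b κ = ∫ y, ∫ z, a (z.1, y) * b z * κ z.2 y ∂P.prod volume := by
  rw [kernelForm, ← (measurePreserving_exchange (P := P) (d := d)).integral_comp
    (exchangeEquiv (Ω := Ω) (d := d)).measurableEmbedding]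
  exact integral_prod _ (integrable_kernelForm_exchange hp hp' ha hb hκ)

/-- The substitution x = y + s displays the form as the average, with weight ρ, of the correlation
of θa with translates of b. -/
theorem kernelForm_eq_shear [ENNReal.HolderConjugate p q] (hp : 1 < p) (hp' : p ≠ ∞)
    {a b : Ω × Space d → ℝ} (ha : MemLp a p (P.prod volume)) (hb : MemLp b q (P.prod volume))
    {θ ρ : Space d → ℝ} (hκ : IsBoundedKernel fun x y => θ y * ρ (x - y)) :
    kernelForm P a b (fun x y => θ y * ρ (x - y)) =
      ∫ s, ρ s * ∫ z, (θ z.2 * a z) * b (z.1, z.2 + s) ∂P.prod volume := by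
  have h1 := integrable_kernelForm hp hp' ha hb hκ
  rw [kernelForm, ← (measurePreserving_shear (P := P) (d := d)).integral_comp
    (shearEquiv (Ω := Ω) (d := d)).measurableEmbedding]
  refine (integral_prod _ (measurePreserving_shear.integrable_comp_of_integrable h1)).trans ?_
  refine integral_congr_ae (ae_of_all _ fun s => ?_)
  simp only [Function.comp_apply]
  rw [← integral_const_mul]
  refine integral_congr_ae (ae_of_all _ fun z => ?_)
  simp only [shearEquiv, MeasurableEquiv.coe_mk, Equiv.coe_fn_mk, add_sub_cancel_left]
  ring

/-- Approximate identities in the kernel form. -/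
theorem tendsto_kernelForm [ENNReal.HolderConjugate p q] (hp : 1 < p) (hp' : p ≠ ∞)
    {a b : Ω × Space d → ℝ} (ha : MemLp a p (P.prod volume)) (hb : MemLp b q (P.prod volume))
    {θ : Space d → ℝ} (hθ : Continuous θ) (hθc : HasCompactSupport θ) {ι : Type*} {l : Filter ι}
    {ρ : ι → Space d → ℝ} (hρ0 : ∀ᶠ t in l, ∀ x, 0 ≤ ρ t x) (hρ1 : ∀ᶠ t in l, ∫ x, ρ t x = 1)
    {r : ι → ℝ} (hr : Tendsto r l (𝓝 0)) (hρr : ∀ᶠ t in l, ∀ x, ρ t x ≠ 0 → ‖x‖ ≤ r t)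
    (hκ : ∀ᶠ t in l, IsBoundedKernel fun x y => θ y * ρ t (x - y)) :
    Tendsto (fun t => kernelForm P a b (fun x y => θ y * ρ t (x - y))) l
      (𝓝 (∫ z, θ z.2 * a z * b z ∂P.prod volume)) := by
  have hq : 1 < q := (ENNReal.HolderConjugate.lt_top_iff_one_lt p q).1 hp'.lt_top
  have hq' : q ≠ ∞ := ((ENNReal.HolderConjugate.lt_top_iff_one_lt q p).2 hp).ne
  obtain ⟨C, hC0, hC⟩ := hθc.exists_nonneg_bound hθ
  have hθa : MemLp (fun z : Ω × Space d => θ z.2 * a z) p (P.prod volume) := by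
    refine MemLp.of_le_mul (c := C) ha ?_ (ae_of_all _ fun z => ?_)
    · exact (hθ.measurable.comp measurable_snd).aestronglyMeasurable.mul ha.1
    · rw [norm_mul]
      exact mul_le_mul_of_nonneg_right (hC _) (norm_nonneg _)
  set c : Space d → ℝ := fun s => ∫ z, (θ z.2 * a z) * b (z.1, z.2 + s) ∂P.prod volume with hc
  have hc0 : c 0 = ∫ z, θ z.2 * a z * b z ∂P.prod volume := by simp [hc]
  have hbs : ∀ s : Space d, MemLp (fun z : Ω × Space d => b (z.1, z.2 + s)) q (P.prod volume) :=
    fun s => hb.comp_measurePreserving (measurePreserving_shift s)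
  -- The correlation is continuous at s = 0 by continuity of translations in L^q; averaging it
  -- against a probability density concentrating at 0 then gives its value at 0.
  have hcc : Tendsto c (𝓝 0) (𝓝 (c 0)) := by
    rw [tendsto_iff_norm_sub_tendsto_zero]
    have h1 : ∀ s, c s - c 0 =
        ∫ z, (θ z.2 * a z) * (b (z.1, z.2 + s) - b z) ∂P.prod volume := by
      intro s
      rw [hc0]
      simp only [hc]
      rw [← integral_sub (integrable_mul_of_conjugate hθa (hbs s))
        (integrable_mul_of_conjugate hθa hb)]
      refine integral_congr_ae (ae_of_all _ fun z => ?_)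
      ring
    have h2 : Tendsto (fun s : Space d => (eLpNorm (fun z => θ z.2 * a z) p (P.prod volume) *
        eLpNorm (fun z => b (z.1, z.2 + s) - b z) q (P.prod volume)).toReal) (𝓝 0) (𝓝 0) := by
      have := ENNReal.Tendsto.const_mul (a := eLpNorm (fun z => θ z.2 * a z) p (P.prod volume))
        (tendsto_eLpNorm_shift_sub (p := q) (q := p) hq hq' hb) (Or.inr hθa.2.ne)
      rw [mul_zero] at this
      have h := (ENNReal.tendsto_toReal ENNReal.zero_ne_top).comp this
      rwa [ENNReal.toReal_zero] at h
    refine squeeze_zero (fun _ => norm_nonneg _) (fun s => ?_) h2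
    rw [h1, ← toReal_enorm]
    exact ENNReal.toReal_mono (ENNReal.mul_ne_top hθa.2.ne ((hbs s).sub hb).2.ne)
      (enorm_integral_mul_le (p := p) (q := q) hθa.1 ((hbs s).sub hb).1)
  rw [← hc0, Metric.tendsto_nhds]
  intro ε hε
  obtain ⟨δ, hδ, hδc⟩ := Metric.tendsto_nhds_nhds.1 hcc (ε / 2) (by positivity)
  filter_upwards [hρ0, hρ1, hρr, hκ, hr.eventually (gt_mem_nhds hδ)] with t h0 h1 hrt hκt hδt
  rw [kernelForm_eq_shear hp hp' ha hb hκt]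
  have hint : Integrable (ρ t) := by
    by_contra h
    rw [integral_undef h] at h1
    exact zero_ne_one h1
  have hbd : ∀ s, ‖ρ t s * c s - ρ t s * c 0‖ ≤ ρ t s * (ε / 2) := by
    intro s
    rw [← mul_sub, norm_mul, Real.norm_of_nonneg (h0 s)]
    by_cases hs : ρ t s = 0
    · simp [hs]
    · refine mul_le_mul_of_nonneg_left ?_ (h0 s)
      rw [← dist_eq_norm]
      exact (hδc (by simpa using (hrt s hs).trans_lt hδt)).le
  have hρc0 : Integrable fun s => ρ t s * c 0 := hint.mul_const _
  have hρc : Integrable fun s => ρ t s * c s := by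
    -- Measurability is read off from Fubini's theorem for the sheared integrand.
    have hmeas : AEStronglyMeasurable (fun s => ρ t s * c s) volume := by
      have h2 := measurePreserving_shear.integrable_comp_of_integrable
        (integrable_kernelForm hp hp' ha hb hκt)
      refine h2.integral_prod_left.1.congr (ae_of_all _ fun s => ?_)
      simp only [hc]
      rw [← integral_const_mul]
      refine integral_congr_ae (ae_of_all _ fun z => ?_)
      simp only [shearEquiv, MeasurableEquiv.coe_mk, Equiv.coe_fn_mk, add_sub_cancel_left,
        Function.comp_apply]
      ring
    have h3 : Integrable fun s => ρ t s * c s - ρ t s * c 0 :=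
      (hint.mul_const (ε / 2)).mono' (hmeas.sub hρc0.1) (ae_of_all _ hbd)
    exact (h3.add hρc0).congr (ae_of_all _ fun s => by simp)
  rw [dist_eq_norm]
  have h4 : c 0 = ∫ s, ρ t s * c 0 := by rw [integral_mul_const, h1, one_mul]
  conv_lhs => rw [h4]
  rw [← integral_sub hρc hρc0]
  calc _ ≤ ∫ s, ρ t s * (ε / 2) := norm_integral_le_of_norm_le (hint.mul_const _)
        (ae_of_all _ hbd)
    _ = ε / 2 := by rw [integral_mul_const, h1, one_mul]
    _ < ε := by linarith

theorem ae_ae_section {Q : Ω × Space d → Prop} (h : ∀ᵐ y ∂P.prod (volume : Measure (Space d)), Q y) :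
    ∀ᵐ x : Space d, ∀ᵐ ω ∂P, Q (ω, x) := by
  have h1 : ∀ᵐ y ∂(volume : Measure (Space d)).prod P, Q y.swap :=
    Measure.measurePreserving_swap.quasiMeasurePreserving.ae h
  exact Measure.ae_ae_of_ae_prod h1

theorem MeasureTheory.MemLp.ae_section (hp : p ≠ 0) (hp' : p ≠ ∞) {f : Ω × Space d → ℝ}
    (hf : MemLp f p (P.prod volume)) : ∀ᵐ x : Space d, MemLp (fun ω => f (ω, x)) p P := by
  have h1 : AEStronglyMeasurable (f ∘ Prod.swap) ((volume : Measure (Space d)).prod P) :=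
    hf.1.comp_measurePreserving Measure.measurePreserving_swap
  have h2 : Integrable (fun y : Space d × Ω => ‖f y.swap‖ ^ p.toReal)
      ((volume : Measure (Space d)).prod P) :=
    Measure.measurePreserving_swap.integrable_comp_of_integrable (hf.integrable_norm_rpow hp hp')
  filter_upwards [h1.prodMk_left, h2.prod_right_ae] with x hx1 hx2
  exact (integrable_norm_rpow_iff hx1 hp hp').1 hx2

end Kernel

/-! ### The product rule for two-scale gradients and annihilators -/

section LocalIdentity

variable {Ω : Type*} [MeasurableSpace Ω] {P : Measure Ω} [IsProbabilityMeasure P] {d : ℕ}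
  {p q : ℝ≥0∞} {T : IntLattice d → Ω → Ω}

/-- `G` acts as the gradient of `U` on products of a solenoidal random field and a test function. -/
def HasTwoScaleGradient (q : ℝ≥0∞) (P : Measure Ω) (T : IntLattice d → Ω → Ω)
    (U : Ω × Space d → ℝ) (G : Fin d → Ω × Space d → ℝ) : Prop :=
  ∀ ψ : Fin d → Ω → ℝ, (∀ j, MemLp (ψ j) q P) →
    (∀ᵐ ω ∂P, ∑ j, (ψ j (T (-latticeUnit j) ω) - ψ j ω) = 0) →
    ∀ η : Space d → ℝ, ContDiff ℝ (⊤ : ℕ∞) η → HasCompactSupport η →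
      ∑ j, ∫ y, G j y * (ψ j y.1 * η y.2) ∂P.prod (volume : Measure (Space d)) =
        -∑ j, ∫ y, U y * (ψ j y.1 * coordDeriv j η y.2) ∂P.prod (volume : Measure (Space d))

/-- `(g₀, g)` annihilates the products of invariant random variables and test functions on `O`,
together with their gradients. -/
def AnnihilatesInvariant (p : ℝ≥0∞) (P : Measure Ω) (T : IntLattice d → Ω → Ω) (O : Set (Space d))
    (g₀ : Ω × Space d → ℝ) (g : Fin d → Ω × Space d → ℝ) : Prop :=
  ∀ φ : Ω → ℝ, MemLp φ p P → (∀ z, ∀ᵐ ω ∂P, φ (T z ω) = φ ω) →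
    ∀ η : Space d → ℝ, ContDiff ℝ (⊤ : ℕ∞) η → HasCompactSupport η → tsupport η ⊆ O →
      ∫ y, (φ y.1 * η y.2) * g₀ y ∂P.prod (volume : Measure (Space d)) +
        ∑ j, ∫ y, (φ y.1 * coordDeriv j η y.2) * g j y ∂P.prod (volume : Measure (Space d)) = 0

theorem contDiff_coordDeriv (j : Fin d) {η : Space d → ℝ} (hη : ContDiff ℝ (⊤ : ℕ∞) η) :
    ContDiff ℝ (⊤ : ℕ∞) (coordDeriv j η) :=
  (hη.fderiv_right (m := (⊤ : ℕ∞)) (by simp)).clm_apply contDiff_const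

theorem support_coordDeriv_subset (j : Fin d) (η : Space d → ℝ) :
    Function.support (coordDeriv j η) ⊆ tsupport η := by
  refine fun x hx => support_fderiv_subset ℝ ?_
  intro h
  exact hx (by simp [coordDeriv, h])

theorem hasCompactSupport_coordDeriv (j : Fin d) {η : Space d → ℝ} (hη : HasCompactSupport η) :
    HasCompactSupport (coordDeriv j η) :=
  HasCompactSupport.of_support_subset_isCompact hη (support_coordDeriv_subset j η)

theorem isBoundedKernel_mul_shift {θ ρ : Space d → ℝ} (hθ : Continuous θ)
    (hθc : HasCompactSupport θ) (hρ : Continuous ρ) (hρc : HasCompactSupport ρ) :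
    IsBoundedKernel fun x y => θ y * ρ (x - y) := by
  obtain ⟨C, hC0, hC⟩ := hθc.exists_nonneg_bound hθ
  obtain ⟨D, hD0, hD⟩ := hρc.exists_nonneg_bound hρ
  obtain ⟨r, hr⟩ := (IsCompact.isBounded hθc).subset_ball 0
  obtain ⟨s, hs⟩ := (IsCompact.isBounded hρc).subset_ball 0
  refine ⟨?_, ⟨C * D, fun x y => ?_⟩, ⟨max r 0 + max s 0, fun x y h => ?_⟩⟩
  · refine Continuous.measurable ?_
    simp only [Function.uncurry_def]
    fun_prop
  · rw [norm_mul]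
    exact mul_le_mul (hC _) (hD _) (norm_nonneg _) hC0
  · by_contra hne
    have h1 : y ∈ tsupport θ := subset_tsupport _ (left_ne_zero_of_mul hne)
    have h2 : x - y ∈ tsupport ρ := subset_tsupport _ (right_ne_zero_of_mul hne)
    have h1' := hr h1
    have h2' := hs h2
    simp only [Metric.mem_ball, dist_zero_right] at h h1' h2'
    have h3 : ‖x‖ ≤ ‖x - y‖ + ‖y‖ := by simpa using norm_add_le (x - y) y
    have := le_max_left r 0
    have := le_max_left s 0
    have := le_max_right r 0
    have := le_max_right s 0
    rcases h with h | h <;> exact h (by linarith)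

theorem kernelForm_sub [ENNReal.HolderConjugate p q] (hp : 1 < p) (hp' : p ≠ ∞)
    {a b : Ω × Space d → ℝ} (ha : MemLp a p (P.prod volume)) (hb : MemLp b q (P.prod volume))
    {κ κ' : Space d → Space d → ℝ} (hκ : IsBoundedKernel κ) (hκ' : IsBoundedKernel κ') :
    kernelForm P a b (fun x y => κ x y - κ' x y) = kernelForm P a b κ - kernelForm P a b κ' := by
  simp only [kernelForm, mul_sub]
  exact integral_sub (integrable_kernelForm hp hp' ha hb hκ)
    (integrable_kernelForm hp hp' ha hb hκ')

/-- Testing a two-scale gradient with the kernel in its second variable. -/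
theorem sum_kernelForm_gradient [ENNReal.HolderConjugate p q] (hp : 1 < p) (hp' : p ≠ ∞)
    {U : Ω × Space d → ℝ} {G g : Fin d → Ω × Space d → ℝ} (hU : MemLp U p (P.prod volume))
    (hG : ∀ j, MemLp (G j) p (P.prod volume)) (hg : ∀ j, MemLp (g j) q (P.prod volume))
    (hUG : HasTwoScaleGradient q P T U G)
    (hsol : ∀ᵐ y ∂P.prod (volume : Measure (Space d)),
      ∑ j, (g j (T (-latticeUnit j) y.1, y.2) - g j y) = 0)
    {κ : Space d → Space d → ℝ} (hκ : IsBoundedKernel κ)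
    (hκ' : ∀ j, IsBoundedKernel fun x y => coordDeriv j (κ x) y)
    (hκs : ∀ x, ContDiff ℝ (⊤ : ℕ∞) (κ x)) (hκc : ∀ x, HasCompactSupport (κ x)) :
    ∑ j, kernelForm P (G j) (g j) κ =
      -∑ j, kernelForm P U (g j) (fun x y => coordDeriv j (κ x) y) := by
  have hq : 1 < q := (ENNReal.HolderConjugate.lt_top_iff_one_lt p q).1 hp'.lt_top
  have hq' : q ≠ ∞ := ((ENNReal.HolderConjugate.lt_top_iff_one_lt q p).2 hp).ne
  simp only [kernelForm_eq_left hp hp' (hG _) (hg _) hκ,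
    kernelForm_eq_left hp hp' hU (hg _) (hκ' _)]
  rw [← integral_finsetSum _ fun j _ =>
      (integrable_kernelForm hp hp' (hG j) (hg j) hκ).integral_prod_left,
    ← integral_finsetSum _ fun j _ =>
      (integrable_kernelForm hp hp' hU (hg j) (hκ' j)).integral_prod_left, ← integral_neg]
  refine integral_congr_ae ?_
  filter_upwards [ae_ae_section hsol, ae_all_iff.2 fun j =>
    (hg j).ae_section (zero_lt_one.trans hq).ne' hq'] with x hx hgx
  -- For almost every x the section g(·, x) is a solenoidal field in L^q and κ(x, ·) is a test
  -- function in y, so the gradient identity applies to them.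
  have := hUG (fun j ω => g j (ω, x)) hgx hx (κ x) (hκs x) (hκc x)
  simpa only [mul_assoc] using this

/-- Testing an annihilator with the kernel in its first variable. -/
theorem kernelForm_annihilator [ENNReal.HolderConjugate p q] (hp : 1 < p) (hp' : p ≠ ∞)
    {O : Set (Space d)}
    {U g₀ : Ω × Space d → ℝ} {g : Fin d → Ω × Space d → ℝ} (hU : MemLp U p (P.prod volume))
    (hg₀ : MemLp g₀ q (P.prod volume)) (hg : ∀ j, MemLp (g j) q (P.prod volume))
    (hUinv : ∀ z, ∀ᵐ y ∂P.prod (volume : Measure (Space d)), U (T z y.1, y.2) = U y)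
    (hUO : ∀ᵐ y ∂P.prod (volume : Measure (Space d)), y.2 ∉ O → U y = 0)
    (hann : AnnihilatesInvariant p P T O g₀ g)
    {κ : Space d → Space d → ℝ} (hκ : IsBoundedKernel κ)
    (hκ' : ∀ j, IsBoundedKernel fun x y => coordDeriv j (fun x' => κ x' y) x)
    (hκs : ∀ y, ContDiff ℝ (⊤ : ℕ∞) fun x => κ x y)
    (hκc : ∀ y, HasCompactSupport fun x => κ x y)
    (hκO : ∀ y ∈ O, tsupport (fun x => κ x y) ⊆ O) :
    kernelForm P U g₀ κ +
      ∑ j, kernelForm P U (g j) (fun x y => coordDeriv j (fun x' => κ x' y) x) = 0 := by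
  simp only [kernelForm_eq_right hp hp' hU hg₀ hκ,
    kernelForm_eq_right hp hp' hU (hg _) (hκ' _)]
  rw [← integral_finsetSum _ fun j _ =>
      (integrable_kernelForm_exchange hp hp' hU (hg j) (hκ' j)).integral_prod_left,
    ← integral_add (integrable_kernelForm_exchange hp hp' hU hg₀ hκ).integral_prod_left
      (integrable_finsetSum _ fun j _ =>
        (integrable_kernelForm_exchange hp hp' hU (hg j) (hκ' j)).integral_prod_left)]
  refine integral_eq_zero_of_ae ?_
  filter_upwards [ae_ae_section hUO, ae_all_iff.2 fun z => ae_ae_section (hUinv z),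
    hU.ae_section (zero_lt_one.trans hp).ne' hp'] with y hy hinv hUy
  simp only [Pi.zero_apply]
  -- For y in O the section U(·, y) is an invariant random variable and κ(·, y) is a test function
  -- on O. For y outside O the section of U vanishes, so the support of κ(·, y) does not matter.
  by_cases hyO : y ∈ O
  · have := hann (fun ω => U (ω, y)) hUy hinv (fun x => κ x y) (hκs y) (hκc y) (hκO y hyO)
    simpa only [mul_right_comm] using this
  · have h0 : ∀ (f : Ω × Space d → ℝ) (η : Space d → ℝ),
        ∫ z, U (z.1, y) * f z * η z.2 ∂P.prod (volume : Measure (Space d)) = 0 := by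
      intro f η
      refine integral_eq_zero_of_ae ?_
      have : ∀ᵐ z ∂P.prod (volume : Measure (Space d)), U (z.1, y) = 0 :=
        Measure.quasiMeasurePreserving_fst.ae (hy.mono fun ω h => h hyO)
      filter_upwards [this] with z hz
      simp [hz]
    have h2 := Finset.sum_eq_zero (s := Finset.univ) fun (j : Fin d) _ =>
      h0 (g j) (coordDeriv j fun x' => κ x' y)
    exact (congrArg₂ (· + ·) (h0 g₀ fun x => κ x y) h2).trans (add_zero 0)

theorem coordDeriv_kernel_left (j : Fin d) {θ ρ : Space d → ℝ} (hρ : ContDiff ℝ (⊤ : ℕ∞) ρ)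
    (x y : Space d) :
    coordDeriv j (fun x' => θ y * ρ (x' - y)) x = θ y * coordDeriv j ρ (x - y) := by
  have h : HasFDerivAt (fun x' => θ y * ρ (x' - y)) (θ y • fderiv ℝ ρ (x - y)) x := by
    have h1 := (hρ.differentiable (by simp) (x - y)).hasFDerivAt
    have h2 : HasFDerivAt (fun x' : Space d => x' - y) (ContinuousLinearMap.id ℝ _) x :=
      (hasFDerivAt_id x).sub_const y
    exact (h1.comp x h2).const_mul (θ y)
  simp [coordDeriv, h.fderiv]

theorem coordDeriv_kernel_right (j : Fin d) {θ ρ : Space d → ℝ} (hθ : ContDiff ℝ (⊤ : ℕ∞) θ)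
    (hρ : ContDiff ℝ (⊤ : ℕ∞) ρ) (x y : Space d) :
    coordDeriv j (fun y' => θ y' * ρ (x - y')) y =
      coordDeriv j θ y * ρ (x - y) - θ y * coordDeriv j ρ (x - y) := by
  have h1 := (hρ.differentiable (by simp) (x - y)).hasFDerivAt
  have h2 : HasFDerivAt (fun y' : Space d => x - y') (-ContinuousLinearMap.id ℝ (Space d)) y :=
    (hasFDerivAt_id y).const_sub x
  have h3 := (hθ.differentiable (by simp) y).hasFDerivAt
  have h4 := h3.mul (h1.comp y h2)
  have h5 : coordDeriv j (fun y' => θ y' * ρ (x - y')) y = _ :=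
    congrArg (fun L : Space d →L[ℝ] ℝ => L (EuclideanSpace.single j 1)) h4.fderiv
  rw [h5]
  simp [coordDeriv]
  ring

/-- The combination of both tests for a convolution kernel that moves `O` into itself. -/
theorem kernelForm_identity [ENNReal.HolderConjugate p q] (hp : 1 < p) (hp' : p ≠ ∞)
    {O : Set (Space d)}
    {U g₀ : Ω × Space d → ℝ} {G g : Fin d → Ω × Space d → ℝ} (hU : MemLp U p (P.prod volume))
    (hG : ∀ j, MemLp (G j) p (P.prod volume))
    (hg₀ : MemLp g₀ q (P.prod volume)) (hg : ∀ j, MemLp (g j) q (P.prod volume))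
    (hUG : HasTwoScaleGradient q P T U G)
    (hsol : ∀ᵐ y ∂P.prod (volume : Measure (Space d)),
      ∑ j, (g j (T (-latticeUnit j) y.1, y.2) - g j y) = 0)
    (hUinv : ∀ z, ∀ᵐ y ∂P.prod (volume : Measure (Space d)), U (T z y.1, y.2) = U y)
    (hUO : ∀ᵐ y ∂P.prod (volume : Measure (Space d)), y.2 ∉ O → U y = 0)
    (hann : AnnihilatesInvariant p P T O g₀ g)
    {θ ρ : Space d → ℝ} (hθ : ContDiff ℝ (⊤ : ℕ∞) θ) (hθc : HasCompactSupport θ)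
    (hρ : ContDiff ℝ (⊤ : ℕ∞) ρ) (hρc : HasCompactSupport ρ)
    (hθρ : ∀ y ∈ O ∩ tsupport θ, ∀ s ∈ tsupport ρ, y + s ∈ O) :
    kernelForm P U g₀ (fun x y => θ y * ρ (x - y)) +
        ∑ j, kernelForm P (G j) (g j) (fun x y => θ y * ρ (x - y)) =
      -∑ j, kernelForm P U (g j) (fun x y => coordDeriv j θ y * ρ (x - y)) := by
  have hκ := isBoundedKernel_mul_shift hθ.continuous hθc hρ.continuous hρc
  have hκ1 := fun j => isBoundedKernel_mul_shift (contDiff_coordDeriv j hθ).continuous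
    (hasCompactSupport_coordDeriv j hθc) hρ.continuous hρc
  have hκ2 := fun j => isBoundedKernel_mul_shift hθ.continuous hθc
    (contDiff_coordDeriv j hρ).continuous (hasCompactSupport_coordDeriv j hρc)
  have hκ3 : ∀ j, IsBoundedKernel fun x y =>
      coordDeriv j θ y * ρ (x - y) - θ y * coordDeriv j ρ (x - y) := by
    intro j
    obtain ⟨C, hC⟩ := (hκ1 j).bounded
    obtain ⟨D, hD⟩ := (hκ2 j).bounded
    obtain ⟨R, hR⟩ := (hκ1 j).support
    obtain ⟨S, hS⟩ := (hκ2 j).support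
    refine ⟨(hκ1 j).measurable.sub (hκ2 j).measurable,
      ⟨C + D, fun x y => (norm_sub_le _ _).trans (add_le_add (hC x y) (hD x y))⟩,
      ⟨max R S, fun x y h => ?_⟩⟩
    have hl := Metric.ball_subset_ball (x := (0 : Space d)) (le_max_left R S)
    have hr := Metric.ball_subset_ball (x := (0 : Space d)) (le_max_right R S)
    rw [hR x y (h.imp (fun h h' => h (hl h')) (fun h h' => h (hl h'))),
      hS x y (h.imp (fun h h' => h (hr h')) (fun h h' => h (hr h'))), sub_zero]
  have h1 := sum_kernelForm_gradient hp hp' hU hG hg hUG hsol hκ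
    (by simpa only [coordDeriv_kernel_right _ hθ hρ] using hκ3)
    (fun x => hθ.mul (hρ.comp (contDiff_const.sub contDiff_id)))
    (fun x => hθc.mul_right)
  have h2 := kernelForm_annihilator hp hp' hU hg₀ hg hUinv hUO hann hκ
    (by simpa only [coordDeriv_kernel_left _ hρ] using hκ2)
    (fun y => contDiff_const.mul (hρ.comp (contDiff_id.sub contDiff_const)))
    (fun y => (hρc.comp_homeomorph (Homeomorph.subRight y)).mul_left)
    (fun y hy => ?_)
  -- The derivatives of ρ(x - y) in x and in y are opposite, so the terms θ ∂_jρ from the two tests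
  -- cancel and only those with ∂_jθ survive.
  · simp only [coordDeriv_kernel_right _ hθ hρ, coordDeriv_kernel_left _ hρ] at h1 h2
    rw [h1]
    have h3 : ∀ j, kernelForm P U (g j)
        (fun x y => coordDeriv j θ y * ρ (x - y) - θ y * coordDeriv j ρ (x - y)) = _ :=
      fun j => kernelForm_sub hp hp' hU (hg j) (hκ1 j) (hκ2 j)
    simp only [h3, Finset.sum_sub_distrib]
    linarith
  · by_cases hyθ : y ∈ tsupport θ
    · intro x hx
      have hx' : x ∈ tsupport (fun x => ρ (x - y)) := by
        exact tsupport_mul_subset_right (f := fun _ => θ y) hx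
      have hx'' : x - y ∈ tsupport ρ := by
        have := tsupport_comp_subset_preimage ρ (f := fun x : Space d => x - y)
          (by fun_prop) hx'
        exact this
      simpa using hθρ y ⟨hy, hyθ⟩ (x - y) hx''
    · simp [image_eq_zero_of_notMem_tsupport hyθ, tsupport]

end LocalIdentity

/-! ### Localization near the boundary of a Lipschitz domain -/

/-- A Lipschitz domain satisfies a uniform inner cone condition near each point of its closure. -/
theorem IsLipschitzDomain.exists_cone {d : ℕ} {O : Set (Space d)} (hO : IsLipschitzDomain O)
    {x₀ : Space d} (hx₀ : x₀ ∈ closure O) :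
    ∃ δ > 0, ∃ ν : Space d, ∃ c > 0, ∃ t₀ > 0, ∀ t, 0 < t → t < t₀ →
      ∀ y ∈ O ∩ Metric.ball x₀ δ, ∀ s ∈ Metric.closedBall (t • ν) (c * t), y + s ∈ O := by
  by_cases hx : x₀ ∈ O
  · obtain ⟨r, hr, hrO⟩ := Metric.isOpen_iff.1 hO.isOpen x₀ hx
    -- In the interior no direction is needed: ν = 0, and all displacements of length at most t <
    -- r/2 stay in the ball.
    refine ⟨r / 2, by positivity, 0, 1, one_pos, r / 2, by positivity, fun t ht htr y hy s hs => ?_⟩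
    apply hrO
    have h1 : dist y x₀ < r / 2 := hy.2
    have h2 : ‖s‖ ≤ t := by simpa using hs
    rw [Metric.mem_ball, dist_eq_norm] at *
    calc ‖y + s - x₀‖ = ‖(y - x₀) + s‖ := by congr 1; abel
      _ ≤ ‖y - x₀‖ + ‖s‖ := norm_add_le _ _
      _ < r := by linarith
  · have hf : x₀ ∈ frontier O := by
      rw [hO.isOpen.frontier_eq]
      exact ⟨hx₀, hx⟩
    obtain ⟨ν, hν, γ, K, hγ, hγν, r, hr, hγO⟩ := hO.lipschitz_boundary x₀ hf
    have hK : (0 : ℝ) < K + 1 := by positivity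
    -- Moving by tν raises ν·y by t and leaves γ unchanged; an error e changes γ by at most K‖e‖ and
    -- ν·y by at most ‖e‖. Both are absorbed when (K + 1)‖e‖ ≤ t, whence the opening 1/(K + 1). The
    -- total displacement is at most 2t < r/2, so the point stays in the chart.
    refine ⟨r / 2, by positivity, ν, 1 / (K + 1), by positivity, r / 4, by positivity,
      fun t ht htr y hy s hs => ?_⟩
    have hc1 : 1 / ((K : ℝ) + 1) ≤ 1 := by
      rw [div_le_one hK]
      linarith [K.coe_nonneg]
    have h1 : dist y x₀ < r / 2 := hy.2
    obtain ⟨e, rfl⟩ : ∃ e, s = t • ν + e := ⟨s - t • ν, by abel⟩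
    have he : ‖e‖ ≤ 1 / (K + 1) * t := by simpa [dist_eq_norm] using hs
    have htν : ‖t • ν‖ = t := by rw [norm_smul, hν, mul_one, Real.norm_of_nonneg ht.le]
    have het : ‖e‖ ≤ t := he.trans (mul_le_of_le_one_left ht.le hc1)
    have hyr : y ∈ Metric.ball x₀ r := Metric.ball_subset_ball (by linarith) hy.2
    have hys : y + (t • ν + e) ∈ Metric.ball x₀ r := by
      rw [Metric.mem_ball, dist_eq_norm] at *
      calc ‖y + (t • ν + e) - x₀‖ = ‖(y - x₀) + (t • ν + e)‖ := by congr 1; abel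
        _ ≤ ‖y - x₀‖ + (‖t • ν‖ + ‖e‖) :=
          (norm_add_le _ _).trans (add_le_add le_rfl (norm_add_le _ _))
        _ < r := by linarith
    rw [hγO _ hys]
    have h2 := (hγO y hyr).1 hy.1
    have h3 : γ (y + (t • ν + e)) = γ (y + e) := by
      rw [show y + (t • ν + e) = (y + e) + t • ν by abel, hγν]
    have h4 : γ (y + e) - γ y ≤ K * ‖e‖ := by
      have := hγ.dist_le_mul (y + e) y
      rw [Real.dist_eq, dist_eq_norm, add_sub_cancel_left] at this
      exact (le_abs_self _).trans this
    have h5 : |inner ℝ ν e| ≤ ‖e‖ := by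
      have := abs_real_inner_le_norm ν e
      rwa [hν, one_mul] at this
    have h6 : inner ℝ ν (y + (t • ν + e)) = inner ℝ ν y + t + inner ℝ ν e := by
      rw [inner_add_right, inner_add_right, inner_smul_right, real_inner_self_eq_norm_sq, hν]
      ring
    have h7 : (K + 1) * ‖e‖ ≤ t := by
      calc (K + 1) * ‖e‖ ≤ (K + 1) * (1 / (K + 1) * t) := by gcongr
        _ = t := by field_simp
    rw [h3, h6]
    linarith [neg_le_of_abs_le h5]

/-! ### Removing the mollification and the localization -/

section GlobalIdentity

variable {Ω : Type*} [MeasurableSpace Ω] {P : Measure Ω} [IsProbabilityMeasure P] {d : ℕ}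
  {p q : ℝ≥0∞} {T : IntLattice d → Ω → Ω}

/-- The localized product rule. -/
theorem localized_product_rule [ENNReal.HolderConjugate p q] (hp : 1 < p) (hp' : p ≠ ∞)
    {O : Set (Space d)}
    {U g₀ : Ω × Space d → ℝ} {G g : Fin d → Ω × Space d → ℝ} (hU : MemLp U p (P.prod volume))
    (hG : ∀ j, MemLp (G j) p (P.prod volume))
    (hg₀ : MemLp g₀ q (P.prod volume)) (hg : ∀ j, MemLp (g j) q (P.prod volume))
    (hUG : HasTwoScaleGradient q P T U G)
    (hsol : ∀ᵐ y ∂P.prod (volume : Measure (Space d)),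
      ∑ j, (g j (T (-latticeUnit j) y.1, y.2) - g j y) = 0)
    (hUinv : ∀ z, ∀ᵐ y ∂P.prod (volume : Measure (Space d)), U (T z y.1, y.2) = U y)
    (hUO : ∀ᵐ y ∂P.prod (volume : Measure (Space d)), y.2 ∉ O → U y = 0)
    (hann : AnnihilatesInvariant p P T O g₀ g)
    {θ : Space d → ℝ} (hθ : ContDiff ℝ (⊤ : ℕ∞) θ) (hθc : HasCompactSupport θ)
    {ν : Space d} {c t₀ : ℝ} (hc : 0 < c) (ht₀ : 0 < t₀)
    (hcone : ∀ t, 0 < t → t < t₀ → ∀ y ∈ O ∩ tsupport θ,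
      ∀ s ∈ Metric.closedBall (t • ν) (c * t), y + s ∈ O) :
    ∫ z, θ z.2 * U z * g₀ z ∂P.prod (volume : Measure (Space d)) +
        ∑ j, ∫ z, θ z.2 * G j z * g j z ∂P.prod (volume : Measure (Space d)) =
      -∑ j, ∫ z, coordDeriv j θ z.2 * U z * g j z ∂P.prod (volume : Measure (Space d)) := by
  set t : ℕ → ℝ := fun n => t₀ * (1 / ((n : ℝ) + 2)) with ht
  have htpos : ∀ n, 0 < t n := fun n => by positivity
  have htlt : ∀ n, t n < t₀ := by
    intro n
    refine mul_lt_of_lt_one_right ht₀ ?_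
    rw [div_lt_one (by positivity)]
    linarith [n.cast_nonneg (α := ℝ)]
  have ht0 : Tendsto t atTop (𝓝 0) := by
    have h1 : Tendsto (fun n : ℕ => 1 / ((n : ℝ) + 2)) atTop (𝓝 0) := by
      have := (tendsto_one_div_add_atTop_nhds_zero_nat (𝕜 := ℝ)).comp (tendsto_add_atTop_nat 1)
      refine this.congr fun n => ?_
      simp only [Function.comp_apply]
      push_cast
      ring
    simpa [ht] using h1.const_mul t₀
  -- The bumps are centred at t ν, not at 0, with radius c t: their supports are exactly the balls
  -- that the cone condition allows as displacements, and they still shrink to the origin.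
  let β : ∀ n, ContDiffBump (t n • ν) := fun n =>
    ⟨c * t n / 2, c * t n, by have := htpos n; positivity, half_lt_self (by have := htpos n; positivity)⟩
  set ρ : ℕ → Space d → ℝ := fun n => (β n).normed volume with hρ
  have hρs : ∀ n, ContDiff ℝ (⊤ : ℕ∞) (ρ n) := fun n => (β n).contDiff_normed
  have hρc : ∀ n, HasCompactSupport (ρ n) := fun n => (β n).hasCompactSupport_normed
  have hρsupp : ∀ n, tsupport (ρ n) = Metric.closedBall (t n • ν) (c * t n) := fun n =>
    (β n).tsupport_normed_eq
  have key : ∀ n, kernelForm P U g₀ (fun x y => θ y * ρ n (x - y)) +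
        ∑ j, kernelForm P (G j) (g j) (fun x y => θ y * ρ n (x - y)) =
      -∑ j, kernelForm P U (g j) (fun x y => coordDeriv j θ y * ρ n (x - y)) := fun n =>
    kernelForm_identity hp hp' hU hG hg₀ hg hUG hsol hUinv hUO hann hθ hθc (hρs n) (hρc n)
      (fun y hy s hs => hcone (t n) (htpos n) (htlt n) y hy s (hρsupp n ▸ hs))
  have lim : ∀ {a b : Ω × Space d → ℝ}, MemLp a p (P.prod volume) → MemLp b q (P.prod volume) →
      ∀ {θ : Space d → ℝ}, Continuous θ → HasCompactSupport θ →
      Tendsto (fun n => kernelForm P a b (fun x y => θ y * ρ n (x - y))) atTop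
        (𝓝 (∫ z, θ z.2 * a z * b z ∂P.prod volume)) := by
    intro a b ha hb θ hθ hθc
    refine tendsto_kernelForm hp hp' ha hb hθ hθc (Eventually.of_forall fun n x =>
      (β n).nonneg_normed x) (Eventually.of_forall fun n => (β n).integral_normed)
      (r := fun n => (‖ν‖ + c) * t n) (by simpa using ht0.const_mul (‖ν‖ + c))
      (Eventually.of_forall fun n x hx => ?_)
      (Eventually.of_forall fun n => isBoundedKernel_mul_shift hθ hθc (hρs n).continuous (hρc n))
    have h1 : x ∈ Metric.closedBall (t n • ν) (c * t n) := hρsupp n ▸ subset_tsupport _ hx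
    rw [Metric.mem_closedBall, dist_eq_norm] at h1
    calc ‖x‖ = ‖(x - t n • ν) + t n • ν‖ := by congr 1; abel
      _ ≤ c * t n + ‖t n • ν‖ := (norm_add_le _ _).trans (by gcongr)
      _ = (‖ν‖ + c) * t n := by rw [norm_smul, Real.norm_of_nonneg (htpos n).le]; ring
  have hl := (lim hU hg₀ hθ.continuous hθc).add
    (tendsto_finsetSum Finset.univ fun j _ => lim (hG j) (hg j) hθ.continuous hθc)
  have hr := (tendsto_finsetSum Finset.univ fun j _ => lim hU (hg j)
    (contDiff_coordDeriv j hθ).continuous (hasCompactSupport_coordDeriv j hθc)).neg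
  exact tendsto_nhds_unique (hl.congr fun n => key n) hr

/-- A finite smooth partition of unity of a bounded closed set, subordinate to balls. -/
theorem exists_finite_partition {K : Set (Space d)} (hK : IsCompact K) (δ : Space d → ℝ)
    (hδ : ∀ x ∈ K, 0 < δ x) :
    ∃ (s : Finset (Space d)) (θ : s → Space d → ℝ), (∀ x ∈ s, x ∈ K) ∧
      (∀ i, ContDiff ℝ (⊤ : ℕ∞) (θ i)) ∧ (∀ i, HasCompactSupport (θ i)) ∧
      (∀ i, tsupport (θ i) ⊆ Metric.ball i.1 (δ i.1)) ∧ ∀ x ∈ K, ∑ i, θ i x = 1 := by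
  obtain ⟨s, hsK, hs⟩ := hK.elim_nhds_subcover (fun x => Metric.ball x (δ x))
    (fun x hx => Metric.ball_mem_nhds x (hδ x hx))
  obtain ⟨f, hf⟩ := SmoothPartitionOfUnity.exists_isSubordinate (modelWithCornersSelf ℝ (Space d))
    hK.isClosed (fun i : s => Metric.ball i.1 (δ i.1)) (fun _ => Metric.isOpen_ball) (by
      intro x hx
      obtain ⟨i, hi, hx⟩ := mem_iUnion₂.1 (hs hx)
      exact mem_iUnion.2 ⟨⟨i, hi⟩, hx⟩)
  refine ⟨s, fun i => f i, hsK, fun i => (f i).contMDiff.contDiff, fun i => ?_, hf, fun x hx => ?_⟩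
  · exact Metric.isCompact_of_isClosed_isBounded (isClosed_tsupport _)
      (Metric.isBounded_ball.subset (hf i))
  · rw [← finsum_eq_sum_of_fintype]
    exact f.sum_eq_one hx

/-- The product rule on a Lipschitz domain. -/
theorem product_rule [ENNReal.HolderConjugate p q] (hp : 1 < p) (hp' : p ≠ ∞)
    {O : Set (Space d)} (hO : IsLipschitzDomain O)
    {U g₀ : Ω × Space d → ℝ} {G g : Fin d → Ω × Space d → ℝ} (hU : MemLp U p (P.prod volume))
    (hG : ∀ j, MemLp (G j) p (P.prod volume))
    (hg₀ : MemLp g₀ q (P.prod volume)) (hg : ∀ j, MemLp (g j) q (P.prod volume))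
    (hUG : HasTwoScaleGradient q P T U G)
    (hsol : ∀ᵐ y ∂P.prod (volume : Measure (Space d)),
      ∑ j, (g j (T (-latticeUnit j) y.1, y.2) - g j y) = 0)
    (hUinv : ∀ z, ∀ᵐ y ∂P.prod (volume : Measure (Space d)), U (T z y.1, y.2) = U y)
    (hUO : ∀ᵐ y ∂P.prod (volume : Measure (Space d)), y.2 ∉ O → U y = 0)
    (hGO : ∀ j, ∀ᵐ y ∂P.prod (volume : Measure (Space d)), y.2 ∉ O → G j y = 0)
    (hann : AnnihilatesInvariant p P T O g₀ g) :
    ∫ z, U z * g₀ z ∂P.prod (volume : Measure (Space d)) +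
        ∑ j, ∫ z, G j z * g j z ∂P.prod (volume : Measure (Space d)) = 0 := by
  have hcone : ∀ x : Space d, ∃ δ : ℝ, x ∈ closure O → 0 < δ ∧ ∃ ν : Space d, ∃ c > 0, ∃ t₀ > 0,
      ∀ t, 0 < t → t < t₀ →
      ∀ y ∈ O ∩ Metric.ball x δ, ∀ s ∈ Metric.closedBall (t • ν) (c * t), y + s ∈ O := by
    intro x
    by_cases hx : x ∈ closure O
    · obtain ⟨δ, hδ, h⟩ := hO.exists_cone hx
      exact ⟨δ, fun _ => ⟨hδ, h⟩⟩
    · exact ⟨0, fun h => (hx h).elim⟩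
  choose δ hδ using hcone
  obtain ⟨s, θ, hsK, hθ, hθc, hθs, hθ1⟩ := exists_finite_partition
    hO.isBounded.isCompact_closure δ (fun x hx => (hδ x hx).1)
  have hloc : ∀ i, ∫ z, θ i z.2 * U z * g₀ z ∂P.prod (volume : Measure (Space d)) +
        ∑ j, ∫ z, θ i z.2 * G j z * g j z ∂P.prod (volume : Measure (Space d)) =
      -∑ j, ∫ z, coordDeriv j (θ i) z.2 * U z * g j z ∂P.prod (volume : Measure (Space d)) := by
    intro i
    obtain ⟨-, ν, c, hc, t₀, ht₀, h⟩ := hδ i.1 (hsK i.1 i.2)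
    exact localized_product_rule hp hp' hU hG hg₀ hg hUG hsol hUinv hUO hann (hθ i) (hθc i) hc ht₀
      (fun t h0 h1 y hy => h t h0 h1 y ⟨hy.1, hθs i hy.2⟩)
  have hint : ∀ {θ : Space d → ℝ} {a b : Ω × Space d → ℝ}, Continuous θ → HasCompactSupport θ →
      MemLp a p (P.prod volume) → MemLp b q (P.prod volume) →
      Integrable (fun z => θ z.2 * a z * b z) (P.prod (volume : Measure (Space d))) := by
    intro θ a b hθ hθc ha hb
    obtain ⟨C, -, hC⟩ := hθc.exists_nonneg_bound hθ
    refine ((integrable_mul_of_conjugate ha hb).bdd_mul (c := C)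
      (hθ.measurable.comp measurable_snd).aestronglyMeasurable
      (ae_of_all _ fun z => hC z.2)).congr (ae_of_all _ fun z => (mul_assoc _ _ _).symm)
  have hsum : ∀ {a b : Ω × Space d → ℝ}, MemLp a p (P.prod volume) → MemLp b q (P.prod volume) →
      (∀ᵐ y ∂P.prod (volume : Measure (Space d)), y.2 ∉ O → a y = 0) →
      ∑ i, ∫ z, θ i z.2 * a z * b z ∂P.prod (volume : Measure (Space d)) =
        ∫ z, a z * b z ∂P.prod (volume : Measure (Space d)) := by
    intro a b ha hb h0
    rw [← integral_finsetSum _ fun i _ => hint (hθ i).continuous (hθc i) ha hb]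
    refine integral_congr_ae ?_
    filter_upwards [h0] with z hz
    by_cases hzO : z.2 ∈ O
    · simp only [mul_assoc]
      rw [← Finset.sum_mul, hθ1 _ (subset_closure hzO), one_mul]
    · simp [hz hzO]
  -- The sum of the θ_i is constant on the open set O, so the derivatives sum to zero there, and U
  -- vanishes elsewhere.
  have hderiv : ∀ j, ∑ i, ∫ z, coordDeriv j (θ i) z.2 * U z * g j z
      ∂P.prod (volume : Measure (Space d)) = 0 := by
    intro j
    rw [← integral_finsetSum _ fun i _ => hint (contDiff_coordDeriv j (hθ i)).continuous
      (hasCompactSupport_coordDeriv j (hθc i)) hU (hg j)]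
    refine integral_eq_zero_of_ae ?_
    filter_upwards [hUO] with z hz
    by_cases hzO : z.2 ∈ O
    · simp only [mul_assoc, Pi.zero_apply]
      rw [← Finset.sum_mul]
      have h1 : (fun x => ∑ i, θ i x) =ᶠ[𝓝 z.2] fun _ => 1 := by
        filter_upwards [hO.isOpen.mem_nhds hzO] with x hx
        exact hθ1 x (subset_closure hx)
      have h2 := h1.fderiv_eq (𝕜 := ℝ)
      rw [fderiv_fun_sum (fun i _ => (hθ i).differentiable (by simp) _)] at h2
      have h3 := congrArg (fun L : Space d →L[ℝ] ℝ => L (EuclideanSpace.single j 1)) h2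
      simp only [fderiv_fun_const, Pi.zero_apply, zero_apply,
        sum_apply] at h3
      simp only [coordDeriv, h3, zero_mul]
    · simp [hz hzO]
  have h := Finset.sum_congr (rfl : (Finset.univ : Finset s) = _) fun i _ => hloc i
  rw [Finset.sum_add_distrib, hsum hU hg₀ hUO, Finset.sum_comm,
    Finset.sum_congr rfl fun j _ => hsum (hG j) (hg j) (hGO j), Finset.sum_neg_distrib,
    Finset.sum_comm, Finset.sum_congr rfl fun j _ => hderiv j] at h
  simpa using h

end GlobalIdentity

/-! ### The structure of two-scale limits -/

section Structure

variable {Ω : Type*} [MeasurableSpace Ω] {P : Measure Ω} [IsProbabilityMeasure P] {d : ℕ}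
  {p q : ℝ≥0∞} {T : IntLattice d → Ω → Ω} [Fact (1 ≤ p)]

theorem gradient_apply (η : Space d → ℝ) (x : Space d) (j : Fin d) :
    gradient η x j = coordDeriv j η x := by
  rw [coordDeriv, ← inner_gradient_left, real_inner_comm, EuclideanSpace.inner_single_left]
  simp

theorem memLp_prodMk {α : Type*} [MeasurableSpace α] {μ : Measure α} {u : α → ℝ}
    {v : Fin d → α → ℝ} (hu : MemLp u p μ) (hv : ∀ j, MemLp (v j) p μ) :
    MemLp (fun y => ((u y, WithLp.toLp 2 fun j => v j y) : ℝ × Space d)) p μ := by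
  have h1 : MemLp (fun y => u y • ((1, 0) : ℝ × Space d) +
      ∑ j, v j y • ((0, EuclideanSpace.single j 1) : ℝ × Space d)) p μ :=
    ((ContinuousLinearMap.toSpanSingleton ℝ ((1, 0) : ℝ × Space d)).comp_memLp' hu).add
      (memLp_finsetSum _ fun j _ => (ContinuousLinearMap.toSpanSingleton ℝ
        ((0, EuclideanSpace.single j 1) : ℝ × Space d)).comp_memLp' (hv j))
  refine h1.ae_eq (ae_of_all _ fun y => Prod.ext ?_ ?_)
  · simp [Prod.fst_sum]
  · ext i
    simp [Prod.snd_sum, Pi.single_apply]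

theorem memLp_toLp {α : Type*} [MeasurableSpace α] {μ : Measure α}
    {v : Fin d → α → ℝ} (hv : ∀ j, MemLp (v j) p μ) :
    MemLp (fun y => (WithLp.toLp 2 fun j => v j y : Space d)) p μ :=
  (ContinuousLinearMap.snd ℝ ℝ (Space d)).comp_memLp' (memLp_prodMk (MemLp.zero' (ε := ℝ)) hv)

theorem exists_mem_sobolevZero {O : Set (Space d)} {η : Space d → ℝ}
    (hη : ContDiff ℝ (⊤ : ℕ∞) η) (hηc : HasCompactSupport η) (hηO : tsupport η ⊆ O) :
    ∃ f ∈ SobolevZero p O, ∀ᵐ x, f x = (η x, gradient η x) := by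
  have h0 : (fun x => (η x, gradient η x)) =
      fun x => (η x, (WithLp.toLp 2 fun j => coordDeriv j η x : Space d)) := by
    funext x
    refine Prod.ext rfl ?_
    ext j
    simp [gradient_apply]
  have h : MemLp (fun x => (η x, gradient η x)) p (volume : Measure (Space d)) := by
    rw [h0]
    exact memLp_prodMk (v := fun j => coordDeriv j η) (hη.continuous.memLp_space hηc)
      fun j => (contDiff_coordDeriv j hη).continuous.memLp_space
        (hasCompactSupport_coordDeriv j hηc)
  exact ⟨h.toLp _, subset_closure ⟨η, hη, hηc, hηO, h.coeFn_toLp⟩, h.coeFn_toLp⟩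

theorem exists_mem_invSobolev (hp' : p ≠ ∞) (hT : IsDynamicalSystem P T) {O : Set (Space d)}
    {φ : Ω → ℝ} (hφ : MemLp φ p P) (hinv : ∀ z, ∀ᵐ ω ∂P, φ (T z ω) = φ ω)
    {η : Space d → ℝ} (hη : ContDiff ℝ (⊤ : ℕ∞) η) (hηc : HasCompactSupport η)
    (hηO : tsupport η ⊆ O) :
    ∃ W ∈ InvSobolev p P T O, ∀ᵐ y ∂P.prod (volume : Measure (Space d)),
      W y = φ y.1 • (η y.2, gradient η y.2) := by
  have hp0 : p ≠ 0 := (zero_lt_one.trans_le Fact.out).ne'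
  obtain ⟨f, hf, hfη⟩ := exists_mem_sobolevZero (p := p) hη hηc hηO
  let t := tensorLp (μ := P) (ν := (volume : Measure (Space d))) hp0 hp'
    (ContinuousLinearMap.lsmul ℝ ℝ : ℝ →L[ℝ] (ℝ × Space d) →L[ℝ] (ℝ × Space d)) (hφ.toLp φ) f
  have ht : t =ᵐ[P.prod volume] fun y => (hφ.toLp φ) y.1 • f y.2 := coeFn_tensorLp hp0 hp' _ _ _
  refine ⟨t, subset_closure (Submodule.subset_span ⟨hφ.toLp φ, fun z => ?_, f, hf, ht⟩), ?_⟩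
  · filter_upwards [hφ.coeFn_toLp,
      (hT.measurePreserving z).quasiMeasurePreserving.ae hφ.coeFn_toLp, hinv z] with ω h1 h2 h3
    rw [h1, h2, h3]
  · filter_upwards [ht, Measure.quasiMeasurePreserving_fst.ae hφ.coeFn_toLp,
      Measure.quasiMeasurePreserving_snd.ae hfη] with y h1 h2 h3
    rw [h1, h2, h3]

/-- The horizontal derivative `Dφ`. -/
noncomputable def horizontalDeriv (T : IntLattice d → Ω → Ω) (φ : Ω → ℝ) (ω : Ω) : Space d :=
  WithLp.toLp 2 fun j => φ (T (latticeUnit j) ω) - φ ω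

theorem memLp_horizontalDeriv (hT : IsDynamicalSystem P T) {φ : Ω → ℝ} (hφ : MemLp φ p P) :
    MemLp (horizontalDeriv T φ) p P :=
  memLp_toLp fun j => (hφ.comp_measurePreserving (hT.measurePreserving (latticeUnit j))).sub hφ

theorem exists_mem_potTensor (hp' : p ≠ ∞) (hT : IsDynamicalSystem P T) {O : Set (Space d)}
    {φ : Ω → ℝ} (hφ : MemLp φ p P) {η : Space d → ℝ} (hη : MemLp η p volume)
    (hηO : ∀ᵐ x, x ∉ O → η x = 0) :
    ∃ χ ∈ PotTensor p P T O, ∀ᵐ y ∂P.prod (volume : Measure (Space d)),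
      χ y = η y.2 • horizontalDeriv T φ y.1 := by
  have hp0 : p ≠ 0 := (zero_lt_one.trans_le Fact.out).ne'
  have hψ := memLp_horizontalDeriv hT hφ
  let t := tensorLp (μ := P) (ν := (volume : Measure (Space d))) hp0 hp'
    ((ContinuousLinearMap.lsmul ℝ ℝ).flip : Space d →L[ℝ] ℝ →L[ℝ] Space d) (hψ.toLp _) (hη.toLp η)
  have ht : t =ᵐ[P.prod volume] fun y => (hη.toLp η) y.2 • (hψ.toLp _) y.1 :=
    coeFn_tensorLp hp0 hp' _ _ _
  refine ⟨t, subset_closure (Submodule.subset_span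
    ⟨hψ.toLp _, subset_closure ⟨hφ.toLp φ, ?_⟩, hη.toLp η, ?_, ht⟩), ?_⟩
  · filter_upwards [hψ.coeFn_toLp, hφ.coeFn_toLp, ae_all_iff.2 fun j =>
      (hT.measurePreserving (latticeUnit j)).quasiMeasurePreserving.ae hφ.coeFn_toLp]
      with ω h1 h2 h3
    rw [h1]
    simp only [horizontalDeriv, h2, h3]
  · filter_upwards [hηO, hη.coeFn_toLp] with x h1 h2 hx
    rw [h2, h1 hx]
  · filter_upwards [ht, Measure.quasiMeasurePreserving_fst.ae hψ.coeFn_toLp,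
      Measure.quasiMeasurePreserving_snd.ae hη.coeFn_toLp] with y h1 h2 h3
    rw [h1, h2, h3]

/-- A random field that annihilates `L^p_pot(Ω) ⊗ L^p(O)` is solenoidal. -/
theorem solenoidal_of_annihilates [ENNReal.HolderConjugate p q] (hp : 1 < p) (hp' : p ≠ ∞)
    (hT : IsDynamicalSystem P T) {O : Set (Space d)} (hO : MeasurableSet O)
    {g : Fin d → Ω × Space d → ℝ} (hg : ∀ j, MemLp (g j) q (P.prod volume))
    (hann : ∀ χ ∈ PotTensor p P T O,
      ∑ j, ∫ y, χ y j * g j y ∂P.prod (volume : Measure (Space d)) = 0) :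
    ∀ᵐ y ∂P.prod (volume : Measure (Space d)),
      ∑ j, ((univ ×ˢ O).indicator (g j) (T (-latticeUnit j) y.1, y.2) -
        (univ ×ˢ O).indicator (g j) y) = 0 := by
  have hp0 : p ≠ 0 := (zero_lt_one.trans hp).ne'
  have hq : 1 < q := (ENNReal.HolderConjugate.lt_top_iff_one_lt p q).1 hp'.lt_top
  set g' : Fin d → Ω × Space d → ℝ := fun j => (univ ×ˢ O).indicator (g j) with hg'
  have hg'm : ∀ j, MemLp (g' j) q (P.prod volume) := fun j =>
    (hg j).indicator (MeasurableSet.univ.prod hO)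
  have hmp := fun j : Fin d => measurePreserving_jointShift hT 0 (-latticeUnit j)
  have hs : ∀ j, MemLp (fun y => g' j (jointShift T 0 (-latticeUnit j) y)) q (P.prod volume) :=
    fun j => (hg'm j).comp_measurePreserving (hmp j)
  have hm : ∀ j, MemLp (fun y => g' j (jointShift T 0 (-latticeUnit j) y) - g' j y) q
      (P.prod volume) := fun j => (hs j).sub (hg'm j)
  have hmain := ae_eq_zero_of_forall_integral_prod hq.le
    (g := fun y => ∑ j, (g' j (jointShift T 0 (-latticeUnit j) y) - g' j y))
    (memLp_finsetSum _ fun j _ => hm j) ?_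
  · filter_upwards [hmain] with y hy
    simpa only [jointShift_zero_apply, Pi.zero_apply] using hy
  intro A hA η hη hηc
  have hφ : MemLp (A.indicator (1 : Ω → ℝ)) p P := memLp_indicator_const p hA 1
    (Or.inr (measure_ne_top _ _))
  have hηp : MemLp (O.indicator η) p volume := (hη.continuous.memLp_space hηc).indicator hO
  -- The test field is D1_A ⊗ 1_O η. Shifting back by change of variables turns D acting on 1_A into
  -- the horizontal divergence of g; the cut-off by O depends on x only and commutes with T.
  obtain ⟨χ, hχ, hχe⟩ := exists_mem_potTensor hp' hT hφ hηp
    (ae_of_all _ fun x hx => indicator_of_notMem hx η)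
  have htest : MemLp (fun y : Ω × Space d => A.indicator 1 y.1 * η y.2) p (P.prod volume) :=
    memLp_indicator_mul hp0 hp' hA hη.continuous hηc
  refine Eq.trans ?_ (hann χ hχ)
  simp only [Finset.sum_mul]
  rw [integral_finsetSum _ fun j _ =>
    (integrable_mul_of_conjugate htest (hm j)).congr (ae_of_all _ fun y => mul_comm _ _)]
  refine Finset.sum_congr rfl fun j _ => ?_
  simp only [sub_mul]
  have hts : MemLp (fun y : Ω × Space d => A.indicator 1 (T (latticeUnit j) y.1) * η y.2) p
      (P.prod volume) := by
    have := htest.comp_measurePreserving (measurePreserving_jointShift hT 0 (latticeUnit j))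
    simpa only [Function.comp_def, jointShift_zero_apply] using this
  rw [integral_sub ((integrable_mul_of_conjugate htest (hs j)).congr
      (ae_of_all _ fun y => mul_comm _ _))
    ((integrable_mul_of_conjugate htest (hg'm j)).congr (ae_of_all _ fun y => mul_comm _ _)),
    integral_comp_jointShift hT, neg_neg]
  simp only [jointShift_zero_apply]
  rw [← integral_sub ((integrable_mul_of_conjugate hts (hg'm j)).congr
      (ae_of_all _ fun y => mul_comm _ _))
    ((integrable_mul_of_conjugate htest (hg'm j)).congr (ae_of_all _ fun y => mul_comm _ _))]
  refine integral_congr_ae ?_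
  filter_upwards [hχe] with y hy
  rw [hy]
  by_cases hyO : y.2 ∈ O
  · simp only [hg', horizontalDeriv, PiLp.smul_apply, smul_eq_mul, indicator_of_mem hyO,
      indicator_of_mem (show y ∈ univ ×ˢ O from ⟨mem_univ _, hyO⟩)]
    ring
  · simp [hg', hyO]

/-- A pair with a two-scale gradient in the sense of test functions is of the form `(U, ∇U + χ)`. -/
theorem exists_decomposition [ENNReal.HolderConjugate p q] (hp : 1 < p) (hp' : p ≠ ∞)
    (hT : IsDynamicalSystem P T) {O : Set (Space d)} (hO : IsLipschitzDomain O)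
    {U : Ω × Space d → ℝ} {G : Fin d → Ω × Space d → ℝ} (hU : MemLp U p (P.prod volume))
    (hG : ∀ j, MemLp (G j) p (P.prod volume)) (hUG : HasTwoScaleGradient q P T U G)
    (hUinv : ∀ z, ∀ᵐ y ∂P.prod (volume : Measure (Space d)), U (T z y.1, y.2) = U y)
    (hUO : ∀ᵐ y ∂P.prod (volume : Measure (Space d)), y.2 ∉ O → U y = 0)
    (hGO : ∀ j, ∀ᵐ y ∂P.prod (volume : Measure (Space d)), y.2 ∉ O → G j y = 0) :
    ∃ W ∈ InvSobolev p P T O, ∃ χ ∈ PotTensor p P T O,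
      (∀ᵐ y ∂P.prod (volume : Measure (Space d)), U y = (W y).1) ∧
      ∀ j, ∀ᵐ y ∂P.prod (volume : Measure (Space d)), G j y = (W y).2 j + χ y j := by
  have hF := memLp_prodMk hU hG
  set F := hF.toLp _ with hFdef
  -- Coordinates of ℝ × ℝ^d: `none` is the function, `some j` the j-th gradient entry.
  let c : Option (Fin d) → (ℝ × Space d) →L[ℝ] ℝ := fun i => i.elim (ContinuousLinearMap.fst ℝ _ _)
    fun j => (EuclideanSpace.proj j : Space d →L[ℝ] ℝ).comp (ContinuousLinearMap.snd ℝ _ _)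
  let e : Option (Fin d) → ℝ × Space d := fun i => i.elim (1, 0)
    fun j => (0, EuclideanSpace.single j 1)
  have hce : ∀ x, x = ∑ i, c i x • e i := by
    intro x
    rw [Fintype.sum_option]
    refine Prod.ext ?_ ?_
    · simp [c, e, Prod.fst_sum]
    · ext i
      simp [c, e, Prod.snd_sum, Pi.single_apply]
  have hmem := mem_of_forall_annihilator (μ := P.prod (volume : Measure (Space d))) (q := q)
    hp hp' c e hce (LinearMap.range (limitSum p P T O).toLinearMap)
    (isClosed_range_limitSum (q := q) hp hp' hT O) F ?_
  · obtain ⟨z, hz⟩ := hmem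
    have hz' : (z.1 : Lp (ℝ × Space d) p (P.prod (volume : Measure (Space d)))) +
        gradInr p P d z.2 = F := (limitSum_apply O z).symm.trans hz
    have h1 := coeFn_add_gradInr (z.1 : Lp (ℝ × Space d) p (P.prod (volume : Measure (Space d))))
      (z.2 : Lp (Space d) p (P.prod (volume : Measure (Space d))))
    rw [hz'] at h1
    have h2 := hF.coeFn_toLp
    refine ⟨z.1, z.1.2, z.2, z.2.2, ?_, fun j => ?_⟩
    · filter_upwards [h1, h2] with y h1 h2
      rw [h2] at h1
      exact congrArg Prod.fst h1
    · filter_upwards [h1, h2] with y h1 h2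
      rw [h2] at h1
      exact congrArg (fun w : ℝ × Space d => w.2 j) h1
  · intro g hg hann
    have hinv : ∀ W ∈ InvSobolev p P T O, ∫ y, (W y).1 * g none y ∂P.prod volume +
        ∑ j, ∫ y, (W y).2 j * g (some j) y ∂P.prod (volume : Measure (Space d)) = 0 := by
      intro W hW
      have := hann W ⟨(⟨W, hW⟩, 0), by
        exact (limitSum_apply O _).trans (by simp)⟩
      rwa [Fintype.sum_option] at this
    have hpot : ∀ χ ∈ PotTensor p P T O,
        ∑ j, ∫ y, χ y j * g (some j) y ∂P.prod (volume : Measure (Space d)) = 0 := by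
      intro χ hχ
      have h0 := hann (gradInr p P d χ) ⟨(0, ⟨χ, hχ⟩), by
        exact (limitSum_apply O _).trans (by simp)⟩
      rw [Fintype.sum_option] at h0
      have h1 : ∫ y, c none (gradInr p P d χ y) * g none y ∂P.prod volume = 0 := by
        refine integral_eq_zero_of_ae ?_
        filter_upwards [coeFn_gradInr χ] with y hy
        rw [hy]
        simp [c]
      rw [h1, zero_add] at h0
      rw [← h0]
      refine Finset.sum_congr rfl fun j _ => integral_congr_ae ?_
      filter_upwards [coeFn_gradInr χ] with y hy
      rw [hy]
      rfl
    -- Potential fields supported in O see g only on O. Truncation makes g solenoidal everywhere and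
    -- changes none of the pairings, because G and the gradients of test functions on O vanish off
    -- O.
    set g' : Fin d → Ω × Space d → ℝ := fun j => (univ ×ˢ O).indicator (g (some j)) with hg'
    have hOm := hO.isOpen.measurableSet
    have hg'm : ∀ j, MemLp (g' j) q (P.prod volume) := fun j =>
      (hg (some j)).indicator (MeasurableSet.univ.prod hOm)
    have hsol := solenoidal_of_annihilates hp hp' hT hOm (fun j => hg (some j)) hpot
    have hA : AnnihilatesInvariant p P T O (g none) g' := by
      intro φ hφ hφinv η hη hηc hηO
      obtain ⟨W, hW, hWe⟩ := exists_mem_invSobolev hp' hT hφ hφinv hη hηc hηO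
      rw [← hinv W hW]
      refine congrArg₂ (· + ·) (integral_congr_ae ?_)
        (Finset.sum_congr rfl fun j _ => integral_congr_ae ?_)
      · filter_upwards [hWe] with y hy
        rw [hy]
        rfl
      · filter_upwards [hWe] with y hy
        rw [hy]
        simp only [Prod.smul_mk, PiLp.smul_apply, gradient_apply, smul_eq_mul]
        by_cases hyO : y.2 ∈ O
        · simp only [hg', indicator_of_mem (show y ∈ univ ×ˢ O from ⟨mem_univ _, hyO⟩)]
        · have : coordDeriv j η y.2 = 0 := by
            by_contra h
            exact hyO (hηO (support_coordDeriv_subset j η h))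
          simp [this]
    have hmain := product_rule hp hp' hO hU hG (hg none) hg'm hUG hsol hUinv hUO hGO hA
    rw [Fintype.sum_option]
    rw [← hmain]
    refine congrArg₂ (· + ·) (integral_congr_ae ?_)
      (Finset.sum_congr rfl fun j _ => integral_congr_ae ?_)
    · filter_upwards [hF.coeFn_toLp] with y hy
      rw [hy]
      rfl
    · filter_upwards [hF.coeFn_toLp, hGO j] with y hy h0
      rw [hy]
      by_cases hyO : y.2 ∈ O
      · simp only [hg', indicator_of_mem (show y ∈ univ ×ˢ O from ⟨mem_univ _, hyO⟩)]
        rfl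
      · simp [c, h0 hyO]

end Structure

/-! ### Passage to the two-scale limit -/

/-- The gradient of η is Lipschitz, so the mean value inequality gives an error linear in ε,
uniformly in x. It serves both the convergence of difference quotients and the rates of the recovery
fields. -/
theorem exists_diffQuotient_bound {d : ℕ} {η : Space d → ℝ} (hη : ContDiff ℝ (⊤ : ℕ∞) η)
    (hηc : HasCompactSupport η) :
    ∃ L : ℝ, 0 ≤ L ∧ ∀ (x v : Space d) (ε : ℝ), ε ≠ 0 →
      |(η (x + ε • v) - η x) / ε - fderiv ℝ η x v| ≤ L * |ε| * ‖v‖ ^ 2 := by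
  obtain ⟨L, hL⟩ := ContDiff.lipschitzWith_of_hasCompactSupport (hηc.fderiv (𝕜 := ℝ))
    (hη.fderiv_right (m := (1 : ℕ∞)) (by exact_mod_cast le_top)) one_ne_zero
  refine ⟨L, L.coe_nonneg, fun x v ε hε => ?_⟩
  have h1 : ‖η (x + ε • v) - η x - fderiv ℝ η x ((x + ε • v) - x)‖ ≤
      (L * ‖ε • v‖) * ‖(x + ε • v) - x‖ := by
    refine Convex.norm_image_sub_le_of_norm_hasFDerivWithin_le' (𝕜 := ℝ)
      (s := Metric.closedBall x ‖ε • v‖)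
      (fun y _ => (hη.differentiable (by simp) y).hasFDerivAt.hasFDerivWithinAt)
      (fun y hy => ?_) (convex_closedBall _ _) (Metric.mem_closedBall_self (norm_nonneg _)) (by simp)
    rw [← dist_eq_norm]
    exact (hL.dist_le_mul y x).trans (by gcongr; exact hy)
  rw [add_sub_cancel_left, map_smul, smul_eq_mul, norm_smul, Real.norm_eq_abs, Real.norm_eq_abs]
    at h1
  have hε' : 0 < |ε| := abs_pos.2 hε
  have h2 : (η (x + ε • v) - η x) / ε - fderiv ℝ η x v =
      (η (x + ε • v) - η x - ε * fderiv ℝ η x v) / ε := by field_simp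
  rw [h2, abs_div, div_le_iff₀ hε']
  calc _ ≤ _ := h1
    _ = _ := by ring

theorem latticePoint_one_unit {d : ℕ} (j : Fin d) :
    latticePoint 1 (latticeUnit j) = (EuclideanSpace.single j 1 : Space d) := by
  ext i
  simp [latticePoint, latticeUnit, Pi.single_apply]

/-- Difference quotients of test functions converge strongly. -/
theorem tendsto_eLpNorm_diffQuotient {d : ℕ} {p : ℝ≥0∞} {η : Space d → ℝ}
    (hη : ContDiff ℝ (⊤ : ℕ∞) η) (hηc : HasCompactSupport η) (v : Space d)
    {ι : Type*} {l : Filter ι} {ε : ι → ℝ} (hε0 : ∀ᶠ n in l, ε n ≠ 0) (hε : Tendsto ε l (𝓝 0)) :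
    Tendsto (fun n => eLpNorm (fun x => (η (x + ε n • v) - η x) / ε n - fderiv ℝ η x v) p volume)
      l (𝓝 0) := by
  obtain ⟨L, hL0, hL⟩ := exists_diffQuotient_bound hη hηc
  set K := Metric.cthickening ‖v‖ (tsupport η) with hK
  have hKc : IsCompact K := IsCompact.cthickening hηc
  have hlim : Tendsto (fun n => volume K ^ p.toReal⁻¹ * ENNReal.ofReal (L * |ε n| * ‖v‖ ^ 2)) l
      (𝓝 0) := by
    have h1 : Tendsto (fun n => L * |ε n| * ‖v‖ ^ 2) l (𝓝 0) := by
      simpa using (hε.abs.const_mul L).mul_const (‖v‖ ^ 2)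
    have h2 := ENNReal.tendsto_ofReal h1
    rw [ENNReal.ofReal_zero] at h2
    have h3 := ENNReal.Tendsto.const_mul (a := volume K ^ p.toReal⁻¹) h2
      (Or.inr (ENNReal.rpow_ne_top_of_nonneg (by positivity) hKc.measure_lt_top.ne))
    rwa [mul_zero] at h3
  have h1 : ∀ᶠ n in l, |ε n| < 1 := by
    have := hε.abs
    rw [abs_zero] at this
    exact this.eventually (gt_mem_nhds one_pos)
  refine tendsto_of_tendsto_of_tendsto_of_le_of_le' tendsto_const_nhds hlim
    (Eventually.of_forall fun _ => zero_le) ?_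
  filter_upwards [hε0, h1] with n hn hn1
  refine eLpNorm_le_of_abs_le_of_support (fun x => hL x v _ hn) (fun x hx => ?_)
  have hx0 : x ∉ tsupport η := fun h => hx (Metric.self_subset_cthickening _ h)
  have hx1 : x + ε n • v ∉ tsupport η := by
    intro h
    refine hx (Metric.mem_cthickening_of_dist_le x _ _ _ h ?_)
    rw [dist_eq_norm, sub_add_cancel_left, norm_neg, norm_smul, Real.norm_eq_abs]
    exact mul_le_of_le_one_left (norm_nonneg _) hn1.le
  have hf : fderiv ℝ η x = 0 := by
    by_contra h
    exact hx0 (support_fderiv_subset ℝ h)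
  simp [image_eq_zero_of_notMem_tsupport hx0, image_eq_zero_of_notMem_tsupport hx1, hf]

/-- The boundary of a Lipschitz domain is a null set. -/
theorem IsLipschitzDomain.volume_frontier {d : ℕ} {O : Set (Space d)} (hO : IsLipschitzDomain O) :
    volume (frontier O) = 0 := by
  refine measure_null_of_locally_null _ fun x hx => ?_
  obtain ⟨ν, hν, γ, K, hγ, hγν, r, hr, hγO⟩ := hO.lipschitz_boundary x hx
  refine ⟨Metric.ball x r ∩ frontier O, ?_, ?_⟩
  · exact inter_comm _ _ ▸ inter_mem_nhdsWithin _ (Metric.ball_mem_nhds x hr)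
  set Γ := Metric.ball x r ∩ {y | γ y = inner ℝ ν y} with hΓ
  have hν' : Continuous fun y : Space d => inner ℝ ν y := continuous_const.inner continuous_id
  have hsub : Metric.ball x r ∩ frontier O ⊆ Γ := by
    rintro y ⟨hy, hyf⟩
    refine ⟨hy, ?_⟩
    rw [hO.isOpen.frontier_eq] at hyf
    refine le_antisymm ?_ (not_lt.1 fun h => hyf.2 ((hγO y hy).2 h))
    by_contra! h
    have hopen : IsOpen (Metric.ball x r ∩ {y | inner ℝ ν y < γ y}) :=
      Metric.isOpen_ball.inter (isOpen_lt hν' hγ.continuous)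
    obtain ⟨z, hz, hzO⟩ := mem_closure_iff.1 hyf.1 _ hopen ⟨hy, h⟩
    exact lt_asymm hz.2 ((hγO z hz.1).1 hzO)
  refine measure_mono_null hsub ?_
  have hm : MeasurableSet Γ :=
    measurableSet_ball.inter (isClosed_eq hγ.continuous hν').measurableSet
  -- The translates of the graph along ν by the distinct steps 1/(n + 1) are disjoint: γ ignores ν,
  -- while ν·y changes by the step. A measurable set with infinitely many disjoint translates by
  -- bounded vectors has measure zero.
  refine Measure.addHaar_eq_zero_of_disjoint_translates volume
    (fun n : ℕ => (1 / ((n : ℝ) + 1)) • ν) ?_ ?_ hm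
  · refine (Metric.isBounded_closedBall (x := (0 : Space d)) (r := 1)).subset ?_
    rintro _ ⟨n, rfl⟩
    rw [mem_closedBall_zero_iff, norm_smul, hν, mul_one, Real.norm_of_nonneg (by positivity),
      div_le_one (by positivity)]
    linarith [n.cast_nonneg (α := ℝ)]
  · intro m n hmn
    simp only [Function.onFun]
    rw [Set.disjoint_left]
    intro y hy hy'
    obtain ⟨_, rfl, z, hz, rfl⟩ := hy
    obtain ⟨_, rfl, w, hw, h⟩ := hy'
    apply hmn
    simp only at h
    have h1 := congrArg γ h
    rw [add_comm, hγν, add_comm _ z, hγν, hw.2, hz.2] at h1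
    have h2 := congrArg (fun y => inner ℝ ν y) h
    simp only [inner_add_right, inner_smul_right, real_inner_self_eq_norm_sq, hν] at h2
    have h3 : (1 / ((n : ℝ) + 1)) = 1 / ((m : ℝ) + 1) := by linarith
    rw [one_div, one_div, inv_inj] at h3
    exact_mod_cast (by linarith : (m : ℝ) = n)

/-! ### Invariance, gradient and support of weak limits -/

section Limit

variable {Ω : Type*} [MeasurableSpace Ω] {P : Measure Ω} [IsProbabilityMeasure P] {d : ℕ}
  {p q : ℝ≥0∞} {T : IntLattice d → Ω → Ω}

/-- Lattice shifts converge strongly to shifts of the random variable. -/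
theorem tendsto_eLpNorm_comp_jointShift_sub [ENNReal.HolderConjugate p q] (hp : 1 < p)
    (hp' : p ≠ ∞) (hT : IsDynamicalSystem P T) (b : IntLattice d) {g : Ω × Space d → ℝ}
    (hg : MemLp g p (P.prod volume)) {ι : Type*} {l : Filter ι} {ε : ι → ℝ}
    (hε : Tendsto ε l (𝓝 0)) :
    Tendsto (fun n => eLpNorm (fun y => g (jointShift T (ε n) b y) - g (jointShift T 0 b y)) p
      (P.prod volume)) l (𝓝 0) := by
  have h1 : Tendsto (fun n => latticePoint (ε n) b) l (𝓝 0) := by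
    have : Tendsto (fun n => ε n • latticePoint 1 b) l (𝓝 ((0 : ℝ) • latticePoint 1 b)) :=
      hε.smul_const _
    rw [zero_smul] at this
    refine this.congr fun n => (latticePoint_eq_smul _ _).symm
  refine ((tendsto_eLpNorm_shift_sub (q := q) hp hp' hg).comp h1).congr fun n => ?_
  have hmp := measurePreserving_jointShift hT 0 b
  have hs : MemLp (fun y : Ω × Space d => g (y.1, y.2 + latticePoint (ε n) b)) p
      (P.prod volume) := hg.comp_measurePreserving (measurePreserving_shift _)
  refine (eLpNorm_comp_measurePreserving (hs.sub hg).1 hmp).symm.trans ?_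
  refine eLpNorm_congr_ae (ae_of_all _ fun y => ?_)
  simp only [Function.comp_apply, Pi.sub_apply, jointShift_zero_apply]
  rfl

/-- Lattice shifts of weakly convergent sequences converge weakly. -/
theorem TendstoWeakLp.comp_jointShift [ENNReal.HolderConjugate p q] (hp : 1 < p)
    (hp' : p ≠ ∞) (hT : IsDynamicalSystem P T) (b : IntLattice d) {ι : Type*} {l : Filter ι}
    {f : ι → Ω × Space d → ℝ} {F : Ω × Space d → ℝ}
    (h : TendstoWeakLp q (P.prod volume) l f F) (hf : ∀ n, MemLp (f n) p (P.prod volume))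
    {C : ℝ≥0∞} (hC : C ≠ ∞) (hfC : ∀ n, eLpNorm (f n) p (P.prod volume) ≤ C)
    {ε : ι → ℝ} (hε : Tendsto ε l (𝓝 0)) :
    TendstoWeakLp q (P.prod volume) l (fun n y => f n (jointShift T (ε n) b y))
      (fun y => F (jointShift T 0 b y)) := by
  have hq : 1 < q := (ENNReal.HolderConjugate.lt_top_iff_one_lt p q).1 hp'.lt_top
  have hq' : q ≠ ∞ := ((ENNReal.HolderConjugate.lt_top_iff_one_lt q p).2 hp).ne
  intro g hg
  -- The shift is moved to the fixed test function, where it converges strongly; a weakly convergent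
  -- bounded sequence may be paired with a strongly convergent one.
  simp only [integral_comp_jointShift hT]
  exact h.tendsto_integral_mul hf hC hfC
    (fun n => hg.comp_measurePreserving (measurePreserving_jointShift hT (ε n) (-b)))
    (hg.comp_measurePreserving (measurePreserving_jointShift hT 0 (-b)))
    (tendsto_eLpNorm_comp_jointShift_sub (q := p) hq hq' hT (-b) hg hε)

theorem eq_of_forall_integral_prod [ENNReal.HolderConjugate p q] (hp : 1 < p) (hp' : p ≠ ∞)
    {F G : Ω × Space d → ℝ}
    (hF : MemLp F p (P.prod volume)) (hG : MemLp G p (P.prod volume))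
    (h : ∀ g, MemLp g q (P.prod (volume : Measure (Space d))) →
      ∫ y, F y * g y ∂P.prod volume = ∫ y, G y * g y ∂P.prod volume) :
    F =ᵐ[P.prod volume] G := by
  have hq : 1 < q := (ENNReal.HolderConjugate.lt_top_iff_one_lt p q).1 hp'.lt_top
  have hq' : q ≠ ∞ := ((ENNReal.HolderConjugate.lt_top_iff_one_lt q p).2 hp).ne
  have h1 := ae_eq_zero_of_forall_integral_prod hp.le (hF.sub hG) fun A hA η hη hηc => ?_
  · filter_upwards [h1] with y hy
    exact sub_eq_zero.1 hy
  · have ht : MemLp (fun y : Ω × Space d => A.indicator 1 y.1 * η y.2) q (P.prod volume) :=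
      memLp_indicator_mul (zero_lt_one.trans hq).ne' hq' hA hη.continuous hηc
    simp only [Pi.sub_apply, sub_mul]
    rw [integral_sub (integrable_mul_of_conjugate hF ht) (integrable_mul_of_conjugate hG ht),
      h _ ht, sub_self]

/-- Weak limits of sequences with bounded difference quotients are invariant. -/
theorem invariant_of_tendstoWeakLp [ENNReal.HolderConjugate p q] (hp : 1 < p)
    (hp' : p ≠ ∞) (hT : IsDynamicalSystem P T) {ι : Type*} {l : Filter ι} [l.NeBot]
    {f : ι → Ω × Space d → ℝ} {U : Ω × Space d → ℝ} {G : Fin d → Ω × Space d → ℝ}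
    (hfU : TendstoWeakLp q (P.prod volume) l f U) (hf : ∀ n, MemLp (f n) p (P.prod volume))
    {C : ℝ≥0∞} (hC : C ≠ ∞) (hfC : ∀ n, eLpNorm (f n) p (P.prod volume) ≤ C)
    {ε : ι → ℝ} (hε0 : ∀ n, 0 < ε n) (hε : Tendsto ε l (𝓝 0)) (hU : MemLp U p (P.prod volume))
    (hfG : ∀ j, TendstoWeakLp q (P.prod volume) l
      (fun n y => (f n (jointShift T (ε n) (latticeUnit j) y) - f n y) / ε n) (G j))
    (z : IntLattice d) :
    ∀ᵐ y ∂P.prod (volume : Measure (Space d)), U (T z y.1, y.2) = U y := by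
  have hmp := fun z : IntLattice d => measurePreserving_jointShift hT 0 z
  have hunit : ∀ j, ∀ᵐ y ∂P.prod (volume : Measure (Space d)),
      U (jointShift T 0 (latticeUnit j) y) = U y := by
    intro j
    refine eq_of_forall_integral_prod (q := q) hp hp' (hU.comp_measurePreserving (hmp _)) hU
      fun g hg => ?_
    have h1 := hfU.comp_jointShift hp hp' hT (latticeUnit j) hf hC hfC hε g hg
    -- The shifted sequence equals f + ε times the difference quotient. The latter has convergent
    -- pairings, so the factor ε removes it and both sequences share the limit.
    have h2 := (hfU g hg).add (hε.mul (hfG j g hg))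
    rw [zero_mul, add_zero] at h2
    refine tendsto_nhds_unique h1 (h2.congr fun n => ?_)
    rw [← integral_const_mul, ← integral_add (integrable_mul_of_conjugate (hf n) hg)]
    · refine integral_congr_ae (ae_of_all _ fun y => ?_)
      have := (hε0 n).ne'
      field_simp
      ring
    · refine Integrable.const_mul ?_ _
      exact integrable_mul_of_conjugate ((((hf n).comp_measurePreserving
        (measurePreserving_jointShift hT (ε n) (latticeUnit j))).sub (hf n)).mul_const _) hg
  have hmem : z ∈ AddSubgroup.closure (Set.range (latticeUnit (d := d))) := by
    have : z = ∑ i, z i • latticeUnit i := by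
      ext j
      simp [latticeUnit, Finset.sum_apply, Pi.single_apply]
    rw [this]
    exact sum_mem fun i _ => zsmul_mem (AddSubgroup.subset_closure (Set.mem_range_self i)) _
  suffices h : ∀ᵐ y ∂P.prod (volume : Measure (Space d)), U (jointShift T 0 z y) = U y by
    simpa only [jointShift_zero_apply] using h
  induction hmem using AddSubgroup.closure_induction with
  | mem c hc =>
    obtain ⟨j, rfl⟩ := hc
    exact hunit j
  | zero => exact ae_of_all _ fun y => by rw [jointShift_zero_apply, hT.zero]
  | add a c _ _ ha hc =>
    filter_upwards [hc, (hmp c).quasiMeasurePreserving.ae ha] with y h1 h2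
    rw [← h1, ← h2, jointShift_zero_apply, jointShift_zero_apply, jointShift_zero_apply, hT.add]
  | neg a _ ha =>
    filter_upwards [(hmp (-a)).quasiMeasurePreserving.ae ha] with y h1
    rw [← h1, jointShift_apply_neg hT]

/-- Weak limits of difference quotients are two-scale gradients. -/
theorem hasTwoScaleGradient_of_tendstoWeakLp [ENNReal.HolderConjugate p q] (hp : 1 < p)
    (hp' : p ≠ ∞) (hT : IsDynamicalSystem P T) {ι : Type*} {l : Filter ι} [l.NeBot]
    {f : ι → Ω × Space d → ℝ} {U : Ω × Space d → ℝ} {G : Fin d → Ω × Space d → ℝ}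
    (hfU : TendstoWeakLp q (P.prod volume) l f U) (hf : ∀ n, MemLp (f n) p (P.prod volume))
    {C : ℝ≥0∞} (hC : C ≠ ∞) (hfC : ∀ n, eLpNorm (f n) p (P.prod volume) ≤ C)
    {ε : ι → ℝ} (hε0 : ∀ n, 0 < ε n) (hε : Tendsto ε l (𝓝 0)) (hU : MemLp U p (P.prod volume))
    (hfG : ∀ j, TendstoWeakLp q (P.prod volume) l
      (fun n y => (f n (jointShift T (ε n) (latticeUnit j) y) - f n y) / ε n) (G j)) :
    HasTwoScaleGradient q P T U G := by
  have hq : 1 < q := (ENNReal.HolderConjugate.lt_top_iff_one_lt p q).1 hp'.lt_top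
  have hq' : q ≠ ∞ := ((ENNReal.HolderConjugate.lt_top_iff_one_lt q p).2 hp).ne
  have hq0 : q ≠ 0 := (zero_lt_one.trans hq).ne'
  intro ψ hψ hψs η hη hηc
  have hηq : MemLp η q volume := hη.continuous.memLp_space hηc
  have hψT : ∀ j, MemLp (fun ω => ψ j (T (-latticeUnit j) ω)) q P := fun j =>
    (hψ j).comp_measurePreserving (hT.measurePreserving _)
  set v : Fin d → Space d := fun j => -latticePoint 1 (latticeUnit j) with hv
  set D : ι → Fin d → Space d → ℝ := fun n j x => (η (x + ε n • v j) - η x) / ε n with hD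
  have hDq : ∀ n j, MemLp (D n j) q volume := by
    intro n j
    have h1 : MemLp (fun x => η (x + ε n • v j)) q volume :=
      hηq.comp_measurePreserving (measurePreserving_add_right volume (ε n • v j))
    exact (h1.sub hηq).mul_const (ε n)⁻¹
  have hdq : ∀ j, MemLp (fun x => fderiv ℝ η x (v j)) q volume := by
    intro j
    refine Continuous.memLp_space ?_ ?_
    · exact (hη.continuous_fderiv (by simp)).clm_apply continuous_const
    · exact (hηc.fderiv (𝕜 := ℝ)).comp_left (g := fun L : Space d →L[ℝ] ℝ => L (v j)) rfl
  have hcd : ∀ j x, fderiv ℝ η x (v j) = -coordDeriv j η x := by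
    intro j x
    rw [hv]
    simp only [map_neg, latticePoint_one_unit]
    rfl
  set g : ι → Ω × Space d → ℝ := fun n y =>
    ∑ j, ψ j (T (-latticeUnit j) y.1) * D n j y.2 with hg
  set g' : Ω × Space d → ℝ := fun y =>
    ∑ j, ψ j (T (-latticeUnit j) y.1) * fderiv ℝ η y.2 (v j) with hg'
  have hgq : ∀ n, MemLp (g n) q (P.prod volume) := fun n =>
    memLp_finsetSum _ fun j _ => (hψT j).mul_prod hq0 hq' (hDq n j)
  have hg'q : MemLp g' q (P.prod volume) :=
    memLp_finsetSum _ fun j _ => (hψT j).mul_prod hq0 hq' (hdq j)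
  have hconv : Tendsto (fun n => eLpNorm (g n - g') q (P.prod volume)) l (𝓝 0) := by
    have h1 : Tendsto (fun n => ∑ j, eLpNorm (fun ω => ψ j (T (-latticeUnit j) ω)) q P *
        eLpNorm (fun x => D n j x - fderiv ℝ η x (v j)) q volume) l (𝓝 0) := by
      have := tendsto_finsetSum (Finset.univ : Finset (Fin d)) fun j _ =>
        ENNReal.Tendsto.const_mul (a := eLpNorm (fun ω => ψ j (T (-latticeUnit j) ω)) q P)
          (tendsto_eLpNorm_diffQuotient (p := q) hη hηc (v j)
            (Eventually.of_forall fun n => (hε0 n).ne') hε) (Or.inr (hψT j).2.ne)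
      simpa using this
    refine tendsto_of_tendsto_of_tendsto_of_le_of_le tendsto_const_nhds h1
      (fun _ => zero_le) fun n => ?_
    have h2 : g n - g' = ∑ j, fun y : Ω × Space d => ψ j (T (-latticeUnit j) y.1) *
        (D n j y.2 - fderiv ℝ η y.2 (v j)) := by
      funext y
      simp [hg, hg', mul_sub, Finset.sum_sub_distrib]
    rw [h2]
    refine (eLpNorm_sum_le (fun j _ => ((hψT j).mul_prod hq0 hq' ((hDq n j).sub (hdq j))).1)
      hq.le).trans (Finset.sum_le_sum fun j _ => ?_)
    have := eLpNorm_prod_le (C := 1) hq0 hq' (hψT j).1 ((hDq n j).sub (hdq j)).1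
      (h := fun y : Ω × Space d => ψ j (T (-latticeUnit j) y.1) *
        (D n j y.2 - fderiv ℝ η y.2 (v j))) (ae_of_all _ fun y => by simp)
    rw [ENNReal.coe_one, one_mul] at this
    exact this
  have hright := hfU.tendsto_integral_mul hf hC hfC hgq hg'q hconv
  have hleft := tendsto_finsetSum (Finset.univ : Finset (Fin d)) fun j _ =>
    hfG j (fun y => ψ j y.1 * η y.2) ((hψ j).mul_prod hq0 hq' hηq)
  have hlim := tendsto_nhds_unique (hleft.congr fun n => ?_) hright
  · rw [hlim]
    simp only [hg', hcd, mul_neg, Finset.sum_neg_distrib, integral_neg, Finset.mul_sum]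
    have hcq : ∀ j, MemLp (coordDeriv j η) q volume := fun j =>
      (contDiff_coordDeriv j hη).continuous.memLp_space (hasCompactSupport_coordDeriv j hηc)
    rw [integral_finsetSum _ fun j _ => integrable_mul_of_conjugate hU
      ((hψT j).mul_prod hq0 hq' (hcq j))]
    refine congrArg _ (Finset.sum_congr rfl fun j _ => ?_)
    -- Summation by parts leaves ψ_j shifted by T_{-e_j}; the invariance of U undoes this shift in
    -- the limit.
    have h1 := integral_comp_jointShift hT 0 (latticeUnit j) U
      (fun y => ψ j y.1 * coordDeriv j η y.2)
    simp only [jointShift_zero_apply] at h1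
    rw [← h1]
    refine integral_congr_ae ?_
    filter_upwards [invariant_of_tendstoWeakLp hp hp' hT hfU hf hC hfC hε0 hε hU hfG
      (latticeUnit j)] with y hy
    rw [hy]
  · have hτ := fun j : Fin d => measurePreserving_jointShift hT (ε n) (-latticeUnit j)
    have h1 : ∀ j, ∫ y, (f n (jointShift T (ε n) (latticeUnit j) y) - f n y) / ε n *
        (ψ j y.1 * η y.2) ∂P.prod volume = ∫ y, f n y *
          ((ψ j (T (-latticeUnit j) y.1) * η (y.2 + ε n • v j) - ψ j y.1 * η y.2) / ε n)
            ∂P.prod volume := by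
      intro j
      have hh : MemLp (fun y : Ω × Space d => ψ j y.1 * η y.2) q (P.prod volume) :=
        (hψ j).mul_prod hq0 hq' hηq
      have hfs := (hf n).comp_measurePreserving
        (measurePreserving_jointShift hT (ε n) (latticeUnit j))
      have hhs := hh.comp_measurePreserving (hτ j)
      have e1 : ∀ y, (f n (jointShift T (ε n) (latticeUnit j) y) - f n y) / ε n *
          (ψ j y.1 * η y.2) = (ε n)⁻¹ * (f n (jointShift T (ε n) (latticeUnit j) y) *
            (ψ j y.1 * η y.2) - f n y * (ψ j y.1 * η y.2)) := fun y => by ring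
      have e2 : ∀ y : Ω × Space d, f n y *
          ((ψ j (T (-latticeUnit j) y.1) * η (y.2 + ε n • v j) - ψ j y.1 * η y.2) / ε n) =
          (ε n)⁻¹ * (f n y * (ψ j (jointShift T (ε n) (-latticeUnit j) y).1 *
            η (jointShift T (ε n) (-latticeUnit j) y).2) - f n y * (ψ j y.1 * η y.2)) := by
        intro y
        simp only [jointShift, hv, smul_neg, latticePoint_neg, ← latticePoint_eq_smul]
        ring
      simp only [e1, e2, integral_const_mul]
      congr 1
      have hi1 : Integrable (fun y => f n (jointShift T (ε n) (latticeUnit j) y) *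
          (ψ j y.1 * η y.2)) (P.prod volume) := integrable_mul_of_conjugate hfs hh
      have hi2 : Integrable (fun y => f n y * (ψ j (jointShift T (ε n) (-latticeUnit j) y).1 *
          η (jointShift T (ε n) (-latticeUnit j) y).2)) (P.prod volume) :=
        integrable_mul_of_conjugate (hf n) hhs
      rw [integral_sub hi1 (integrable_mul_of_conjugate (hf n) hh),
        integral_sub hi2 (integrable_mul_of_conjugate (hf n) hh),
        integral_comp_jointShift hT (ε n) (latticeUnit j) (f n) (fun y => ψ j y.1 * η y.2)]
    have hi : ∀ j, Integrable (fun y : Ω × Space d => f n y *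
          ((ψ j (T (-latticeUnit j) y.1) * η (y.2 + ε n • v j) - ψ j y.1 * η y.2) / ε n))
            (P.prod volume) := by
      intro j
      refine integrable_mul_of_conjugate (q := q) (hf n) (MemLp.mul_const ?_ (ε n)⁻¹)
      refine MemLp.sub ?_ ((hψ j).mul_prod hq0 hq' hηq)
      have h1 : MemLp (fun x => η (x + ε n • v j)) q volume :=
        hηq.comp_measurePreserving (measurePreserving_add_right volume (ε n • v j))
      exact (hψT j).mul_prod hq0 hq' h1
    rw [Finset.sum_congr rfl fun j _ => h1 j, ← integral_finsetSum _ fun j _ => hi j]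
    refine integral_congr_ae ?_
    filter_upwards [Measure.quasiMeasurePreserving_fst.ae hψs] with y hy
    rw [← Finset.mul_sum]
    congr 1
    -- Discrete Leibniz rule. The second term is of order 1/ε, but its coefficient summed over j is
    -- the horizontal divergence of ψ, which vanishes; only the difference quotients of η remain.
    have h2 : ∀ j, (ψ j (T (-latticeUnit j) y.1) * η (y.2 + ε n • v j) - ψ j y.1 * η y.2) / ε n =
        ψ j (T (-latticeUnit j) y.1) * D n j y.2 +
          (ψ j (T (-latticeUnit j) y.1) - ψ j y.1) * (η y.2 / ε n) := fun j => by
      simp only [hD]; ring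
    rw [Finset.sum_congr rfl fun j _ => h2 j, Finset.sum_add_distrib, ← Finset.sum_mul, hy,
      zero_mul, add_zero]

/-- Weak limits vanish outside the closure of `O` when the sequence does up to distance `c ε`. -/
theorem ae_eq_zero_of_tendstoWeakLp [ENNReal.HolderConjugate p q] (hp : 1 < p)
    (hp' : p ≠ ∞) {O : Set (Space d)} (hO : IsLipschitzDomain O)
    {ι : Type*} {l : Filter ι} [l.NeBot]
    {f : ι → Ω × Space d → ℝ} {F : Ω × Space d → ℝ}
    (hfF : TendstoWeakLp q (P.prod volume) l f F) (hF : MemLp F p (P.prod volume))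
    {c : ℝ} {ε : ι → ℝ} (hε : Tendsto ε l (𝓝 0))
    (hf : ∀ n, ∀ᵐ y ∂P.prod (volume : Measure (Space d)),
      c * ε n < Metric.infDist y.2 O → f n y = 0) :
    ∀ᵐ y ∂P.prod (volume : Measure (Space d)), y.2 ∉ O → F y = 0 := by
  have hm : ∀ m : ℕ, ∀ᵐ y ∂P.prod (volume : Measure (Space d)),
      1 / ((m : ℝ) + 1) < Metric.infDist y.2 O → F y = 0 := by
    intro m
    -- At a fixed positive distance from O the sequence is eventually zero, and so is the weak
    -- limit. These sets exhaust the complement of the closure of O, and the boundary is a null set.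
    set S : Set (Ω × Space d) := univ ×ˢ {x | 1 / ((m : ℝ) + 1) < Metric.infDist x O} with hS
    have hSm : MeasurableSet S := MeasurableSet.univ.prod
      (isOpen_lt continuous_const (Metric.continuous_infDist_pt O)).measurableSet
    have h0 : S.indicator F =ᵐ[P.prod volume] fun _ => 0 := by
      refine eq_of_forall_integral_prod (q := q) hp hp' (hF.indicator hSm) MemLp.zero' fun g hg => ?_
      have h1 := hfF _ (hg.indicator hSm)
      have h2 : ∀ᶠ n in l, ∫ y, f n y * S.indicator g y ∂P.prod volume = 0 := by
        have h3 : Tendsto (fun n => c * ε n) l (𝓝 0) := by simpa using hε.const_mul c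
        filter_upwards [h3.eventually (gt_mem_nhds (Nat.one_div_pos_of_nat (n := m)))] with n hn
        refine integral_eq_zero_of_ae ?_
        filter_upwards [hf n] with y hy
        by_cases hyS : y ∈ S
        · simp [hy (hn.trans hyS.2)]
        · simp [hyS]
      have h4 := tendsto_nhds_unique h1 (tendsto_const_nhds.congr' (h2.mono fun n h => h.symm))
      simp only [zero_mul, integral_zero]
      rw [← h4]
      refine integral_congr_ae (ae_of_all _ fun y => ?_)
      by_cases hyS : y ∈ S <;> simp [hyS]
    filter_upwards [h0] with y hy h
    rwa [indicator_of_mem (show y ∈ S from ⟨mem_univ _, h⟩)] at hy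
  have hfr : ∀ᵐ y ∂P.prod (volume : Measure (Space d)), y.2 ∉ frontier O :=
    Measure.quasiMeasurePreserving_snd.ae
      (measure_eq_zero_iff_ae_notMem.1 hO.volume_frontier)
  filter_upwards [ae_all_iff.2 hm, hfr] with y hy hyf hyO
  have hcl : y.2 ∉ closure O := fun h => hyf (by rw [hO.isOpen.frontier_eq]; exact ⟨h, hyO⟩)
  have hpos : 0 < Metric.infDist y.2 O :=
    (Metric.infDist_pos_iff_notMem_closure hO.isConnected.nonempty).1 hcl
  obtain ⟨m, hm⟩ := exists_nat_one_div_lt hpos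
  exact hy m hm

end Limit

/-! ### Random lattice fields: integrability, Korn and Poincaré inequalities -/

section LatticeField

variable {Ω : Type*} [MeasurableSpace Ω] {P : Measure Ω} [IsProbabilityMeasure P] {d k : ℕ}
  {p : ℝ≥0∞} {T : IntLattice d → Ω → Ω} {b : Fin k → IntLattice d} {O : Set (Space d)} {ε : ℝ}

theorem measurePreserving_prod_lattice_add (ε : ℝ) (w : IntLattice d) :
    MeasurePreserving (fun y : Ω × IntLattice d => (y.1, y.2 + w)) (P.prod (latticeMeasure d ε))
      (P.prod (latticeMeasure d ε)) :=
  (MeasurePreserving.id P).prod (measurePreserving_lattice_add ε w)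

theorem memLp_lattice_shift {E : Type*} [NormedAddCommGroup E] {u : Ω → IntLattice d → E}
    (hu : MemLp (fun y : Ω × IntLattice d => u y.1 y.2) p (P.prod (latticeMeasure d ε)))
    (w : IntLattice d) :
    MemLp (fun y : Ω × IntLattice d => u y.1 (y.2 + w)) p (P.prod (latticeMeasure d ε)) :=
  hu.comp_measurePreserving (measurePreserving_prod_lattice_add ε w)

theorem memLp_discreteGrad {u : Ω → IntLattice d → ℝ}
    (hu : MemLp (fun y : Ω × IntLattice d => u y.1 y.2) p (P.prod (latticeMeasure d ε)))
    (j : Fin d) :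
    MemLp (fun y : Ω × IntLattice d => discreteGrad ε (u y.1) y.2 j) p
      (P.prod (latticeMeasure d ε)) :=
  ((memLp_lattice_shift hu (latticeUnit j)).sub hu).mul_const ε⁻¹

theorem memLp_discreteSymGrad [Fact (1 ≤ p)] {u : Ω → IntLattice d → Space d}
    (hu : MemLp (fun y : Ω × IntLattice d => u y.1 y.2) p (P.prod (latticeMeasure d ε))) :
    MemLp (fun y : Ω × IntLattice d => discreteSymGrad ε b (u y.1) y.2) p
      (P.prod (latticeMeasure d ε)) := by
  refine memLp_toLp fun i => ?_
  let L : Space d →L[ℝ] ℝ := (ε * ‖latticePoint 1 (b i)‖)⁻¹ •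
    innerSL ℝ (‖latticePoint 1 (b i)‖⁻¹ • latticePoint 1 (b i))
  have h := L.comp_memLp' ((memLp_lattice_shift hu (b i)).sub hu)
  refine h.ae_eq (ae_of_all _ fun y => ?_)
  simp only [L, Function.comp_apply, Pi.sub_apply, smul_apply, innerSL_apply_apply,
    inner_smul_right, smul_eq_mul]

theorem finite_latticePoint_mem (hO : Bornology.IsBounded O) (hε : 0 < ε) :
    {z : IntLattice d | latticePoint ε z ∈ O}.Finite := by
  obtain ⟨R, hR⟩ := hO.subset_closedBall 0
  refine (Set.finite_Icc (fun _ : Fin d => -⌈R / ε⌉) (fun _ => ⌈R / ε⌉)).subset fun z hz => ?_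
  have h1 : ∀ i, |(z i : ℝ)| ≤ R / ε := by
    intro i
    have h2 : ‖latticePoint ε z‖ ≤ R := by simpa using hR hz
    have h3 := (PiLp.norm_apply_le (latticePoint ε z) i).trans h2
    rw [latticePoint_apply, norm_mul, Real.norm_of_nonneg hε.le, Real.norm_eq_abs] at h3
    rw [le_div_iff₀ hε]
    linarith
  constructor <;> intro i
  · have h2 : (-⌈R / ε⌉ : ℝ) ≤ z i := by linarith [Int.le_ceil (R / ε), neg_le_of_abs_le (h1 i)]
    exact_mod_cast h2
  · have h2 : (z i : ℝ) ≤ ⌈R / ε⌉ := by linarith [Int.le_ceil (R / ε), le_of_abs_le (h1 i)]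
    exact_mod_cast h2

theorem IsLatticeField.ae_finite_support {u : Ω → IntLattice d → Space d}
    (hu : IsLatticeField p P O ε u) (hO : Bornology.IsBounded O) (hε : 0 < ε) :
    ∀ᵐ ω ∂P, (Function.support (u ω)).Finite := by
  filter_upwards [hu.2] with ω hω
  refine (finite_latticePoint_mem hO hε).subset fun z hz => ?_
  by_contra h
  exact hz (hω z h)

theorem finite_support_shift {E : Type*} [Zero E] {v : IntLattice d → E}
    (hv : (Function.support v).Finite) (w : IntLattice d) : {z | v (z + w) ≠ 0}.Finite :=
  hv.preimage (add_left_injective w).injOn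

theorem discreteGrad_eq_smul (ε : ℝ) (v : IntLattice d → ℝ) (z : IntLattice d) (j : Fin d) :
    discreteGrad ε v z j = ε⁻¹ * discreteGrad 1 v z j := by
  simp [discreteGrad, div_eq_inv_mul]

theorem discreteSymGrad_eq_smul (ε : ℝ) (v : IntLattice d → Space d) (z : IntLattice d) :
    discreteSymGrad ε b v z = ε⁻¹ • discreteSymGrad 1 b v z := by
  ext i
  simp only [discreteSymGrad, one_mul, inner_smul_right, mul_inv, PiLp.smul_apply, smul_eq_mul]
  ring

theorem lintegral_latticeMeasure (ε : ℝ) (f : IntLattice d → ℝ≥0∞) :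
    ∫⁻ z, f z ∂latticeMeasure d ε = ENNReal.ofReal (ε ^ d) * ∑' z, f z := by
  rw [latticeMeasure, lintegral_smul_measure, lintegral_count, smul_eq_mul]

/-- The Korn inequality on `ε ℤ^d`. -/
theorem SatisfiesKorn.lintegral_le (hK : SatisfiesKorn p b) (hp0 : p ≠ 0) (hp' : p ≠ ∞) :
    ∃ C : ℝ≥0∞, C ≠ ∞ ∧ ∀ (ε : ℝ), 0 < ε → ∀ v : IntLattice d → Space d,
      (Function.support v).Finite → ∀ a j,
      ∫⁻ z, ‖discreteGrad ε (fun z' => v z' a) z j‖ₑ ^ p.toReal ∂latticeMeasure d ε ≤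
        C * ∫⁻ z, ‖discreteSymGrad ε b v z‖ₑ ^ p.toReal ∂latticeMeasure d ε := by
  obtain ⟨C, hC, hK⟩ := hK
  have hpr : 0 < p.toReal := ENNReal.toReal_pos hp0 hp'
  refine ⟨ENNReal.ofReal C, ENNReal.ofReal_ne_top, fun ε hε v hv a j => ?_⟩
  -- Both gradients on εℤ^d are ε⁻¹ times those on ℤ^d and both sides carry the same weight ε^d, so
  -- the constant does not depend on ε.
  have hεi : 0 ≤ ε⁻¹ := (inv_pos.2 hε).le
  set F : IntLattice d → ℝ := fun z =>
    Real.sqrt (∑ i, ‖discreteGrad 1 (fun z' => v z' i) z‖ ^ 2) ^ p.toReal with hF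
  set S : IntLattice d → ℝ := fun z => ‖discreteSymGrad 1 b v z‖ ^ p.toReal with hS
  have hF0 : ∀ z, 0 ≤ F z := fun z => by positivity
  have hS0 : ∀ z, 0 ≤ S z := fun z => by positivity
  -- Since a non-summable real `tsum` has the value 0, summability must be known before the
  -- inequality is transferred to extended nonnegative sums. It holds because the terms vanish off a
  -- finite union of translates of the support.
  have hsub : ∀ {f : IntLattice d → ℝ} {W : Finset (IntLattice d)},
      (∀ z, (∀ w ∈ W, v (z + w) = 0) → f z = 0) → Summable f := by
    intro f W h
    have hfin : (⋃ w ∈ W, {z | v (z + w) ≠ 0}).Finite :=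
      W.finite_toSet.biUnion fun w _ => finite_support_shift hv w
    refine summable_of_ne_finset_zero (s := hfin.toFinset) fun z hz => h z fun w hw => ?_
    by_contra hne
    exact hz (hfin.mem_toFinset.2 (mem_biUnion hw hne))
  classical
  have hFs : Summable F := by
    refine hsub (W := insert 0 (Finset.univ.image latticeUnit)) fun z hz => ?_
    have h0 : v z = 0 := by simpa using hz 0 (Finset.mem_insert_self _ _)
    have h1 : ∀ j, v (z + latticeUnit j) = 0 := fun j =>
      hz _ (Finset.mem_insert_of_mem (Finset.mem_image_of_mem _ (Finset.mem_univ j)))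
    have h2 : ∀ i, discreteGrad 1 (fun z' => v z' i) z = 0 := by
      intro i
      ext j
      simp [discreteGrad, h0, h1]
    simp [hF, h2, Real.zero_rpow hpr.ne']
  have hSs : Summable S := by
    refine hsub (W := insert 0 (Finset.univ.image b)) fun z hz => ?_
    have h0 : v z = 0 := by simpa using hz 0 (Finset.mem_insert_self _ _)
    have h1 : ∀ i, v (z + b i) = 0 := fun i =>
      hz _ (Finset.mem_insert_of_mem (Finset.mem_image_of_mem _ (Finset.mem_univ i)))
    have h2 : discreteSymGrad 1 b v z = 0 := by
      ext i
      simp [discreteSymGrad, h0, h1]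
    simp [hS, h2, Real.zero_rpow hpr.ne']
  have hleft : ∀ z, ‖discreteGrad ε (fun z' => v z' a) z j‖ₑ ^ p.toReal ≤
      ENNReal.ofReal (ε⁻¹ ^ p.toReal) * ENNReal.ofReal (F z) := by
    intro z
    rw [discreteGrad_eq_smul, enorm_mul, ENNReal.mul_rpow_of_nonneg _ _ hpr.le,
      Real.enorm_of_nonneg hεi, ENNReal.ofReal_rpow_of_nonneg hεi hpr.le]
    gcongr
    rw [← ofReal_norm, ENNReal.ofReal_rpow_of_nonneg (norm_nonneg _) hpr.le]
    refine ENNReal.ofReal_le_ofReal (Real.rpow_le_rpow (norm_nonneg _) ?_ hpr.le)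
    refine (PiLp.norm_apply_le _ j).trans (Real.le_sqrt_of_sq_le ?_)
    exact Finset.single_le_sum (f := fun i => ‖discreteGrad 1 (fun z' => v z' i) z‖ ^ 2)
      (fun i _ => by positivity) (Finset.mem_univ a)
  have hright : ∀ z, ‖discreteSymGrad ε b v z‖ₑ ^ p.toReal =
      ENNReal.ofReal (ε⁻¹ ^ p.toReal) * ENNReal.ofReal (S z) := by
    intro z
    rw [discreteSymGrad_eq_smul, enorm_smul, ENNReal.mul_rpow_of_nonneg _ _ hpr.le,
      Real.enorm_of_nonneg hεi, ENNReal.ofReal_rpow_of_nonneg hεi hpr.le,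
      ← ofReal_norm, ENNReal.ofReal_rpow_of_nonneg (norm_nonneg _) hpr.le]
  rw [lintegral_latticeMeasure, lintegral_latticeMeasure]
  simp only [hright]
  refine (mul_le_mul_right (ENNReal.tsum_le_tsum hleft) _).trans ?_
  rw [ENNReal.tsum_mul_left, ENNReal.tsum_mul_left, ← ENNReal.ofReal_tsum_of_nonneg hF0 hFs,
    ← ENNReal.ofReal_tsum_of_nonneg hS0 hSs]
  have h1 := ENNReal.ofReal_le_ofReal (hK v hv)
  rw [ENNReal.ofReal_mul hC.le] at h1
  calc _ ≤ ENNReal.ofReal (ε ^ d) * (ENNReal.ofReal (ε⁻¹ ^ p.toReal) *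
        (ENNReal.ofReal C * ENNReal.ofReal (∑' z, S z))) := by gcongr
    _ = _ := by ring

/-- The averaged Korn inequality. -/
theorem SatisfiesKorn.eLpNorm_le [Fact (1 ≤ p)] (hK : SatisfiesKorn p b) (hp0 : p ≠ 0)
    (hp' : p ≠ ∞) (hO : Bornology.IsBounded O) :
    ∃ C : ℝ≥0∞, C ≠ ∞ ∧ ∀ (ε : ℝ), 0 < ε → ∀ u : Ω → IntLattice d → Space d,
      IsLatticeField p P O ε u → ∀ a j,
      eLpNorm (fun y : Ω × IntLattice d => discreteGrad ε (fun z => u y.1 z a) y.2 j) p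
          (P.prod (latticeMeasure d ε)) ≤
        C * eLpNorm (fun y : Ω × IntLattice d => discreteSymGrad ε b (u y.1) y.2) p
          (P.prod (latticeMeasure d ε)) := by
  obtain ⟨C, hC, hK⟩ := hK.lintegral_le hp0 hp'
  have hpr : 0 < p.toReal := ENNReal.toReal_pos hp0 hp'
  refine ⟨C ^ (1 / p.toReal), ENNReal.rpow_ne_top_of_nonneg (by positivity) hC,
    fun ε hε u hu a j => ?_⟩
  have hm1 := memLp_discreteGrad (u := fun ω z => u ω z a) (memLp_coord hu.1 a) j
  have hm2 := memLp_discreteSymGrad (b := b) hu.1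
  rw [eLpNorm_eq_lintegral_rpow_enorm_toReal hp0 hp', eLpNorm_eq_lintegral_rpow_enorm_toReal hp0 hp',
    ← ENNReal.mul_rpow_of_nonneg _ _ (by positivity)]
  refine ENNReal.rpow_le_rpow ?_ (by positivity)
  rw [lintegral_prod _ (hm1.1.enorm.pow_const _), lintegral_prod _ (hm2.1.enorm.pow_const _),
    ← lintegral_const_mul' _ _ hC]
  refine lintegral_mono_ae ?_
  filter_upwards [hu.ae_finite_support hO hε] with ω hω
  exact hK ε hε (u ω) hω a j

theorem discreteGrad_shift_sub (hε : 0 < ε) (v : IntLattice d → ℝ) (z : IntLattice d) (j : Fin d)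
    (N : ℕ) : v (z + N • latticeUnit j) - v z =
      ∑ m ∈ Finset.range N, ε * discreteGrad ε v (z + m • latticeUnit j) j := by
  have h : ∀ m : ℕ, ε * discreteGrad ε v (z + m • latticeUnit j) j =
      v (z + (m + 1) • latticeUnit j) - v (z + m • latticeUnit j) := by
    intro m
    have := hε.ne'
    simp only [discreteGrad, add_assoc, add_smul, one_smul]
    field_simp
  rw [Finset.sum_congr rfl fun m _ => h m,
    Finset.sum_range_sub (fun m => v (z + m • latticeUnit j))]
  simp

/-- Telescoping over N unit steps: each increment is ε times a shifted gradient, and lattice shifts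
preserve the norm. -/
theorem eLpNorm_lattice_shift_sub_le [Fact (1 ≤ p)] (hε : 0 < ε) {u : Ω → IntLattice d → ℝ}
    (hu : MemLp (fun y : Ω × IntLattice d => u y.1 y.2) p (P.prod (latticeMeasure d ε)))
    (j : Fin d) (N : ℕ) :
    eLpNorm (fun y : Ω × IntLattice d => u y.1 (y.2 + N • latticeUnit j) - u y.1 y.2) p
        (P.prod (latticeMeasure d ε)) ≤
      ENNReal.ofReal (N * ε) * eLpNorm (fun y : Ω × IntLattice d => discreteGrad ε (u y.1) y.2 j)
        p (P.prod (latticeMeasure d ε)) := by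
  set μ := P.prod (latticeMeasure d ε) with hμ
  set g : Ω × IntLattice d → ℝ := fun y => discreteGrad ε (u y.1) y.2 j with hgdef
  have hg : MemLp g p μ := memLp_discreteGrad hu j
  set s : ℕ → Ω × IntLattice d → ℝ := fun m y => g (y.1, y.2 + m • latticeUnit j) with hs
  have hsm : ∀ m, MemLp (s m) p μ := fun m =>
    hg.comp_measurePreserving (measurePreserving_prod_lattice_add ε _)
  have hgs : ∀ m, eLpNorm (s m) p μ = eLpNorm g p μ := by
    intro m
    have h := eLpNorm_comp_measurePreserving (p := p) hg.1
      (measurePreserving_prod_lattice_add (P := P) ε (m • latticeUnit j))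
    exact h
  have h0 : (fun y : Ω × IntLattice d => u y.1 (y.2 + N • latticeUnit j) - u y.1 y.2) =
      ∑ m ∈ Finset.range N, ε • s m := by
    funext y
    rw [discreteGrad_shift_sub hε, Finset.sum_apply]
    rfl
  rw [h0]
  refine (eLpNorm_sum_le (fun m _ => ((hsm m).const_smul ε).1) Fact.out).trans ?_
  have h1 : ∀ m, eLpNorm (ε • s m) p μ = ENNReal.ofReal ε * eLpNorm g p μ := by
    intro m
    rw [eLpNorm_const_smul, hgs, Real.enorm_of_nonneg hε.le]
  rw [Finset.sum_congr rfl fun m _ => h1 m, Finset.sum_const, Finset.card_range, nsmul_eq_mul,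
    ← mul_assoc, ← ENNReal.ofReal_natCast, ← ENNReal.ofReal_mul (Nat.cast_nonneg N)]

/-- The Poincaré inequality for lattice fields that vanish outside a bounded set. -/
theorem eLpNorm_le_discreteGrad [Fact (1 ≤ p)] (hO : Bornology.IsBounded O) :
    ∃ D : ℝ, 0 ≤ D ∧ ∀ (ε : ℝ), 0 < ε → ∀ u : Ω → IntLattice d → ℝ,
      MemLp (fun y : Ω × IntLattice d => u y.1 y.2) p (P.prod (latticeMeasure d ε)) →
      (∀ᵐ ω ∂P, ∀ z, latticePoint ε z ∉ O → u ω z = 0) → ∀ j,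
      eLpNorm (fun y : Ω × IntLattice d => u y.1 y.2) p (P.prod (latticeMeasure d ε)) ≤
        ENNReal.ofReal (D + ε) * eLpNorm (fun y : Ω × IntLattice d => discreteGrad ε (u y.1) y.2 j)
          p (P.prod (latticeMeasure d ε)) := by
  obtain ⟨R, hR⟩ := hO.subset_closedBall 0
  refine ⟨2 * max R 0 + 1, by positivity, fun ε hε u hu hu0 j => ?_⟩
  -- A displacement by Nε exceeds 2R, the diameter of a ball containing O, so a shifted point of O
  -- lies outside and u equals minus its increment. The ceiling costs at most one more step, hence D
  -- + ε; `max R 0` covers a negative R, possible only for empty O.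
  set N : ℕ := ⌈(2 * max R 0 + 1) / ε⌉₊ with hN
  have hN1 : 2 * max R 0 + 1 ≤ N * ε := by
    rw [← div_le_iff₀ hε]
    exact Nat.le_ceil _
  have hN2 : N * ε ≤ 2 * max R 0 + 1 + ε := by
    have h1 := (Nat.ceil_lt_add_one (show 0 ≤ (2 * max R 0 + 1) / ε by positivity)).le
    calc (N : ℝ) * ε ≤ ((2 * max R 0 + 1) / ε + 1) * ε := by gcongr
      _ = _ := by field_simp
  have hpt : ∀ᵐ y ∂P.prod (latticeMeasure d ε), ‖u y.1 y.2‖ ≤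
      ‖u y.1 (y.2 + N • latticeUnit j) - u y.1 y.2‖ := by
    filter_upwards [Measure.quasiMeasurePreserving_fst.ae hu0] with y hy
    by_cases hz : u y.1 y.2 = 0
    · simp [hz]
    · have h1 : latticePoint ε y.2 ∈ O := by
        by_contra h
        exact hz (hy _ h)
      have h2 : u y.1 (y.2 + N • latticeUnit j) = 0 := by
        refine hy _ fun h => ?_
        have h3 : |latticePoint ε y.2 j| ≤ R :=
          (PiLp.norm_apply_le (latticePoint ε y.2) j).trans (by simpa using hR h1)
        have h4 : |latticePoint ε (y.2 + N • latticeUnit j) j| ≤ R :=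
          (PiLp.norm_apply_le (latticePoint ε (y.2 + N • latticeUnit j)) j).trans
            (by simpa using hR h)
        have h5 : latticePoint ε (y.2 + N • latticeUnit j) j = latticePoint ε y.2 j + N * ε := by
          simp [latticeUnit]
          ring
        have := le_max_left R 0
        have := le_of_abs_le h4
        have := neg_le_of_abs_le h3
        linarith
      rw [h2, zero_sub, norm_neg]
  refine ((eLpNorm_mono_ae hpt).trans (eLpNorm_lattice_shift_sub_le hε hu j N)).trans ?_
  gcongr

end LatticeField

/-! ### The unfolded energy and a priori bounds -/

section Geometry

variable {d k : ℕ}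

theorem norm_sub_latticePoint_cellIndex_le {ε : ℝ} (hε : 0 < ε) (x : Space d) :
    ‖x - latticePoint ε (cellIndex ε x)‖ ≤ d * ε := by
  refine (norm_le_sum_abs _).trans ?_
  have h : ∀ i, |(x - latticePoint ε (cellIndex ε x)) i| ≤ ε := by
    intro i
    rw [PiLp.sub_apply, latticePoint_apply]
    have h1 := Int.floor_le (x i / ε + 1 / 2)
    have h2 := Int.lt_floor_add_one (x i / ε + 1 / 2)
    have h3 : x i = ε * (x i / ε) := by field_simp
    change |x i - ε * ((⌊x i / ε + 1 / 2⌋ : ℤ) : ℝ)| ≤ ε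
    rw [abs_le]
    constructor <;> nlinarith
  calc _ ≤ ∑ _i : Fin d, ε := Finset.sum_le_sum fun i _ => h i
    _ = d * ε := by simp

/-- The union of the cells of the lattice points in `O^{+ε}`. -/
def cellSet (ε : ℝ) (b : Fin k → IntLattice d) (O : Set (Space d)) : Set (Space d) :=
  {x | latticePoint ε (cellIndex ε x) ∈ enlarge ε b O}

theorem measurableSet_cellSet (ε : ℝ) (b : Fin k → IntLattice d) (O : Set (Space d)) :
    MeasurableSet (cellSet ε b O) :=
  measurable_cellIndex ε (MeasurableSet.of_discrete (s := {z | latticePoint ε z ∈ enlarge ε b O}))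

/-- A length that controls the edges and the cells. -/
noncomputable def edgeRange (b : Fin k → IntLattice d) : ℝ := d + ∑ i, ‖latticePoint 1 (b i)‖

theorem edgeRange_nonneg (b : Fin k → IntLattice d) : 0 ≤ edgeRange b := by
  unfold edgeRange; positivity

theorem infDist_le_of_mem_cellSet {ε : ℝ} (hε : 0 < ε) {b : Fin k → IntLattice d}
    {O : Set (Space d)} {x : Space d} (hx : x ∈ cellSet ε b O) :
    Metric.infDist x O ≤ edgeRange b * ε := by
  have h0 := norm_sub_latticePoint_cellIndex_le hε x
  rw [edgeRange, add_mul]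
  rcases hx with hx | ⟨i, w, hw, hwO⟩
  · refine (Metric.infDist_le_dist_of_mem hx).trans ?_
    rw [dist_eq_norm]
    have : 0 ≤ (∑ i, ‖latticePoint 1 (b i)‖) * ε := by positivity
    linarith
  · refine (Metric.infDist_le_dist_of_mem hwO).trans ((dist_triangle _
      (latticePoint ε (cellIndex ε x)) _).trans (add_le_add (by rwa [dist_eq_norm]) ?_))
    obtain ⟨s, t, hs, ht, hst, rfl⟩ := hw
    have h1 : s • latticePoint ε (cellIndex ε x) +
        t • (latticePoint ε (cellIndex ε x) + latticePoint ε (b i)) =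
        latticePoint ε (cellIndex ε x) + t • latticePoint ε (b i) := by
      rw [smul_add, ← add_assoc, ← add_smul, hst, one_smul]
    rw [h1, dist_self_add_right, latticePoint_eq_smul, norm_smul, norm_smul,
      Real.norm_of_nonneg ht.le, Real.norm_of_nonneg hε.le]
    have h2 : ‖latticePoint 1 (b i)‖ ≤ ∑ i, ‖latticePoint 1 (b i)‖ :=
      Finset.single_le_sum (f := fun i => ‖latticePoint 1 (b i)‖) (fun _ _ => norm_nonneg _)
        (Finset.mem_univ i)
    have h3 : 0 ≤ ε * ‖latticePoint 1 (b i)‖ := by positivity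
    nlinarith

/-- If the endpoint of an edge lies in the open set O, so do interior points of the edge close to
it. This is why O^{+ε} can be defined with open segments. -/
theorem mem_enlarge_of_add_mem {ε : ℝ} {b : Fin k → IntLattice d}
    {O : Set (Space d)} (hO : IsOpen O) {z : IntLattice d} (i : Fin k)
    (h : latticePoint ε (z + b i) ∈ O) : latticePoint ε z ∈ enlarge ε b O := by
  refine Or.inr ⟨i, ?_⟩
  rw [latticePoint_add] at h
  set x := latticePoint ε z
  set v := latticePoint ε (b i)
  have hc : Tendsto (fun t : ℝ => x + (1 - t) • v) (𝓝[>] 0) (𝓝 (x + v)) := by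
    have : Continuous fun t : ℝ => x + (1 - t) • v := by fun_prop
    have h := (this.tendsto 0).mono_left (nhdsWithin_le_nhds (s := Ioi 0))
    simpa using h
  have h1 : ∀ᶠ t in 𝓝[>] (0 : ℝ), t < 1 :=
    nhdsWithin_le_nhds (gt_mem_nhds one_pos)
  obtain ⟨t, ht, ht0, ht1⟩ :=
    ((hc.eventually (hO.mem_nhds h)).and ((eventually_mem_nhdsWithin (a := (0 : ℝ))).and h1)).exists
  refine ⟨_, ⟨t, 1 - t, ht0, sub_pos.2 ht1, by ring, ?_⟩, ht⟩
  rw [smul_add, ← add_assoc, ← add_smul, add_sub_cancel, one_smul]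

/-- All cell sets for `ε ≤ 1` lie in a set of finite measure. -/
theorem volume_cellSet_le {O : Set (Space d)} (hO : Bornology.IsBounded O)
    (b : Fin k → IntLattice d) :
    ∃ A : Set (Space d), MeasurableSet A ∧ volume A ≠ ∞ ∧ O ⊆ A ∧
      ∀ ε, 0 < ε → ε ≤ 1 → cellSet ε b O ⊆ A := by
  by_cases hne : O.Nonempty
  · refine ⟨Metric.cthickening (edgeRange b) O, Metric.isClosed_cthickening.measurableSet,
      hO.cthickening.measure_lt_top.ne, Metric.self_subset_cthickening _,
      fun ε hε hε1 x hx => ?_⟩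
    rw [Metric.mem_cthickening_iff, ENNReal.le_ofReal_iff_toReal_le (Metric.infEDist_ne_top hne)
      (edgeRange_nonneg b)]
    exact (infDist_le_of_mem_cellSet hε hx).trans (mul_le_of_le_one_right (edgeRange_nonneg b) hε1)
  · rw [not_nonempty_iff_eq_empty] at hne
    refine ⟨∅, MeasurableSet.empty, by simp, by simp [hne], fun ε _ _ x hx => ?_⟩
    simp [hne, cellSet, enlarge] at hx

end Geometry

/-! ### The energy in unfolded variables and its coercivity -/

section Energy

variable {Ω : Type*} [MeasurableSpace Ω] {P : Measure Ω} [IsProbabilityMeasure P] {d k : ℕ}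
  {p : ℝ≥0∞} [Fact (1 ≤ p)] {T : IntLattice d → Ω → Ω} {b : Fin k → IntLattice d}
  {O : Set (Space d)} {ε : ℝ} {V : Ω → EuclideanSpace ℝ (Fin k) → ℝ}

/-- The unfolded symmetrized gradient. -/
noncomputable def symUnfold (T : IntLattice d → Ω → Ω) (ε : ℝ) (b : Fin k → IntLattice d)
    (u : Ω → IntLattice d → Space d) (y : Ω × Space d) : EuclideanSpace ℝ (Fin k) :=
  discreteSymGrad ε b (u (unfoldMap T ε y).1) (unfoldMap T ε y).2

theorem memLp_symUnfold (hT : IsDynamicalSystem P T) (hε : 0 < ε)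
    {u : Ω → IntLattice d → Space d}
    (hu : MemLp (fun y : Ω × IntLattice d => u y.1 y.2) p (P.prod (latticeMeasure d ε))) :
    MemLp (symUnfold T ε b u) p (P.prod volume) :=
  (memLp_discreteSymGrad hu).comp_measurePreserving (measurePreserving_unfoldMap hT hε)

theorem eLpNorm_symUnfold (hT : IsDynamicalSystem P T) (hε : 0 < ε)
    {u : Ω → IntLattice d → Space d}
    (hu : MemLp (fun y : Ω × IntLattice d => u y.1 y.2) p (P.prod (latticeMeasure d ε))) :
    eLpNorm (symUnfold T ε b u) p (P.prod volume) =
      eLpNorm (fun y : Ω × IntLattice d => discreteSymGrad ε b (u y.1) y.2) p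
        (P.prod (latticeMeasure d ε)) :=
  eLpNorm_comp_measurePreserving (p := p) (memLp_discreteSymGrad hu).1
    (measurePreserving_unfoldMap hT hε)

theorem memLp_unfolding (hT : IsDynamicalSystem P T) (hε : 0 < ε) {u : Ω → IntLattice d → ℝ}
    (hu : MemLp (fun y : Ω × IntLattice d => u y.1 y.2) p (P.prod (latticeMeasure d ε))) :
    MemLp (unfolding T ε u) p (P.prod volume) :=
  hu.comp_measurePreserving (measurePreserving_unfoldMap hT hε)

theorem eLpNorm_unfolding (hT : IsDynamicalSystem P T) (hε : 0 < ε) {u : Ω → IntLattice d → ℝ}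
    (hu : MemLp (fun y : Ω × IntLattice d => u y.1 y.2) p (P.prod (latticeMeasure d ε))) :
    eLpNorm (unfolding T ε u) p (P.prod volume) =
      eLpNorm (fun y : Ω × IntLattice d => u y.1 y.2) p (P.prod (latticeMeasure d ε)) := by
  have h := eLpNorm_comp_measurePreserving (p := p) hu.1 (measurePreserving_unfoldMap hT hε)
  exact h

theorem ae_unfoldMap_of_ae (hT : IsDynamicalSystem P T) (hε : 0 < ε) {Q : Ω → Prop}
    (h : ∀ᵐ ω ∂P, Q ω) :
    ∀ᵐ y ∂P.prod (volume : Measure (Space d)), Q (unfoldMap T ε y).1 :=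
  (measurePreserving_unfoldMap hT hε).quasiMeasurePreserving.ae
    (Measure.quasiMeasurePreserving_fst.ae h)

/-- A nonzero difference needs one end of the edge in O, which puts the base point into O^{+ε}.
Hence the energy sees the whole symmetrized gradient. -/
theorem symUnfold_eq_zero (hT : IsDynamicalSystem P T) (hε : 0 < ε) (hO : IsOpen O)
    {u : Ω → IntLattice d → Space d} (hu : IsLatticeField p P O ε u) :
    ∀ᵐ y ∂P.prod (volume : Measure (Space d)), y.2 ∉ cellSet ε b O → symUnfold T ε b u y = 0 := by
  filter_upwards [ae_unfoldMap_of_ae hT hε hu.2] with y hy hyO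
  have h0 : u (unfoldMap T ε y).1 (unfoldMap T ε y).2 = 0 := hy _ fun h => hyO (Or.inl h)
  have h1 : ∀ i, u (unfoldMap T ε y).1 ((unfoldMap T ε y).2 + b i) = 0 := fun i =>
    hy _ fun h => hyO (mem_enlarge_of_add_mem hO i h)
  ext i
  simp [symUnfold, discreteSymGrad, h0, h1]

theorem IsConvexIntegrand.aestronglyMeasurable {α : Type*} [MeasurableSpace α] {ν : Measure α}
    (hV : IsConvexIntegrand p P V) {θ : α → Ω} (hθ : Measurable θ)
    {S : α → EuclideanSpace ℝ (Fin k)} (hS : AEStronglyMeasurable S ν) :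
    AEStronglyMeasurable (fun y => V (θ y) (S y)) ν :=
  (hV.measurable.comp_aemeasurable (hθ.aemeasurable.prodMk hS.aemeasurable)).aestronglyMeasurable

theorem IsConvexIntegrand.integrableOn (hV : IsConvexIntegrand p P V) (hp0 : p ≠ 0) (hp' : p ≠ ∞)
    {S : Ω × Space d → EuclideanSpace ℝ (Fin k)} (hS : MemLp S p (P.prod volume))
    {A : Set (Space d)} (hA : volume A ≠ ∞) :
    IntegrableOn (fun y => V y.1 (S y)) (univ ×ˢ A) (P.prod volume) := by
  obtain ⟨C, hC, hVC⟩ := hV.growth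
  have hfin : (P.prod volume) (univ ×ˢ A) ≠ ∞ := by
    rw [Measure.prod_prod, measure_univ, one_mul]
    exact hA
  have hi : IntegrableOn (fun y => C * (‖S y‖ ^ p.toReal + 1) + C) (univ ×ˢ A) (P.prod volume) := by
    refine ((Integrable.add ?_ ?_).const_mul C).add ?_
    · exact (hS.integrable_norm_rpow hp0 hp').integrableOn
    · exact integrableOn_const hfin
    · exact integrableOn_const hfin
  refine hi.mono' (hV.aestronglyMeasurable measurable_fst hS.1).restrict ?_
  refine ae_restrict_of_ae ?_
  filter_upwards [Measure.quasiMeasurePreserving_fst.ae hVC] with y hy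
  obtain ⟨h1, h2⟩ := hy (S y)
  have h3 : 0 ≤ ‖S y‖ ^ p.toReal := by positivity
  rw [Real.norm_eq_abs, abs_le]
  have h4 : 0 ≤ C⁻¹ * ‖S y‖ ^ p.toReal := by positivity
  have h5 : 0 ≤ C * (‖S y‖ ^ p.toReal + 1) := by positivity
  constructor <;> linarith

/-- The energy in terms of the unfolded symmetrized gradient. -/
theorem discreteEnergy_eq (hT : IsDynamicalSystem P T) (hV : IsConvexIntegrand p P V)
    (hp0 : p ≠ 0) (hp' : p ≠ ∞) (hε : 0 < ε) (hε1 : ε ≤ 1) (hO : Bornology.IsBounded O)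
    {u : Ω → IntLattice d → Space d} (hu : IsLatticeField p P O ε u) :
    discreteEnergy P T V b O ε u =
      ∫ y in univ ×ˢ cellSet ε b O, V y.1 (symUnfold T ε b u y) ∂P.prod volume := by
  set S : Set (IntLattice d) := {z | latticePoint ε z ∈ enlarge ε b O} with hS
  set H : Ω × IntLattice d → ℝ := (univ ×ˢ S).indicator
    fun y => V (T y.2 y.1) (discreteSymGrad ε b (u y.1) y.2) with hH
  have hmp := measurePreserving_unfoldMap hT hε
  have hθ : Measurable fun y : Ω × IntLattice d => T y.2 y.1 :=
    hT.measurable_uncurry.comp measurable_swap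
  have hHm : AEStronglyMeasurable H (P.prod (latticeMeasure d ε)) :=
    (hV.aestronglyMeasurable hθ (memLp_discreteSymGrad hu.1).1).indicator
      (MeasurableSet.univ.prod MeasurableSet.of_discrete)
  have hcm : MeasurableSet (univ ×ˢ cellSet ε b O : Set (Ω × Space d)) :=
    MeasurableSet.univ.prod (measurableSet_cellSet ε b O)
  have hcomp : H ∘ unfoldMap T ε =
      (univ ×ˢ cellSet ε b O).indicator fun y => V y.1 (symUnfold T ε b u y) := by
    funext y
    have h1 : unfoldMap T ε y ∈ (univ ×ˢ S : Set (Ω × IntLattice d)) ↔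
        y ∈ (univ ×ˢ cellSet ε b O : Set (Ω × Space d)) := by
      simp [hS, cellSet, unfoldMap]
    by_cases hy : y ∈ (univ ×ˢ cellSet ε b O : Set (Ω × Space d))
    · rw [Function.comp_apply, hH, indicator_of_mem (h1.2 hy), indicator_of_mem hy]
      -- The T_z in the argument of V and the T_{-z} of the unfolding cancel, so the unfolded
      -- integrand is V at ω itself.
      simp only [unfoldMap, symUnfold, hT.apply_neg]
    · rw [Function.comp_apply, hH, indicator_of_notMem (fun h => hy (h1.1 h)),
        indicator_of_notMem hy]
  obtain ⟨A, -, hA, -, hAc⟩ := volume_cellSet_le hO b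
  have hint : Integrable (H ∘ unfoldMap T ε) (P.prod volume) := by
    rw [hcomp, integrable_indicator_iff hcm]
    exact hV.integrableOn hp0 hp' (memLp_symUnfold hT hε hu.1)
      (measure_ne_top_of_subset (hAc ε hε hε1) hA)
  have hHi : Integrable H (P.prod (latticeMeasure d ε)) := (hmp.integrable_comp hHm).1 hint
  have h1 : ∫ y, H (unfoldMap T ε y) ∂P.prod volume = ∫ y, H y ∂P.prod (latticeMeasure d ε) := by
    rw [← hmp.map_eq] at hHm ⊢
    exact (integral_map hmp.measurable.aemeasurable hHm).symm
  have h2 : ∫ y, H (unfoldMap T ε y) ∂P.prod volume =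
      ∫ y in univ ×ˢ cellSet ε b O, V y.1 (symUnfold T ε b u y) ∂P.prod volume := by
    rw [← integral_indicator hcm]
    exact congrArg (fun f : Ω × Space d → ℝ => ∫ y, f y ∂P.prod volume) hcomp
  rw [← h2, h1, integral_prod _ hHi, discreteEnergy]
  refine integral_congr_ae (ae_of_all _ fun ω => ?_)
  simp only
  rw [← integral_indicator MeasurableSet.of_discrete]
  refine integral_congr_ae (ae_of_all _ fun z => ?_)
  by_cases hz : z ∈ S
  · simp only [hH]
    rw [indicator_of_mem hz, indicator_of_mem (show (ω, z) ∈ univ ×ˢ S from ⟨mem_univ _, hz⟩)]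
  · simp only [hH]
    rw [indicator_of_notMem hz, indicator_of_notMem (fun h => hz h.2)]

/-- A bound of the energy bounds the symmetrized gradient. -/
theorem exists_eLpNorm_symUnfold_le (hT : IsDynamicalSystem P T) (hV : IsConvexIntegrand p P V)
    (hp0 : p ≠ 0) (hp' : p ≠ ∞) (hO : IsOpen O) (hOb : Bornology.IsBounded O)
    (b : Fin k → IntLattice d) (M : ℝ) :
    ∃ C : ℝ≥0∞, C ≠ ∞ ∧ ∀ ε, 0 < ε → ε ≤ 1 → ∀ u : Ω → IntLattice d → Space d,
      IsLatticeField p P O ε u → discreteEnergy P T V b O ε u ≤ M →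
        eLpNorm (symUnfold T ε b u) p (P.prod volume) ≤ C := by
  obtain ⟨A, -, hA, -, hAc⟩ := volume_cellSet_le hOb b
  obtain ⟨C, hC, hVC⟩ := hV.growth
  have hpr : 0 < p.toReal := ENNReal.toReal_pos hp0 hp'
  refine ⟨ENNReal.ofReal ((C * M + C * (C * (volume A).toReal)) ^ p.toReal⁻¹),
    ENNReal.ofReal_ne_top, fun ε hε hε1 u hu hM => ?_⟩
  have hS := memLp_symUnfold (b := b) hT hε hu.1
  set S := symUnfold T ε b u with hSdef
  have hcm : MeasurableSet (univ ×ˢ cellSet ε b O : Set (Ω × Space d)) :=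
    MeasurableSet.univ.prod (measurableSet_cellSet ε b O)
  have hfin : volume (cellSet ε b O) ≠ ∞ := measure_ne_top_of_subset (hAc ε hε hε1) hA
  have hfin' : (P.prod volume) (univ ×ˢ cellSet ε b O) ≠ ∞ := by
    rwa [Measure.prod_prod, measure_univ, one_mul]
  have hVi := hV.integrableOn hp0 hp' hS hfin
  rw [hS.eLpNorm_eq_integral_rpow_norm hp0 hp']
  refine ENNReal.ofReal_le_ofReal (Real.rpow_le_rpow (integral_nonneg fun y => by positivity) ?_
    (by positivity))
  have h1 : ∫ y, ‖S y‖ ^ p.toReal ∂P.prod volume =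
      ∫ y in univ ×ˢ cellSet ε b O, ‖S y‖ ^ p.toReal ∂P.prod volume := by
    rw [← integral_indicator hcm]
    refine integral_congr_ae ?_
    filter_upwards [symUnfold_eq_zero (b := b) hT hε hO hu] with y hy
    by_cases hyc : y.2 ∈ cellSet ε b O
    · rw [indicator_of_mem (show y ∈ univ ×ˢ _ from ⟨mem_univ _, hyc⟩)]
    · rw [indicator_of_notMem (fun h => hyc h.2), hSdef, hy hyc, norm_zero,
        Real.zero_rpow hpr.ne']
  rw [h1]
  calc ∫ y in univ ×ˢ cellSet ε b O, ‖S y‖ ^ p.toReal ∂P.prod volume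
      ≤ ∫ y in univ ×ˢ cellSet ε b O, (C * V y.1 (S y) + C * C) ∂P.prod volume := by
        refine integral_mono_ae (hS.integrable_norm_rpow hp0 hp').integrableOn
          ((hVi.const_mul C).add (integrableOn_const hfin')) (ae_restrict_of_ae ?_)
        filter_upwards [Measure.quasiMeasurePreserving_fst.ae hVC] with y hy
        have h2 := mul_le_mul_of_nonneg_left (hy (S y)).1 hC.le
        rw [mul_sub, ← mul_assoc, mul_inv_cancel₀ hC.ne', one_mul] at h2
        linarith
    _ = C * discreteEnergy P T V b O ε u + C * (C * (volume (cellSet ε b O)).toReal) := by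
        rw [integral_add (hVi.const_mul C) (integrableOn_const hfin'), integral_const_mul,
          setIntegral_const, discreteEnergy_eq hT hV hp0 hp' hε hε1 hOb hu, measureReal_def,
          Measure.prod_prod, measure_univ, one_mul, smul_eq_mul]
        ring
    _ ≤ C * M + C * (C * (volume A).toReal) := by
        gcongr
        · exact hAc ε hε hε1

/-- A bound of the energy bounds the field and its gradient. -/
theorem exists_eLpNorm_unfolding_le (hT : IsDynamicalSystem P T) (hV : IsConvexIntegrand p P V)
    (hK : SatisfiesKorn p b) (hd : 1 ≤ d)
    (hp0 : p ≠ 0) (hp' : p ≠ ∞) (hO : IsOpen O) (hOb : Bornology.IsBounded O) (M : ℝ) :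
    ∃ C : ℝ≥0∞, C ≠ ∞ ∧ ∀ ε, 0 < ε → ε ≤ 1 → ∀ u : Ω → IntLattice d → Space d,
      IsLatticeField p P O ε u → discreteEnergy P T V b O ε u ≤ M →
        ∀ a, eLpNorm (unfolding T ε fun ω z => u ω z a) p (P.prod volume) ≤ C ∧
          ∀ j, eLpNorm (unfolding T ε fun ω z => discreteGrad ε (fun z' => u ω z' a) z j) p
            (P.prod volume) ≤ C := by
  -- The three constants form a chain: energy to symmetrized gradient, Korn to the full gradient,
  -- Poincaré to the field. The first direction, which exists as d ≥ 1, serves in the last step.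
  obtain ⟨C₁, hC₁, h₁⟩ := exists_eLpNorm_symUnfold_le hT hV hp0 hp' hO hOb b M
  obtain ⟨C₂, hC₂, h₂⟩ := hK.eLpNorm_le (P := P) hp0 hp' hOb
  obtain ⟨D, hD, h₃⟩ := eLpNorm_le_discreteGrad (P := P) (p := p) hOb
  have hC : C₂ * C₁ ≠ ∞ := ENNReal.mul_ne_top hC₂ hC₁
  refine ⟨max (C₂ * C₁) (ENNReal.ofReal (D + 1) * (C₂ * C₁)),
    max_ne_top hC (ENNReal.mul_ne_top ENNReal.ofReal_ne_top hC),
    fun ε hε hε1 u hu hM a => ?_⟩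
  have hua : MemLp (fun y : Ω × IntLattice d => u y.1 y.2 a) p (P.prod (latticeMeasure d ε)) :=
    memLp_coord hu.1 a
  have hg : ∀ j, eLpNorm (fun y : Ω × IntLattice d => discreteGrad ε (fun z => u y.1 z a) y.2 j) p
      (P.prod (latticeMeasure d ε)) ≤ C₂ * C₁ := by
    intro j
    refine (h₂ ε hε u hu a j).trans ?_
    gcongr
    rw [← eLpNorm_symUnfold hT hε hu.1]
    exact h₁ ε hε hε1 u hu hM
  refine ⟨?_, fun j => ?_⟩
  · rw [eLpNorm_unfolding (u := fun ω z => u ω z a) hT hε hua]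
    refine ((h₃ ε hε (fun ω z => u ω z a) hua (hu.2.mono fun ω h z hz => by simp [h z hz])
      ⟨0, hd⟩).trans ?_).trans (le_max_right _ _)
    gcongr
    exact hg _
  · rw [eLpNorm_unfolding (u := fun ω z => discreteGrad ε (fun z' => u ω z' a) z j) hT hε
      (memLp_discreteGrad (u := fun ω z => u ω z a) hua j)]
    exact (hg j).trans (le_max_left _ _)

end Energy

/-! ### Compactness -/

section Compactness

variable {Ω : Type*} [MeasurableSpace Ω] {P : Measure Ω} [IsProbabilityMeasure P] {d k : ℕ}
  {p q : ℝ≥0∞} [Fact (1 ≤ p)] {T : IntLattice d → Ω → Ω} {b : Fin k → IntLattice d}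
  {O : Set (Space d)} {ε : ℝ} {V : Ω → EuclideanSpace ℝ (Fin k) → ℝ}

theorem TendstoWeakLp.congr_limit {α ι : Type*} [MeasurableSpace α] {μ : Measure α} {l : Filter ι}
    {f : ι → α → ℝ} {F F' : α → ℝ} (h : TendstoWeakLp q μ l f F) (hF : F =ᵐ[μ] F') :
    TendstoWeakLp q μ l f F' := by
  intro g hg
  rw [show ∫ x, F' x * g x ∂μ = ∫ x, F x * g x ∂μ from
    integral_congr_ae (hF.mono fun x hx => by simp only [hx])]
  exact h g hg

/-- The centre of the cell of x lies within dε of x, and a forward neighbour is one further step ε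
away; beyond (d + 1)ε from O all values entering the gradient vanish. -/
theorem unfolding_eq_zero (hT : IsDynamicalSystem P T) (hε : 0 < ε)
    {u : Ω → IntLattice d → Space d} (hu : IsLatticeField p P O ε u) (a : Fin d) :
    ∀ᵐ y ∂P.prod (volume : Measure (Space d)), (d + 1 : ℝ) * ε < Metric.infDist y.2 O →
      unfolding T ε (fun ω z => u ω z a) y = 0 ∧
      ∀ j, unfolding T ε (fun ω z => discreteGrad ε (fun z' => u ω z' a) z j) y = 0 := by
  filter_upwards [ae_unfoldMap_of_ae hT hε hu.2] with y hy hyO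
  have hd := norm_sub_latticePoint_cellIndex_le hε y.2
  rw [← dist_eq_norm] at hd
  have h0 : u (unfoldMap T ε y).1 (unfoldMap T ε y).2 = 0 := by
    refine hy _ fun h => ?_
    have := Metric.infDist_le_dist_of_mem (x := y.2) h
    rw [show (unfoldMap T ε y).2 = cellIndex ε y.2 from rfl] at this
    linarith
  have h1 : ∀ j, u (unfoldMap T ε y).1 ((unfoldMap T ε y).2 + latticeUnit j) = 0 := by
    intro j
    refine hy _ fun h => ?_
    have h2 := Metric.infDist_le_dist_of_mem (x := y.2) h
    have h3 := dist_triangle y.2 (latticePoint ε (cellIndex ε y.2))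
      (latticePoint ε (cellIndex ε y.2 + latticeUnit j))
    have h4 : dist (latticePoint ε (cellIndex ε y.2))
        (latticePoint ε (cellIndex ε y.2 + latticeUnit j)) = ε := by
      rw [latticePoint_add, dist_self_add_right, latticePoint_eq_smul, latticePoint_one_unit,
        norm_smul, PiLp.norm_single, norm_one, mul_one, Real.norm_of_nonneg hε.le]
    rw [show (unfoldMap T ε y).2 = cellIndex ε y.2 from rfl] at h2
    linarith
  refine ⟨?_, fun j => ?_⟩
  · rw [unfolding_eq_comp]
    simp [h0]
  · rw [unfolding_eq_comp]
    simp [discreteGrad, h0, h1]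

/-- The weak two-scale limit of a bounded sequence of lattice fields with bounded gradients. -/
theorem exists_twoScale_limit [ENNReal.HolderConjugate p q] (hp : 1 < p) (hp' : p ≠ ∞)
    (hT : IsDynamicalSystem P T) (hO : IsLipschitzDomain O)
    {ε : ℕ → ℝ} (hε0 : ∀ n, 0 < ε n) (hε : Tendsto ε atTop (𝓝 0))
    {u : ℕ → Ω → IntLattice d → Space d} (hu : ∀ n, IsLatticeField p P O (ε n) (u n))
    {C : ℝ≥0∞} (hC : C ≠ ∞) (a : Fin d)
    (huC : ∀ n, eLpNorm (unfolding T (ε n) fun ω z => u n ω z a) p (P.prod volume) ≤ C)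
    {U : Ω × Space d → ℝ} (hU : MemLp U p (P.prod volume))
    (huU : TendstoWeakLp q (P.prod volume) atTop
      (fun n => unfolding T (ε n) fun ω z => u n ω z a) U)
    {G : Fin d → Ω × Space d → ℝ} (hG : ∀ j, MemLp (G j) p (P.prod volume))
    (huG : ∀ j, TendstoWeakLp q (P.prod volume) atTop (fun n => unfolding T (ε n)
      fun ω z => discreteGrad (ε n) (fun z' => u n ω z' a) z j) (G j)) :
    ∃ W ∈ InvSobolev p P T O, ∃ χ ∈ PotTensor p P T O,
      (∀ᵐ y ∂P.prod (volume : Measure (Space d)), U y = (W y).1) ∧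
      ∀ j, ∀ᵐ y ∂P.prod (volume : Measure (Space d)), G j y = (W y).2 j + χ y j := by
  have hf : ∀ n, MemLp (unfolding T (ε n) fun ω z => u n ω z a) p (P.prod volume) := fun n =>
    memLp_unfolding hT (hε0 n) (memLp_coord (hu n).1 a)
  have huG' : ∀ j, TendstoWeakLp q (P.prod volume) atTop (fun n y =>
      (unfolding T (ε n) (fun ω z => u n ω z a) (jointShift T (ε n) (latticeUnit j) y) -
        unfolding T (ε n) (fun ω z => u n ω z a) y) / ε n) (G j) := by
    intro j
    have h : (fun n y => (unfolding T (ε n) (fun ω z => u n ω z a)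
        (jointShift T (ε n) (latticeUnit j) y) -
        unfolding T (ε n) (fun ω z => u n ω z a) y) / ε n) = fun n => unfolding T (ε n)
          fun ω z => discreteGrad (ε n) (fun z' => u n ω z' a) z j := by
      funext n y
      exact (unfolding_discreteGrad hT (hε0 n) (fun ω z => u n ω z a) j y).symm
    rw [h]
    exact huG j
  refine exists_decomposition hp hp' hT hO hU hG
    (hasTwoScaleGradient_of_tendstoWeakLp hp hp' hT huU hf hC huC hε0 hε hU huG')
    (invariant_of_tendstoWeakLp hp hp' hT huU hf hC huC hε0 hε hU huG')
    (ae_eq_zero_of_tendstoWeakLp hp hp' hO huU hU (c := d + 1) hε fun n => ?_)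
    (fun j => ae_eq_zero_of_tendstoWeakLp hp hp' hO (huG j) (hG j) (c := d + 1) hε fun n => ?_)
  · exact (unfolding_eq_zero hT (hε0 n) (hu n) a).mono fun y h hy => (h hy).1
  · exact (unfolding_eq_zero hT (hε0 n) (hu n) a).mono fun y h hy => (h hy).2 j

theorem twoScale_compactness [IsSeparable P] [ENNReal.HolderConjugate p q] (hp : 1 < p)
    (hp' : p ≠ ∞) (hd : 1 ≤ d) (hT : IsDynamicalSystem P T) (hK : SatisfiesKorn p b)
    (hO : IsLipschitzDomain O) (hV : IsConvexIntegrand p P V)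
    {ε : ℕ → ℝ} (hε0 : ∀ n, 0 < ε n) (hε : Tendsto ε atTop (𝓝 0))
    {u : ℕ → Ω → IntLattice d → Space d} (hu : ∀ n, IsLatticeField p P O (ε n) (u n))
    (hE : limsup (fun n => (discreteEnergy P T V b O (ε n) (u n) : EReal)) atTop < ⊤) :
    ∃ s : ℕ → ℕ, StrictMono s ∧
      ∃ U : Fin d → Lp (ℝ × Space d) p (P.prod (volume : Measure (Space d))),
      ∃ χ : Fin d → Lp (Space d) p (P.prod (volume : Measure (Space d))),
        (∀ i, U i ∈ InvSobolev p P T O) ∧ (∀ i, χ i ∈ PotTensor p P T O) ∧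
        (∀ i, WeakTwoScale q P T atTop (fun n => ε (s n))
          (fun n ω z => u (s n) ω z i) (fun y => (U i y).1)) ∧
        ∀ i j, WeakTwoScale q P T atTop (fun n => ε (s n))
          (fun n ω z => discreteGrad (ε (s n)) (fun z' => u (s n) ω z' i) z j)
          (fun y => gradField U χ y i j) := by
  have hp0 : p ≠ 0 := (zero_lt_one.trans hp).ne'
  have hq : 1 < q := (ENNReal.HolderConjugate.lt_top_iff_one_lt p q).1 hp'.lt_top
  have hq' : q ≠ ∞ := ((ENNReal.HolderConjugate.lt_top_iff_one_lt q p).2 hp).ne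
  have : Fact (1 ≤ q) := ⟨hq.le⟩
  have := separableSpace_Lp_prod (P := P) (d := d) (p := q) (q := p) hq hq'
  -- From some index N on, the energies are below M and ε ≤ 1, so the a priori bounds apply to the
  -- tail.
  obtain ⟨M, hM, -⟩ := EReal.lt_iff_exists_real_btwn.1 hE
  have h1 := eventually_lt_of_limsup_lt hM
  have h2 := hε.eventually (gt_mem_nhds one_pos)
  obtain ⟨N, hN⟩ := eventually_atTop.1 (h1.and h2)
  obtain ⟨C, hC, hbd⟩ := exists_eLpNorm_unfolding_le hT hV hK hd hp0 hp' hO.isOpen hO.isBounded M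
  have hbd' : ∀ n, _ := fun n => hbd (ε (n + N)) (hε0 _) (hN _ (Nat.le_add_left N n)).2.le
    (u (n + N)) (hu _) (by exact_mod_cast (hN _ (Nat.le_add_left N n)).1.le)
  -- The components (`none`) and all gradient entries (`some j`) form one finite family, so a single
  -- subsequence serves them all.
  let f : Fin d × Option (Fin d) → ℕ → Ω × Space d → ℝ := fun i n =>
    i.2.elim (unfolding T (ε (n + N)) fun ω z => u (n + N) ω z i.1)
      fun j => unfolding T (ε (n + N)) fun ω z =>
        discreteGrad (ε (n + N)) (fun z' => u (n + N) ω z' i.1) z j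
  have hf : ∀ i n, MemLp (f i n) p (P.prod volume) := by
    rintro ⟨a, _ | j⟩ n
    · exact memLp_unfolding (u := fun ω z => u (n + N) ω z a) hT (hε0 _) (memLp_coord (hu _).1 a)
    · exact memLp_unfolding (u := fun ω z => discreteGrad _ (fun z' => u (n + N) ω z' a) z j) hT
        (hε0 _) (memLp_discreteGrad (u := fun ω z => u (n + N) ω z a) (memLp_coord (hu _).1 a) j)
  have hfC : ∀ i n, eLpNorm (f i n) p (P.prod volume) ≤ C := by
    rintro ⟨a, _ | j⟩ n
    · exact (hbd' n a).1
    · exact (hbd' n a).2 j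
  obtain ⟨s, hs, F, hF⟩ := exists_subseq_tendstoWeakLp_fintype hq hq' hf hC hfC
  have hεs : Tendsto (fun n => ε (s n + N)) atTop (𝓝 0) :=
    hε.comp ((tendsto_add_atTop_nat N).comp hs.tendsto_atTop)
  have hdec := fun a => exists_twoScale_limit hp hp' hT hO (ε := fun n => ε (s n + N))
    (fun n => hε0 _) hεs (u := fun n => u (s n + N)) (fun n => hu _) hC a
    (fun n => hfC (a, none) (s n)) (hF (a, none)).1 (hF (a, none)).2
    (G := fun j => F (a, some j)) (fun j => (hF (a, some j)).1) (fun j => (hF (a, some j)).2)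
  choose U hUi χ hχi hU hχ using hdec
  refine ⟨fun n => s n + N, fun m n h => Nat.add_lt_add_right (hs h) N, U, χ, hUi, hχi,
    fun i => ?_, fun i j => ?_⟩
  · exact (hF (i, none)).2.congr_limit (hU i)
  · exact (hF (i, some j)).2.congr_limit (hχ i j)

end Compactness

/-! ### The two-scale energy and the lower bound -/

theorem integral_norm_rpow_eq {α E : Type*} [MeasurableSpace α] {μ : Measure α}
    [NormedAddCommGroup E] {p : ℝ≥0∞} (hp0 : p ≠ 0) (hp' : p ≠ ∞) {S : α → E} (hS : MemLp S p μ) :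
    ∫ y, ‖S y‖ ^ p.toReal ∂μ = (eLpNorm S p μ).toReal ^ p.toReal := by
  have h0 : 0 ≤ ∫ y, ‖S y‖ ^ p.toReal ∂μ := integral_nonneg fun y => by positivity
  rw [hS.eLpNorm_eq_integral_rpow_norm hp0 hp', ENNReal.toReal_ofReal (by positivity),
    Real.rpow_inv_rpow h0 (ENNReal.toReal_pos hp0 hp').ne']

section Energy

variable {Ω : Type*} [MeasurableSpace Ω] {P : Measure Ω} [IsProbabilityMeasure P] {d k : ℕ}
  {p q : ℝ≥0∞} [Fact (1 ≤ p)] {T : IntLattice d → Ω → Ω} {b : Fin k → IntLattice d}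
  {B : Fin k → IntLattice d →₀ Space d}
  {O : Set (Space d)} {ε : ℝ} {V : Ω → EuclideanSpace ℝ (Fin k) → ℝ}

/-- The functional `S ↦ ⟨∫_O V(ω, S(ω, x)) dx⟩`. -/
noncomputable def domainEnergy (P : Measure Ω) (V : Ω → EuclideanSpace ℝ (Fin k) → ℝ)
    (O : Set (Space d)) (S : Ω × Space d → EuclideanSpace ℝ (Fin k)) : ℝ :=
  ∫ y in univ ×ˢ O, V y.1 (S y) ∂P.prod volume

theorem domainEnergy_congr {S S' : Ω × Space d → EuclideanSpace ℝ (Fin k)}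
    (h : S =ᵐ[P.prod volume] S') : domainEnergy P V O S = domainEnergy P V O S' :=
  integral_congr_ae (ae_restrict_of_ae (h.mono fun y hy => by simp only [hy]))

theorem measure_univ_prod (P : Measure Ω) [IsProbabilityMeasure P] (A : Set (Space d)) :
    (P.prod volume) (univ ×ˢ A) = volume A := by
  rw [Measure.prod_prod, measure_univ, one_mul]

theorem domainEnergy_le (hV : IsConvexIntegrand p P V) (hp0 : p ≠ 0) (hp' : p ≠ ∞)
    (hO : volume O ≠ ∞) :
    ∃ C > 0, ∀ S : Ω × Space d → EuclideanSpace ℝ (Fin k), MemLp S p (P.prod volume) →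
      domainEnergy P V O S ≤
        C * ((eLpNorm S p (P.prod volume)).toReal ^ p.toReal + (volume O).toReal) := by
  obtain ⟨C, hC, hVC⟩ := hV.growth
  refine ⟨C, hC, fun S hS => ?_⟩
  have hi := hS.integrable_norm_rpow hp0 hp'
  have hc : IntegrableOn (fun _ : Ω × Space d => (1 : ℝ)) (univ ×ˢ O) (P.prod volume) :=
    integrableOn_const (by rwa [measure_univ_prod])
  calc domainEnergy P V O S
      ≤ ∫ y in univ ×ˢ O, C * (‖S y‖ ^ p.toReal + 1) ∂P.prod volume := by
        refine integral_mono_ae (hV.integrableOn hp0 hp' hS hO)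
          ((hi.integrableOn.add hc).const_mul C) (ae_restrict_of_ae ?_)
        filter_upwards [Measure.quasiMeasurePreserving_fst.ae hVC] with y hy
        exact (hy (S y)).2
    _ = C * (∫ y in univ ×ˢ O, ‖S y‖ ^ p.toReal ∂P.prod volume + (volume O).toReal) := by
        rw [integral_const_mul, integral_add hi.integrableOn hc, setIntegral_const,
          measureReal_def, measure_univ_prod, smul_eq_mul, mul_one]
    _ ≤ _ := by
        gcongr
        rw [← integral_norm_rpow_eq hp0 hp' hS]
        exact setIntegral_le_integral hi (ae_of_all _ fun y => by positivity)

theorem convexOn_domainEnergy (hV : IsConvexIntegrand p P V) (hp0 : p ≠ 0) (hp' : p ≠ ∞)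
    (hO : volume O ≠ ∞) :
    ConvexOn ℝ univ fun S : Lp (EuclideanSpace ℝ (Fin k)) p (P.prod (volume : Measure (Space d))) =>
      domainEnergy P V O S := by
  refine ⟨convex_univ, fun S _ S' _ s t hs ht hst => ?_⟩
  have h1 := hV.integrableOn hp0 hp' (Lp.memLp S) hO
  have h2 := hV.integrableOn hp0 hp' (Lp.memLp S') hO
  have h3 := hV.integrableOn hp0 hp' (Lp.memLp (s • S + t • S')) hO
  simp only [domainEnergy, smul_eq_mul]
  rw [← integral_const_mul, ← integral_const_mul,
    ← integral_add (h1.const_mul s) (h2.const_mul t)]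
  refine integral_mono_ae h3 ((h1.const_mul s).add (h2.const_mul t)) (ae_restrict_of_ae ?_)
  filter_upwards [Measure.quasiMeasurePreserving_fst.ae hV.convex, Lp.coeFn_add (s • S) (t • S'),
    Lp.coeFn_smul s S, Lp.coeFn_smul t S'] with y hy ha hb hc
  simp only [ha, Pi.add_apply, hb, hc, Pi.smul_apply]
  exact hy.2 (mem_univ _) (mem_univ _) hs ht hst

/-- A convex function that is bounded above near one point is continuous; the upper growth bound on
V provides this near 0. -/
theorem continuous_domainEnergy (hV : IsConvexIntegrand p P V) (hp0 : p ≠ 0) (hp' : p ≠ ∞)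
    (hO : volume O ≠ ∞) :
    Continuous fun S : Lp (EuclideanSpace ℝ (Fin k)) p (P.prod (volume : Measure (Space d))) =>
      domainEnergy P V O S := by
  rw [← continuousOn_univ]
  refine ((convexOn_domainEnergy hV hp0 hp' hO).continuousOn_tfae isOpen_univ univ_nonempty).out
    3 1 |>.1 ?_
  obtain ⟨C, hC, h⟩ := domainEnergy_le (P := P) hV hp0 hp' hO
  refine ⟨0, mem_univ _, C * (1 ^ p.toReal + (volume O).toReal), ?_⟩
  rw [eventually_map]
  filter_upwards [Metric.closedBall_mem_nhds (0 : Lp (EuclideanSpace ℝ (Fin k)) p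
    (P.prod (volume : Measure (Space d)))) one_pos] with S hS
  refine (h S (Lp.memLp S)).trans ?_
  rw [mem_closedBall_zero_iff, Lp.norm_def] at hS
  gcongr

theorem tendsto_domainEnergy (hV : IsConvexIntegrand p P V) (hp0 : p ≠ 0) (hp' : p ≠ ∞)
    (hO : volume O ≠ ∞) {ι : Type*} {l : Filter ι}
    {S : ι → Ω × Space d → EuclideanSpace ℝ (Fin k)} (hS : ∀ n, MemLp (S n) p (P.prod volume))
    {F : Ω × Space d → EuclideanSpace ℝ (Fin k)} (hF : MemLp F p (P.prod volume))
    (h : Tendsto (fun n => eLpNorm (S n - F) p (P.prod volume)) l (𝓝 0)) :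
    Tendsto (fun n => domainEnergy P V O (S n)) l (𝓝 (domainEnergy P V O F)) := by
  have h1 := (Lp.tendsto_Lp_iff_tendsto_eLpNorm'' S hS F hF).2 h
  have h2 := ((continuous_domainEnergy hV hp0 hp' hO).tendsto _).comp h1
  rw [← domainEnergy_congr hF.coeFn_toLp]
  exact h2.congr fun n => domainEnergy_congr (hS n).coeFn_toLp

theorem twoScaleEnergy_eq (hV : IsConvexIntegrand p P V) (hp0 : p ≠ 0) (hp' : p ≠ ∞)
    (hO : volume O ≠ ∞) {F : Ω × Space d → Matrix (Fin d) (Fin d) ℝ}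
    (hF : MemLp (symField T b B F) p (P.prod volume)) :
    twoScaleEnergy P T V b B O F = domainEnergy P V O (symField T b B F) := by
  have h := hV.integrableOn hp0 hp' hF hO
  rw [IntegrableOn, ← Measure.prod_restrict, Measure.restrict_univ] at h
  rw [domainEnergy, ← Measure.prod_restrict, Measure.restrict_univ, integral_prod _ h]
  rfl

theorem memLp_symField (hT : IsDynamicalSystem P T) {F : Ω × Space d → Matrix (Fin d) (Fin d) ℝ}
    (hF : ∀ i j, MemLp (fun y => F y i j) p (P.prod volume)) :
    MemLp (symField T b B F) p (P.prod volume) := by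
  have h : MemLp (fun y => (WithLp.toLp 2 fun i => symField T b B F y i :
      EuclideanSpace ℝ (Fin k))) p (P.prod volume) := by
    refine memLp_toLp fun i => ?_
    simp only [symField_apply]
    refine memLp_finsetSum _ fun a _ => memLp_finsetSum _ fun z _ => memLp_finsetSum _ fun j _ =>
      MemLp.const_mul ?_ _
    have := (hF a j).comp_measurePreserving (measurePreserving_jointShift hT 0 (-z))
    simpa only [Function.comp_def, jointShift_zero_apply] using this
  exact h

/-- The cells of the lattice points in `O^{+ε}` exhaust `O` up to a null set. -/
theorem tendsto_volume_symmDiff_cellSet (hO : IsLipschitzDomain O) (b : Fin k → IntLattice d) :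
    Tendsto (fun ε => volume (symmDiff (cellSet ε b O) O)) (𝓝[>] 0) (𝓝 0) := by
  obtain ⟨A, hAm, hA, hOA, hAc⟩ := volume_cellSet_le hO.isBounded b
  have h := tendsto_measure_of_ae_tendsto_indicator (μ := (volume : Measure (Space d)))
    (𝓝[>] (0 : ℝ)) (As := fun ε => symmDiff (cellSet ε b O) O) MeasurableSet.empty
    (fun ε => (measurableSet_cellSet ε b O).symmDiff hO.isOpen.measurableSet) hAm hA ?_ ?_
  · simpa using h
  · filter_upwards [Ioc_mem_nhdsGT (one_pos (α := ℝ))] with ε hε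
    exact symmDiff_le (fun x hx => Or.inr (hAc ε hε.1 hε.2 hx)) fun x hx => Or.inr (hOA hx)
  · filter_upwards [measure_eq_zero_iff_ae_notMem.1 hO.volume_frontier] with x hx
    rw [hO.isOpen.frontier_eq] at hx
    simp only [mem_empty_iff_false, iff_false]
    by_cases hxO : x ∈ O
    · obtain ⟨r, hr, hrO⟩ := Metric.isOpen_iff.1 hO.isOpen x hxO
      have h1 : Tendsto (fun ε : ℝ => (d : ℝ) * ε) (𝓝[>] 0) (𝓝 0) := by
        have := (continuous_const_mul (d : ℝ)).tendsto 0
        rw [mul_zero] at this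
        exact this.mono_left nhdsWithin_le_nhds
      filter_upwards [h1.eventually (gt_mem_nhds hr), self_mem_nhdsWithin] with ε hε hε0
      have h2 : x ∈ cellSet ε b O := by
        refine Or.inl (hrO ?_)
        rw [Metric.mem_ball, dist_comm, dist_eq_norm]
        exact (norm_sub_latticePoint_cellIndex_le hε0 x).trans_lt hε
      rw [mem_symmDiff]
      tauto
    · have hcl : x ∉ closure O := fun h => hx ⟨h, hxO⟩
      have hpos : 0 < Metric.infDist x O :=
        (Metric.infDist_pos_iff_notMem_closure hO.isConnected.nonempty).1 hcl
      have h1 : Tendsto (fun ε : ℝ => edgeRange b * ε) (𝓝[>] 0) (𝓝 0) := by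
        have := (continuous_const_mul (edgeRange b)).tendsto 0
        rw [mul_zero] at this
        exact this.mono_left nhdsWithin_le_nhds
      filter_upwards [h1.eventually (gt_mem_nhds hpos), self_mem_nhdsWithin] with ε hε hε0
      have h2 : x ∉ cellSet ε b O := fun h =>
        (infDist_le_of_mem_cellSet hε0 h).not_gt hε
      rw [mem_symmDiff]
      tauto

/-- Comparison of the discrete energy with the functional on `O`. -/
theorem exists_discreteEnergy_bounds (hT : IsDynamicalSystem P T) (hV : IsConvexIntegrand p P V)
    (hp0 : p ≠ 0) (hp' : p ≠ ∞) (hO : IsLipschitzDomain O) (b : Fin k → IntLattice d) :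
    ∃ C > 0, ∀ ε, 0 < ε → ε ≤ 1 → ∀ u : Ω → IntLattice d → Space d, IsLatticeField p P O ε u →
      domainEnergy P V O (symUnfold T ε b u) ≤ discreteEnergy P T V b O ε u +
          C * (volume (symmDiff (cellSet ε b O) O)).toReal ∧
      discreteEnergy P T V b O ε u ≤ domainEnergy P V O (symUnfold T ε b u) +
          C * (volume (symmDiff (cellSet ε b O) O)).toReal +
            C * (eLpNorm ((univ ×ˢ Oᶜ).indicator (symUnfold T ε b u)) p
              (P.prod volume)).toReal ^ p.toReal := by
  obtain ⟨A, hAm, hA, hOA, hAc⟩ := volume_cellSet_le hO.isBounded b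
  obtain ⟨C, hC, hVC⟩ := hV.growth
  have hpr : 0 < p.toReal := ENNReal.toReal_pos hp0 hp'
  refine ⟨C, hC, fun ε hε hε1 u hu => ?_⟩
  rw [discreteEnergy_eq hT hV hp0 hp' hε hε1 hO.isBounded hu, domainEnergy]
  have hS := memLp_symUnfold (b := b) hT hε hu.1
  have hS0 := symUnfold_eq_zero (b := b) hT hε hO.isOpen hu
  set S := symUnfold T ε b u
  set K := cellSet ε b O with hK
  have hOm := hO.isOpen.measurableSet
  have hKm : MeasurableSet K := measurableSet_cellSet ε b O
  have hm : ∀ {A : Set (Space d)}, MeasurableSet A → MeasurableSet (univ ×ˢ A : Set (Ω × Space d)) :=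
    fun h => MeasurableSet.univ.prod h
  have hΔm := hKm.symmDiff hOm
  have hKfin : volume K ≠ ∞ := measure_ne_top_of_subset (hAc ε hε hε1) hA
  have hOfin : volume O ≠ ∞ := measure_ne_top_of_subset hOA hA
  have hΔfin : volume (symmDiff K O) ≠ ∞ :=
    measure_ne_top_of_subset (symmDiff_le (fun x hx => Or.inr (hAc ε hε hε1 hx))
      fun x hx => Or.inr (hOA hx)) hA
  have hVK := hV.integrableOn hp0 hp' hS hKfin
  have hVO := hV.integrableOn hp0 hp' hS hOfin
  have hSc : MemLp ((univ ×ˢ Oᶜ).indicator S) p (P.prod volume) := hS.indicator (hm hOm.compl)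
  have hci : Integrable ((univ ×ˢ symmDiff K O).indicator fun _ : Ω × Space d => C)
      (P.prod volume) := by
    rw [integrable_indicator_iff (hm hΔm)]
    exact integrableOn_const (by rwa [measure_univ_prod])
  have hcv : ∫ y, (univ ×ˢ symmDiff K O).indicator (fun _ : Ω × Space d => C) y ∂P.prod volume =
      C * (volume (symmDiff K O)).toReal := by
    rw [integral_indicator (hm hΔm), setIntegral_const, measureReal_def, measure_univ_prod,
      smul_eq_mul, mul_comm]
  have hpi := (hSc.integrable_norm_rpow hp0 hp').const_mul C
  rw [← hcv, ← integral_norm_rpow_eq hp0 hp' hSc, ← integral_const_mul,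
    ← integral_indicator (hm hKm), ← integral_indicator (hm hOm)]
  have hVK' := (integrable_indicator_iff (hm hKm)).2 hVK
  have hVO' := (integrable_indicator_iff (hm hOm)).2 hVO
  have hadd : Integrable (fun y => (univ ×ˢ O).indicator (fun y => V y.1 (S y)) y +
      (univ ×ˢ symmDiff K O).indicator (fun _ => C) y) (P.prod volume) := hVO'.add hci
  rw [← integral_add hVK' hci, ← integral_add hVO' hci, ← integral_add hadd hpi]
  -- Pointwise comparison in four regions. On O outside the cells the gradient is zero and V lies in
  -- [-C, C]; on the cells outside O, V is at least -C and at most C(‖S‖^p + 1). Thus the lower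
  -- estimate needs only the measure of the symmetric difference, while the upper one also carries
  -- the p-th power outside O.
  constructor
  · refine integral_mono_ae hVO' (hVK'.add hci) ?_
    filter_upwards [hS0, Measure.quasiMeasurePreserving_fst.ae hVC] with y h0 hy
    have hlow := (hy (S y)).1
    have hup := (hy (S y)).2
    have hpos : 0 ≤ C⁻¹ * ‖S y‖ ^ p.toReal := by positivity
    by_cases hyK : y.2 ∈ K <;> by_cases hyO : y.2 ∈ O
    · simp [indicator, hyK, hyO, mem_symmDiff]
    · simp only [indicator, mem_prod, mem_univ, hyK, hyO, mem_symmDiff, not_false_eq_true,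
        not_true_eq_false, and_false, and_true, or_false, if_true, if_false]
      linarith
    · have hz : ‖S y‖ ^ p.toReal = 0 := by rw [h0 hyK, norm_zero, Real.zero_rpow hpr.ne']
      rw [hz] at hup
      simp only [indicator, mem_prod, mem_univ, hyK, hyO, mem_symmDiff, true_and, not_false_eq_true,
        and_self, false_and, false_or, if_true, if_false]
      linarith
    · simp [indicator, hyK, hyO, mem_symmDiff]
  · refine integral_mono_ae hVK' ((hVO'.add hci).add hpi) ?_
    filter_upwards [hS0, Measure.quasiMeasurePreserving_fst.ae hVC] with y h0 hy
    have hlow := (hy (S y)).1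
    have hup := (hy (S y)).2
    have hpos : 0 ≤ C * ‖S y‖ ^ p.toReal := by positivity
    have hz' : (0 : ℝ) ^ p.toReal = 0 := Real.zero_rpow hpr.ne'
    by_cases hyK : y.2 ∈ K <;> by_cases hyO : y.2 ∈ O
    · simp [indicator, hyK, hyO, mem_symmDiff, hz']
    · simp only [indicator, mem_prod, mem_univ, hyK, hyO, mem_symmDiff, not_false_eq_true,
        not_true_eq_false, and_false, and_true, or_false, if_true, if_false, mem_compl_iff]
      linarith
    · have hz : ‖S y‖ ^ p.toReal = 0 := by rw [h0 hyK, norm_zero, Real.zero_rpow hpr.ne']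
      rw [hz, mul_zero] at hlow
      simp only [indicator, mem_prod, mem_univ, hyK, hyO, mem_symmDiff, true_and, not_false_eq_true,
        and_self, false_or, if_true, if_false, mem_compl_iff, not_true_eq_false,
        norm_zero, hz', mul_zero, add_zero]
      linarith
    · simp only [indicator, mem_prod, mem_univ, hyK, hyO, mem_symmDiff, true_and, not_false_eq_true,
        and_self, false_and, or_self, if_true, if_false, mem_compl_iff]
      linarith

/-- The symmetrized gradients converge weakly. -/
theorem tendstoWeakLp_symUnfold [ENNReal.HolderConjugate p q] (hp : 1 < p) (hp' : p ≠ ∞)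
    (hT : IsDynamicalSystem P T) (hB : ∀ i, RepresentsEdge (b i) (B i))
    {ε : ℕ → ℝ} (hε0 : ∀ n, 0 < ε n) (hε : Tendsto ε atTop (𝓝 0))
    {u : ℕ → Ω → IntLattice d → Space d} (hu : ∀ n, IsLatticeField p P O (ε n) (u n))
    {C : ℝ≥0∞} (hC : C ≠ ∞)
    (huC : ∀ n a j, eLpNorm (unfolding T (ε n) fun ω z =>
      discreteGrad (ε n) (fun z' => u n ω z' a) z j) p (P.prod volume) ≤ C)
    {F : Ω × Space d → Matrix (Fin d) (Fin d) ℝ}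
    (hF : ∀ a j, MemLp (fun y => F y a j) p (P.prod volume))
    (huF : ∀ a j, WeakTwoScale q P T atTop ε
      (fun n ω z => discreteGrad (ε n) (fun z' => u n ω z' a) z j) (fun y => F y a j)) (i : Fin k) :
    TendstoWeakLp q (P.prod volume) atTop (fun n y => symUnfold T (ε n) b (u n) y i)
      (fun y => symField T b B F y i) := by
  intro g hg
  have hm : ∀ n a j, MemLp (unfolding T (ε n) fun ω z =>
      discreteGrad (ε n) (fun z' => u n ω z' a) z j) p (P.prod volume) := fun n a j =>
    memLp_unfolding (u := fun ω z => discreteGrad (ε n) (fun z' => u n ω z' a) z j) hT (hε0 n)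
      (memLp_discreteGrad (u := fun ω z => u n ω z a) (memLp_coord (hu n).1 a) j)
  have e1 : ∀ n y, symUnfold T (ε n) b (u n) y i = _ := fun n y =>
    unfolding_discreteSymGrad hT hB (hε0 n) (u n) y i
  have e2 : ∀ y, symField T b B F y i = ∑ a, ∑ w ∈ (B i).support, ∑ j,
      (edgeDirection (b i) a * B i w j) * F (jointShift T 0 (-w) y) a j := fun y => by
    simp only [symField_apply, jointShift_zero_apply]
  simp only [e1, e2, Finset.sum_mul, mul_assoc]
  have hi1 : ∀ n a w j, Integrable (fun y => edgeDirection (b i) a * (B i w j *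
      (unfolding T (ε n) (fun ω z => discreteGrad (ε n) (fun z' => u n ω z' a) z j)
        (jointShift T (ε n) (-w) y) * g y))) (P.prod volume) := fun n a w j =>
    ((integrable_mul_of_conjugate ((hm n a j).comp_measurePreserving
      (measurePreserving_jointShift hT (ε n) (-w))) hg).const_mul _).const_mul _
  have hi2 : ∀ a w j, Integrable (fun y => edgeDirection (b i) a * (B i w j *
      (F (jointShift T 0 (-w) y) a j * g y))) (P.prod volume) := fun a w j =>
    ((integrable_mul_of_conjugate ((hF a j).comp_measurePreserving
      (measurePreserving_jointShift hT 0 (-w))) hg).const_mul _).const_mul _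
  have key : ∀ H : Fin d → IntLattice d → Fin d → Ω × Space d → ℝ,
      (∀ a w j, Integrable (fun y => edgeDirection (b i) a * (B i w j * H a w j y))
        (P.prod volume)) →
      ∫ y, ∑ a, ∑ w ∈ (B i).support, ∑ j, edgeDirection (b i) a * (B i w j * H a w j y)
        ∂P.prod volume =
      ∑ a, ∑ w ∈ (B i).support, ∑ j,
        edgeDirection (b i) a * (B i w j * ∫ y, H a w j y ∂P.prod volume) := fun H hH => by
    rw [integral_finsetSum _ fun a _ => integrable_finsetSum _ fun w _ =>
      integrable_finsetSum _ fun j _ => hH a w j]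
    refine Finset.sum_congr rfl fun a _ => ?_
    rw [integral_finsetSum _ fun w _ => integrable_finsetSum _ fun j _ => hH a w j]
    refine Finset.sum_congr rfl fun w _ => ?_
    rw [integral_finsetSum _ fun j _ => hH a w j]
    refine Finset.sum_congr rfl fun j _ => ?_
    rw [integral_const_mul, integral_const_mul]
  rw [key (fun a w j y => F (jointShift T 0 (-w) y) a j * g y) hi2]
  refine Tendsto.congr (fun n => (key (fun a w j y =>
    unfolding T (ε n) (fun ω z => discreteGrad (ε n) (fun z' => u n ω z' a) z j)
      (jointShift T (ε n) (-w) y) * g y) (hi1 n)).symm) ?_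
  refine tendsto_finsetSum _ fun a _ => tendsto_finsetSum _ fun w _ => tendsto_finsetSum _ fun j _ =>
    Tendsto.const_mul _ (Tendsto.const_mul _ ?_)
  have hw : TendstoWeakLp q (P.prod volume) atTop (fun n => unfolding T (ε n) fun ω z =>
      discreteGrad (ε n) (fun z' => u n ω z' a) z j) (fun y => F y a j) := huF a j
  exact hw.comp_jointShift hp hp' hT (-w) (fun n => hm n a j) hC (fun n => huC n a j) hε g hg

theorem memLp_gradField
    (U : Fin d → Lp (ℝ × Space d) p (P.prod (volume : Measure (Space d))))
    (χ : Fin d → Lp (Space d) p (P.prod (volume : Measure (Space d)))) (i j : Fin d) :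
    MemLp (fun y => gradField U χ y i j) p (P.prod volume) :=
  (memLp_snd_coord (Lp.memLp (U i)) j).add (memLp_coord (Lp.memLp (χ i)) j)

/-- Weak lower semicontinuity: the sublevel sets of a continuous convex functional are closed and
convex, hence weakly closed. Weak convergence of the gradients yields that of the symmetrized
gradients once these are bounded. -/
theorem twoScale_lowerBound [ENNReal.HolderConjugate p q] (hp : 1 < p)
    (hp' : p ≠ ∞) (hd : 1 ≤ d) (hT : IsDynamicalSystem P T) (hK : SatisfiesKorn p b)
    (hB : ∀ i, RepresentsEdge (b i) (B i))
    (hO : IsLipschitzDomain O) (hV : IsConvexIntegrand p P V)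
    {ε : ℕ → ℝ} (hε0 : ∀ n, 0 < ε n) (hε : Tendsto ε atTop (𝓝 0))
    {u : ℕ → Ω → IntLattice d → Space d} (hu : ∀ n, IsLatticeField p P O (ε n) (u n))
    {F : Ω × Space d → Matrix (Fin d) (Fin d) ℝ}
    (hF : ∀ a j, MemLp (fun y => F y a j) p (P.prod volume))
    (huF : ∀ a j, WeakTwoScale q P T atTop ε
      (fun n ω z => discreteGrad (ε n) (fun z' => u n ω z' a) z j) (fun y => F y a j)) :
    (twoScaleEnergy P T V b B O F : EReal) ≤
      liminf (fun n => (discreteEnergy P T V b O (ε n) (u n) : EReal)) atTop := by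
  have hp0 : p ≠ 0 := (zero_lt_one.trans hp).ne'
  have hOfin : volume O ≠ ∞ := hO.isBounded.measure_lt_top.ne
  by_contra! hlt
  -- Along a subsequence the energies stay below c, which is strictly smaller than the asserted
  -- bound. Coercivity then supplies uniform norm bounds along that subsequence.
  obtain ⟨c, hc1, hc2⟩ := EReal.lt_iff_exists_real_btwn.1 hlt
  have hfreq := (frequently_lt_of_liminf_lt (by isBoundedDefault) hc1).and_eventually
    (hε.eventually (gt_mem_nhds one_pos))
  obtain ⟨s, hs, hsP⟩ := extraction_of_frequently_atTop hfreq
  have hEc : ∀ n, discreteEnergy P T V b O (ε (s n)) (u (s n)) ≤ c := fun n => by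
    exact_mod_cast (hsP n).1.le
  have hεs := hε.comp hs.tendsto_atTop
  obtain ⟨C, hC, hbd⟩ := exists_eLpNorm_unfolding_le hT hV hK hd hp0 hp' hO.isOpen hO.isBounded c
  have hSF := memLp_symField (b := b) (B := B) hT hF
  have hSm : ∀ n, MemLp (symUnfold T (ε (s n)) b (u (s n))) p (P.prod volume) := fun n =>
    memLp_symUnfold hT (hε0 _) (hu _).1
  have hweak : ∀ i, TendstoWeakLp q (P.prod volume) atTop
      (fun n y => symUnfold T (ε (s n)) b (u (s n)) y i) (fun y => symField T b B F y i) :=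
    tendstoWeakLp_symUnfold hp hp' hT hB (ε := ε ∘ s) (fun n => hε0 _) hεs (u := u ∘ s)
      (fun n => hu _) hC (fun n a j => (hbd _ (hε0 _) (hsP n).2.le _ (hu _) (hEc n) a).2 j) hF
      (fun a j g hg => (huF a j g hg).comp hs.tendsto_atTop)
  obtain ⟨D, hD, hbounds⟩ := exists_discreteEnergy_bounds hT hV hp0 hp' hO b
  have hvol : Tendsto (fun n => c + D * (volume (symmDiff (cellSet (ε (s n)) b O) O)).toReal) atTop
      (𝓝 c) := by
    have h1 : Tendsto (fun n => ε (s n)) atTop (𝓝[>] 0) :=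
      tendsto_nhdsWithin_iff.2 ⟨hεs, Eventually.of_forall fun n => hε0 _⟩
    have h2 := (ENNReal.tendsto_toReal ENNReal.zero_ne_top).comp
      ((tendsto_volume_symmDiff_cellSet hO b).comp h1)
    simpa using (h2.const_mul D).const_add c
  -- The margin δ absorbs the vanishing error between the discrete energy and the functional on O.
  have hle : ∀ δ > 0, twoScaleEnergy P T V b B O F ≤ c + δ := by
    intro δ hδ
    rw [twoScaleEnergy_eq hV hp0 hp' hOfin hSF, ← domainEnergy_congr hSF.coeFn_toLp]
    have hclosed : IsClosed {S : Lp (EuclideanSpace ℝ (Fin k)) p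
        (P.prod (volume : Measure (Space d))) | domainEnergy P V O S ≤ c + δ} :=
      isClosed_le (continuous_domainEnergy hV hp0 hp' hOfin) continuous_const
    have hconv : Convex ℝ {S : Lp (EuclideanSpace ℝ (Fin k)) p
        (P.prod (volume : Measure (Space d))) | domainEnergy P V O S ≤ c + δ} := by
      simpa using (convexOn_domainEnergy (P := P) hV hp0 hp' hOfin).convex_le (c + δ)
    refine mem_of_tendstoWeakLp (q := q) hp hp'
      (fun i : Fin k => (EuclideanSpace.proj i : EuclideanSpace ℝ (Fin k) →L[ℝ] ℝ))
      (fun i => EuclideanSpace.single i 1) (fun x => ?_) hclosed hconv (l := atTop)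
      (u := fun n => (hSm n).toLp _) ?_ ?_
    · ext i
      simp [Pi.single_apply]
    · refine Eventually.frequently ?_
      filter_upwards [hvol.eventually (gt_mem_nhds (lt_add_of_pos_right c hδ))] with n hn
      rw [domainEnergy_congr (hSm n).coeFn_toLp]
      have := (hbounds _ (hε0 (s n)) (hsP n).2.le _ (hu (s n))).1
      linarith [hEc n]
    · intro i
      have h1 := (hweak i).congr_limit (F' := fun y =>
        (EuclideanSpace.proj i : EuclideanSpace ℝ (Fin k) →L[ℝ] ℝ) (hSF.toLp _ y))
        (hSF.coeFn_toLp.mono fun y hy => by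
          change symField T b B F y i = (EuclideanSpace.proj i) (hSF.toLp _ y)
          rw [hy]
          rfl)
      intro g hg
      refine (h1 g hg).congr fun n => integral_congr_ae ?_
      filter_upwards [(hSm n).coeFn_toLp] with y hy
      rw [hy]
      rfl
  have h := le_of_forall_pos_le_add hle
  exact absurd hc2 (not_lt.2 (by exact_mod_cast h))

end Energy

/-! ### Fields with a prescribed strong two-scale limit -/

/-- A test function, its differences over cells and its difference quotients, at the lattice points
near `x`. -/
theorem exists_cell_bounds {d : ℕ} {η : Space d → ℝ} (hη : ContDiff ℝ (⊤ : ℕ∞) η)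
    (hηc : HasCompactSupport η) :
    ∃ c : ℝ, 0 ≤ c ∧ ∃ K : Set (Space d), IsCompact K ∧ ∀ ε, 0 < ε → ε ≤ 1 → ∀ x,
      |η (latticePoint ε (cellIndex ε x))| ≤ K.indicator (fun _ => c) x ∧
      |η (latticePoint ε (cellIndex ε x)) - η x| ≤ K.indicator (fun _ => c * ε) x ∧
      ∀ j, |η (latticePoint ε (cellIndex ε x + latticeUnit j)) - η x| ≤
          K.indicator (fun _ => c * ε) x ∧
        |(η (latticePoint ε (cellIndex ε x + latticeUnit j)) -
          η (latticePoint ε (cellIndex ε x))) / ε - gradient η x j| ≤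
          K.indicator (fun _ => c * ε) x := by
  obtain ⟨M, hM0, hM⟩ := hηc.exists_nonneg_bound hη.continuous
  obtain ⟨L, hL0, hL⟩ := exists_diffQuotient_bound hη hηc
  obtain ⟨A, hA⟩ := hη.lipschitzWith_of_hasCompactSupport hηc (by simp)
  have hB : ∀ j : Fin d, ∃ A, LipschitzWith A (coordDeriv j η) := fun j =>
    (contDiff_coordDeriv j hη).lipschitzWith_of_hasCompactSupport
      (hasCompactSupport_coordDeriv j hηc) (by simp)
  choose B hB using hB
  -- The summands are the supremum of |η|, its variation over the distance (d + 1)ε, the error of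
  -- difference quotients, and the variation of the derivatives over the distance dε. For ε ≤ 1 all
  -- points involved are within d + 1 of x, so everything vanishes off the neighbourhood K of that
  -- width.
  set c : ℝ := M + A * (d + 1) + L + ∑ j, (B j : ℝ) * d with hc
  have hsum : ∀ j, (B j : ℝ) * d ≤ ∑ j, (B j : ℝ) * d := fun j =>
    Finset.single_le_sum (f := fun j => (B j : ℝ) * d) (fun i _ => by positivity) (Finset.mem_univ j)
  have hsum0 : 0 ≤ ∑ j, (B j : ℝ) * d := Finset.sum_nonneg fun i _ => by positivity
  have hA0 : 0 ≤ (A : ℝ) * (d + 1) := by positivity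
  refine ⟨c, by positivity, Metric.cthickening (d + 1) (tsupport η), IsCompact.cthickening hηc,
    fun ε hε hε1 x => ?_⟩
  set K := Metric.cthickening (d + 1 : ℝ) (tsupport η) with hK
  set s := latticePoint ε (cellIndex ε x) with hs
  have hxs : ‖x - s‖ ≤ d * ε := norm_sub_latticePoint_cellIndex_le hε x
  have hunit : ∀ j, latticePoint ε (cellIndex ε x + latticeUnit j) =
      s + ε • (EuclideanSpace.single j 1 : Space d) := fun j => by
    rw [latticePoint_add, latticePoint_eq_smul ε (latticeUnit j), latticePoint_one_unit]
  have hxt : ∀ j, ‖x - (s + ε • (EuclideanSpace.single j 1 : Space d))‖ ≤ (d + 1) * ε := fun j => by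
    rw [← sub_sub]
    refine (norm_sub_le _ _).trans ?_
    rw [norm_smul, PiLp.norm_single, norm_one, mul_one, Real.norm_of_nonneg hε.le]
    linarith
  have hlip : ∀ y, |η y - η x| ≤ A * ‖x - y‖ := fun y => by
    have := hA.dist_le_mul y x
    rwa [Real.dist_eq, dist_comm, dist_eq_norm] at this
  by_cases hx : x ∈ K
  · simp only [indicator_of_mem hx]
    refine ⟨(hM s).trans (by linarith), ?_, fun j => ⟨?_, ?_⟩⟩
    · refine (hlip s).trans ((mul_le_mul_of_nonneg_left hxs A.coe_nonneg).trans ?_)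
      rw [← mul_assoc]
      refine mul_le_mul_of_nonneg_right ?_ hε.le
      linarith [A.coe_nonneg]
    · rw [hunit]
      refine (hlip _).trans ((mul_le_mul_of_nonneg_left (hxt j) A.coe_nonneg).trans ?_)
      rw [← mul_assoc]
      refine mul_le_mul_of_nonneg_right ?_ hε.le
      linarith
    · rw [hunit, gradient_apply]
      have h1 := hL s (EuclideanSpace.single j 1) ε hε.ne'
      rw [PiLp.norm_single, norm_one, one_pow, mul_one, abs_of_pos hε] at h1
      have h2 : |coordDeriv j η s - coordDeriv j η x| ≤ B j * d * ε := by
        have := (hB j).dist_le_mul s x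
        rw [Real.dist_eq, dist_comm, dist_eq_norm] at this
        refine this.trans ((mul_le_mul_of_nonneg_left hxs (B j).coe_nonneg).trans ?_)
        rw [← mul_assoc]
      have h3 := abs_add_le ((η (s + ε • EuclideanSpace.single j 1) - η s) / ε - coordDeriv j η s)
        (coordDeriv j η s - coordDeriv j η x)
      rw [sub_add_sub_cancel] at h3
      refine h3.trans ((add_le_add h1 h2).trans ?_)
      rw [← add_mul]
      refine mul_le_mul_of_nonneg_right ?_ hε.le
      linarith [hsum j]
  · have hfar : ∀ y, ‖x - y‖ ≤ d + 1 → η y = 0 := fun y hy => by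
      by_contra h
      refine hx (Metric.mem_cthickening_of_dist_le x y _ _ (subset_tsupport _ h) ?_)
      rwa [dist_eq_norm]
    have h0 : η x = 0 := hfar x (by rw [sub_self, norm_zero]; positivity)
    have h1 : η s = 0 := hfar s (hxs.trans (by nlinarith [(Nat.cast_nonneg d : (0 : ℝ) ≤ d)]))
    have h2 : ∀ j, η (s + ε • (EuclideanSpace.single j 1 : Space d)) = 0 := fun j =>
      hfar _ ((hxt j).trans (by nlinarith [(Nat.cast_nonneg d : (0 : ℝ) ≤ d)]))
    have h3 : ∀ j, coordDeriv j η x = 0 := fun j => by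
      by_contra h
      exact hx (Metric.self_subset_cthickening _ (support_coordDeriv_subset j η h))
    simp [indicator_of_notMem hx, hunit, gradient_apply, h0, h1, h2, h3]

/-! ### The closed subspace of strong two-scale limits -/

section Recovery

variable {Ω : Type*} [MeasurableSpace Ω] {P : Measure Ω} [IsProbabilityMeasure P] {d k : ℕ}
  {p q : ℝ≥0∞} [Fact (1 ≤ p)] {T : IntLattice d → Ω → Ω} {O : Set (Space d)} {ε : ℝ}

/-- The unfolding of a scalar field together with its discrete gradient. -/
noncomputable def unfoldJet (T : IntLattice d → Ω → Ω) (ε : ℝ) (u : Ω → IntLattice d → ℝ)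
    (y : Ω × Space d) : ℝ × Space d :=
  (u (unfoldMap T ε y).1 (unfoldMap T ε y).2,
    discreteGrad ε (u (unfoldMap T ε y).1) (unfoldMap T ε y).2)

/-- The scalar `p`-integrable random fields on `ε ℤ^d` that vanish outside `O`. -/
def latticeFields (p : ℝ≥0∞) (P : Measure Ω) (O : Set (Space d)) (ε : ℝ) :
    Set (Ω → IntLattice d → ℝ) :=
  {u | MemLp (fun y : Ω × IntLattice d => u y.1 y.2) p (P.prod (latticeMeasure d ε)) ∧
    ∀ᵐ ω ∂P, ∀ z, latticePoint ε z ∉ O → u ω z = 0}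

theorem memLp_unfoldJet (hT : IsDynamicalSystem P T) (hε : 0 < ε) {u : Ω → IntLattice d → ℝ}
    (hu : MemLp (fun y : Ω × IntLattice d => u y.1 y.2) p (P.prod (latticeMeasure d ε))) :
    MemLp (unfoldJet T ε u) p (P.prod volume) := by
  have h := memLp_prodMk hu fun j => memLp_discreteGrad (ε := ε) hu j
  exact h.comp_measurePreserving (measurePreserving_unfoldMap hT hε)

theorem zero_mem_latticeFields : (0 : Ω → IntLattice d → ℝ) ∈ latticeFields p P O ε :=
  ⟨MemLp.zero, ae_of_all _ fun _ _ _ => rfl⟩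

theorem unfoldJet_zero (y : Ω × Space d) : unfoldJet T ε 0 y = 0 := by
  refine Prod.ext rfl ?_
  ext j
  simp [unfoldJet, discreteGrad]

/-- The fields `X = (U, G)` that are strong two-scale limits of lattice fields and their discrete
gradients. -/
noncomputable def recoverable (hT : IsDynamicalSystem P T) (O : Set (Space d)) (p : ℝ≥0∞)
    [Fact (1 ≤ p)] : Submodule ℝ (Lp (ℝ × Space d) p (P.prod (volume : Measure (Space d)))) where
  carrier := {X | ∀ δ : ℝ≥0∞, 0 < δ → ∀ᶠ ε in 𝓝[>] (0 : ℝ), ∃ u ∈ latticeFields p P O ε,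
    eLpNorm (unfoldJet T ε u - ⇑X) p (P.prod volume) ≤ δ}
  zero_mem' := fun δ _ => by
    refine Eventually.of_forall fun ε => ⟨0, zero_mem_latticeFields, ?_⟩
    have : unfoldJet T ε 0 - ⇑(0 : Lp (ℝ × Space d) p (P.prod (volume : Measure (Space d))))
        =ᵐ[P.prod volume] 0 := by
      filter_upwards [Lp.coeFn_zero (ℝ × Space d) p (P.prod (volume : Measure (Space d)))] with y hy
      rw [Pi.sub_apply, hy, unfoldJet_zero]
      simp
    rw [eLpNorm_congr_ae this, eLpNorm_zero]
    exact zero_le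
  add_mem' := fun {X Y} hX hY δ hδ => by
    have hδ2 : 0 < δ / 2 := ENNReal.half_pos hδ.ne'
    filter_upwards [hX _ hδ2, hY _ hδ2, self_mem_nhdsWithin] with ε ⟨u, hu, hux⟩ ⟨v, hv, hvy⟩ hε
    refine ⟨u + v, ⟨hu.1.add hv.1, ?_⟩, ?_⟩
    · filter_upwards [hu.2, hv.2] with ω h1 h2 z hz
      simp [h1 z hz, h2 z hz]
    have h : unfoldJet T ε (u + v) - ⇑(X + Y) =ᵐ[P.prod volume]
        (unfoldJet T ε u - ⇑X) + (unfoldJet T ε v - ⇑Y) := by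
      filter_upwards [Lp.coeFn_add X Y] with y hy
      simp only [Pi.sub_apply, Pi.add_apply, hy]
      rw [sub_add_sub_comm]
      congr 1
      refine Prod.ext rfl ?_
      ext j
      simp only [unfoldJet, discreteGrad, Pi.add_apply, Prod.snd_add, PiLp.add_apply]
      ring
    rw [eLpNorm_congr_ae h]
    refine (eLpNorm_add_le ((memLp_unfoldJet hT hε hu.1).1.sub (Lp.aestronglyMeasurable X))
      ((memLp_unfoldJet hT hε hv.1).1.sub (Lp.aestronglyMeasurable Y)) Fact.out).trans ?_
    exact (add_le_add hux hvy).trans (ENNReal.add_halves δ).le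
  smul_mem' := fun a X hX δ hδ => by
    have hδa : 0 < δ / (‖a‖ₑ + 1) := ENNReal.div_pos hδ.ne' (by simp)
    filter_upwards [hX _ hδa] with ε ⟨u, hu, hux⟩
    refine ⟨a • u, ⟨hu.1.const_smul a, ?_⟩, ?_⟩
    · filter_upwards [hu.2] with ω h1 z hz
      simp [h1 z hz]
    have h : unfoldJet T ε (a • u) - ⇑(a • X) =ᵐ[P.prod volume] a • (unfoldJet T ε u - ⇑X) := by
      filter_upwards [Lp.coeFn_smul a X] with y hy
      simp only [Pi.sub_apply, Pi.smul_apply, hy]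
      rw [smul_sub]
      congr 1
      refine Prod.ext rfl ?_
      ext j
      simp only [unfoldJet, discreteGrad, Pi.smul_apply, Prod.smul_snd, PiLp.smul_apply, smul_eq_mul]
      ring
    rw [eLpNorm_congr_ae h, eLpNorm_const_smul]
    calc ‖a‖ₑ * eLpNorm (unfoldJet T ε u - ⇑X) p (P.prod volume)
        ≤ (‖a‖ₑ + 1) * (δ / (‖a‖ₑ + 1)) := mul_le_mul' le_self_add hux
      _ ≤ δ := ENNReal.mul_div_le

/-- Recoverability asks only for approximation up to each δ, for all small ε. An approximation of a
nearby Y up to δ/2 therefore also approximates X, and no diagonal sequence is needed. -/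
theorem isClosed_recoverable (hT : IsDynamicalSystem P T) (O : Set (Space d)) :
    IsClosed (recoverable hT O p :
      Set (Lp (ℝ × Space d) p (P.prod (volume : Measure (Space d))))) := by
  refine isClosed_of_closure_subset fun X hX δ hδ => ?_
  have hδ2 : 0 < δ / 2 := ENNReal.half_pos hδ.ne'
  obtain ⟨Y, hY, hXY⟩ := EMetric.mem_closure_iff.1 hX _ hδ2
  filter_upwards [hY _ hδ2, self_mem_nhdsWithin] with ε ⟨u, hu, huy⟩ hε
  refine ⟨u, hu, ?_⟩
  have h : unfoldJet T ε u - ⇑X = (unfoldJet T ε u - ⇑Y) + (⇑Y - ⇑X) := by abel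
  rw [h]
  refine (eLpNorm_add_le ((memLp_unfoldJet hT hε hu.1).1.sub (Lp.aestronglyMeasurable Y))
      ((Lp.aestronglyMeasurable Y).sub (Lp.aestronglyMeasurable X)) Fact.out).trans ?_
  rw [edist_comm, Lp.edist_def] at hXY
  exact (add_le_add huy hXY.le).trans (ENNReal.add_halves δ).le

/-- A bound of order `ε` makes a family of fields a recovery family. -/
theorem mem_recoverable_of_bound (hT : IsDynamicalSystem P T) (hp0 : p ≠ 0) (hp' : p ≠ ∞)
    {X : Lp (ℝ × Space d) p (P.prod (volume : Measure (Space d)))}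
    {u : ℝ → Ω → IntLattice d → ℝ} (hu : ∀ ε, 0 < ε → u ε ∈ latticeFields p P O ε)
    {Φ : Ω → ℝ} (hΦ : MemLp Φ p P) {K : Set (Space d)} (hK : IsCompact K) {c : ℝ} (hc : 0 ≤ c)
    (h : ∀ ε, 0 < ε → ε ≤ 1 → ∀ᵐ y ∂P.prod (volume : Measure (Space d)),
      ‖unfoldJet T ε (u ε) y - X y‖ ≤ ‖Φ y.1‖ * K.indicator (fun _ => c * ε) y.2) :
    X ∈ recoverable hT O p := by
  intro δ hδ
  have hlim : Tendsto (fun ε : ℝ => eLpNorm Φ p P *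
      (volume K ^ p.toReal⁻¹ * ENNReal.ofReal (c * ε))) (𝓝[>] 0) (𝓝 0) := by
    have h1 : Tendsto (fun ε : ℝ => ENNReal.ofReal (c * ε)) (𝓝[>] 0) (𝓝 0) := by
      have : Tendsto (fun ε : ℝ => ENNReal.ofReal (c * ε)) (𝓝 0) (𝓝 (ENNReal.ofReal (c * 0))) :=
        (ENNReal.continuous_ofReal.comp (continuous_const.mul continuous_id)).tendsto 0
      rw [mul_zero, ENNReal.ofReal_zero] at this
      exact this.mono_left nhdsWithin_le_nhds
    have hK' : volume K ^ p.toReal⁻¹ ≠ ∞ :=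
      ENNReal.rpow_ne_top_of_nonneg (by positivity) hK.measure_lt_top.ne
    have h2 := ENNReal.Tendsto.const_mul h1 (Or.inr hK')
    have h3 := ENNReal.Tendsto.const_mul h2 (Or.inr hΦ.eLpNorm_ne_top)
    simpa using h3
  filter_upwards [hlim.eventually (gt_mem_nhds hδ), Ioc_mem_nhdsGT (one_pos (α := ℝ))] with ε h1 hε
  refine ⟨u ε, hu ε hε.1, le_trans ?_ h1.le⟩
  have hKm : AEStronglyMeasurable (K.indicator fun _ => c * ε) (volume : Measure (Space d)) :=
    (stronglyMeasurable_const.indicator hK.isClosed.measurableSet).aestronglyMeasurable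
  have hnn : ∀ x, 0 ≤ K.indicator (fun _ => c * ε) x := fun x =>
    indicator_nonneg (fun _ _ => mul_nonneg hc hε.1.le) x
  refine (eLpNorm_prod_le (C := 1) hp0 hp' hΦ.1 hKm (h := unfoldJet T ε (u ε) - ⇑X) ?_).trans ?_
  · filter_upwards [h ε hε.1 hε.2] with y hy
    rw [Real.norm_of_nonneg (hnn y.2), NNReal.coe_one, one_mul]
    exact hy
  · rw [ENNReal.coe_one, one_mul]
    refine mul_le_mul_right (eLpNorm_le_of_abs_le_of_support (fun x => ?_) fun x hx => ?_) _
    · rw [Real.norm_of_nonneg (hnn x)]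
      exact indicator_le_self' (fun _ _ => mul_nonneg hc hε.1.le) x
    · exact indicator_of_notMem hx _

/-- Restrictions of test functions to the lattice. -/
theorem memLp_comp_latticePoint {η : Space d → ℝ} (hη : Continuous η) (hηc : HasCompactSupport η)
    (hε : 0 < ε) : MemLp (fun z => η (latticePoint ε z)) p (latticeMeasure d ε) := by
  obtain ⟨M, hM0, hM⟩ := hηc.exists_nonneg_bound hη
  refine ⟨(measurable_of_countable _).aestronglyMeasurable, ?_⟩
  refine (eLpNorm_le_of_abs_le_of_support (fun z => hM _)
    (K := {z | latticePoint ε z ∈ tsupport η}) fun z hz => image_eq_zero_of_notMem_tsupport hz).trans_lt ?_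
  refine ENNReal.mul_lt_top (ENNReal.rpow_lt_top_of_nonneg (by positivity) ?_) ENNReal.ofReal_lt_top
  rw [latticeMeasure, Measure.smul_apply, smul_eq_mul]
  exact ENNReal.mul_ne_top ENNReal.ofReal_ne_top
    (Measure.count_apply_lt_top.2 (finite_latticePoint_mem hηc.isCompact.isBounded hε)).ne

theorem mul_test_mem_latticeFields (hp0 : p ≠ 0) (hp' : p ≠ ∞) {φ : Ω → ℝ} (hφ : MemLp φ p P)
    {η : Space d → ℝ} (hη : Continuous η) (hηc : HasCompactSupport η) (hηO : tsupport η ⊆ O)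
    (hε : 0 < ε) : (fun ω z => φ ω * η (latticePoint ε z)) ∈ latticeFields p P O ε := by
  refine ⟨hφ.mul_prod hp0 hp' (memLp_comp_latticePoint hη hηc hε), ae_of_all _ fun ω z hz => ?_⟩
  simp only
  rw [image_eq_zero_of_notMem_tsupport fun h => hz (hηO h), mul_zero]

/-- The map (ω, z) ↦ (T_z ω, z) is a measure-preserving skew product, so inserting the action keeps
integrability. The lattice being countable, one null set suffices for the vanishing outside O. -/
theorem comp_action_mem_latticeFields (hT : IsDynamicalSystem P T) {u : Ω → IntLattice d → ℝ}
    (hu : u ∈ latticeFields p P O ε) : (fun ω z => u (T z ω) z) ∈ latticeFields p P O ε := by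
  constructor
  · have h1 : MeasurePreserving (fun y : IntLattice d × Ω => (y.1, T y.1 y.2))
        ((latticeMeasure d ε).prod P) ((latticeMeasure d ε).prod P) :=
      (MeasurePreserving.id _).skew_product (g := fun z ω => T z ω) hT.measurable_uncurry
        (ae_of_all _ fun z => (hT.measurePreserving z).map_eq)
    have h2 : MeasurePreserving (fun y : Ω × IntLattice d => (T y.2 y.1, y.2))
        (P.prod (latticeMeasure d ε)) (P.prod (latticeMeasure d ε)) :=
      Measure.measurePreserving_swap.comp (h1.comp Measure.measurePreserving_swap)
    exact hu.1.comp_measurePreserving h2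
  · have : ∀ᵐ ω ∂P, ∀ z, ∀ z', latticePoint ε z' ∉ O → u (T z ω) z' = 0 :=
      ae_all_iff.2 fun z => (hT.measurePreserving z).quasiMeasurePreserving.ae hu.2
    exact this.mono fun ω h z hz => h z z hz

end Recovery

/-! ### Recovery fields -/

/-- A sequence converging in L^p has a subsequence converging almost everywhere, and vanishing off A
survives pointwise limits. -/
theorem isClosed_setOf_ae_eq_zero {α E : Type*} [MeasurableSpace α] {μ : Measure α}
    [NormedAddCommGroup E] {p : ℝ≥0∞} [Fact (1 ≤ p)] (A : Set α) :
    IsClosed {f : Lp E p μ | ∀ᵐ y ∂μ, y ∉ A → f y = 0} := by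
  refine isClosed_of_closure_subset fun f hf => ?_
  obtain ⟨g, hg, hgf⟩ := mem_closure_iff_seq_limit.1 hf
  obtain ⟨ns, -, hns⟩ := (tendstoInMeasure_of_tendsto_Lp hgf).exists_seq_tendsto_ae
  filter_upwards [hns, ae_all_iff.2 hg] with y h1 h2 hy
  refine tendsto_nhds_unique h1 ?_
  simp only [h2 _ hy]
  exact tendsto_const_nhds

section Recovery

variable {Ω : Type*} [MeasurableSpace Ω] {P : Measure Ω} [IsProbabilityMeasure P] {d k : ℕ}
  {p q : ℝ≥0∞} [Fact (1 ≤ p)] {T : IntLattice d → Ω → Ω} {O : Set (Space d)} {ε : ℝ}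

/-- The elements of `L^p` that vanish off `A`. -/
noncomputable def vanishingSubmodule {α : Type*} [MeasurableSpace α] (μ : Measure α) (E : Type*)
    [NormedAddCommGroup E] [NormedSpace ℝ E] (p : ℝ≥0∞) [Fact (1 ≤ p)] (A : Set α) :
    Submodule ℝ (Lp E p μ) where
  carrier := {f | ∀ᵐ y ∂μ, y ∉ A → f y = 0}
  zero_mem' := by
    filter_upwards [Lp.coeFn_zero E p μ] with y hy _
    rw [hy, Pi.zero_apply]
  add_mem' := fun {f g} hf hg => by
    filter_upwards [hf, hg, Lp.coeFn_add f g] with y h1 h2 h3 hy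
    rw [h3, Pi.add_apply, h1 hy, h2 hy, add_zero]
  smul_mem' := fun a f hf => by
    filter_upwards [hf, Lp.coeFn_smul a f] with y h1 h2 hy
    rw [h2, Pi.smul_apply, h1 hy, smul_zero]

theorem SobolevZero.ae_eq_zero {f : Lp (ℝ × Space d) p (volume : Measure (Space d))}
    (hf : f ∈ SobolevZero p O) : ∀ᵐ x, x ∉ O → f x = 0 := by
  refine closure_minimal ?_ (isClosed_setOf_ae_eq_zero O) hf
  rintro f ⟨η, hη, hηc, hηO, hf⟩
  filter_upwards [hf] with x hx hxO
  have h1 : x ∉ tsupport η := fun h => hxO (hηO h)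
  rw [hx, image_eq_zero_of_notMem_tsupport h1]
  refine Prod.ext rfl ?_
  ext j
  rw [gradient_apply]
  by_contra h
  exact h1 (support_coordDeriv_subset j η h)

theorem InvSobolev.ae_eq_zero {W : Lp (ℝ × Space d) p (P.prod (volume : Measure (Space d)))}
    (hW : W ∈ InvSobolev p P T O) :
    ∀ᵐ y ∂P.prod (volume : Measure (Space d)), y.2 ∉ O → W y = 0 := by
  have h : W ∈ vanishingSubmodule (P.prod (volume : Measure (Space d))) (ℝ × Space d) p
      (Prod.snd ⁻¹' O) := by
    refine closure_minimal (SetLike.coe_subset_coe.2 (Submodule.span_le.2 ?_))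
      (isClosed_setOf_ae_eq_zero _) hW
    rintro f ⟨φ, -, η, hη, hf⟩
    filter_upwards [hf, Measure.quasiMeasurePreserving_snd.ae (SobolevZero.ae_eq_zero hη)]
      with y h1 h2 hy
    rw [h1, h2 hy, smul_zero]
  exact h

theorem PotTensor.ae_eq_zero {χ : Lp (Space d) p (P.prod (volume : Measure (Space d)))}
    (hχ : χ ∈ PotTensor p P T O) :
    ∀ᵐ y ∂P.prod (volume : Measure (Space d)), y.2 ∉ O → χ y = 0 := by
  have h : χ ∈ vanishingSubmodule (P.prod (volume : Measure (Space d))) (Space d) p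
      (Prod.snd ⁻¹' O) := by
    refine closure_minimal (SetLike.coe_subset_coe.2 (Submodule.span_le.2 ?_))
      (isClosed_setOf_ae_eq_zero _) hχ
    rintro f ⟨ψ, -, η, hη, hf⟩
    filter_upwards [hf, Measure.quasiMeasurePreserving_snd.ae hη] with y h1 h2 hy
    rw [h1, h2 hy, zero_smul]
  exact h

/-- Test functions are dense in `L^p(O)`. -/
theorem lpDomain_subset_closure [ENNReal.HolderConjugate p q] (hp : 1 < p) (hp' : p ≠ ∞)
    (hO : IsOpen O) {η : Lp ℝ p (volume : Measure (Space d))} (hη : η ∈ LpDomain p O) :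
    η ∈ (Submodule.span ℝ {f : Lp ℝ p (volume : Measure (Space d)) | ∃ ζ : Space d → ℝ,
      ContDiff ℝ (⊤ : ℕ∞) ζ ∧ HasCompactSupport ζ ∧ tsupport ζ ⊆ O ∧
        f =ᵐ[volume] ζ}).topologicalClosure := by
  have hq : 1 < q := (ENNReal.HolderConjugate.lt_top_iff_one_lt p q).1 hp'.lt_top
  refine mem_of_forall_annihilator (q := q) (κ := Unit) hp hp'
    (fun _ => ContinuousLinearMap.id ℝ ℝ) (fun _ => 1) (fun x => by simp) _
    (Submodule.isClosed_topologicalClosure _) η fun g hg hann => ?_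
  have h0 : ∀ᵐ x, x ∈ O → g () x = 0 := by
    refine hO.ae_eq_zero_of_integral_contDiff_smul_eq_zero
      (((hg ()).locallyIntegrable hq.le).locallyIntegrableOn O) fun ζ hζ hζc hζO => ?_
    have hm := hζ.continuous.memLp_space (p := p) hζc
    have := hann (hm.toLp ζ) (Submodule.le_topologicalClosure _
      (Submodule.subset_span ⟨ζ, hζ, hζc, hζO, hm.coeFn_toLp⟩))
    rw [Fintype.sum_unique] at this
    rw [← this]
    refine integral_congr_ae ?_
    filter_upwards [hm.coeFn_toLp] with x hx
    rw [ContinuousLinearMap.id_apply, hx]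
    rfl
  rw [Fintype.sum_unique]
  refine integral_eq_zero_of_ae ?_
  filter_upwards [h0, hη] with x h1 h2
  by_cases hx : x ∈ O
  · simp [h1 hx]
  · simp [h2 hx]

theorem norm_prod_le_sum (x : ℝ × Space d) : ‖x‖ ≤ |x.1| + ∑ j, |x.2 j| := by
  refine max_le ?_ ((norm_le_sum_abs _).trans ?_)
  · rw [Real.norm_eq_abs]
    linarith [Finset.sum_nonneg fun (j : Fin d) (_ : j ∈ Finset.univ) => abs_nonneg (x.2 j)]
  · linarith [abs_nonneg x.1]

/-- The field φ(ω)η(x) recovers the pair: unfolding does not change the invariant φ, so the only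
error is the discretization of η and ∇η, of order ε. -/
theorem invariant_test_mem_recoverable (hT : IsDynamicalSystem P T) (hp' : p ≠ ∞)
    {φ : Ω → ℝ} (hφ : MemLp φ p P) (hinv : ∀ z, ∀ᵐ ω ∂P, φ (T z ω) = φ ω)
    {η : Space d → ℝ} (hη : ContDiff ℝ (⊤ : ℕ∞) η) (hηc : HasCompactSupport η)
    (hηO : tsupport η ⊆ O) {X : Lp (ℝ × Space d) p (P.prod (volume : Measure (Space d)))}
    (hX : ∀ᵐ y ∂P.prod (volume : Measure (Space d)), X y = φ y.1 • (η y.2, gradient η y.2)) :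
    X ∈ recoverable hT O p := by
  have hp0 : p ≠ 0 := (zero_lt_one.trans_le Fact.out).ne'
  obtain ⟨c, hc, K, hK, hb⟩ := exists_cell_bounds hη hηc
  refine mem_recoverable_of_bound hT hp0 hp'
    (fun ε hε => mul_test_mem_latticeFields hp0 hp' hφ hη.continuous hηc hηO hε)
    (hφ.const_mul (1 + d : ℝ)) hK hc fun ε hε hε1 => ?_
  filter_upwards [hX, Measure.quasiMeasurePreserving_fst.ae (ae_all_iff.2 hinv)] with y h1 h2
  obtain ⟨-, hb1, hb2⟩ := hb ε hε hε1 y.2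
  rw [h1]
  refine (norm_prod_le_sum _).trans ?_
  have e1 : (unfoldJet T ε (fun ω z => φ ω * η (latticePoint ε z)) y -
      φ y.1 • (η y.2, gradient η y.2)).1 =
      φ y.1 * (η (latticePoint ε (cellIndex ε y.2)) - η y.2) := by
    simp only [unfoldJet, unfoldMap, h2, Prod.fst_sub, Prod.smul_fst, smul_eq_mul]
    ring
  have e2 : ∀ j, (unfoldJet T ε (fun ω z => φ ω * η (latticePoint ε z)) y -
      φ y.1 • (η y.2, gradient η y.2)).2 j =
      φ y.1 * ((η (latticePoint ε (cellIndex ε y.2 + latticeUnit j)) -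
          η (latticePoint ε (cellIndex ε y.2))) / ε - gradient η y.2 j) := fun j => by
    simp only [unfoldJet, unfoldMap, discreteGrad, h2, Prod.snd_sub, Prod.smul_snd, smul_eq_mul,
      PiLp.sub_apply, PiLp.smul_apply]
    ring
  simp only [e1, e2, abs_mul]
  calc |φ y.1| * |η (latticePoint ε (cellIndex ε y.2)) - η y.2| +
        ∑ j, |φ y.1| * |(η (latticePoint ε (cellIndex ε y.2 + latticeUnit j)) -
          η (latticePoint ε (cellIndex ε y.2))) / ε - gradient η y.2 j|
      ≤ |φ y.1| * K.indicator (fun _ => c * ε) y.2 +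
        ∑ _j : Fin d, |φ y.1| * K.indicator (fun _ => c * ε) y.2 := by
        gcongr with j
        exact (hb2 j).2
    _ = ‖(1 + d : ℝ) * φ y.1‖ * K.indicator (fun _ => c * ε) y.2 := by
        rw [Finset.sum_const, Finset.card_univ, Fintype.card_fin, nsmul_eq_mul, norm_mul,
          Real.norm_of_nonneg (by positivity : (0 : ℝ) ≤ 1 + d), Real.norm_eq_abs]
        ring

/-- The corrector εφ(T_{x/ε}ω)η(x) is of order ε in L^p. In its difference quotient the factor ε
cancels, leaving φ(T_{e_j}ω)η(x + εe_j) - φ(ω)η(x) at lattice points after unfolding, which is η Dφ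
up to the variation of η. -/
theorem horizontalDeriv_test_mem_recoverable (hT : IsDynamicalSystem P T) (hp' : p ≠ ∞)
    {φ : Ω → ℝ} (hφ : MemLp φ p P)
    {η : Space d → ℝ} (hη : ContDiff ℝ (⊤ : ℕ∞) η) (hηc : HasCompactSupport η)
    (hηO : tsupport η ⊆ O) {X : Lp (ℝ × Space d) p (P.prod (volume : Measure (Space d)))}
    (hX : ∀ᵐ y ∂P.prod (volume : Measure (Space d)),
      X y = (0, η y.2 • horizontalDeriv T φ y.1)) :
    X ∈ recoverable hT O p := by
  have hp0 : p ≠ 0 := (zero_lt_one.trans_le Fact.out).ne'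
  obtain ⟨c, hc, K, hK, hb⟩ := exists_cell_bounds hη hηc
  -- The random factor of the error: one |φ| from the function, one from each of the d difference
  -- quotients, and the shifted |φ| from each of these quotients.
  have hΦ : MemLp (fun ω => (1 + d : ℝ) * |φ ω| + ∑ j, |φ (T (latticeUnit j) ω)|) p P :=
    (hφ.abs.const_mul _).add (memLp_finsetSum _ fun j _ =>
      (hφ.comp_measurePreserving (hT.measurePreserving (latticeUnit j))).abs)
  refine mem_recoverable_of_bound hT hp0 hp'
    (u := fun ε ω z => ε * φ (T z ω) * η (latticePoint ε z))
    (fun ε hε => comp_action_mem_latticeFields hT (u := fun ω z => ε * φ ω * η (latticePoint ε z))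
      (mul_test_mem_latticeFields hp0 hp' (hφ.const_mul ε) hη.continuous hηc hηO hε))
    hΦ hK hc fun ε hε hε1 => ?_
  filter_upwards [hX] with y h1
  obtain ⟨hb0, hb1, hb2⟩ := hb ε hε hε1 y.2
  rw [h1]
  refine (norm_prod_le_sum _).trans ?_
  set I := K.indicator (fun _ => c * ε) y.2 with hI
  have hI0 : 0 ≤ I := indicator_nonneg (fun _ _ => mul_nonneg hc hε.le) _
  have hIε : ε * K.indicator (fun _ => c) y.2 = I := by
    by_cases hy : y.2 ∈ K
    · simp [hI, hy, mul_comm]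
    · simp [hI, hy]
  have e1 : (unfoldJet T ε (fun ω z => ε * φ (T z ω) * η (latticePoint ε z)) y -
      ((0 : ℝ), η y.2 • horizontalDeriv T φ y.1)).1 =
      φ y.1 * (ε * η (latticePoint ε (cellIndex ε y.2))) := by
    simp only [unfoldJet, unfoldMap, hT.apply_neg, Prod.fst_sub]
    ring
  have e2 : ∀ j, (unfoldJet T ε (fun ω z => ε * φ (T z ω) * η (latticePoint ε z)) y -
      ((0 : ℝ), η y.2 • horizontalDeriv T φ y.1)).2 j =
      φ (T (latticeUnit j) y.1) *
        (η (latticePoint ε (cellIndex ε y.2 + latticeUnit j)) - η y.2) -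
      φ y.1 * (η (latticePoint ε (cellIndex ε y.2)) - η y.2) := fun j => by
    have h3 : T (cellIndex ε y.2 + latticeUnit j) (T (-cellIndex ε y.2) y.1) =
        T (latticeUnit j) y.1 := by
      rw [add_comm, hT.add, hT.apply_neg]
    simp only [unfoldJet, unfoldMap, discreteGrad, h3, hT.apply_neg, Prod.snd_sub, smul_eq_mul,
      PiLp.sub_apply, PiLp.smul_apply, horizontalDeriv]
    field_simp
    ring
  simp only [e1, e2]
  calc |φ y.1 * (ε * η (latticePoint ε (cellIndex ε y.2)))| +
        ∑ j, |φ (T (latticeUnit j) y.1) *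
          (η (latticePoint ε (cellIndex ε y.2 + latticeUnit j)) - η y.2) -
            φ y.1 * (η (latticePoint ε (cellIndex ε y.2)) - η y.2)|
      ≤ |φ y.1| * I + ∑ j, (|φ (T (latticeUnit j) y.1)| * I + |φ y.1| * I) := by
        refine add_le_add ?_ (Finset.sum_le_sum fun j _ => (abs_sub _ _).trans ?_)
        · rw [abs_mul, abs_mul, abs_of_pos hε, ← hIε]
          gcongr
        · rw [abs_mul, abs_mul]
          gcongr
          exact (hb2 j).1
    _ = ((1 + d : ℝ) * |φ y.1| + ∑ j, |φ (T (latticeUnit j) y.1)|) * I := by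
        rw [Finset.sum_add_distrib, Finset.sum_const, Finset.card_univ, Fintype.card_fin,
          nsmul_eq_mul, ← Finset.sum_mul]
        ring
    _ = _ := by
        rw [Real.norm_of_nonneg]
        positivity

/-- By linearity and closedness it suffices to treat products; for fixed φ continuity of the tensor
product reduces the Sobolev factor to test functions. -/
theorem invSobolev_le_recoverable (hT : IsDynamicalSystem P T) (hp' : p ≠ ∞)
    {W : Lp (ℝ × Space d) p (P.prod (volume : Measure (Space d)))} (hW : W ∈ InvSobolev p P T O) :
    W ∈ recoverable hT O p := by
  have hp0 : p ≠ 0 := (zero_lt_one.trans_le Fact.out).ne'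
  refine closure_minimal (SetLike.coe_subset_coe.2 (Submodule.span_le.2 ?_))
    (isClosed_recoverable hT O) hW
  rintro X ⟨φ, hφ, f, hf, hX⟩
  let t := tensorLp (μ := P) (ν := (volume : Measure (Space d))) hp0 hp'
    (ContinuousLinearMap.lsmul ℝ ℝ : ℝ →L[ℝ] (ℝ × Space d) →L[ℝ] (ℝ × Space d)) φ
  have ht : ∀ f, t f =ᵐ[P.prod volume] fun y => φ y.1 • f y.2 := fun f =>
    coeFn_tensorLp hp0 hp' _ _ _
  have hXt : X = t f := Lp.ext (EventuallyEq.trans hX (ht f).symm)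
  rw [hXt]
  have hcl := (isClosed_recoverable (p := p) hT O).preimage t.continuous
  refine closure_minimal ?_ hcl hf
  rintro f ⟨η, hη, hηc, hηO, hfη⟩
  refine invariant_test_mem_recoverable hT hp' (Lp.memLp φ) hφ hη hηc hηO ?_
  filter_upwards [ht f, Measure.quasiMeasurePreserving_snd.ae hfη] with y h1 h2
  rw [h1, h2]

/-- Density is used once in each factor: with ψ fixed, η is approximated by test functions supported
in O; with the test function fixed, ψ is approximated by horizontal derivatives. -/
theorem potTensor_le_recoverable [ENNReal.HolderConjugate p q] (hp : 1 < p)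
    (hT : IsDynamicalSystem P T) (hp' : p ≠ ∞) (hO : IsOpen O)
    {χ : Lp (Space d) p (P.prod (volume : Measure (Space d)))} (hχ : χ ∈ PotTensor p P T O) :
    gradInr p P d χ ∈ recoverable hT O p := by
  have hp0 : p ≠ 0 := (zero_lt_one.trans_le Fact.out).ne'
  have hcl := (isClosed_recoverable (p := p) hT O).preimage (gradInr p P d).continuous
  have hle : Submodule.span ℝ {f : Lp (Space d) p (P.prod (volume : Measure (Space d))) |
      ∃ ψ ∈ LpPot p P T, ∃ η ∈ LpDomain p O,
        ∀ᵐ y ∂P.prod (volume : Measure (Space d)), f y = η y.2 • ψ y.1} ≤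
      (recoverable hT O p).comap (gradInr p P d).toLinearMap := by
    refine Submodule.span_le.2 ?_
    rintro X ⟨ψ, hψ, η, hη, hX⟩
    let t := tensorLp (μ := P) (ν := (volume : Measure (Space d))) hp0 hp'
      ((ContinuousLinearMap.lsmul ℝ ℝ).flip : Space d →L[ℝ] ℝ →L[ℝ] Space d)
    have ht : ∀ ψ η, t ψ η =ᵐ[P.prod volume] fun y => η y.2 • ψ y.1 := fun ψ η =>
      coeFn_tensorLp hp0 hp' _ _ _
    have hXt : X = t ψ η := Lp.ext (EventuallyEq.trans hX (ht ψ η).symm)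
    rw [hXt]
    have h1 : (Submodule.span ℝ {f : Lp ℝ p (volume : Measure (Space d)) | ∃ ζ : Space d → ℝ,
        ContDiff ℝ (⊤ : ℕ∞) ζ ∧ HasCompactSupport ζ ∧ tsupport ζ ⊆ O ∧
          f =ᵐ[volume] ζ} : Set (Lp ℝ p (volume : Measure (Space d)))) ⊆
        ((recoverable hT O p).comap ((gradInr p P d).comp (t ψ)).toLinearMap :
          Set (Lp ℝ p (volume : Measure (Space d)))) := by
      refine SetLike.coe_subset_coe.2 (Submodule.span_le.2 ?_)
      rintro f ⟨ζ, hζ, hζc, hζO, hf⟩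
      refine closure_minimal ?_ (hcl.preimage (t.flip f).continuous) hψ
      rintro ψ ⟨φ, hφ⟩
      refine horizontalDeriv_test_mem_recoverable hT hp' (Lp.memLp φ) hζ hζc hζO ?_
      filter_upwards [coeFn_gradInr (t.flip f ψ), ht ψ f,
        Measure.quasiMeasurePreserving_snd.ae hf, Measure.quasiMeasurePreserving_fst.ae hφ]
        with y h1 h2 h3 h4
      rw [h1]
      refine Prod.ext rfl ?_
      change t ψ f y = _
      rw [h2, h3, h4]
      rfl
    exact closure_minimal h1 (hcl.preimage (t ψ).continuous)
      (lpDomain_subset_closure (q := q) hp hp' hO hη)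
  exact closure_minimal (SetLike.coe_subset_coe.2 hle) hcl hχ

/-- Near-minimizers of the distance form a recovery family. -/
theorem exists_recovery (hT : IsDynamicalSystem P T)
    {X : Lp (ℝ × Space d) p (P.prod (volume : Measure (Space d)))} (hX : X ∈ recoverable hT O p) :
    ∃ u : ℝ → Ω → IntLattice d → ℝ, (∀ ε > 0, u ε ∈ latticeFields p P O ε) ∧
      Tendsto (fun ε => eLpNorm (unfoldJet T ε (u ε) - ⇑X) p (P.prod volume)) (𝓝[>] 0) (𝓝 0) := by
  set S : ℝ → Set ℝ≥0∞ := fun ε =>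
    (fun u => eLpNorm (unfoldJet T ε u - ⇑X) p (P.prod volume)) '' latticeFields p P O ε with hS
  have h0 : ∀ ε, sInf (S ε) ≠ ∞ := fun ε => by
    refine ne_top_of_le_ne_top (Lp.eLpNorm_ne_top X)
      (sInf_le ⟨0, zero_mem_latticeFields, ?_⟩)
    have : unfoldJet T ε 0 - ⇑X = -⇑X := by
      funext y
      rw [Pi.sub_apply, unfoldJet_zero, zero_sub, Pi.neg_apply]
    simp only [this, eLpNorm_neg]
  have h1 : ∀ ε : ℝ, ∃ u : Ω → IntLattice d → ℝ, 0 < ε → u ∈ latticeFields p P O ε ∧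
      eLpNorm (unfoldJet T ε u - ⇑X) p (P.prod volume) ≤ sInf (S ε) + ENNReal.ofReal ε := by
    intro ε
    by_cases hε : 0 < ε
    · obtain ⟨-, ⟨u, hu, rfl⟩, hlt⟩ := sInf_lt_iff.1
        (ENNReal.lt_add_right (h0 ε) (ENNReal.ofReal_pos.2 hε).ne')
      exact ⟨u, fun _ => ⟨hu, hlt.le⟩⟩
    · exact ⟨0, fun h => absurd h hε⟩
  choose u hu using h1
  refine ⟨u, fun ε hε => (hu ε hε).1, ?_⟩
  -- Recoverability says precisely that the distance to the lattice fields tends to 0; the slack ε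
  -- in the choice of u tends to 0 as well.
  have h2 : Tendsto (fun ε => sInf (S ε)) (𝓝[>] 0) (𝓝 0) := by
    rw [ENNReal.tendsto_nhds_zero]
    intro δ hδ
    filter_upwards [hX δ hδ] with ε ⟨v, hv, hvδ⟩
    exact (sInf_le (mem_image_of_mem _ hv)).trans hvδ
  have h3 : Tendsto (fun ε : ℝ => ENNReal.ofReal ε) (𝓝[>] 0) (𝓝 0) := by
    have := ENNReal.continuous_ofReal.tendsto 0
    rw [ENNReal.ofReal_zero] at this
    exact this.mono_left nhdsWithin_le_nhds
  have h4 := h2.add h3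
  rw [add_zero] at h4
  refine tendsto_of_tendsto_of_tendsto_of_le_of_le' tendsto_const_nhds h4
    (Eventually.of_forall fun _ => zero_le) ?_
  filter_upwards [self_mem_nhdsWithin] with ε hε
  exact (hu ε hε).2

end Recovery

/-! ### The upper bound -/

section UpperBound

variable {Ω : Type*} [MeasurableSpace Ω] {P : Measure Ω} [IsProbabilityMeasure P] {d k : ℕ}
  {p q : ℝ≥0∞} [Fact (1 ≤ p)] {T : IntLattice d → Ω → Ω} {O : Set (Space d)} {ε : ℝ}
  {b : Fin k → IntLattice d} {B : Fin k → IntLattice d →₀ Space d}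
  {V : Ω → EuclideanSpace ℝ (Fin k) → ℝ}

theorem tendsto_eLpNorm_sum {α κ ι : Type*} [MeasurableSpace α] {μ : Measure α} {l : Filter ι}
    (s : Finset κ) {f : κ → ι → α → ℝ} (hf : ∀ᶠ n in l, ∀ a ∈ s, AEStronglyMeasurable (f a n) μ)
    (h : ∀ a ∈ s, Tendsto (fun n => eLpNorm (f a n) p μ) l (𝓝 0)) :
    Tendsto (fun n => eLpNorm (∑ a ∈ s, f a n) p μ) l (𝓝 0) := by
  have h1 := tendsto_finsetSum s h
  rw [Finset.sum_const_zero] at h1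
  refine tendsto_of_tendsto_of_tendsto_of_le_of_le' tendsto_const_nhds h1
    (Eventually.of_forall fun _ => zero_le) ?_
  filter_upwards [hf] with n hn
  exact eLpNorm_sum_le hn Fact.out

/-- The symmetrized gradients converge strongly. -/
theorem tendsto_eLpNorm_symUnfold_sub [ENNReal.HolderConjugate p q] (hp : 1 < p) (hp' : p ≠ ∞)
    (hT : IsDynamicalSystem P T) (hB : ∀ i, RepresentsEdge (b i) (B i))
    {u : ℝ → Ω → IntLattice d → Space d} (hu : ∀ ε > 0, IsLatticeField p P O ε (u ε))
    {F : Ω × Space d → Matrix (Fin d) (Fin d) ℝ}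
    (hF : ∀ a j, MemLp (fun y => F y a j) p (P.prod volume))
    (huF : ∀ a j, StrongTwoScale p P T (𝓝[>] 0) id
      (fun ε ω z => discreteGrad ε (fun z' => u ε ω z' a) z j) (fun y => F y a j)) :
    Tendsto (fun ε => eLpNorm (symUnfold T ε b (u ε) - symField T b B F) p (P.prod volume))
      (𝓝[>] 0) (𝓝 0) := by
  have hp0 : p ≠ 0 := (zero_lt_one.trans hp).ne'
  set G : ℝ → Fin d → Fin d → Ω × Space d → ℝ := fun ε a j =>
    unfolding T ε fun ω z => discreteGrad ε (fun z' => u ε ω z' a) z j with hG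
  have hGm : ∀ ε > 0, ∀ a j, MemLp (G ε a j) p (P.prod volume) := fun ε hε a j =>
    memLp_unfolding (u := fun ω z => discreteGrad ε (fun z' => u ε ω z' a) z j) hT hε
      (memLp_discreteGrad (u := fun ω z => u ε ω z a) (memLp_coord (hu ε hε).1 a) j)
  set D : Fin d → IntLattice d → Fin d → ℝ → Ω × Space d → ℝ := fun a w j ε y =>
    G ε a j (jointShift T ε (-w) y) - F (jointShift T 0 (-w) y) a j with hD
  have hDm : ∀ ε > 0, ∀ a w j, AEStronglyMeasurable (D a w j ε) (P.prod volume) :=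
    fun ε hε a w j => (((hGm ε hε a j).comp_measurePreserving
      (measurePreserving_jointShift hT ε (-w))).sub ((hF a j).comp_measurePreserving
      (measurePreserving_jointShift hT 0 (-w)))).1
  have hDlim : ∀ a w j, Tendsto (fun ε => eLpNorm (D a w j ε) p (P.prod volume)) (𝓝[>] 0) (𝓝 0) := by
    intro a w j
    have h1 := tendsto_eLpNorm_comp_jointShift_sub (q := q) hp hp' hT (-w) (hF a j) (l := 𝓝[>] 0)
      (ε := fun ε : ℝ => ε) (tendsto_id.mono_left nhdsWithin_le_nhds)
    have h2 := (huF a j).add h1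
    rw [add_zero] at h2
    refine tendsto_of_tendsto_of_tendsto_of_le_of_le' tendsto_const_nhds h2
      (Eventually.of_forall fun _ => zero_le) ?_
    filter_upwards [self_mem_nhdsWithin] with ε hε
    have hmp := measurePreserving_jointShift hT ε (-w)
    have hm1 := (hGm ε hε a j).sub (hF a j)
    have e1 := eLpNorm_comp_measurePreserving (p := p) hm1.1 hmp
    -- The joint shift preserves the norm of the first term, so strong convergence of the gradients
    -- controls it; the second tends to 0 by continuity of translations.
    have hsplit : D a w j ε = (fun y => G ε a j y - F y a j) ∘ jointShift T ε (-w) +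
        fun y => F (jointShift T ε (-w) y) a j - F (jointShift T 0 (-w) y) a j := by
      funext y
      simp [hD]
    rw [hsplit]
    refine (eLpNorm_add_le (hm1.comp_measurePreserving hmp).1
      (((hF a j).comp_measurePreserving hmp).sub ((hF a j).comp_measurePreserving
        (measurePreserving_jointShift hT 0 (-w)))).1 Fact.out).trans ?_
    exact add_le_add e1.le le_rfl
  have hi : ∀ i : Fin k, Tendsto (fun ε => eLpNorm (fun y => symUnfold T ε b (u ε) y i -
      symField T b B F y i) p (P.prod volume)) (𝓝[>] 0) (𝓝 0) := by
    intro i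
    have h3 : Tendsto (fun ε => eLpNorm (∑ a, ∑ w ∈ (B i).support, ∑ j,
        (edgeDirection (b i) a * B i w j) • D a w j ε) p (P.prod volume)) (𝓝[>] 0) (𝓝 0) := by
      have hev : ∀ {Q : ℝ → Prop}, (∀ ε > 0, Q ε) → ∀ᶠ ε in 𝓝[>] (0 : ℝ), Q ε := fun h => by
        filter_upwards [self_mem_nhdsWithin] with ε hε using h ε hε
      refine tendsto_eLpNorm_sum _ (hev fun ε hε a _ => ?_) fun a _ =>
        tendsto_eLpNorm_sum _ (hev fun ε hε w _ => ?_) fun w _ =>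
          tendsto_eLpNorm_sum _ (hev fun ε hε j _ => ?_) fun j _ => ?_
      · exact Finset.aestronglyMeasurable_sum _ fun w _ =>
          Finset.aestronglyMeasurable_sum _ fun j _ => (hDm ε hε a w j).const_smul _
      · exact Finset.aestronglyMeasurable_sum _ fun j _ => (hDm ε hε a w j).const_smul _
      · exact (hDm ε hε a w j).const_smul _
      · simp only [eLpNorm_const_smul]
        simpa using ENNReal.Tendsto.const_mul (hDlim a w j) 
          (Or.inr (enorm_ne_top (x := edgeDirection (b i) a * B i w j)))
    refine h3.congr' ?_
    filter_upwards [self_mem_nhdsWithin] with ε hε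
    congr 1
    funext y
    have e1 : symUnfold T ε b (u ε) y i = _ := unfolding_discreteSymGrad hT hB hε (u ε) y i
    have e2 : symField T b B F y i = ∑ a, ∑ w ∈ (B i).support, ∑ j,
        (edgeDirection (b i) a * B i w j) * F (jointShift T 0 (-w) y) a j := by
      simp only [symField_apply, jointShift_zero_apply]
    rw [e1, e2]
    simp only [Finset.sum_apply, Pi.smul_apply, smul_eq_mul, hD, mul_sub, Finset.sum_sub_distrib]
    rfl
  have hsum := tendsto_finsetSum Finset.univ fun i (_ : i ∈ Finset.univ) => hi i
  rw [Finset.sum_const_zero] at hsum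
  refine tendsto_of_tendsto_of_tendsto_of_le_of_le' tendsto_const_nhds hsum
    (Eventually.of_forall fun _ => zero_le) ?_
  filter_upwards [self_mem_nhdsWithin] with ε hε
  have hSm := memLp_symUnfold (b := b) hT hε (hu ε hε).1
  have hFm := memLp_symField (b := b) (B := B) hT hF
  have hm : ∀ i, AEStronglyMeasurable (fun y => ‖symUnfold T ε b (u ε) y i -
      symField T b B F y i‖) (P.prod volume) := fun i =>
    ((memLp_coord hSm i).sub (memLp_coord hFm i)).1.norm
  calc eLpNorm (symUnfold T ε b (u ε) - symField T b B F) p (P.prod volume)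
      ≤ eLpNorm (∑ i, fun y => ‖symUnfold T ε b (u ε) y i - symField T b B F y i‖) p
          (P.prod volume) := by
        refine eLpNorm_mono_real fun y => ?_
        rw [Finset.sum_apply]
        exact norm_le_sum_abs _
    _ ≤ _ := by
        refine (eLpNorm_sum_le (fun i _ => hm i) Fact.out).trans ?_
        exact Finset.sum_le_sum fun i _ => by rw [eLpNorm_norm]

theorem symField_eq_zero (hT : IsDynamicalSystem P T)
    {F : Ω × Space d → Matrix (Fin d) (Fin d) ℝ}
    (hF : ∀ᵐ y ∂P.prod (volume : Measure (Space d)), y.2 ∉ O → F y = 0) :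
    ∀ᵐ y ∂P.prod (volume : Measure (Space d)), y.2 ∉ O → symField T b B F y = 0 := by
  have h : ∀ᵐ y ∂P.prod (volume : Measure (Space d)), ∀ w : IntLattice d, y.2 ∉ O →
      F (T (-w) y.1, y.2) = 0 := ae_all_iff.2 fun w => by
    have := (measurePreserving_jointShift hT 0 (-w)).quasiMeasurePreserving.ae hF
    simpa only [jointShift_zero_apply] using this
  filter_upwards [h] with y hy hyO
  ext i
  rw [symField_apply]
  simp [hy _ hyO]

/-- Convergence of the energies along strongly convergent fields. -/
theorem tendsto_discreteEnergy [ENNReal.HolderConjugate p q] (hp : 1 < p) (hp' : p ≠ ∞)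
    (hT : IsDynamicalSystem P T) (hB : ∀ i, RepresentsEdge (b i) (B i))
    (hO : IsLipschitzDomain O) (hV : IsConvexIntegrand p P V)
    {u : ℝ → Ω → IntLattice d → Space d} (hu : ∀ ε > 0, IsLatticeField p P O ε (u ε))
    {F : Ω × Space d → Matrix (Fin d) (Fin d) ℝ}
    (hF : ∀ a j, MemLp (fun y => F y a j) p (P.prod volume))
    (hFO : ∀ᵐ y ∂P.prod (volume : Measure (Space d)), y.2 ∉ O → F y = 0)
    (huF : ∀ a j, StrongTwoScale p P T (𝓝[>] 0) id
      (fun ε ω z => discreteGrad ε (fun z' => u ε ω z' a) z j) (fun y => F y a j)) :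
    Tendsto (fun ε => discreteEnergy P T V b O ε (u ε)) (𝓝[>] 0)
      (𝓝 (twoScaleEnergy P T V b B O F)) := by
  have hp0 : p ≠ 0 := (zero_lt_one.trans hp).ne'
  have hpr : 0 < p.toReal := ENNReal.toReal_pos hp0 hp'
  have hOfin : volume O ≠ ∞ := hO.isBounded.measure_lt_top.ne
  have hFm := memLp_symField (b := b) (B := B) hT hF
  have hS := tendsto_eLpNorm_symUnfold_sub (q := q) (b := b) hp hp' hT hB hu hF huF
  obtain ⟨C, hC, hbd⟩ := exists_discreteEnergy_bounds hT hV hp0 hp' hO b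
  have hvol : Tendsto (fun ε => C * (volume (symmDiff (cellSet ε b O) O)).toReal) (𝓝[>] 0)
      (𝓝 0) := by
    simpa using ((ENNReal.tendsto_toReal ENNReal.zero_ne_top).comp
      (tendsto_volume_symmDiff_cellSet hO b)).const_mul C
  have hE : Tendsto (fun ε => domainEnergy P V O (symUnfold T ε b (u ε))) (𝓝[>] 0)
      (𝓝 (twoScaleEnergy P T V b B O F)) := by
    rw [twoScaleEnergy_eq hV hp0 hp' hOfin hFm]
    -- For ε ≤ 0 the limit itself is used as a default, so that every member of the family lies in
    -- L^p; this does not affect the limit from the right.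
    set S : ℝ → Ω × Space d → EuclideanSpace ℝ (Fin k) := fun ε =>
      if 0 < ε then symUnfold T ε b (u ε) else symField T b B F with hSdef
    have hSm : ∀ ε, MemLp (S ε) p (P.prod volume) := fun ε => by
      by_cases hε : 0 < ε
      · simpa only [hSdef, if_pos hε] using memLp_symUnfold hT hε (hu ε hε).1
      · simpa only [hSdef, if_neg hε] using hFm
    have hSe : ∀ᶠ ε in 𝓝[>] (0 : ℝ), S ε = symUnfold T ε b (u ε) := by
      filter_upwards [self_mem_nhdsWithin] with ε hε using if_pos hε
    refine (tendsto_domainEnergy (l := 𝓝[>] (0 : ℝ)) hV hp0 hp' hOfin hSm hFm ?_).congr' ?_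
    · exact hS.congr' (hSe.mono fun ε h => by simp only [h])
    · exact hSe.mono fun ε h => by simp only [h]
  have hout : Tendsto (fun ε => C * (eLpNorm ((univ ×ˢ Oᶜ).indicator (symUnfold T ε b (u ε))) p
      (P.prod volume)).toReal ^ p.toReal) (𝓝[>] 0) (𝓝 0) := by
    have h1 : Tendsto (fun ε => eLpNorm ((univ ×ˢ Oᶜ).indicator (symUnfold T ε b (u ε))) p
        (P.prod volume)) (𝓝[>] 0) (𝓝 0) := by
      -- The limit vanishes outside O, so the outer part of the unfolded gradient is bounded by its
      -- distance to the limit.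
      refine tendsto_of_tendsto_of_tendsto_of_le_of_le tendsto_const_nhds hS
        (fun _ => zero_le) fun ε => eLpNorm_mono_ae ?_
      filter_upwards [symField_eq_zero (b := b) (B := B) hT hFO] with y hy
      by_cases hyO : y.2 ∈ O
      · rw [indicator_of_notMem (fun h => h.2 hyO), norm_zero]
        exact norm_nonneg _
      · rw [indicator_of_mem (show y ∈ univ ×ˢ Oᶜ from ⟨mem_univ _, hyO⟩), Pi.sub_apply, hy hyO,
          sub_zero]
    have h2 := ((ENNReal.tendsto_toReal ENNReal.zero_ne_top).comp h1).rpow_const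
      (p := p.toReal) (Or.inr hpr.le)
    simpa [Real.zero_rpow hpr.ne'] using h2.const_mul C
  have hlow := hE.sub hvol
  have hup := (hE.add hvol).add hout
  rw [sub_zero] at hlow
  rw [add_zero, add_zero] at hup
  refine tendsto_of_tendsto_of_tendsto_of_le_of_le' hlow hup ?_ ?_
  · filter_upwards [Ioc_mem_nhdsGT (one_pos (α := ℝ))] with ε hε
    have := (hbd ε hε.1 hε.2 _ (hu ε hε.1)).1
    linarith
  · filter_upwards [Ioc_mem_nhdsGT (one_pos (α := ℝ))] with ε hε
    exact (hbd ε hε.1 hε.2 _ (hu ε hε.1)).2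

theorem twoScale_upperBound [ENNReal.HolderConjugate p q] (hp : 1 < p) (hp' : p ≠ ∞)
    (hT : IsDynamicalSystem P T) (hB : ∀ i, RepresentsEdge (b i) (B i))
    (hO : IsLipschitzDomain O) (hV : IsConvexIntegrand p P V)
    (U : Fin d → Lp (ℝ × Space d) p (P.prod (volume : Measure (Space d))))
    (χ : Fin d → Lp (Space d) p (P.prod (volume : Measure (Space d))))
    (hU : ∀ i, U i ∈ InvSobolev p P T O) (hχ : ∀ i, χ i ∈ PotTensor p P T O) :
    ∃ u : ℝ → Ω → IntLattice d → Space d,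
      (∀ ε > 0, IsLatticeField p P O ε (u ε)) ∧
      (∀ i, StrongTwoScale p P T (𝓝[>] 0) id (fun ε ω z => u ε ω z i) (fun y => (U i y).1)) ∧
      (∀ i j, StrongTwoScale p P T (𝓝[>] 0) id
        (fun ε ω z => discreteGrad ε (fun z' => u ε ω z' i) z j)
        (fun y => gradField U χ y i j)) ∧
      Tendsto (fun ε => discreteEnergy P T V b O ε (u ε)) (𝓝[>] 0)
        (𝓝 (twoScaleEnergy P T V b B O (gradField U χ))) := by
  -- The subspace contains both (U_i, ∇U_i) and (0, χ_i), hence their sum; the scalar recovery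
  -- fields are then assembled into a vector field.
  have hrec : ∀ i, U i + gradInr p P d (χ i) ∈ recoverable hT O p := fun i =>
    Submodule.add_mem _ (invSobolev_le_recoverable hT hp' (hU i))
      (potTensor_le_recoverable (q := q) hp hT hp' hO.isOpen (hχ i))
  choose v hv hvlim using fun i => exists_recovery hT (hrec i)
  have hu : ∀ ε > 0, IsLatticeField p P O ε fun ω z => WithLp.toLp 2 fun i => v i ε ω z := by
    intro ε hε
    refine ⟨memLp_toLp fun i => (hv i ε hε).1, ?_⟩
    filter_upwards [ae_all_iff.2 fun i => (hv i ε hε).2] with ω hω z hz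
    ext i
    exact hω i z hz
  have hcomp : ∀ i, ∀ {f : ℝ → Ω × Space d → ℝ} {g : Ω × Space d → ℝ},
      (∀ᵐ y ∂P.prod (volume : Measure (Space d)), ∀ ε, ‖f ε y - g y‖ ≤
        ‖(unfoldJet T ε (v i ε) - ⇑(U i + gradInr p P d (χ i))) y‖) →
      Tendsto (fun ε => eLpNorm (fun y => f ε y - g y) p (P.prod volume)) (𝓝[>] 0) (𝓝 0) :=
    fun i f g h => tendsto_of_tendsto_of_tendsto_of_le_of_le tendsto_const_nhds (hvlim i)
      (fun _ => zero_le) fun ε => eLpNorm_mono_ae (h.mono fun y hy => hy ε)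
  have hgrad : ∀ i j, StrongTwoScale p P T (𝓝[>] 0) id
      (fun ε ω z => discreteGrad ε (fun z' => v i ε ω z') z j)
      (fun y => gradField U χ y i j) := fun i j => by
    refine hcomp i ?_
    filter_upwards [coeFn_add_gradInr (U i) (χ i)] with y hy ε
    rw [Pi.sub_apply, hy]
    refine le_trans ?_ (norm_snd_le _)
    exact PiLp.norm_apply_le ((unfoldJet T ε (v i ε) y).2 - ((U i y).2 + χ i y)) j
  have hFO : ∀ᵐ y ∂P.prod (volume : Measure (Space d)), y.2 ∉ O → gradField U χ y = 0 := by
    filter_upwards [ae_all_iff.2 fun i => InvSobolev.ae_eq_zero (hU i),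
      ae_all_iff.2 fun i => PotTensor.ae_eq_zero (hχ i)] with y h1 h2 hy
    ext i j
    simp [gradField, h1 i hy, h2 i hy]
  refine ⟨fun ε ω z => WithLp.toLp 2 fun i => v i ε ω z, hu, fun i => ?_, hgrad,
    tendsto_discreteEnergy (q := q) hp hp' hT hB hO hV hu (memLp_gradField U χ) hFO hgrad⟩
  refine hcomp i ?_
  filter_upwards [coeFn_add_gradInr (U i) (χ i)] with y hy ε
  rw [Pi.sub_apply, hy]
  exact norm_fst_le (unfoldJet T ε (v i ε) y - ((U i y).1, (U i y).2 + χ i y))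

end UpperBound

/-! ### The theorem -/

theorem theorem4p1 {Ω : Type*} [MeasurableSpace Ω] (P : Measure Ω) [IsProbabilityMeasure P]
    [IsSeparable P] {d k : ℕ} (hd : 1 ≤ d) (p q : ℝ≥0∞) [Fact (1 ≤ p)] (hp : 1 < p) (hp' : p ≠ ∞)
    [ENNReal.HolderConjugate p q]
    (T : IntLattice d → Ω → Ω) (hT : IsDynamicalSystem P T)
    (b : Fin k → IntLattice d) (hb : IsEdgeGenerating b) (hKorn : SatisfiesKorn p b)
    (B : Fin k → IntLattice d →₀ Space d) (hB : ∀ i, RepresentsEdge (b i) (B i))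
    (O : Set (Space d)) (hO : IsLipschitzDomain O)
    (V : Ω → EuclideanSpace ℝ (Fin k) → ℝ) (hV : IsConvexIntegrand p P V) :
    -- compactness
    (∀ (ε : ℕ → ℝ) (u : ℕ → Ω → IntLattice d → Space d),
      (∀ n, 0 < ε n) → Tendsto ε atTop (𝓝 0) → (∀ n, IsLatticeField p P O (ε n) (u n)) →
      limsup (fun n => (discreteEnergy P T V b O (ε n) (u n) : EReal)) atTop < ⊤ →
      ∃ s : ℕ → ℕ, StrictMono s ∧
        ∃ U : Fin d → Lp (ℝ × Space d) p (P.prod (volume : Measure (Space d))),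
        ∃ χ : Fin d → Lp (Space d) p (P.prod (volume : Measure (Space d))),
          (∀ i, U i ∈ InvSobolev p P T O) ∧ (∀ i, χ i ∈ PotTensor p P T O) ∧
          (∀ i, WeakTwoScale q P T atTop (fun n => ε (s n))
            (fun n ω z => u (s n) ω z i) (fun y => (U i y).1)) ∧
          ∀ i j, WeakTwoScale q P T atTop (fun n => ε (s n))
            (fun n ω z => discreteGrad (ε (s n)) (fun z' => u (s n) ω z' i) z j)
            (fun y => gradField U χ y i j)) ∧
    -- lower bound
    (∀ (ε : ℕ → ℝ) (u : ℕ → Ω → IntLattice d → Space d)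
      (U : Fin d → Lp (ℝ × Space d) p (P.prod (volume : Measure (Space d))))
      (χ : Fin d → Lp (Space d) p (P.prod (volume : Measure (Space d)))),
      (∀ n, 0 < ε n) → Tendsto ε atTop (𝓝 0) → (∀ n, IsLatticeField p P O (ε n) (u n)) →
      (∀ i, U i ∈ InvSobolev p P T O) → (∀ i, χ i ∈ PotTensor p P T O) →
      (∀ i, WeakTwoScale q P T atTop ε (fun n ω z => u n ω z i) (fun y => (U i y).1)) →
      (∀ i j, WeakTwoScale q P T atTop ε
        (fun n ω z => discreteGrad (ε n) (fun z' => u n ω z' i) z j)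
        (fun y => gradField U χ y i j)) →
      (twoScaleEnergy P T V b B O (gradField U χ) : EReal) ≤
        liminf (fun n => (discreteEnergy P T V b O (ε n) (u n) : EReal)) atTop) ∧
    -- upper bound
    (∀ (U : Fin d → Lp (ℝ × Space d) p (P.prod (volume : Measure (Space d))))
      (χ : Fin d → Lp (Space d) p (P.prod (volume : Measure (Space d)))),
      (∀ i, U i ∈ InvSobolev p P T O) → (∀ i, χ i ∈ PotTensor p P T O) →
      ∃ u : ℝ → Ω → IntLattice d → Space d,
        (∀ ε > 0, IsLatticeField p P O ε (u ε)) ∧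
        (∀ i, StrongTwoScale p P T (𝓝[>] 0) id (fun ε ω z => u ε ω z i) (fun y => (U i y).1)) ∧
        (∀ i j, StrongTwoScale p P T (𝓝[>] 0) id
          (fun ε ω z => discreteGrad ε (fun z' => u ε ω z' i) z j)
          (fun y => gradField U χ y i j)) ∧
        Tendsto (fun ε => discreteEnergy P T V b O ε (u ε)) (𝓝[>] 0)
          (𝓝 (twoScaleEnergy P T V b B O (gradField U χ)))) := by

  exact ⟨fun _ _ hε0 hε hu hE => twoScale_compactness hp hp' hd hT hKorn hO hV hε0 hε hu hE,
    fun _ _ U χ hε0 hε hu _ _ _ huG =>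
      twoScale_lowerBound hp hp' hd hT hKorn hB hO hV hε0 hε hu (memLp_gradField U χ) huG,
    fun U χ hU hχ => twoScale_upperBound (q := q) hp hp' hT hB hO hV U χ hU hχ⟩
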